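/- **Setting.** Let $V$ be the space of traceless $2\times 2$ matrices with $(x,y)=\operatorname{tr}(xy)$ (so $\tfrac12(x,x)=-\det x$), on which $\mathrm{SL}_2$ acts by conjugation; $e_1=\tfrac1{\sqrt2}\begin{pmatrix}0&1\\1&0\end{pmatrix}$, $e_2=\tfrac1{\sqrt2}\begin{pmatrix}1&0\\0&-1\end{pmatrix}$, $e_3=\tfrac1{\sqrt2}\begin{pmatrix}0&1\\-1&0\end{pmatrix}$, $u=\begin{pmatrix}0&1\\0&0\end{pmatrix}$, $u'=\begin{pmatrix}0&0\\-1&0\end{pmatrix}$. Let $L\subset V(\mathbb Q)$ be an even lattice of full rank, $h\in L^\#$, $k\ge1$, and let $E=\mathcal H_k(V_{\mathbb C})$ be the space of symmetric traceless tensors of degree $k$, with the representation $\rho$ and the bilinear form $(\cdot,\cdot)$ induced from $V$, and $\pi_k:V_{\mathbb C}^{\otimes k}\to E$ the orthogonal projection; we write $x^k$ also for $\pi_k(x^{\otimes k})$. Let $\Gamma\subset\mathrm{SL}_2(\mathbb Z)$ be a subgroup of finite index with $\gamma(L+h)\gamma^{-1}=L+h$ for all $\gamma\in\Gamma$; torsion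 is allowed, e.g. $\Gamma=\mathrm{SL}_2(\mathbb Z)$. Let $\overline D=D\cup\partial\overline D$ be the Borel–Serre enlargement of the upper half plane $D$ by one real line for each cusp $\sigma\infty$, $\sigma\in \mathrm{SL}_2(\mathbb Z)$, whose points are $[\sigma,r]=\lim_{y\to\infty}\sigma(r+iy)$, and $\overline X=\Gamma\backslash\overline D$. A smooth form on $\overline X$ with values in $E$ is a $\Gamma$-equivariant form on $D$ that is smooth in the coordinates $(r,t)$, $t\ge0$, of $\sigma(r+i/t)$, for all $\sigma$. **Cohomology.** $H^1_c$ is the first cohomology of the mapping cone of the restriction $i^*$ to $\partial\overline X$: pairs $(a,b)$ of a closed smooth $E$-valued $1$-form $a$ on $\overline X$ and an equivariant function $b$ on the boundary with $db=i^*a$, modulo pairs $(df,i^*f)$. For a closed smooth $1$-form $\eta$ on $\overline X$ put $\langle\eta,(a,b)\rangle=\int_X\eta\wedge a-\int_{\partial\overline X}(i^*\eta,b)$ (boundary oriented by $dr$). **Homology.** $H_1(\overline X,\mathcal E)$ is simplicial homology with coefficients in the quotient local system $\mathcal E$ of $\overline D\times E$ by $\Gamma$, in general not locally constant: the fibre at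 the orbit of $p$ is the space of coinvariants of $E$ under the isotropy group $\Gamma_p$. Simplices are ordered, with isotropy groups in $\mathrm{SL}_2(\mathbb Z)$ non-decreasing along directed edges; the chains are spanned by $s\otimes v$ with $v$ in the fibre at the first vertex of $s$, and the arrow along an edge is induced by the identity of $E$ on lifts. Chains $(p,q)\otimes v$ with $p,q\in\overline D$, $v\in E$, denote their images in the chains of $\overline X$. For a closed $\eta$ with primitive $F$ on $\overline D$, $\int_{(p,q)\otimes v}\eta=(F(q)-F(p),v)$. A class $\operatorname{PD}(C)\in H^1_c$ is Poincaré dual to $C\in H_1(\overline X,\mathcal E)$ if $\langle\eta,\operatorname{PD}(C)\rangle=\int_C\eta$ for all closed $\eta$. **Cycles.** For $\sigma\in\mathrm{SL}_2(\mathbb Z)$ let $u_\sigma=\sigma u\sigma^{-1}$, $\ell=\mathbb Qu_\sigma$, $L\cap\ell=\mathbb ZM_\ell u_\sigma$ with $M_\ell>0$, let $m_\sigma\ge1$ be the width of the cusp $\sigma\infty$ of $\Gamma$, $g_\sigma=\sigma\begin{pmatrix}1&m_\sigma\\0&1\end{pmatrix}\sigma^{-1}$, and for $c=[\sigma,r]$,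 $w\in E$ let $X_{\ell,c}\otimes w=(c,g_\sigma c)\otimes w$. Then $$C_0^c(\Gamma)=\sum_{\sigma\infty\in\Gamma\backslash\{\text{cusps}\}}-M_\ell^k\frac{B_{k+1}(h_\ell/M_\ell)}{k+1}\,X_{\ell,[\sigma,0]}\otimes u_\sigma^k,$$ where $(L+h)\cap\ell=(M_\ell\mathbb Z+h_\ell)u_\sigma$, $0\le h_\ell<M_\ell$, and the summand is $0$ if $(L+h)\cap\ell=\emptyset$. For $n\in\mathbb Q_{>0}$, $C_n^c(\Gamma)=\sum_xC_x^c$ over $\Gamma$-orbits of $x\in L+h$ with $\tfrac12(x,x)=n$. Here $D_x=\{z\in D:(x,x(z))=0\}$ with $x(z)=\frac1{\sqrt2\,y}\begin{pmatrix}-\mathrm{Re}\,z&|z|^2\\-1&\mathrm{Re}\,z\end{pmatrix}$, $y=\operatorname{Im}z$, and $v=x^k$. * If $\Gamma_x$ is infinite, $C_x^c=(z,\gamma z)\otimes v$ with $z\in D_x$ of trivial isotropy (up to $\pm1$), and $\gamma$ generating $\Gamma_x$ up to sign, with $\operatorname{tr}(\gamma)\operatorname{tr}(\gamma x)>0$.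 * Otherwise $D_x$ joins two cusps, with end points $c'=[\sigma',r']$ and $c=[\sigma,r]$, numbered so that $(u_\sigma,x,u_{\sigma'})$ has positive determinant in the basis $e_1,e_2,e_3$, and $C_x^c=(z,c)\otimes v-(z,c')\otimes v-X_{\ell,c}\otimes w+X_{\ell',c'}\otimes w'$ with $z\in D_x$ of trivial isotropy. The cap vector $w$ is determined by $\rho(g_\sigma)^{-1}w-w=v$ and $\int_r^{r+m_\sigma}\bigl(\rho(\sigma\begin{pmatrix}1&t\\0&1\end{pmatrix})u'^k,w\bigr)dt=0$; $w'$ likewise from $(\sigma',r')$. **Theta class.** For $\tau=\mu+i\nu\in\mathbb H$, $\nu>0$, let $\theta(\varphi)(\tau,z)=\nu^{-k/2}\sum_{x\in L+h}\varphi(\sqrt{\nu}x,z)e^{\pi i(x,x)\mu}$, where $$\varphi(x,z)=2^{-k-\frac12}\sum_{\alpha,\beta_1,\dots,\beta_k\in\{1,2\}}(\mathcal D_\alpha\mathcal D_{\beta_1}\cdots\mathcal D_{\beta_k}\varphi_0)(g_z^{-1}x)\;\omega_\alpha\otimes\rho(g_z)\pi_k(e_{\beta_1}\otimes\cdots\otimes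 e_{\beta_k}),$$ with, for $z=X+iy$, $g_z=\begin{pmatrix}\sqrt y&X/\sqrt y\\0&1/\sqrt y\end{pmatrix}$, and $\varphi_0=e^{-\pi(x_1^2+x_2^2+x_3^2)}$, $\mathcal D_j=x_j-\frac1{2\pi}\partial_j$ in the coordinates $x=\sum x_je_j$, $\omega_1=dy/y$, $\omega_2=-dX/y$. On the boundary let $$\theta(\phi)(\tau,[\sigma,r])=\rho(\sigma)\,\frac{\nu^{-(k+1)/2}}{M_\ell}\sum_{t}\frac{-\widetilde H_{k+1}(\sqrt{\nu}t)e^{-\pi \nu t^2}}{2^{3k/2+1/2}\,k}\,e^{\pi it^2\mu}\;\rho\begin{pmatrix}1&r\\0&1\end{pmatrix}v_{-2},$$ $t$ over the set of all $(\sigma^{-1}x\sigma,e_2)$ with $x\in L+h$, $(x,u_\sigma)=0$; $\widetilde H_j(t)=(2\pi)^{-j/2}H_j(\sqrt{2\pi}t)$ with the Hermite polynomials $H_j(t)=(-1)^je^{t^2}\frac{d^j}{dt^j}e^{-t^2}$, and $v_{-2}=\frac{(-2)^k(k!)^2}{(2k)!\,(k-1)!}\,(\operatorname{ad}u)^{k-1}u'^k$.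 Write $(\ast_\Gamma)$ for the assertion that for every $\tau$ the pair $(\theta(\varphi),\theta(\phi))$ is a $1$-cocycle of the mapping cone, that the classes $C_n^c(\Gamma)$ have Poincaré duals (not depending on $\tau$), and that, with $q=e^{2\pi i\tau}$, the sum being convergent in $H^1_c$, $$[\theta(\varphi,\phi,\Gamma)]:=[(\theta(\varphi),\theta(\phi))]=\sum_{n\in\mathbb Q_{\ge0}}\operatorname{PD}(C^c_n(\Gamma))\,q^n.\tag{$\ast_\Gamma$}$$ **Theorem.** Let $\Gamma'$ be a normal subgroup of $\Gamma$ of finite index. If $(\ast_{\Gamma'})$ holds, then $(\ast_\Gamma)$ holds. -/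

import Mathlib

open Matrix UpperHalfPlane MeasureTheory Filter Topology
open scoped MatrixGroups UpperHalfPlane ContDiff DirectSum Modular

noncomputable section

namespace Spectacle

/-! ## Ordered simplicial complexes, local systems, simplicial homology -/

/-- The part of an ordered simplicial complex (or of a quotient of one by a group) that matters
for `H_1`: vertices, directed edges, and ordered 2-simplices `(x₀, x₁, x₂)` with their edges
`(x₀, x₁)`, `(x₁, x₂)`, `(x₀, x₂)`. -/
structure OrderedComplex where
  V : Type
  Edge : V → V → Type
  Tri : ∀ {a b c : V}, Edge a b → Edge b c → Edge a c → Type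

/-- A local system: a finite-dimensional vector space on each vertex, a linear map (not necessarily
injective or surjective) along each directed edge, with zero curvature on each 2-simplex. -/
structure LocalSystem (K : OrderedComplex) where
  fiber : K.V → Type
  [addCommGroup : ∀ v, AddCommGroup (fiber v)]
  [module : ∀ v, Module ℂ (fiber v)]
  [finite : ∀ v, FiniteDimensional ℂ (fiber v)]
  T : ∀ {a b : K.V}, K.Edge a b → fiber a →ₗ[ℂ] fiber b
  zeroCurvature : ∀ {a b c : K.V} (f : K.Edge a b) (g : K.Edge b c) (h : K.Edge a c),
    K.Tri f g h → T h = T g ∘ₗ T f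

attribute [instance] LocalSystem.addCommGroup LocalSystem.module LocalSystem.finite

namespace LocalSystem

/-- The edges of `K`, with their end points. -/
abbrev E1 (K : OrderedComplex) : Type := Σ a b : K.V, K.Edge a b

/-- The ordered 2-simplices of `K`, with their edges. -/
structure T2 (K : OrderedComplex) where
  {a : K.V}
  {b : K.V}
  {c : K.V}
  ab : K.Edge a b
  bc : K.Edge b c
  ac : K.Edge a c
  tri : K.Tri ab bc ac

variable {K : OrderedComplex} (S : LocalSystem K)

/-- Simplicial `p`-chains with coefficients, `p = 0, 1, 2`: sums of `s ⊗ v` with `v` in the fibre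
over the first vertex of `s`. -/
abbrev C0 : Type := ⨁ v : K.V, S.fiber v
abbrev C1 : Type := ⨁ e : E1 K, S.fiber e.1
abbrev C2 : Type := ⨁ t : T2 K, S.fiber t.a

open scoped Classical in
/-- `∂ ((x₀, x₁) ⊗ v) = x₁ ⊗ T v - x₀ ⊗ v`. -/
def d1 : S.C1 →ₗ[ℂ] S.C0 :=
  DirectSum.toModule ℂ (E1 K) S.C0 fun e =>
    DirectSum.lof ℂ K.V S.fiber e.2.1 ∘ₗ S.T e.2.2 - DirectSum.lof ℂ K.V S.fiber e.1

open scoped Classical in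
/-- `∂ ((x₀, x₁, x₂) ⊗ v) = (x₁, x₂) ⊗ T v - (x₀, x₂) ⊗ v + (x₀, x₁) ⊗ v`. -/
def d2 : S.C2 →ₗ[ℂ] S.C1 :=
  DirectSum.toModule ℂ (T2 K) S.C1 fun t =>
    DirectSum.lof ℂ (E1 K) (fun e => S.fiber e.1) ⟨t.b, t.c, t.bc⟩ ∘ₗ S.T t.ab
      - DirectSum.lof ℂ (E1 K) (fun e => S.fiber e.1) ⟨t.a, t.c, t.ac⟩
      + DirectSum.lof ℂ (E1 K) (fun e => S.fiber e.1) ⟨t.a, t.b, t.ab⟩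

theorem d1_comp_d2 : S.d1 ∘ₗ S.d2 = 0 := by
  classical
  refine DirectSum.linearMap_ext _ fun t => LinearMap.ext fun v => ?_
  have h := S.zeroCurvature t.ab t.bc t.ac t.tri
  simp only [d1, d2, LinearMap.comp_apply, DirectSum.toModule_lof, LinearMap.add_apply,
    LinearMap.sub_apply, map_add, map_sub, h, LinearMap.zero_apply]
  abel

/-- The first simplicial homology with coefficients in a local system. -/
abbrev H1 : Type := LinearMap.ker S.d1 ⧸ (LinearMap.range S.d2).submoduleOf (LinearMap.ker S.d1)

end LocalSystem

/-! ## The quotient of a flat bundle by a group -/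

/-- An ordered simplicial complex on the vertex set `V` (with all 2-simplices whose edges are
present) on which `G` acts, such that isotropy groups increase along directed edges. -/
structure GComplex (G V : Type) [Group G] [MulAction G V] where
  Adj : V → V → Prop
  smul_adj : ∀ (g : G) {a b : V}, Adj a b → Adj (g • a) (g • b)
  stab_le : ∀ {a b : V}, Adj a b → MulAction.stabilizer G a ≤ MulAction.stabilizer G b

section Quotient

variable {G V E : Type} [Group G] [MulAction G V] [AddCommGroup E] [Module ℂ E]
  (M : GComplex G V) (ρ : Representation ℂ G E)

/-- The complex `M` itself. -/
def GComplex.toComplex : OrderedComplex where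
  V := V
  Edge a b := PLift (M.Adj a b)
  Tri _ _ _ := PUnit

/-- The trivialised flat bundle `M × E`, as a local system. -/
def flatSystem (E : Type) [AddCommGroup E] [Module ℂ E] [FiniteDimensional ℂ E] :
    LocalSystem M.toComplex where
  fiber _ := E
  T _ := LinearMap.id
  zeroCurvature _ _ _ _ := rfl

/-- The quotient complex: simplices are the `G`-orbits of the simplices of `M`. -/
def GComplex.quotient : OrderedComplex where
  V := MulAction.orbitRel.Quotient G V
  Edge y z := {s : Set (V × V) // ∃ a b, M.Adj a b ∧ Quotient.mk _ a = y ∧ Quotient.mk _ b = z ∧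
    s = MulAction.orbit G (a, b)}
  Tri f g h := {s : Set (V × V × V) // ∃ a b c, M.Adj a b ∧ M.Adj b c ∧ M.Adj a c ∧
    s = MulAction.orbit G (a, b, c) ∧ f.1 = MulAction.orbit G (a, b) ∧
    g.1 = MulAction.orbit G (b, c) ∧ h.1 = MulAction.orbit G (a, c)}

/-- The kernel of the projection of `E` to its coinvariants under the isotropy group of `x`. -/
def coinvKer (x : V) : Submodule ℂ E :=
  Submodule.span ℂ {w | ∃ g ∈ MulAction.stabilizer G x, ∃ v : E, w = ρ g v - v}

theorem coinvKer_le_comap {a b : V} (h : MulAction.stabilizer G a ≤ MulAction.stabilizer G b)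
    (γ : G) : coinvKer ρ a ≤ (coinvKer ρ (γ • b)).comap (ρ γ) := by
  refine Submodule.span_le.2 ?_
  rintro _ ⟨g, hg, v, rfl⟩
  refine Submodule.subset_span ⟨γ * g * γ⁻¹, ?_, ρ γ v, ?_⟩
  · have hb : g • b = b := h hg
    simp [MulAction.mem_stabilizer_iff, mul_smul, hb]
  · simp [map_mul]

variable {M} in
theorem exists_lift {y z : M.quotient.V} (s : M.quotient.Edge y z) :
    ∃ p : G × V, (y.out, p.2) ∈ s.1 ∧ M.Adj y.out p.2 ∧ p.1 • p.2 = z.out := by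
  obtain ⟨s, a, b, hab, rfl, rfl, rfl⟩ := s
  obtain ⟨g, hg⟩ := Quotient.exact (Quotient.out_eq (Quotient.mk (MulAction.orbitRel G V) a))
  obtain ⟨g', hg'⟩ := Quotient.exact (Quotient.out_eq (Quotient.mk (MulAction.orbitRel G V) b))
  simp only at hg hg'
  refine ⟨⟨g' * g⁻¹, g • b⟩, ⟨g, ?_⟩, ?_, ?_⟩
  · rw [← hg]; rfl
  · rw [← hg]; exact M.smul_adj g hab
  · rw [← hg']; simp [mul_smul]

/-- The transition map of the quotient system along the edge `s` from `y` to `z`. If `x`, `x'`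
are the chosen points of the orbits `y`, `z`, then a lift of `s` that starts in `x` ends in a point
`b` with `γ b = x'`, and the transition map is `[v] ↦ [γ v]`. -/
def quotientT {y z : M.quotient.V} (s : M.quotient.Edge y z) :
    (E ⧸ coinvKer ρ y.out) →ₗ[ℂ] (E ⧸ coinvKer ρ z.out) :=
  Submodule.mapQ _ _ (ρ (exists_lift s).choose.1) <| by
    have h := (exists_lift s).choose_spec
    have h' := coinvKer_le_comap ρ (M.stab_le h.2.1) (exists_lift s).choose.1
    rwa [h.2.2] at h'

variable {M} in
theorem quotientT_mk {y z : M.quotient.V} (s : M.quotient.Edge y z) {γ : G} {b : V}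
    (hb : (y.out, b) ∈ s.1) (hγ : γ • b = z.out) (v : E) :
    quotientT M ρ s (Submodule.Quotient.mk v) = Submodule.Quotient.mk (ρ γ v) := by
  obtain ⟨h1, h2, h3⟩ := (exists_lift s).choose_spec
  set γ₀ := (exists_lift s).choose.1 with hγ₀
  set b₀ := (exists_lift s).choose.2
  have hT : quotientT M ρ s (Submodule.Quotient.mk v) = Submodule.Quotient.mk (ρ γ₀ v) := rfl
  obtain ⟨δ, hδ1, hδ2⟩ : ∃ δ : G, δ • y.out = y.out ∧ δ • b₀ = b := by
    obtain ⟨s, a', b', hab, hy, hz, rfl⟩ := s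
    obtain ⟨g, hg⟩ := h1
    obtain ⟨g', hg'⟩ := hb
    simp only [Prod.smul_mk, Prod.mk.injEq] at hg hg'
    refine ⟨g' * g⁻¹, ?_, ?_⟩
    · conv_lhs => rw [← hg.1]
      rw [← hg'.1]; simp [mul_smul]
    · rw [← hg.2, ← hg'.2]; simp [mul_smul]
  rw [hT, Submodule.Quotient.eq]
  have hle := coinvKer_le_comap ρ (M.stab_le h2) γ₀
  rw [h3] at hle
  have hst : γ * δ * γ₀⁻¹ ∈ MulAction.stabilizer G z.out := by
    rw [MulAction.mem_stabilizer_iff, ← h3, mul_smul, mul_smul, inv_smul_smul, hδ2, hγ, h3]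
  have hst' : γ * δ⁻¹ * γ⁻¹ ∈ MulAction.stabilizer G z.out := by
    have hAdj : δ⁻¹ • b = b := by
      have : δ⁻¹ ∈ MulAction.stabilizer G y.out := inv_mem hδ1
      have h4 := M.stab_le h2 this
      have h5 : δ⁻¹ • b₀ = b₀ := h4
      rw [← hδ2, inv_smul_smul]
      have := congrArg (fun t => δ • t) h5
      simpa using this
    rw [MulAction.mem_stabilizer_iff, ← hγ, mul_smul, mul_smul, inv_smul_smul, hAdj]
  have e : ρ γ₀ v - ρ γ v
      = -(ρ (γ * δ * γ₀⁻¹) (ρ γ₀ v) - ρ γ₀ v) + -(ρ (γ * δ⁻¹ * γ⁻¹) (ρ (γ * δ) v) - ρ (γ * δ) v)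
        := by
    simp only [← Module.End.mul_apply, ← map_mul]
    simp [mul_assoc]
  rw [e]
  exact add_mem (neg_mem (Submodule.subset_span ⟨_, hst, _, rfl⟩))
    (neg_mem (Submodule.subset_span ⟨_, hst', _, rfl⟩))

variable [FiniteDimensional ℂ E]

/-- The quotient of the flat bundle `M × E` by `G`, as a local system on `M / G`: its fibre over an
orbit is the space of coinvariants of `E` under the isotropy group of a point of the orbit. -/
def quotientSystem : LocalSystem M.quotient where
  fiber y := E ⧸ coinvKer ρ y.out
  T s := quotientT M ρ s
  zeroCurvature := by
    intro y z w f g h t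
    obtain ⟨s, a, b, c, hab, hbc, hac, rfl, hf, hg, hh⟩ := t
    obtain ⟨p, hp1, -, -⟩ := exists_lift f
    rw [hf] at hp1
    obtain ⟨k, hk⟩ := hp1
    simp only [Prod.smul_mk, Prod.mk.injEq] at hk
    obtain ⟨p', hp1', -, hp3'⟩ := exists_lift g
    rw [hg] at hp1'
    obtain ⟨k', hk'⟩ := hp1'
    simp only [Prod.smul_mk, Prod.mk.injEq] at hk'
    ext v
    simp only [LinearMap.comp_apply, Submodule.mkQ_apply]
    rw [quotientT_mk ρ f (γ := k' * k⁻¹) (b := k • b), quotientT_mk ρ g (γ := p'.1) (b := k' • c),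
      quotientT_mk ρ h (γ := p'.1 * (k' * k⁻¹)) (b := k • c), map_mul, Module.End.mul_apply]
    · rw [hh]; exact ⟨k, by simp [hk.1]⟩
    · rw [← hp3', ← hk'.2]; simp [mul_smul]
    · rw [hg]; exact ⟨k', by simp [hk'.1]⟩
    · rw [← hp3', ← hk'.2]
    · rw [hf]; exact ⟨k, by simp [hk.1]⟩
    · rw [← hk'.1]; simp [mul_smul]

theorem exists_smul_eq_out (a : V) :
    ∃ g : G, g • a = (Quotient.mk (MulAction.orbitRel G V) a).out :=
  Quotient.exact (Quotient.out_eq (Quotient.mk (MulAction.orbitRel G V) a))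

open scoped Classical in
/-- The image of `(a, b) ⊗ v` in the chains on `M / G`. -/
def pushEdge (a b : V) (h : M.Adj a b) : E →ₗ[ℂ] (quotientSystem M ρ).C1 :=
  DirectSum.lof ℂ (LocalSystem.E1 M.quotient) (fun e => (quotientSystem M ρ).fiber e.1)
      ⟨Quotient.mk _ a, Quotient.mk _ b, ⟨MulAction.orbit G (a, b), a, b, h, rfl, rfl, rfl⟩⟩
    ∘ₗ (coinvKer ρ (Quotient.mk (MulAction.orbitRel G V) a).out).mkQ
    ∘ₗ ρ (exists_smul_eq_out (G := G) a).choose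

open scoped Classical in
/-- The projection from chains on `M` to chains on `M / G`. -/
def pushforward : (flatSystem M E).C1 →ₗ[ℂ] (quotientSystem M ρ).C1 :=
  DirectSum.toModule ℂ (LocalSystem.E1 M.toComplex) (quotientSystem M ρ).C1 fun e =>
    pushEdge M ρ e.1 e.2.1 e.2.2.down

open scoped Classical in
/-- The chain `(p, q) ⊗ v` on `M`. -/
def edgeChain (p q : V) (v : E) : (flatSystem M E).C1 :=
  if h : M.Adj p q then
    DirectSum.lof ℂ (LocalSystem.E1 M.toComplex) (fun _ => E) ⟨p, q, ⟨h⟩⟩ v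
  else 0

open scoped Classical in
/-- The homology class of the projection of a chain on `M` to `M / G`, if that is a cycle. -/
def homClass (c : (flatSystem M E).C1) : (quotientSystem M ρ).H1 :=
  if h : pushforward M ρ c ∈ LinearMap.ker (quotientSystem M ρ).d1 then
    Submodule.Quotient.mk ⟨_, h⟩
  else 0

end Quotient

/-! ## The quadratic space and its harmonic tensors -/

/-- Coordinates of a traceless matrix in the basis `e₁ = (1/√2)(0, 1; 1, 0)`,
`e₂ = (1/√2)(1, 0; 0, -1)`, `e₃ = (1/√2)(0, 1; -1, 0)`. -/
def coord (x : Matrix (Fin 2) (Fin 2) ℝ) : Fin 3 → ℝ :=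
  ![(x 0 1 + x 1 0) / √2, (x 0 0 - x 1 1) / √2, (x 0 1 - x 1 0) / √2]

def basisMat : Fin 3 → Matrix (Fin 2) (Fin 2) ℝ :=
  ![(√2)⁻¹ • !![0, 1; 1, 0], (√2)⁻¹ • !![1, 0; 0, -1], (√2)⁻¹ • !![0, 1; -1, 0]]

/-- The form `(x, y) = tr (x y)`; on traceless matrices `(x, x) = -2 det x`. -/
def form (x y : Matrix (Fin 2) (Fin 2) ℝ) : ℝ := (x * y).trace

/-- `(eᵢ, eᵢ)`. -/
def eps : Fin 3 → ℂ := ![1, 1, -1]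

def conj (g : SL(2, ℝ)) (x : Matrix (Fin 2) (Fin 2) ℝ) : Matrix (Fin 2) (Fin 2) ℝ :=
  (g : Matrix (Fin 2) (Fin 2) ℝ) * x * (g⁻¹ : SL(2, ℝ))

/-- The matrix of `x ↦ g x g⁻¹` in the basis `e₁, e₂, e₃`. -/
def adMatrix (g : SL(2, ℝ)) : Matrix (Fin 3) (Fin 3) ℂ :=
  Matrix.of fun i j => ((coord (conj g (basisMat j)) i : ℝ) : ℂ)

theorem coord_sum (c : Fin 3 → ℝ) : coord (∑ j, c j • basisMat j) = c := by
  have h : (√2 : ℝ) ≠ 0 := by positivity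
  have h2 : (√2 : ℝ) ^ 2 = 2 := by norm_num
  ext i
  fin_cases i <;>
    simp [coord, basisMat, Fin.sum_univ_three] <;> field_simp <;> rw [h2] <;> ring

theorem sum_coord {x : Matrix (Fin 2) (Fin 2) ℝ} (hx : x.trace = 0) :
    ∑ j, coord x j • basisMat j = x := by
  have h : (√2 : ℝ) ≠ 0 := by positivity
  have h2 : (√2 : ℝ) ^ 2 = 2 := by norm_num
  have hx' : x 1 1 = - x 0 0 := by
    rw [Matrix.trace_fin_two] at hx; linarith
  ext i j
  fin_cases i <;> fin_cases j <;>
    simp [coord, basisMat, Fin.sum_univ_three, hx'] <;> field_simp <;> rw [h2] <;> ring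

theorem trace_conj (g : SL(2, ℝ)) (x : Matrix (Fin 2) (Fin 2) ℝ) :
    (conj g x).trace = x.trace := by
  rw [conj, Matrix.trace_mul_cycle, ← Matrix.SpecialLinearGroup.coe_mul]; simp

theorem conj_mul (g h : SL(2, ℝ)) (x : Matrix (Fin 2) (Fin 2) ℝ) :
    conj (g * h) x = conj g (conj h x) := by
  simp [conj, Matrix.mul_assoc, -Matrix.SpecialLinearGroup.coe_inv]

theorem conj_mul_conj (g : SL(2, ℝ)) (x y : Matrix (Fin 2) (Fin 2) ℝ) :
    conj g x * conj g y = conj g (x * y) := by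
  have h : ((g⁻¹ : SL(2, ℝ)) : Matrix (Fin 2) (Fin 2) ℝ) * (g : Matrix (Fin 2) (Fin 2) ℝ) = 1 := by
    rw [← Matrix.SpecialLinearGroup.coe_mul]; simp
  calc conj g x * conj g y
      = (g : Matrix (Fin 2) (Fin 2) ℝ) * x * (((g⁻¹ : SL(2, ℝ)) : Matrix (Fin 2) (Fin 2) ℝ)
          * (g : Matrix (Fin 2) (Fin 2) ℝ)) * y * (g⁻¹ : SL(2, ℝ)) := by
        simp only [conj, Matrix.mul_assoc]
    _ = _ := by rw [h]; simp only [conj, Matrix.mul_assoc, Matrix.mul_one]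

theorem conj_sum (g : SL(2, ℝ)) (c : Fin 3 → ℝ) :
    conj g (∑ j, c j • basisMat j) = ∑ j, c j • conj g (basisMat j) := by
  simp only [conj, Matrix.mul_sum, Matrix.sum_mul, Matrix.mul_smul, Matrix.smul_mul]

theorem trace_basisMat (j : Fin 3) : (basisMat j).trace = 0 := by
  fin_cases j <;> simp [basisMat, Matrix.trace_fin_two]

theorem coord_linear (c : Fin 3 → ℝ) (x : Fin 3 → Matrix (Fin 2) (Fin 2) ℝ) (i : Fin 3) :
    coord (∑ j, c j • x j) i = ∑ j, c j * coord (x j) i := by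
  fin_cases i <;> simp [coord, Fin.sum_univ_three] <;> ring

theorem adMatrix_mul (g h : SL(2, ℝ)) : adMatrix (g * h) = adMatrix g * adMatrix h := by
  ext i j
  simp only [adMatrix, Matrix.of_apply, Matrix.mul_apply]
  have e : conj (g * h) (basisMat j)
      = ∑ l, coord (conj h (basisMat j)) l • conj g (basisMat l) := by
    rw [conj_mul, ← conj_sum, sum_coord]
    rw [trace_conj, trace_basisMat]
  rw [e, coord_linear]
  push_cast
  exact Finset.sum_congr rfl fun l _ => mul_comm _ _

theorem adMatrix_one : adMatrix 1 = 1 := by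
  ext i j
  have : conj 1 (basisMat j) = ∑ l, (Pi.single j (1 : ℝ) : Fin 3 → ℝ) l • basisMat l := by
    simp [conj, Pi.single_apply]
  simp only [adMatrix, Matrix.of_apply, this, coord_sum, Matrix.one_apply, Pi.single_apply]
  split_ifs <;> simp

theorem form_eq {x y : Matrix (Fin 2) (Fin 2) ℝ} (hx : x.trace = 0) (hy : y.trace = 0) :
    ((form x y : ℝ) : ℂ) = ∑ a, eps a * coord x a * coord y a := by
  have h : (√2 : ℝ) ≠ 0 := by positivity
  have h2 : (√2 : ℝ) ^ 2 = 2 := by norm_num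
  have hx' : x 1 1 = - x 0 0 := by
    rw [Matrix.trace_fin_two] at hx; linarith
  have hy' : y 1 1 = - y 0 0 := by
    rw [Matrix.trace_fin_two] at hy; linarith
  have : form x y = coord x 0 * coord y 0 + coord x 1 * coord y 1 - coord x 2 * coord y 2 := by
    simp [form, coord, Matrix.trace_fin_two, Matrix.mul_apply, hx', hy']
    field_simp
    rw [h2]; ring
  rw [this]
  simp [Fin.sum_univ_three, eps]
  ring

/-- The action preserves the form. -/
theorem adMatrix_isometry (g : SL(2, ℝ)) (p q : Fin 3) :
    ∑ a, eps a * adMatrix g a p * adMatrix g a q = if p = q then eps p else 0 := by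
  have h1 := form_eq (x := conj g (basisMat p)) (y := conj g (basisMat q))
    (by rw [trace_conj, trace_basisMat]) (by rw [trace_conj, trace_basisMat])
  have h2 := form_eq (trace_basisMat p) (trace_basisMat q)
  have e : form (conj g (basisMat p)) (conj g (basisMat q)) = form (basisMat p) (basisMat q) := by
    rw [form, conj_mul_conj, trace_conj, form]
  rw [e, h2] at h1
  have hc : ∀ j, coord (basisMat j) = Pi.single j 1 := by
    intro j
    have : basisMat j = ∑ l, (Pi.single j (1 : ℝ) : Fin 3 → ℝ) l • basisMat l := by
      simp [Pi.single_apply]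
    rw [this, coord_sum]
  simp only [adMatrix, Matrix.of_apply]
  rw [← h1]
  simp only [hc, Pi.single_apply]
  fin_cases p <;> fin_cases q <;> simp [Fin.sum_univ_three]

/-- Tensors of degree `k` over `V_ℂ`, as coefficient families in the basis `e_{β₁} ⊗ ⋯ ⊗ e_{β_k}`. -/
abbrev Tensor (k : ℕ) : Type := (Fin k → Fin 3) → ℂ

/-- The bilinear extension of the form of `V` to tensors. -/
def tForm (k : ℕ) : LinearMap.BilinForm ℂ (Tensor k) :=
  LinearMap.mk₂ ℂ (fun S T => ∑ β, (∏ i, eps (β i)) * S β * T β)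
    (fun S S' T => by simp [mul_add, add_mul, Finset.sum_add_distrib])
    (fun c S T => by
      simp only [Pi.smul_apply, smul_eq_mul, Finset.mul_sum]
      exact Finset.sum_congr rfl fun β _ => by ring)
    (fun S T T' => by simp [mul_add, Finset.sum_add_distrib])
    (fun c S T => by
      simp only [Pi.smul_apply, smul_eq_mul, Finset.mul_sum]
      exact Finset.sum_congr rfl fun β _ => by ring)

/-- The harmonic (symmetric and traceless) tensors of degree `k`: the irreducible representation of
dimension `2 k + 1`. -/
def Harm (k : ℕ) : Submodule ℂ (Tensor k) where
  carrier := {T | (∀ (s : Equiv.Perm (Fin k)) (β : Fin k → Fin 3), T (β ∘ s) = T β) ∧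
    ∀ i j : Fin k, i ≠ j → ∀ β : Fin k → Fin 3,
      ∑ a, eps a * T (Function.update (Function.update β i a) j a) = 0}
  add_mem' := by
    rintro S T ⟨hS, hS'⟩ ⟨hT, hT'⟩
    refine ⟨fun s β => by simp [hS, hT], fun i j hij β => ?_⟩
    simp only [Pi.add_apply, mul_add, Finset.sum_add_distrib, hS' i j hij, hT' i j hij, add_zero]
  zero_mem' := by simp
  smul_mem' := by
    rintro c T ⟨hT, hT'⟩
    refine ⟨fun s β => by simp [hT], fun i j hij β => ?_⟩
    simp only [Pi.smul_apply, smul_eq_mul, mul_left_comm _ c, ← Finset.mul_sum, hT' i j hij,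
      mul_zero]

/-- The space of harmonic tensors, as a normed space of its own. -/
def Coeff (k : ℕ) : Type := Harm k

instance (k : ℕ) : NormedAddCommGroup (Coeff k) := inferInstanceAs (NormedAddCommGroup (Harm k))

instance (k : ℕ) : NormedSpace ℂ (Coeff k) := inferInstanceAs (NormedSpace ℂ (Harm k))

instance (k : ℕ) : FiniteDimensional ℂ (Coeff k) := inferInstanceAs (FiniteDimensional ℂ (Harm k))

/-- The inclusion of the harmonic tensors in all tensors. -/
def incl (k : ℕ) : Coeff k →ₗ[ℂ] Tensor k := (Harm k).subtype

/-- The form of `V` on harmonic tensors. -/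
def hForm {k : ℕ} (v w : Coeff k) : ℂ := tForm k (incl k v) (incl k w)

theorem isCompl_harm (k : ℕ) : IsCompl (Harm k) ((tForm k).orthogonal (Harm k)) := by
  have hrefl : (tForm k).IsRefl := by
    intro S T h
    simp only [tForm, LinearMap.mk₂_apply] at h ⊢
    rw [← h]
    exact Finset.sum_congr rfl fun β _ => by ring
  refine (LinearMap.BilinForm.isCompl_orthogonal_iff_disjoint hrefl).2 ?_
  rw [Submodule.disjoint_def]
  intro T hT hT'
  have heps : ∀ a, eps a * eps a = 1 := by intro a; fin_cases a <;> simp [eps]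
  have hconj : ∀ a, star (eps a) = eps a := by intro a; fin_cases a <;> simp [eps]
  let S : Tensor k := fun β => (∏ i, eps (β i)) * star (T β)
  have hS : S ∈ Harm k := by
    refine ⟨fun s β => ?_, fun i j hij β => ?_⟩
    · simp only [S, hT.1, Function.comp_apply]
      rw [Equiv.prod_comp s (fun i => eps (β i))]
    · have h := congrArg star (hT.2 i j hij β)
      simp only [star_sum, star_mul', hconj, star_zero] at h
      have hprod : ∀ a, (∏ l, eps (Function.update (Function.update β i a) j a l))
          = ∏ l ∈ (Finset.univ.erase j).erase i, eps (β l) := by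
        intro a
        rw [← Finset.mul_prod_erase _ _ (Finset.mem_univ j),
          ← Finset.mul_prod_erase (Finset.univ.erase j) _ (Finset.mem_erase.2
            ⟨hij, Finset.mem_univ i⟩)]
        simp only [Function.update_self, Function.update_of_ne hij, ← mul_assoc, heps, one_mul]
        refine Finset.prod_congr rfl fun l hl => ?_
        have h1 : l ≠ i := Finset.ne_of_mem_erase hl
        have h2 : l ≠ j := Finset.ne_of_mem_erase (Finset.mem_of_mem_erase hl)
        rw [Function.update_of_ne h2, Function.update_of_ne h1]
      simp only [S, hprod, mul_left_comm (eps _), ← Finset.mul_sum, h, mul_zero]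
  have h0 : tForm k S T = 0 := hT' S hS
  simp only [tForm, LinearMap.mk₂_apply, S] at h0
  have h1 : ∑ β, ((Complex.normSq (T β) : ℝ) : ℂ) = 0 := by
    rw [← h0]
    refine Finset.sum_congr rfl fun β _ => ?_
    have : (∏ i, eps (β i)) * (∏ i, eps (β i)) = 1 := by
      rw [← Finset.prod_mul_distrib]; simp [heps]
    rw [← mul_assoc, this, one_mul, Complex.normSq_eq_conj_mul_self]; rfl
  rw [← Complex.ofReal_sum, Complex.ofReal_eq_zero,
    Finset.sum_eq_zero_iff_of_nonneg fun β _ => Complex.normSq_nonneg _] at h1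
  ext β
  simpa using h1 β (Finset.mem_univ β)

/-- The orthogonal projection of tensors to harmonic tensors. -/
def harmProj (k : ℕ) : Tensor k →ₗ[ℂ] Coeff k := Submodule.projectionOnto _ _ (isCompl_harm k)

/-- The pure tensor `x ⊗ ⋯ ⊗ x`, for a traceless matrix `x`. -/
def purePow (k : ℕ) (x : Matrix (Fin 2) (Fin 2) ℝ) : Tensor k :=
  fun β => ∏ i, ((coord x (β i) : ℝ) : ℂ)

/-- The action of `g` on tensors. -/
def tensorAct (k : ℕ) (g : SL(2, ℝ)) : Tensor k →ₗ[ℂ] Tensor k :=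
  Matrix.toLin' (Matrix.of fun β α => ∏ i, adMatrix g (β i) (α i))

theorem tensorAct_apply (k : ℕ) (g : SL(2, ℝ)) (T : Tensor k) (β : Fin k → Fin 3) :
    tensorAct k g T β = ∑ α : Fin k → Fin 3, (∏ i, adMatrix g (β i) (α i)) * T α := rfl

theorem tensorAct_mul (k : ℕ) (g h : SL(2, ℝ)) :
    tensorAct k (g * h) = tensorAct k g ∘ₗ tensorAct k h := by
  rw [tensorAct, tensorAct, tensorAct, ← Matrix.toLin'_mul]
  congr 1
  ext β α
  simp only [adMatrix_mul, Matrix.of_apply, Matrix.mul_apply, Finset.prod_univ_sum,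
    Fintype.piFinset_univ, Finset.prod_mul_distrib]

theorem tensorAct_one (k : ℕ) : tensorAct k 1 = LinearMap.id := by
  rw [tensorAct, ← Matrix.toLin'_one]
  congr 1
  ext β α
  simp only [adMatrix_one, Matrix.of_apply, Matrix.one_apply, Finset.prod_ite_zero,
    Finset.prod_const_one, Finset.mem_univ, true_implies, funext_iff]

theorem sum_update {k : ℕ} (i : Fin k) (H : (Fin k → Fin 3) → ℂ) :
    ∑ α : Fin k → Fin 3, ∑ a, H (Function.update α i a) = 3 * ∑ α, H α := by
  let e : (Fin k → Fin 3) × Fin 3 ≃ (Fin k → Fin 3) × Fin 3 :=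
    { toFun := fun p => (Function.update p.1 i p.2, p.1 i)
      invFun := fun p => (Function.update p.1 i p.2, p.1 i)
      left_inv := fun p => by simp
      right_inv := fun p => by simp }
  rw [← Fintype.sum_prod_type' (fun α a => H (Function.update α i a))]
  have h := Equiv.sum_comp e (fun p => H p.1)
  simp only [e, Equiv.coe_fn_mk] at h
  rw [h, Fintype.sum_prod_type]
  simp [Finset.mul_sum]

theorem tensorAct_mem {k : ℕ} (g : SL(2, ℝ)) {T : Tensor k} (hT : T ∈ Harm k) :
    tensorAct k g T ∈ Harm k := by
  refine ⟨fun s β => ?_, fun i j hij β => ?_⟩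
  · simp only [tensorAct_apply]
    refine Fintype.sum_equiv (Equiv.arrowCongr s (Equiv.refl (Fin 3))) _ _ fun α => ?_
    have e1 : (Equiv.arrowCongr s (Equiv.refl (Fin 3))) α = α ∘ s.symm := rfl
    rw [e1, hT.1 s.symm α, ← Equiv.prod_comp s (fun l => adMatrix g (β l) ((α ∘ s.symm) l))]
    simp
  · simp only [tensorAct_apply, Finset.mul_sum]
    rw [Finset.sum_comm]
    set R : (Fin k → Fin 3) → ℂ :=
      fun α => ∏ l ∈ (Finset.univ.erase j).erase i, adMatrix g (β l) (α l) with hR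
    have key : ∀ α : Fin k → Fin 3,
        ∑ a, eps a * ((∏ l, adMatrix g (Function.update (Function.update β i a) j a l) (α l)) * T α)
          = (if α i = α j then eps (α i) else 0) * (R α * T α) := by
      intro α
      rw [← adMatrix_isometry g (α i) (α j), Finset.sum_mul]
      refine Finset.sum_congr rfl fun a _ => ?_
      rw [← Finset.mul_prod_erase _ _ (Finset.mem_univ j),
          ← Finset.mul_prod_erase (Finset.univ.erase j) _ (Finset.mem_erase.2
            ⟨hij, Finset.mem_univ i⟩)]
      have : (∏ l ∈ (Finset.univ.erase j).erase i,
          adMatrix g (Function.update (Function.update β i a) j a l) (α l)) = R α := by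
        refine Finset.prod_congr rfl fun l hl => ?_
        have h1 : l ≠ i := Finset.ne_of_mem_erase hl
        have h2 : l ≠ j := Finset.ne_of_mem_erase (Finset.mem_of_mem_erase hl)
        rw [Function.update_of_ne h2, Function.update_of_ne h1]
      rw [this]
      simp only [Function.update_self, Function.update_of_ne hij]
      ring
    simp only [key]
    have h9 : (3 : ℂ) * (3 * ∑ α : Fin k → Fin 3,
        (if α i = α j then eps (α i) else 0) * (R α * T α)) = 0 := by
      rw [← sum_update j, ← sum_update i]
      refine Finset.sum_eq_zero fun α _ => ?_
      have hRα : ∀ p q, R (Function.update (Function.update α i p) j q) = R α := by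
        intro p q
        refine Finset.prod_congr rfl fun l hl => ?_
        have h1 : l ≠ i := Finset.ne_of_mem_erase hl
        have h2 : l ≠ j := Finset.ne_of_mem_erase (Finset.mem_of_mem_erase hl)
        rw [Function.update_of_ne h2, Function.update_of_ne h1]
      simp only [hRα, Function.update_self, Function.update_of_ne hij, ite_mul, zero_mul,
        Finset.sum_ite_eq, Finset.mem_univ, if_true]
      have := hT.2 i j hij α
      calc _ = R α * ∑ a, eps a * T (Function.update (Function.update α i a) j a) := by
            rw [Finset.mul_sum]; exact Finset.sum_congr rfl fun a _ => by ring
        _ = 0 := by rw [this, mul_zero]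
    simpa using h9

/-- The representation of `SL₂(ℝ)` on harmonic tensors of degree `k`. -/
def harmRep (k : ℕ) : Representation ℂ SL(2, ℝ) (Coeff k) where
  toFun g := ((tensorAct k g).restrict fun _ hT => tensorAct_mem g hT : Harm k →ₗ[ℂ] Harm k)
  map_one' := LinearMap.ext fun T => Subtype.ext (by simp [tensorAct_one]; rfl)
  map_mul' g h := LinearMap.ext fun T => Subtype.ext (by simp [tensorAct_mul]; rfl)

/-- `SL₂(ℤ) → SL₂(ℝ)`. -/
def toReal : SL(2, ℤ) →* SL(2, ℝ) := Matrix.SpecialLinearGroup.map (Int.castRingHom ℝ)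

/-- The coefficient module `E`. -/
def rep (k : ℕ) : Representation ℂ SL(2, ℤ) (Coeff k) := (harmRep k).comp toReal

/-! ## The Borel-Serre enlargement of the upper half plane -/

/-- Two pairs `(σ, x)` are identified when they give the same cusp `σ ∞` and the same limit of the
points `σ (x + i y)`, `y → ∞`, in the horocycle at that cusp. -/
instance boundarySetoid : Setoid (SL(2, ℤ) × ℝ) where
  r p q := ∃ m : ℤ, (q.1 = p.1 * ModularGroup.T ^ m ∨ q.1 = -(p.1 * ModularGroup.T ^ m)) ∧
    p.2 = q.2 + m
  iseqv :=
    { refl := fun p => ⟨0, by simp⟩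
      symm := by
        rintro ⟨a, x⟩ ⟨b, y⟩ ⟨m, h, h'⟩
        refine ⟨-m, ?_, ?_⟩
        · rcases h with h | h <;> simp only at h <;> subst h <;> simp
        · simp only at h' ⊢; rw [h']; push_cast; ring
      trans := by
        rintro ⟨a, x⟩ ⟨b, y⟩ ⟨c, z⟩ ⟨m, h, h'⟩ ⟨n, g, g'⟩
        refine ⟨m + n, ?_, ?_⟩
        · rcases h with h | h <;> rcases g with g | g <;> simp only at h g <;> subst h <;>
            subst g <;> simp [_root_.zpow_add, mul_assoc]
        · simp only at h' g' ⊢; rw [h', g']; push_cast; ring }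

/-- The boundary of the Borel-Serre enlargement: one real line for each cusp. -/
def Boundary : Type := Quotient boundarySetoid

/-- The boundary point `lim σ (x + i y)`, `y → ∞`. -/
def bdry (σ : SL(2, ℤ)) (x : ℝ) : Boundary := Quotient.mk _ (σ, x)

instance : MulAction SL(2, ℤ) Boundary where
  smul γ := Quotient.map (fun p => (γ * p.1, p.2)) (by
    rintro ⟨a, x⟩ ⟨b, y⟩ ⟨m, h, h'⟩
    refine ⟨m, ?_, h'⟩
    rcases h with h | h <;> simp only at h <;> subst h <;> simp [mul_assoc])
  one_smul := by rintro ⟨a, x⟩; exact congrArg (Quotient.mk _) (by simp)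
  mul_smul γ δ := by rintro ⟨a, x⟩; exact congrArg (Quotient.mk _) (by simp [mul_assoc])

/-- The upper half plane with the boundary lines added at all cusps. The Borel-Serre
compactification of `Γ \ ℍ` is its quotient by `Γ`. -/
abbrev Dbar : Type := ℍ ⊕ Boundary

/-- The point `σ (x + i y)` of `ℍ`, for `0 < y`. -/
def frame (σ : SL(2, ℤ)) (x y : ℝ) : ℍ := σ • (ofComplex (x + y * Complex.I))

/-- The chart at the cusp `σ ∞`, defined on `{(x, t) | 0 ≤ t}`. -/
def chart (σ : SL(2, ℤ)) (p : ℝ × ℝ) : Dbar :=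
  if 0 < p.2 then .inl (frame σ p.1 p.2⁻¹) else .inr (bdry σ p.1)

/-- The ordered simplices with vertices in the enlarged upper half plane whose isotropy groups
increase along the directed edges, with the action of `Γ`. -/
def simplices (Γ : Subgroup SL(2, ℤ)) : GComplex Γ Dbar where
  Adj p q := p ≠ q ∧ MulAction.stabilizer SL(2, ℤ) p ≤ MulAction.stabilizer SL(2, ℤ) q
  smul_adj := by
    rintro ⟨g, hg⟩ a b ⟨h, h'⟩
    refine ⟨fun e => h ?_, ?_⟩
    · exact smul_left_cancel g e
    · change MulAction.stabilizer _ (g • a) ≤ MulAction.stabilizer _ (g • b)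
      intro δ hδ
      have e : g⁻¹ * δ * g ∈ MulAction.stabilizer SL(2, ℤ) b := by
        apply h'
        rw [MulAction.mem_stabilizer_iff] at hδ ⊢
        rw [mul_smul, mul_smul, hδ, inv_smul_smul]
      rw [MulAction.mem_stabilizer_iff] at e ⊢
      rw [mul_smul, mul_smul, inv_smul_eq_iff] at e
      exact e
  stab_le := by
    rintro a b ⟨-, h'⟩ ⟨g, hg⟩ hga
    have : g • b = b := h' (show g • a = a from hga)
    exact this

/-- The coefficient module as a representation of `Γ`. -/
def repSub (k : ℕ) (Γ : Subgroup SL(2, ℤ)) : Representation ℂ Γ (Coeff k) :=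
  (rep k).comp Γ.subtype

/-- `H₁` of the Borel-Serre compactification of `Γ \ ℍ`, with coefficients in the quotient of the
flat bundle with fibre `Coeff k`. -/
abbrev Homology (k : ℕ) (Γ : Subgroup SL(2, ℤ)) : Type :=
  (quotientSystem (simplices Γ) (repSub k Γ)).H1

/-- Chains upstairs, with coefficients in `Coeff k`. -/
abbrev Chain (k : ℕ) (Γ : Subgroup SL(2, ℤ)) : Type := (flatSystem (simplices Γ) (Coeff k)).C1

/-! ## Differential forms with coefficients -/

/-- A 1-form on `ℍ` with values in `Coeff k`. -/
abbrev OneForm (k : ℕ) : Type := ℍ → (ℂ →L[ℝ] Coeff k)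

/-- `v` is the value at `bdry σ x`, on the tangent vector `∂ / ∂ x`, of the restriction of `ξ` to
the boundary. -/
def RestrictsTo {k : ℕ} (ξ : OneForm k) (σ : SL(2, ℤ)) (x : ℝ) (v : Coeff k) : Prop :=
  Tendsto (fun y : ℝ => ξ (frame σ x y) (1 / denom σ (x + y * Complex.I) ^ 2)) atTop (𝓝 v)

/-- A closed 1-form on `ℍ`, smooth up to the boundary at all cusps, and `Γ`-equivariant. -/
structure IsClosedForm {k : ℕ} (Γ : Subgroup SL(2, ℤ)) (ξ : OneForm k) : Prop where
  smooth : ∀ σ : SL(2, ℤ), ∃ A : ℝ × ℝ → (ℝ × ℝ →L[ℝ] Coeff k),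
    ContDiffOn ℝ ∞ A {p | 0 ≤ p.2} ∧ ∀ p : ℝ × ℝ, 0 < p.2 →
      A p = (ξ (frame σ p.1 p.2⁻¹)).comp
        (fderiv ℝ (fun p : ℝ × ℝ => (frame σ p.1 p.2⁻¹ : ℂ)) p)
  closed : ∀ z : ℍ, ∃ A : ℂ →L[ℝ] ℂ →L[ℝ] Coeff k,
    HasFDerivAt (fun w : ℂ => ξ (ofComplex w)) A z ∧ ∀ u v, A u v = A v u
  equivariant : ∀ γ ∈ Γ, ∀ (z : ℍ) (u : ℂ), ξ (γ • z) (u / denom γ z ^ 2) = rep k γ (ξ z u)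

/-- A function on the enlarged upper half plane that is smooth up to the boundary. -/
def SmoothFun {k : ℕ} (f : Dbar → Coeff k) : Prop :=
  ∀ σ : SL(2, ℤ), ContDiffOn ℝ ∞ (f ∘ chart σ) {p | 0 ≤ p.2}

/-- `f` is smooth up to the boundary, with differential `ξ` on `ℍ`. -/
def IsPrimitive {k : ℕ} (f : Dbar → Coeff k) (ξ : OneForm k) : Prop :=
  SmoothFun f ∧ ∀ z : ℍ, HasFDerivAt (fun w : ℂ => f (.inl (ofComplex w))) (ξ z) z

/-- The 1-cocycles `(a, b)` of the mapping cone of the restriction to the boundary: `a` is a closed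
1-form on the compactification, `b` a function on the boundary, and `d b` is the restriction of
`a`. -/
def coneCocycles (k : ℕ) (Γ : Subgroup SL(2, ℤ)) :
    Submodule ℂ (OneForm k × (Boundary → Coeff k)) where
  carrier := {p | IsClosedForm Γ p.1 ∧ (∀ γ ∈ Γ, ∀ q, p.2 (γ • q) = rep k γ (p.2 q)) ∧
    ∀ σ x, ∃ v, RestrictsTo p.1 σ x v ∧ HasDerivAt (fun x => p.2 (bdry σ x)) v x}
  add_mem' := by
    rintro ⟨a, b⟩ ⟨a', b'⟩ ⟨h1, h2, h3⟩ ⟨h1', h2', h3'⟩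
    refine ⟨⟨fun σ => ?_, fun z => ?_, fun γ hγ z u => ?_⟩, fun γ hγ q => ?_, fun σ x => ?_⟩
    · obtain ⟨A, hA, hA'⟩ := h1.smooth σ
      obtain ⟨B, hB, hB'⟩ := h1'.smooth σ
      exact ⟨A + B, hA.add hB, fun p hp => by
        simp only [Pi.add_apply, hA' p hp, hB' p hp, Prod.mk_add_mk, ContinuousLinearMap.add_comp]⟩
    · obtain ⟨A, hA, hA'⟩ := h1.closed z
      obtain ⟨B, hB, hB'⟩ := h1'.closed z
      exact ⟨A + B, hA.add hB, fun u v => by simp [hA' u v, hB' u v]⟩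
    · have e := h1.equivariant γ hγ z u
      have e' := h1'.equivariant γ hγ z u
      simp only at e e'
      simp only [Prod.mk_add_mk, Pi.add_apply, _root_.add_apply, e, e', map_add]
    · simp only at h2 h2'
      simp [h2 γ hγ q, h2' γ hγ q]
    · obtain ⟨v, hv, hv'⟩ := h3 σ x
      obtain ⟨w, hw, hw'⟩ := h3' σ x
      exact ⟨v + w, hv.add hw, hv'.add hw'⟩
  zero_mem' := by
    refine ⟨⟨fun σ => ⟨0, contDiffOn_const, fun p _ => by simp⟩, fun z => ⟨0, ?_, fun _ _ => rfl⟩,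
      fun γ hγ z u => by simp⟩, fun γ hγ q => by simp, fun σ x => ⟨0, ?_, ?_⟩⟩
    · exact hasFDerivAt_const _ _
    · exact tendsto_const_nhds
    · exact hasDerivAt_const _ _
  smul_mem' := by
    rintro c ⟨a, b⟩ ⟨h1, h2, h3⟩
    refine ⟨⟨fun σ => ?_, fun z => ?_, fun γ hγ z u => ?_⟩, fun γ hγ q => ?_, fun σ x => ?_⟩
    · obtain ⟨A, hA, hA'⟩ := h1.smooth σ
      exact ⟨c • A, hA.const_smul c, fun p hp => by
        simp only [Pi.smul_apply, hA' p hp, Prod.smul_mk]; rfl⟩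
    · obtain ⟨A, hA, hA'⟩ := h1.closed z
      exact ⟨c • A, hA.const_smul c, fun u v => by simp [hA' u v]⟩
    · have e := h1.equivariant γ hγ z u
      simp only at e
      simp only [Prod.smul_mk, Pi.smul_apply, _root_.smul_apply, e, map_smul]
    · simp only at h2
      simp [h2 γ hγ q]
    · obtain ⟨v, hv, hv'⟩ := h3 σ x
      exact ⟨c • v, hv.const_smul c, hv'.const_smul c⟩

/-- The 1-coboundaries `(d f, f |_∂)` of the mapping cone. -/
def coneCoboundaries (k : ℕ) (Γ : Subgroup SL(2, ℤ)) :
    Submodule ℂ (OneForm k × (Boundary → Coeff k)) where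
  carrier := {p | ∃ f : Dbar → Coeff k, IsPrimitive f p.1 ∧
    (∀ γ ∈ Γ, ∀ q, f (γ • q) = rep k γ (f q)) ∧ ∀ q, p.2 q = f (.inr q)}
  add_mem' := by
    rintro ⟨a, b⟩ ⟨a', b'⟩ ⟨f, ⟨h1, h2⟩, h3, h4⟩ ⟨f', ⟨h1', h2'⟩, h3', h4'⟩
    refine ⟨f + f', ⟨fun σ => (h1 σ).add (h1' σ), fun z => (h2 z).add (h2' z)⟩,
      fun γ hγ q => ?_, fun q => ?_⟩
    · simp [h3 γ hγ q, h3' γ hγ q]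
    · simp only at h4 h4'
      simp [h4, h4']
  zero_mem' := ⟨0, ⟨fun σ => contDiffOn_const, fun z => hasFDerivAt_const _ _⟩,
    fun γ hγ q => by simp, fun q => rfl⟩
  smul_mem' := by
    rintro c ⟨a, b⟩ ⟨f, ⟨h1, h2⟩, h3, h4⟩
    refine ⟨c • f, ⟨fun σ => (h1 σ).const_smul c, fun z => (h2 z).const_smul c⟩,
      fun γ hγ q => ?_, fun q => ?_⟩
    · simp [h3 γ hγ q]
    · simp only at h4
      simp [h4]

/-- The cohomology `H¹` of the mapping cone of the restriction to the boundary, which is the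
compactly supported cohomology `H¹_c`. -/
def ConeCohomology (k : ℕ) (Γ : Subgroup SL(2, ℤ)) : Type :=
  coneCocycles k Γ ⧸ (coneCoboundaries k Γ).submoduleOf (coneCocycles k Γ)

instance (k : ℕ) (Γ : Subgroup SL(2, ℤ)) : AddCommGroup (ConeCohomology k Γ) :=
  inferInstanceAs (AddCommGroup (_ ⧸ (coneCoboundaries k Γ).submoduleOf (coneCocycles k Γ)))

instance (k : ℕ) (Γ : Subgroup SL(2, ℤ)) : Module ℂ (ConeCohomology k Γ) :=
  inferInstanceAs (Module ℂ (_ ⧸ (coneCoboundaries k Γ).submoduleOf (coneCocycles k Γ)))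

/-- The canonical topology of a (finite-dimensional) complex vector space. -/
instance (k : ℕ) (Γ : Subgroup SL(2, ℤ)) : TopologicalSpace (ConeCohomology k Γ) :=
  moduleTopology ℂ (ConeCohomology k Γ)

/-- The class of a cocycle. -/
def coneClass {k : ℕ} {Γ : Subgroup SL(2, ℤ)} (p : coneCocycles k Γ) : ConeCohomology k Γ :=
  Submodule.Quotient.mk p

/-! ## The pairing with closed forms, and Poincaré duality -/

/-- The group generated by `Γ` and `-1`. -/
def plusMinus (Γ : Subgroup SL(2, ℤ)) : Subgroup SL(2, ℤ) := Γ ⊔ Subgroup.closure {-1}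

/-- The coefficient of `d x ∧ d y` in `η ∧ a`. -/
def wedge {k : ℕ} (η a : OneForm k) (z : ℍ) : ℂ :=
  hForm (η z 1) (a z Complex.I) - hForm (η z Complex.I) (a z 1)

/-- The value on `∂ / ∂ x` at `bdry σ x` of the restriction of a form to the boundary. -/
def boundaryValue {k : ℕ} (ξ : OneForm k) (σ : SL(2, ℤ)) (x : ℝ) : Coeff k :=
  limUnder atTop
    fun y : ℝ => ξ (frame σ x y) (1 / denom σ (x + y * Complex.I) ^ 2)

/-- `⟨η, (a, b)⟩ = ∫_X η ∧ a - ∫_{∂ X} η b`. The quotient of `ℍ` by `Γ` is cut into the translates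
of the standard fundamental domain of `SL₂(ℤ)` by representatives of the cosets of `Γ`, with their
boundary segments; the invariant measure of `ℍ` is `d x d y / y ^ 2`. -/
def pairing {k : ℕ} (Γ : Subgroup SL(2, ℤ)) (η : OneForm k)
    (p : OneForm k × (Boundary → Coeff k)) : ℂ :=
  ∑ᶠ q : Quotient (QuotientGroup.rightRel (plusMinus Γ)),
    ((∫ w in ModularGroup.fd, ((q.out • w : ℍ).im : ℂ) ^ 2 * wedge η p.1 (q.out • w))
      - ∫ x in (-1 / 2 : ℝ)..(1 / 2 : ℝ),
          hForm (boundaryValue η q.out x) (p.2 (bdry q.out x)))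

open scoped Classical in
/-- The integral over a chain of the form with primitive `F`: on `(p, q) ⊗ v` it is
`(F q - F p, v)`. -/
def period {k : ℕ} (Γ : Subgroup SL(2, ℤ)) (F : Dbar → Coeff k) : Chain k Γ →ₗ[ℂ] ℂ :=
  DirectSum.toModule ℂ (LocalSystem.E1 (simplices Γ).toComplex) ℂ fun e =>
    tForm k (incl k (F e.2.1 - F e.1)) ∘ₗ incl k

/-- `P` is Poincaré dual to the homology class `C`: `⟨η, P⟩ = ∫_C η` for all closed `η`. -/
def IsPoincareDual {k : ℕ} {Γ : Subgroup SL(2, ℤ)} (C : Homology k Γ)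
    (P : ConeCohomology k Γ) : Prop :=
  ∀ η : OneForm k, IsClosedForm Γ η → ∀ F : Dbar → Coeff k, IsPrimitive F η →
    ∀ p : coneCocycles k Γ, coneClass p = P →
    ∀ (c : Chain k Γ)
      (hc : pushforward (simplices Γ) (repSub k Γ) c ∈
        LinearMap.ker (quotientSystem (simplices Γ) (repSub k Γ)).d1),
      (Submodule.Quotient.mk ⟨_, hc⟩ : Homology k Γ) = C →
      pairing Γ η p = period Γ F c

/-! ## The lattice and the theta series -/

/-- A lattice in the space of traceless rational matrices that is even for the form
`(x, y) = tr (x y)`. -/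
structure IsEvenLattice (L : AddSubgroup (Matrix (Fin 2) (Fin 2) ℚ)) : Prop where
  fg : L.FG
  span_eq : ∀ x : Matrix (Fin 2) (Fin 2) ℚ, x ∈ Submodule.span ℚ (L : Set _) ↔ x.trace = 0
  even : ∀ x ∈ L, ∃ m : ℤ, (x * x).trace = 2 * m

/-- `h` lies in the dual lattice of `L`. -/
def IsDual (L : AddSubgroup (Matrix (Fin 2) (Fin 2) ℚ)) (h : Matrix (Fin 2) (Fin 2) ℚ) : Prop :=
  h.trace = 0 ∧ ∀ x ∈ L, ∃ m : ℤ, (h * x).trace = m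

/-- The action of `SL₂(ℤ)` on rational matrices. -/
def conjQ (γ : SL(2, ℤ)) (x : Matrix (Fin 2) (Fin 2) ℚ) : Matrix (Fin 2) (Fin 2) ℚ :=
  (γ : Matrix (Fin 2) (Fin 2) ℤ).map (fun n : ℤ => (n : ℚ)) * x *
    ((γ⁻¹ : SL(2, ℤ)) : Matrix (Fin 2) (Fin 2) ℤ).map (fun n : ℤ => (n : ℚ))

theorem conjQ_one (x : Matrix (Fin 2) (Fin 2) ℚ) : conjQ 1 x = x := by
  simp [conjQ]

theorem conjQ_mul (γ δ : SL(2, ℤ)) (x : Matrix (Fin 2) (Fin 2) ℚ) :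
    conjQ (γ * δ) x = conjQ γ (conjQ δ x) := by
  have e : ∀ A B : Matrix (Fin 2) (Fin 2) ℤ, (A * B).map (fun n : ℤ => (n : ℚ)) =
      A.map (fun n : ℤ => (n : ℚ)) * B.map (fun n : ℤ => (n : ℚ)) :=
    fun A B => Matrix.map_mul (f := Int.castRingHom ℚ)
  simp only [conjQ, _root_.mul_inv_rev, Matrix.SpecialLinearGroup.coe_mul, e, Matrix.mul_assoc]

/-- A rational matrix as a real matrix. -/
def ratReal (x : Matrix (Fin 2) (Fin 2) ℚ) : Matrix (Fin 2) (Fin 2) ℝ := x.map fun q : ℚ => (q : ℝ)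

/-- `D_j f = x_j f - (1 / 2π) ∂_j f`. -/
def howe (j : Fin 3) (f : (Fin 3 → ℝ) → ℝ) : (Fin 3 → ℝ) → ℝ :=
  fun x => x j * f x - (2 * Real.pi)⁻¹ * fderiv ℝ f x (Pi.single j 1)

/-- The Gaussian of the majorant at the base point. -/
def gauss (x : Fin 3 → ℝ) : ℝ := Real.exp (-Real.pi * (x 0 ^ 2 + x 1 ^ 2 + x 2 ^ 2))

/-- The upper triangular matrix that maps `i` to `z`. -/
def gMat (z : ℍ) : SL(2, ℝ) :=
  ⟨!![√z.im, z.re / √z.im; 0, (√z.im)⁻¹], by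
    have : √z.im ≠ 0 := (Real.sqrt_pos.2 z.im_pos).ne'
    simp [this]⟩

/-- The invariant forms `ξ₁ = d y / y` and `ξ₂ = - d x / y` at `z`. -/
def invForm (z : ℍ) : Fin 2 → (ℂ →L[ℝ] ℝ) :=
  ![z.im⁻¹ • Complex.imCLM, -(z.im⁻¹ • Complex.reCLM)]

/-- The Schwartz form
`2 ^ (-k - 1 / 2) ∑_{α, β₁, …, β_k ∈ {1, 2}} D_α D_{β₁} ⋯ D_{β_k} φ₀ ⊗ ξ_α ⊗ π (e_{β₁} ⊗ ⋯ ⊗ e_{β_k})`,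
moved to the point `z`. -/
def schwartzForm (k : ℕ) (x : Matrix (Fin 2) (Fin 2) ℝ) (z : ℍ) : ℂ →L[ℝ] Coeff k :=
  ∑ α : Fin 2, ∑ β : Fin k → Fin 2,
    ((2 : ℝ) ^ (-((k : ℝ) + 1 / 2)) *
      ((α.castSucc :: List.ofFn fun i => (β i).castSucc).foldr howe gauss)
        (coord (conj (gMat z)⁻¹ x))) •
    (invForm z α).smulRight
      (harmRep k (gMat z) (harmProj k (Pi.single (fun i => (β i).castSucc) 1)))

/-- The theta form on `ℍ` attached to `L + h`, with parameter `τ = u + i v`. -/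
def thetaForm (k : ℕ) (L : AddSubgroup (Matrix (Fin 2) (Fin 2) ℚ)) (h : Matrix (Fin 2) (Fin 2) ℚ)
    (τ : ℍ) : OneForm k :=
  fun z => τ.im ^ (-(k : ℝ) / 2) •
    ∑' x : {x // x - h ∈ L},
      Complex.exp (Real.pi * Complex.I * form (ratReal x) (ratReal x) * τ.re) •
        schwartzForm k (√τ.im • ratReal x) z

def uMat : Matrix (Fin 2) (Fin 2) ℝ := !![0, 1; 0, 0]

def uMat' : Matrix (Fin 2) (Fin 2) ℝ := !![0, 0; -1, 0]

/-- The generator `u_ℓ = σ u σ⁻¹` of the isotropic line `ℓ` of the cusp `σ ∞`. -/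
def uAt (σ : SL(2, ℤ)) : Matrix (Fin 2) (Fin 2) ℝ := conj (toReal σ) uMat

/-- The positive `M_ℓ` with `L ∩ ℓ = M_ℓ ℤ u_ℓ`. -/
def latGen (L : AddSubgroup (Matrix (Fin 2) (Fin 2) ℚ)) (σ : SL(2, ℤ)) : ℝ :=
  sInf {r : ℝ | 0 < r ∧ ∃ x ∈ L, ratReal x = r • uAt σ}

/-- Translation by `x`. -/
def nMat (x : ℝ) : SL(2, ℝ) := ⟨!![1, x; 0, 1], by simp⟩

/-- Hermite polynomials `(-1)^j e^{t²} (d / d t)^j e^{-t²}`. -/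
def hermite (j : ℕ) (t : ℝ) : ℝ :=
  (-1) ^ j * Real.exp (t ^ 2) * iteratedDeriv j (fun s : ℝ => Real.exp (-s ^ 2)) t

/-- `(2π)^{-j/2} H_j(√(2π) t)`. -/
def hermite' (j : ℕ) (t : ℝ) : ℝ :=
  (2 * Real.pi) ^ (-(j : ℝ) / 2) * hermite j (√(2 * Real.pi) * t)

/-- The derivation of the tensor algebra induced by `[u, ·]`. -/
def raise (k : ℕ) (T : Tensor k) : Tensor k :=
  fun β => ∑ i, ∑ a,
    ((coord (uMat * basisMat a - basisMat a * uMat) (β i) : ℝ) : ℂ) * T (Function.update β i a)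

/-- The vector of weight `-2`, that is `(c_k / (k - 1)!) (ad u)^{k - 1} (u'^k)` with
`c_k = (-2)^k (k!)² / (2 k)!`. -/
def vMinusTwo (k : ℕ) : Coeff k :=
  ((-2) ^ k * (k.factorial : ℂ) ^ 2 / ((2 * k).factorial : ℂ) / ((k - 1).factorial : ℂ)) •
    harmProj k ((raise k)^[k - 1] (purePow k uMat'))

/-- The image of `(L + h) ∩ ℓ^⊥` in `ℓ^⊥ / ℓ = ℝ`. -/
def projSet (L : AddSubgroup (Matrix (Fin 2) (Fin 2) ℚ)) (h : Matrix (Fin 2) (Fin 2) ℚ)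
    (σ : SL(2, ℤ)) : Set ℝ :=
  {w | ∃ x : Matrix (Fin 2) (Fin 2) ℚ, x - h ∈ L ∧ form (ratReal x) (uAt σ) = 0 ∧
    w = form (conj (toReal σ)⁻¹ (ratReal x)) (basisMat 1)}

/-- The theta function at the boundary point `bdry σ x`. -/
def thetaAt (k : ℕ) (L : AddSubgroup (Matrix (Fin 2) (Fin 2) ℚ)) (h : Matrix (Fin 2) (Fin 2) ℚ)
    (τ : ℍ) (σ : SL(2, ℤ)) (x : ℝ) : Coeff k :=
  rep k σ <| ((τ.im ^ (-((k : ℝ) + 1) / 2) / latGen L σ : ℝ) : ℂ) •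
    ∑' w : projSet L h σ,
      (((-1 / ((2 : ℝ) ^ (3 * (k : ℝ) / 2 + 1 / 2) * k) * hermite' (k + 1) (√τ.im * w) *
          Real.exp (-Real.pi * (√τ.im * w) ^ 2) : ℝ) : ℂ) *
        Complex.exp (Real.pi * Complex.I * (w : ℝ) ^ 2 * τ.re)) •
      harmRep k (nMat x) (vMinusTwo k)

/-- The theta function on the boundary (it does not depend on the choice of representatives). -/
def thetaBdry (k : ℕ) (L : AddSubgroup (Matrix (Fin 2) (Fin 2) ℚ)) (h : Matrix (Fin 2) (Fin 2) ℚ)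
    (τ : ℍ) : Boundary → Coeff k :=
  fun q => thetaAt k L h τ (Quotient.out q).1 (Quotient.out q).2

/-! ## Spectacle cycles -/

/-- `z` has trivial isotropy in `SL₂(ℤ)`, up to sign. -/
def IsGeneric (z : ℍ) : Prop := ∀ g : SL(2, ℤ), g • z = z → g = 1 ∨ g = -1

/-- `x(z) = (1 / (√2 y)) (-x, |z|²; -1, x)`, a generator of the negative line at `z`. -/
def negVec (z : ℍ) : Matrix (Fin 2) (Fin 2) ℝ :=
  (√2 * z.im)⁻¹ • !![-z.re, Complex.normSq z; -1, z.re]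

/-- `z` lies on the geodesic `D_x`. -/
def OnGeodesic (x : Matrix (Fin 2) (Fin 2) ℚ) (z : ℍ) : Prop := form (ratReal x) (negVec z) = 0

/-- The harmonic projection of `x ⊗ ⋯ ⊗ x`. -/
def harmPow (k : ℕ) (x : Matrix (Fin 2) (Fin 2) ℝ) : Coeff k := harmProj k (purePow k x)

/-- The width of the cusp `σ ∞`. -/
def width (Γ : Subgroup SL(2, ℤ)) (σ : SL(2, ℤ)) : ℕ :=
  sInf {m : ℕ | 0 < m ∧ σ * ModularGroup.T ^ m * σ⁻¹ ∈ plusMinus Γ}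

/-- The generator `σ T ^ m σ⁻¹` of the isotropy group of the cusp `σ ∞`. -/
def cuspGen (Γ : Subgroup SL(2, ℤ)) (σ : SL(2, ℤ)) : SL(2, ℤ) :=
  σ * ModularGroup.T ^ width Γ σ * σ⁻¹

/-- The chain `(p, q) ⊗ v`. -/
def seg {k : ℕ} (Γ : Subgroup SL(2, ℤ)) (p q : Dbar) (v : Coeff k) : Chain k Γ :=
  edgeChain (simplices Γ) p q v

/-- The boundary circle `X_ℓ`, based at `c = bdry σ r`, with coefficient `w`. -/
def circle {k : ℕ} (Γ : Subgroup SL(2, ℤ)) (σ : SL(2, ℤ)) (r : ℝ) (w : Coeff k) : Chain k Γ :=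
  seg Γ (.inr (bdry σ r)) (.inr (cuspGen Γ σ • bdry σ r)) w

/-- `D_x` maps to a closed geodesic: the chain is `(z, γ z) ⊗ π(x^k)` with `z` on `D_x` and `γ` the
generator (up to sign) of `Γ_x` that translates `D_x` in the positive direction. -/
def IsClosedGeodesicChain {k : ℕ} (Γ : Subgroup SL(2, ℤ)) (x : Matrix (Fin 2) (Fin 2) ℚ)
    (c : Chain k Γ) : Prop :=
  ∃ (γ : SL(2, ℤ)) (z : ℍ), γ ∈ Γ ∧ conjQ γ x = x ∧
    (∀ δ ∈ Γ, conjQ δ x = x → ∃ m : ℤ, δ = γ ^ m ∨ δ = -γ ^ m) ∧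
    0 < (γ : Matrix (Fin 2) (Fin 2) ℤ).trace *
      ((γ : Matrix (Fin 2) (Fin 2) ℤ).map (fun n : ℤ => (n : ℚ)) * x).trace ∧
    OnGeodesic x z ∧ IsGeneric z ∧
    c = seg Γ (.inl z) (.inl (γ • z)) (harmPow k (ratReal x))

/-- The chain `X_ℓ ⊗ w` based at the end point `c = bdry σ r` of a geodesic caps off `c ⊗ v`:
its boundary `g c ⊗ w - c ⊗ w` projects to the class of `c ⊗ v`, and it is orthogonal to the invariant forms on the circle. -/
def IsCap {k : ℕ} (Γ : Subgroup SL(2, ℤ)) (σ : SL(2, ℤ)) (r : ℝ) (v w : Coeff k) : Prop :=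
  rep k (cuspGen Γ σ)⁻¹ w - w = v ∧
    ∫ t in r..(r + width Γ σ), hForm (harmRep k (toReal σ * nMat t) (harmPow k uMat')) w = 0

/-- `D_x` maps to an infinite geodesic from the cusp `σ' ∞` to the cusp `σ ∞`: the chain is
`C_x ⊗ π(x^k)` with a cap added at each of the two ends. -/
def IsSpectacleChain {k : ℕ} (Γ : Subgroup SL(2, ℤ)) (x : Matrix (Fin 2) (Fin 2) ℚ)
    (c : Chain k Γ) : Prop :=
  ∃ (σ σ' : SL(2, ℤ)) (r r' : ℝ) (w w' : Coeff k) (z : ℍ),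
    form (ratReal x) (uAt σ) = 0 ∧ form (ratReal x) (uAt σ') = 0 ∧
    0 < (Matrix.of ![coord (uAt σ), coord (ratReal x), coord (uAt σ')]).det ∧
    (∀ y : ℝ, 0 < y → OnGeodesic x (frame σ r y)) ∧
    (∀ y : ℝ, 0 < y → OnGeodesic x (frame σ' r' y)) ∧
    OnGeodesic x z ∧ IsGeneric z ∧
    IsCap Γ σ r (harmPow k (ratReal x)) w ∧ IsCap Γ σ' r' (harmPow k (ratReal x)) w' ∧
    c = seg Γ (.inl z) (.inr (bdry σ r)) (harmPow k (ratReal x))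
      - seg Γ (.inl z) (.inr (bdry σ' r')) (harmPow k (ratReal x))
      - circle Γ σ r w + circle Γ σ' r' w'

open scoped Classical in
/-- The homology class `C^c_x`, for `x` of positive norm. -/
def cycleClass (k : ℕ) (Γ : Subgroup SL(2, ℤ)) (x : Matrix (Fin 2) (Fin 2) ℚ) : Homology k Γ :=
  if h : ∃ c : Chain k Γ, IsClosedGeodesicChain Γ x c ∨ IsSpectacleChain Γ x c then
    homClass (simplices Γ) (repSub k Γ) h.choose
  else 0

/-- `Γ`-equivalence of the vectors in `L + h` with `(x, x) / 2 = n`. -/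
def vecSetoid (L : AddSubgroup (Matrix (Fin 2) (Fin 2) ℚ)) (h : Matrix (Fin 2) (Fin 2) ℚ)
    (n : ℚ≥0) (Γ : Subgroup SL(2, ℤ)) :
    Setoid {x : Matrix (Fin 2) (Fin 2) ℚ // x - h ∈ L ∧ (x * x).trace = 2 * n} where
  r x y := ∃ γ ∈ Γ, y.1 = conjQ γ x.1
  iseqv :=
    { refl := fun x => ⟨1, one_mem Γ, (conjQ_one x.1).symm⟩
      symm := by
        rintro x y ⟨γ, hγ, h⟩
        exact ⟨γ⁻¹, inv_mem hγ, by rw [h, ← conjQ_mul, inv_mul_cancel, conjQ_one]⟩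
      trans := by
        rintro x y z ⟨γ, hγ, h⟩ ⟨δ, hδ, h'⟩
        exact ⟨δ * γ, mul_mem hδ hγ, by rw [h', h, conjQ_mul]⟩ }

open scoped Classical in
/-- The coefficient `- M_ℓ^k B_{k + 1}(h_ℓ / M_ℓ) / (k + 1)`, where
`(L + h) ∩ ℓ = (M_ℓ ℤ + h_ℓ) u_ℓ` and `0 ≤ h_ℓ < M_ℓ`, or `0` if `(L + h) ∩ ℓ` is empty. -/
def cuspCoeff (k : ℕ) (L : AddSubgroup (Matrix (Fin 2) (Fin 2) ℚ))
    (h : Matrix (Fin 2) (Fin 2) ℚ) (σ : SL(2, ℤ)) : ℝ :=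
  let S : Set ℝ := {r | 0 ≤ r ∧ ∃ x : Matrix (Fin 2) (Fin 2) ℚ, x - h ∈ L ∧
    ratReal x = r • uAt σ}
  if S.Nonempty then
    -(latGen L σ ^ k * Polynomial.aeval (sInf S / latGen L σ) (Polynomial.bernoulli (k + 1)) /
      (k + 1))
  else 0

/-- The cusps of `Γ`, as double cosets. -/
abbrev Cusps (Γ : Subgroup SL(2, ℤ)) : Type :=
  DoubleCoset.Quotient (Γ : Set SL(2, ℤ)) (Subgroup.closure {ModularGroup.T, -1} : Set SL(2, ℤ))

/-- The composite cycle `C^c_n`. -/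
def specialClass (k : ℕ) (L : AddSubgroup (Matrix (Fin 2) (Fin 2) ℚ))
    (h : Matrix (Fin 2) (Fin 2) ℚ) (Γ : Subgroup SL(2, ℤ)) (n : ℚ≥0) : Homology k Γ :=
  if n = 0 then
    ∑ᶠ q : Cusps Γ, (cuspCoeff k L h q.out : ℂ) •
      homClass (simplices Γ) (repSub k Γ) (circle Γ q.out 0 (harmPow k (uAt q.out)))
  else
    ∑ᶠ q : Quotient (vecSetoid L h n Γ), cycleClass k Γ q.out.1

/-- The identity `[θ(φ, ϕ, Γ)] = ∑ₙ PD(C^c_n(Γ)) qⁿ`, with values in the cohomology of the mapping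
cone. -/
def MainIdentity (k : ℕ) (L : AddSubgroup (Matrix (Fin 2) (Fin 2) ℚ))
    (h : Matrix (Fin 2) (Fin 2) ℚ) (Γ : Subgroup SL(2, ℤ)) : Prop :=
  ∃ P : ℚ≥0 → ConeCohomology k Γ,
    (∀ n, IsPoincareDual (specialClass k L h Γ n) (P n)) ∧
    ∀ τ : ℍ, ∃ hθ : (thetaForm k L h τ, thetaBdry k L h τ) ∈ coneCocycles k Γ,
      HasSum (fun n : ℚ≥0 => Complex.exp (2 * Real.pi * Complex.I * (n : ℚ) * τ) • P n)
        (coneClass ⟨_, hθ⟩)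

end Spectacle

end

/-!
The identity descends from `Γ'` to `Γ` along the transfer `H¹_c(Γ') → H¹_c(Γ)`, the average of the
pullbacks over `Γ / Γ'` (`transfer`). Two facts about it carry the proof: it maps the theta class of
`Γ'` to the theta class of `Γ`, and it maps a Poincaré dual of `C_n(Γ')` to a Poincaré dual of
`C_n(Γ)`. As it is continuous (`continuous_transfer`), it can be applied term by term to the series.

*The theta class.* The forms `θ(φ)` and `θ(ϕ)` are equivariant under all of `Γ`, so averaging does
not change them. On the boundary this is a change of variables in the sum over the lattice
(`pullFun_thetaBdry`). In the interior the frames `g_{γ z}` and `γ g_z` differ by a rotation; the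
Howe operators applied to the Gaussian rotate with the frame, and so do the invariant forms
`ω₁, ω₂` and the vectors `e₁, e₂`, and the rotations cancel in the sum over all indices
(`schwartzForm_smul`, `pullForm_thetaForm`).

*Poincaré duals.* The pairing over `Γ \ D` is a sum over the cosets of `± Γ` of integrals over the
standard fundamental domain (`pairing_eq_cosetSum`). Hence for classes of `Γ` it is multiplied by
the index of `± Γ'` in `± Γ` when `Γ` is replaced by `Γ'`, and it is unchanged under averaging when
`η` is closed for `Γ`. This needs the integrals to be additive, which holds since a form smooth up
to the boundary is bounded in the coordinates of the cusp. What remains (`IsPoincareDual.transfer`)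
is an identity of periods: if `F` has `Γ`-equivariant increments, its period over `C_n(Γ')` is the
index of `± Γ'` in `± Γ` times its period over `C_n(Γ)`.

*Index zero.* A circle at the cusp `σ ∞` of width `m` is the sum of `m` unit segments, so the period
is a sum over the cosets of `± Γ` of contributions that do not depend on the subgroup
(`cosetSum_eq_sum_cusps`, `apply_specialClass_zero_of_le`).

*Positive index.* For a single vector `x` the period is multiplied by the index of the isotropy
groups of `x`. If the geodesic is closed, the generator of the isotropy group of `Γ'` is, up to
sign, a power of the one for `Γ` (`closedGeodesic_of_le`). If it joins two cusps, the isotropy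
group of `x` is contained in `± 1` and the periods are equal: the cap vectors for `Γ'` are turned into those
for `Γ` by the operator `∑ g⁻ⁱ`, `0 ≤ i < d`, where `d` is the quotient of the widths
(`isCap_iff_unroll`, `spectacle_of_le`). That operator is bijective because the cap vector is
unique (`IsCap.unique`), and this in turn because a harmonic tensor is determined by its values on
the null cone. Summing over orbits is then an orbit–stabilizer count (`finsum_orbits`); there are
finitely many orbits of vectors of a given norm by reduction theory
(`finite_quotient_vecSetoid`), so that no junk value enters (`apply_specialClass_pos_of_le`).
-/

noncomputable section

namespace Spectacle

/-! ### Chains and cycles on a quotient complex -/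

open scoped Classical in
theorem LocalSystem.d2_lof {K : OrderedComplex} (S : LocalSystem K) (t : T2 K) (v : S.fiber t.a) :
    S.d2 (DirectSum.lof ℂ (T2 K) (fun t => S.fiber t.a) t v) =
      DirectSum.lof ℂ (E1 K) (fun e => S.fiber e.1) ⟨t.b, t.c, t.bc⟩ (S.T t.ab v)
        - DirectSum.lof ℂ (E1 K) (fun e => S.fiber e.1) ⟨t.a, t.c, t.ac⟩ v
        + DirectSum.lof ℂ (E1 K) (fun e => S.fiber e.1) ⟨t.a, t.b, t.ab⟩ v :=
  DirectSum.toModule_lof ..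

section Quotient

variable {G V E : Type} [Group G] [MulAction G V] [AddCommGroup E] [Module ℂ E]
  (M : GComplex G V) (ρ : Representation ℂ G E)

theorem mk_rep_eq_of_smul_eq {a x : V} {g g' : G} (hg : g • a = x) (hg' : g' • a = x) (v : E) :
    (Submodule.Quotient.mk (ρ g v) : E ⧸ coinvKer ρ x) = Submodule.Quotient.mk (ρ g' v) := by
  rw [Submodule.Quotient.eq]
  refine Submodule.subset_span ⟨g * g'⁻¹, ?_, ρ g' v, ?_⟩
  · rw [MulAction.mem_stabilizer_iff, mul_smul, ← hg', inv_smul_smul, hg, hg']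
  · rw [← Module.End.mul_apply, ← map_mul, inv_mul_cancel_right]

variable [FiniteDimensional ℂ E]

/-- The orbit of a vertex, as a vertex of the quotient complex. -/
abbrev GComplex.proj (a : V) : M.quotient.V := Quotient.mk (MulAction.orbitRel G V) a

open scoped Classical in
/-- The image of `a ⊗ v` in the 0-chains on `M / G`. -/
def pushVertex (a : V) : E →ₗ[ℂ] (quotientSystem M ρ).C0 :=
  DirectSum.lof ℂ M.quotient.V (quotientSystem M ρ).fiber (M.proj a)
    ∘ₗ (coinvKer ρ (Quotient.mk (MulAction.orbitRel G V) a).out).mkQ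
    ∘ₗ ρ (exists_smul_eq_out (G := G) a).choose

open scoped Classical in
theorem lof_mk_eq_pushVertex {a : V} {y : M.quotient.V}
    (hy : M.proj a = y)
    {g : G} (hg : g • a = y.out) (v : E) :
    DirectSum.lof ℂ M.quotient.V (quotientSystem M ρ).fiber y
      (Submodule.Quotient.mk (ρ g v) : E ⧸ coinvKer ρ y.out) = pushVertex M ρ a v := by
  subst hy
  exact congrArg (DirectSum.lof ℂ M.quotient.V (quotientSystem M ρ).fiber _)
    (mk_rep_eq_of_smul_eq ρ hg (exists_smul_eq_out (G := G) a).choose_spec v)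

theorem pushVertex_smul (γ : G) (a : V) (v : E) :
    pushVertex M ρ (γ • a) (ρ γ v) = pushVertex M ρ a v := by
  obtain ⟨g, hg⟩ := exists_smul_eq_out (G := G) (γ • a)
  have hy : M.proj a = M.proj (γ • a) :=
    Quotient.sound ⟨γ⁻¹, by simp⟩
  rw [← lof_mk_eq_pushVertex M ρ rfl hg (ρ γ v),
    ← lof_mk_eq_pushVertex M ρ hy (g := g * γ) (by rw [mul_smul, hg]) v, map_mul,
    Module.End.mul_apply]

open scoped Classical in
theorem lof_mk_eq_pushEdge {a b : V} (h : M.Adj a b) (e : LocalSystem.E1 M.quotient)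
    (h1 : M.proj a = e.1) (h2 : M.proj b = e.2.1)
    (h3 : e.2.2.1 = MulAction.orbit G (a, b)) {g : G} (hg : g • a = e.1.out) (v : E) :
    DirectSum.lof ℂ (LocalSystem.E1 M.quotient) (fun e => (quotientSystem M ρ).fiber e.1) e
      (Submodule.Quotient.mk (ρ g v) : E ⧸ coinvKer ρ e.1.out) = pushEdge M ρ a b h v := by
  obtain ⟨y, z, ⟨s, hs⟩⟩ := e
  simp only at h1 h2 h3
  subst h1 h2 h3
  exact congrArg (DirectSum.lof ℂ (LocalSystem.E1 M.quotient)
    (fun e => (quotientSystem M ρ).fiber e.1) _)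
    (mk_rep_eq_of_smul_eq ρ hg (exists_smul_eq_out (G := G) a).choose_spec v)

/-- Every edge of the quotient, with coefficients, is the image of an edge of `M`. -/
theorem exists_pushEdge_eq (e : LocalSystem.E1 M.quotient) :
    ∃ a b, ∃ h : M.Adj a b, a = e.1.out ∧ (a, b) ∈ e.2.2.1 ∧ ∀ v : E,
      open scoped Classical in
      DirectSum.lof ℂ (LocalSystem.E1 M.quotient) (fun e => (quotientSystem M ρ).fiber e.1) e
        (Submodule.Quotient.mk v : E ⧸ coinvKer ρ e.1.out) = pushEdge M ρ a b h v := by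
  classical
  obtain ⟨⟨g, b⟩, h1, h2, h3⟩ := exists_lift e.2.2
  refine ⟨_, b, h2, rfl, h1, fun v => ?_⟩
  have hb : M.proj b = e.2.1 :=
    (Quotient.sound ⟨g⁻¹, by simp only; rw [← h3, inv_smul_smul]⟩ : M.proj b = _).trans
      (Quotient.out_eq e.2.1)
  have hs : e.2.2.1 = MulAction.orbit G (Quotient.out e.1, b) := by
    obtain ⟨a, b', -, -, -, hs⟩ := e.2.2.2
    have h1' := h1
    rw [hs] at h1'
    exact hs.trans (MulAction.orbit_eq_iff.2 h1').symm
  have := lof_mk_eq_pushEdge M ρ h2 e (Quotient.out_eq _) hb hs (one_smul G _) v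
  rw [map_one] at this
  exact this

open scoped Classical in
theorem pushforward_lof (e : LocalSystem.E1 M.toComplex) (v : E) :
    pushforward M ρ (DirectSum.lof ℂ (LocalSystem.E1 M.toComplex) (fun _ => E) e v)
      = pushEdge M ρ e.1 e.2.1 e.2.2.down v :=
  DirectSum.toModule_lof ..

theorem pushforward_surjective : Function.Surjective (pushforward M ρ) := by
  classical
  intro c
  induction c using DirectSum.induction_on with
  | zero => exact ⟨0, map_zero _⟩
  | add x y hx hy =>
    obtain ⟨x', rfl⟩ := hx
    obtain ⟨y', rfl⟩ := hy
    exact ⟨x' + y', map_add _ _ _⟩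
  | of e w =>
    obtain ⟨a, b, h, -, -, hv⟩ := exists_pushEdge_eq M ρ e
    obtain ⟨v, rfl⟩ := Submodule.Quotient.mk_surjective _ w
    exact ⟨DirectSum.lof ℂ (LocalSystem.E1 M.toComplex) (fun _ => E) ⟨a, b, ⟨h⟩⟩ v,
      (pushforward_lof M ρ _ v).trans (hv v).symm⟩

/-- Every homology class is the class of the image of a chain on `M`. -/
theorem exists_pushforward_eq (C : (quotientSystem M ρ).H1) :
    ∃ (c : (flatSystem M E).C1)
      (hc : pushforward M ρ c ∈ LinearMap.ker (quotientSystem M ρ).d1),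
      Submodule.Quotient.mk ⟨_, hc⟩ = C := by
  obtain ⟨⟨c', hc'⟩, rfl⟩ := Submodule.Quotient.mk_surjective _ C
  obtain ⟨c, rfl⟩ := pushforward_surjective M ρ c'
  exact ⟨c, hc', rfl⟩

theorem d1_pushEdge {a b : V} (h : M.Adj a b) (v : E) :
    (quotientSystem M ρ).d1 (pushEdge M ρ a b h v) = pushVertex M ρ b v - pushVertex M ρ a v := by
  classical
  obtain ⟨g, hg⟩ := exists_smul_eq_out (G := G) a
  obtain ⟨g', hg'⟩ := exists_smul_eq_out (G := G) b
  rw [← lof_mk_eq_pushEdge M ρ h ⟨Quotient.mk _ a, Quotient.mk _ b,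
      ⟨MulAction.orbit G (a, b), a, b, h, rfl, rfl, rfl⟩⟩ rfl rfl rfl hg v,
    ← lof_mk_eq_pushVertex M ρ rfl hg v, ← lof_mk_eq_pushVertex M ρ rfl hg' v]
  refine (DirectSum.toModule_lof ..).trans ?_
  refine congrArg₂ (· - ·)
    (congrArg (DirectSum.lof ℂ M.quotient.V (quotientSystem M ρ).fiber _) ?_) rfl
  refine (quotientT_mk ρ (⟨MulAction.orbit G (a, b), a, b, h, rfl, rfl, rfl⟩ :
    M.quotient.Edge (M.proj a) (M.proj b)) (γ := g' * g⁻¹) (b := g • b) ⟨g, by simp [hg]⟩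
    (by rw [mul_smul, inv_smul_smul, hg']) _).trans ?_
  rw [map_mul, Module.End.mul_apply, ← Module.End.mul_apply (f := ρ g⁻¹), ← map_mul]
  simp

/-- `∂ ((p, q) ⊗ v) = q ⊗ v - p ⊗ v` on the quotient. -/
theorem d1_pushforward_edgeChain {p q : V} (h : M.Adj p q) (v : E) :
    (quotientSystem M ρ).d1 (pushforward M ρ (edgeChain M p q v))
      = pushVertex M ρ q v - pushVertex M ρ p v := by
  have : edgeChain M p q v = open scoped Classical in
      DirectSum.lof ℂ (LocalSystem.E1 M.toComplex) (fun _ => E) ⟨p, q, ⟨h⟩⟩ v := dif_pos h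
  rw [this]
  exact (congrArg _ (pushforward_lof M ρ _ v)).trans (d1_pushEdge M ρ h v)

/-- A cocycle on pairs of vertices of `M` that is additive and invariant under `G` defines a
functional on the homology of the quotient. -/
theorem exists_functional {ψ : V → V → E →ₗ[ℂ] ℂ} (hadd : ∀ a b c, ψ a c = ψ a b + ψ b c)
    (hinv : ∀ (γ : G) (a b : V) (v : E), ψ (γ • a) (γ • b) (ρ γ v) = ψ a b v) :
    ∃ Λ : (quotientSystem M ρ).H1 →ₗ[ℂ] ℂ, ∀ (c : (flatSystem M E).C1)
      (hc : pushforward M ρ c ∈ LinearMap.ker (quotientSystem M ρ).d1),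
      Λ (Submodule.Quotient.mk ⟨_, hc⟩) =
        open scoped Classical in
        DirectSum.toModule ℂ (LocalSystem.E1 M.toComplex) ℂ (fun e => ψ e.1 e.2.1) c := by
  classical
  have hker : ∀ e : LocalSystem.E1 M.quotient, coinvKer ρ e.1.out ≤
      LinearMap.ker (ψ e.1.out (exists_lift e.2.2).choose.2) := by
    intro e
    refine Submodule.span_le.2 ?_
    rintro _ ⟨g, hg, v, rfl⟩
    have h1 : g • e.1.out = e.1.out := hg
    have h2 : g • (exists_lift e.2.2).choose.2 = (exists_lift e.2.2).choose.2 :=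
      M.stab_le (exists_lift e.2.2).choose_spec.2.1 hg
    have h3 := hinv g e.1.out (exists_lift e.2.2).choose.2 v
    rw [h1, h2] at h3
    simp [h3]
  set Ψ : (quotientSystem M ρ).C1 →ₗ[ℂ] ℂ :=
    DirectSum.toModule ℂ (LocalSystem.E1 M.quotient) ℂ fun e =>
      (coinvKer ρ e.1.out).liftQ (ψ e.1.out (exists_lift e.2.2).choose.2) (hker e) with hΨ
  have hpush : ∀ a b (h : M.Adj a b) (v : E), Ψ (pushEdge M ρ a b h v) = ψ a b v := by
    intro a b h v
    obtain ⟨g, hg⟩ := exists_smul_eq_out (G := G) a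
    set e : LocalSystem.E1 M.quotient := ⟨Quotient.mk _ a, Quotient.mk _ b,
      ⟨MulAction.orbit G (a, b), a, b, h, rfl, rfl, rfl⟩⟩ with he
    rw [← lof_mk_eq_pushEdge M ρ h e rfl rfl rfl hg v, hΨ]
    refine (DirectSum.toModule_lof ..).trans ?_
    change ψ e.1.out (exists_lift e.2.2).choose.2 (ρ g v) = _
    obtain ⟨γ, hγ⟩ := (exists_lift e.2.2).choose_spec.1
    simp only [Prod.smul_mk, Prod.mk.injEq] at hγ
    refine (congrArg₂ (fun x y => ψ x y (ρ g v)) hγ.1 hγ.2).symm.trans ?_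
    have hst : γ⁻¹ * g ∈ MulAction.stabilizer G a := by
      rw [MulAction.mem_stabilizer_iff, mul_smul, hg, inv_smul_eq_iff]
      exact hγ.1.symm
    have e1 := hinv γ a b (ρ (γ⁻¹ * g) v)
    have e2 := hinv (γ⁻¹ * g) a b v
    rw [show (γ⁻¹ * g) • a = a from hst, show (γ⁻¹ * g) • b = b from M.stab_le h hst] at e2
    rw [← e2, ← e1, ← Module.End.mul_apply, ← map_mul, mul_inv_cancel_left]
  have hd2 : Ψ ∘ₗ (quotientSystem M ρ).d2 = 0 := by
    refine DirectSum.linearMap_ext _ fun t => LinearMap.ext fun w => ?_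
    obtain ⟨⟨s, a, b, c, hab, hbc, hac, rfl, hf, hg, hh⟩⟩ := (⟨t.tri⟩ : PLift _)
    -- the chosen representative of the first vertex is a translate of `a`
    obtain ⟨a₁, b₁, -, ha₁, hab₁, -⟩ := exists_pushEdge_eq M ρ ⟨t.a, t.b, t.ab⟩
    simp only at ha₁ hab₁
    rw [hf] at hab₁
    obtain ⟨k, hk⟩ := hab₁
    simp only [Prod.smul_mk, Prod.mk.injEq] at hk
    have hka : k • a = Quotient.out t.a := hk.1.trans ha₁
    have hmem : ∀ {y z : M.quotient.V} (f : M.quotient.Edge y z) {p q : V},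
        f.1 = MulAction.orbit G (p, q) →
        M.proj p = y ∧ M.proj q = z := by
      intro y z f p q hpq
      obtain ⟨p', q', -, rfl, rfl, hs⟩ := f.2
      have : (p, q) ∈ MulAction.orbit G (p', q') := by
        rw [← hs, hpq]
        exact MulAction.mem_orbit_self _
      obtain ⟨g, hg⟩ := this
      simp only [Prod.smul_mk, Prod.mk.injEq] at hg
      exact ⟨Quotient.sound ⟨g, hg.1⟩, Quotient.sound ⟨g, hg.2⟩⟩
    obtain ⟨v, rfl⟩ := Submodule.Quotient.mk_surjective _ w
    obtain ⟨v, rfl⟩ : ∃ v', v = ρ k v' := ⟨ρ k⁻¹ v, by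
      rw [← Module.End.mul_apply, ← map_mul, mul_inv_cancel, map_one, Module.End.one_apply]⟩
    obtain ⟨l, hl⟩ : ∃ l : G, l • b = Quotient.out t.b := by
      rw [← (hmem t.ab hf).2]; exact exists_smul_eq_out b
    have hT : (quotientSystem M ρ).T t.ab
        (Submodule.Quotient.mk (ρ k v) : E ⧸ coinvKer ρ (Quotient.out t.a)) =
        (Submodule.Quotient.mk (ρ l v) : E ⧸ coinvKer ρ (Quotient.out t.b)) := by
      refine (quotientT_mk ρ t.ab (γ := l * k⁻¹) (b := k • b) ?_ ?_ _).trans ?_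
      · rw [hf]; exact ⟨k, by simp [hka]⟩
      · rw [mul_smul, inv_smul_smul, hl]
      · rw [← Module.End.mul_apply, ← map_mul, inv_mul_cancel_right]
    change Ψ ((quotientSystem M ρ).d2 (DirectSum.lof ℂ (LocalSystem.T2 M.quotient)
      (fun t => (quotientSystem M ρ).fiber t.a) t _)) = 0
    refine (congrArg Ψ (LocalSystem.d2_lof _ t _)).trans ?_
    refine (congrArg Ψ (congrArg₂ (· + ·) (congrArg₂ (· - ·)
      ((congrArg (DirectSum.lof ℂ (LocalSystem.E1 M.quotient)
        (fun e => (quotientSystem M ρ).fiber e.1) ⟨t.b, t.c, t.bc⟩) hT).trans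
        (lof_mk_eq_pushEdge M ρ hbc ⟨t.b, t.c, t.bc⟩ (hmem _ hg).1 (hmem _ hg).2 hg hl v))
      (lof_mk_eq_pushEdge M ρ hac ⟨t.a, t.c, t.ac⟩ (hmem _ hh).1 (hmem _ hh).2 hh hka v))
      (lof_mk_eq_pushEdge M ρ hab ⟨t.a, t.b, t.ab⟩ (hmem _ hf).1 (hmem _ hf).2 hf hka v))).trans ?_
    rw [map_add, map_sub, hpush, hpush, hpush, hadd a b c, LinearMap.add_apply]
    change ψ b c v - (ψ a b v + ψ b c v) + ψ a b v = 0
    ring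
  refine ⟨Submodule.liftQ _ (Ψ ∘ₗ (LinearMap.ker (quotientSystem M ρ).d1).subtype) ?_, ?_⟩
  · rintro ⟨x, hx⟩ ⟨y, hy⟩
    have h0 : Ψ ((quotientSystem M ρ).d2 y) = 0 := LinearMap.congr_fun hd2 y
    rw [hy] at h0
    exact h0
  · intro c hc
    change Ψ (pushforward M ρ c) = _
    rw [← LinearMap.comp_apply]
    congr 1
    refine DirectSum.linearMap_ext _ fun e => LinearMap.ext fun v => ?_
    exact ((congrArg Ψ (pushforward_lof M ρ e v)).trans (hpush ..)).trans
      (DirectSum.toModule_lof (M := fun _ : LocalSystem.E1 M.toComplex => E) ℂ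
        (φ := fun e => ψ e.1 e.2.1) e v).symm

end Quotient

/-! ### The form on harmonic tensors -/

theorem tForm_apply {k : ℕ} (S T : Tensor k) :
    tForm k S T = ∑ β, (∏ i, eps (β i)) * S β * T β := rfl

theorem tForm_comm {k : ℕ} (S T : Tensor k) : tForm k S T = tForm k T S := by
  simp only [tForm_apply]
  exact Finset.sum_congr rfl fun β _ => by ring

theorem tForm_tensorAct {k : ℕ} (g : SL(2, ℝ)) (S T : Tensor k) :
    tForm k (tensorAct k g S) (tensorAct k g T) = tForm k S T := by
  have key : ∀ α α' : Fin k → Fin 3,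
      ∑ β : Fin k → Fin 3, (∏ i, eps (β i)) * (∏ i, adMatrix g (β i) (α i)) *
        (∏ i, adMatrix g (β i) (α' i)) = if α = α' then ∏ i, eps (α i) else 0 := by
    intro α α'
    have h1 : ∀ β : Fin k → Fin 3, (∏ i, eps (β i)) * (∏ i, adMatrix g (β i) (α i)) *
        (∏ i, adMatrix g (β i) (α' i)) =
        ∏ i, (fun i b => eps b * adMatrix g b (α i) * adMatrix g b (α' i)) i (β i) := by
      intro β
      rw [← Finset.prod_mul_distrib, ← Finset.prod_mul_distrib]
    rw [Finset.sum_congr rfl fun β _ => h1 β]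
    have h2 := Finset.prod_univ_sum (fun _ : Fin k => (Finset.univ : Finset (Fin 3)))
      (fun i b => eps b * adMatrix g b (α i) * adMatrix g b (α' i))
    rw [Fintype.piFinset_univ] at h2
    refine h2.symm.trans ?_
    simp only [adMatrix_isometry]
    split_ifs with h
    · subst h; simp
    · obtain ⟨i, hi⟩ := Function.ne_iff.1 h
      exact Finset.prod_eq_zero (Finset.mem_univ i) (if_neg hi)
  calc tForm k (tensorAct k g S) (tensorAct k g T)
      = ∑ β : Fin k → Fin 3, ∑ α : Fin k → Fin 3, ∑ α' : Fin k → Fin 3,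
        ((∏ i, eps (β i)) * (∏ i, adMatrix g (β i) (α i)) *
        (∏ i, adMatrix g (β i) (α' i))) * (S α * T α') := by
        simp only [tForm_apply, tensorAct_apply]
        refine Finset.sum_congr rfl fun β _ => ?_
        rw [mul_assoc, Finset.sum_mul_sum, Finset.mul_sum]
        refine Finset.sum_congr rfl fun α _ => ?_
        rw [Finset.mul_sum]
        exact Finset.sum_congr rfl fun α' _ => by ring
    _ = ∑ α : Fin k → Fin 3, ∑ α' : Fin k → Fin 3,
          (if α = α' then ∏ i, eps (α i) else 0) * (S α * T α') := by
        rw [Finset.sum_comm]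
        refine Finset.sum_congr rfl fun α _ => ?_
        rw [Finset.sum_comm]
        refine Finset.sum_congr rfl fun α' _ => ?_
        rw [← key, Finset.sum_mul]
    _ = tForm k S T := by
        simp only [tForm_apply, ite_mul, zero_mul, Finset.sum_ite_eq, Finset.mem_univ, if_true,
          mul_assoc]

theorem incl_harmRep {k : ℕ} (g : SL(2, ℝ)) (v : Coeff k) :
    incl k (harmRep k g v) = tensorAct k g (incl k v) := rfl

theorem hForm_harmRep {k : ℕ} (g : SL(2, ℝ)) (v w : Coeff k) :
    hForm (harmRep k g v) (harmRep k g w) = hForm v w := by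
  rw [hForm, incl_harmRep, incl_harmRep, tForm_tensorAct, hForm]

theorem hForm_rep {k : ℕ} (g : SL(2, ℤ)) (v w : Coeff k) :
    hForm (rep k g v) (rep k g w) = hForm v w :=
  hForm_harmRep _ _ _

theorem hForm_add_left {k : ℕ} (v v' w : Coeff k) :
    hForm (v + v') w = hForm v w + hForm v' w := by simp [hForm]

theorem hForm_sub_left {k : ℕ} (v v' w : Coeff k) :
    hForm (v - v') w = hForm v w - hForm v' w := by simp [hForm]

theorem hForm_smul_left {k : ℕ} (c : ℂ) (v w : Coeff k) :
    hForm (c • v) w = c * hForm v w := by simp [hForm]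

theorem hForm_add_right {k : ℕ} (v w w' : Coeff k) :
    hForm v (w + w') = hForm v w + hForm v w' := by simp [hForm]

theorem hForm_sub_right {k : ℕ} (v w w' : Coeff k) :
    hForm v (w - w') = hForm v w - hForm v w' := by simp [hForm]

theorem hForm_smul_right {k : ℕ} (c : ℂ) (v w : Coeff k) :
    hForm v (c • w) = c * hForm v w := by simp [hForm]

theorem hForm_sum_left {k : ℕ} {ι : Type*} (s : Finset ι) (f : ι → Coeff k) (w : Coeff k) :
    hForm (∑ i ∈ s, f i) w = ∑ i ∈ s, hForm (f i) w := by
  simp [hForm, map_sum, LinearMap.sum_apply]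

theorem hForm_sum_right {k : ℕ} {ι : Type*} (s : Finset ι) (f : ι → Coeff k) (w : Coeff k) :
    hForm w (∑ i ∈ s, f i) = ∑ i ∈ s, hForm w (f i) := by
  simp [hForm, map_sum]

theorem incl_mem {k : ℕ} (v : Coeff k) : incl k v ∈ Harm k := Subtype.property (p := (· ∈ Harm k)) v

theorem incl_injective (k : ℕ) : Function.Injective (incl k) := Subtype.val_injective

theorem incl_harmProj_of_mem {k : ℕ} {T : Tensor k} (hT : T ∈ Harm k) :
    incl k (harmProj k T) = T :=
  congrArg (Harm k).subtype
    (Submodule.projectionOnto_apply_left (isCompl_harm k) (⟨T, hT⟩ : Harm k))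

theorem hForm_harmProj_left {k : ℕ} (S : Tensor k) (w : Coeff k) :
    hForm (harmProj k S) w = tForm k S (incl k w) := by
  have h1 : S - incl k (harmProj k S) ∈ (tForm k).orthogonal (Harm k) := by
    have : harmProj k (S - incl k (harmProj k S)) = 0 := by
      rw [map_sub, sub_eq_zero]
      exact incl_injective k (incl_harmProj_of_mem (incl_mem _)).symm
    exact (Submodule.projectionOnto_apply_eq_zero_iff (isCompl_harm k)).1 this
  have h2 : tForm k (incl k w) (S - incl k (harmProj k S)) = 0 := h1 _ (incl_mem w)
  rw [hForm, tForm_comm, tForm_comm S]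
  rw [map_sub, sub_eq_zero] at h2
  exact h2.symm

/-- The form is nondegenerate on harmonic tensors because the projection is orthogonal and the form
on all tensors is nondegenerate. -/
theorem hForm_nondegenerate {k : ℕ} {v v' : Coeff k} (h : ∀ w, hForm v w = hForm v' w) :
    v = v' := by
  have h0 : incl k (v - v') ∈ (tForm k).orthogonal (Harm k) := by
    intro T hT
    have := h (harmProj k T)
    rw [← sub_eq_zero, ← hForm_sub_left, hForm, incl_harmProj_of_mem hT] at this
    exact (tForm_comm _ _).trans this
  have := (Submodule.disjoint_def.1 (isCompl_harm k).disjoint) _ (incl_mem _) h0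
  exact sub_eq_zero.1 (incl_injective k (by rw [this, map_zero]))

theorem harmProj_tensorAct {k : ℕ} (g : SL(2, ℝ)) (S : Tensor k) :
    harmProj k (tensorAct k g S) = harmRep k g (harmProj k S) := by
  refine hForm_nondegenerate fun w => ?_
  have hw : harmRep k g (harmRep k g⁻¹ w) = w := by
    rw [← Module.End.mul_apply, ← map_mul, mul_inv_cancel, map_one, Module.End.one_apply]
  rw [← hw, hForm_harmRep, hForm_harmProj_left, hForm_harmProj_left, incl_harmRep,
    tForm_tensorAct]

theorem coord_conj (g : SL(2, ℝ)) {x : Matrix (Fin 2) (Fin 2) ℝ} (hx : x.trace = 0) (i : Fin 3) :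
    ((coord (conj g x) i : ℝ) : ℂ) = ∑ j, adMatrix g i j * coord x j := by
  conv_lhs => rw [← sum_coord hx, conj_sum, coord_linear]
  push_cast
  exact Finset.sum_congr rfl fun j _ => mul_comm _ _

theorem tensorAct_purePow {k : ℕ} (g : SL(2, ℝ)) {x : Matrix (Fin 2) (Fin 2) ℝ}
    (hx : x.trace = 0) : tensorAct k g (purePow k x) = purePow k (conj g x) := by
  ext β
  simp only [tensorAct_apply, purePow, coord_conj g hx, Finset.prod_univ_sum,
    Fintype.piFinset_univ, Finset.prod_mul_distrib]

theorem harmPow_conj {k : ℕ} (g : SL(2, ℝ)) {x : Matrix (Fin 2) (Fin 2) ℝ} (hx : x.trace = 0) :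
    harmPow k (conj g x) = harmRep k g (harmPow k x) := by
  rw [harmPow, ← tensorAct_purePow g hx, harmProj_tensorAct, harmPow]

theorem rep_mul_apply {k : ℕ} (g h : SL(2, ℤ)) (v : Coeff k) :
    rep k (g * h) v = rep k g (rep k h v) := by
  rw [map_mul, Module.End.mul_apply]

theorem rep_one_apply {k : ℕ} (v : Coeff k) : rep k 1 v = v := by
  rw [map_one, Module.End.one_apply]

theorem rep_inv_rep {k : ℕ} (g : SL(2, ℤ)) (v : Coeff k) : rep k g⁻¹ (rep k g v) = v := by
  rw [← rep_mul_apply, inv_mul_cancel, rep_one_apply]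

theorem rep_rep_inv {k : ℕ} (g : SL(2, ℤ)) (v : Coeff k) : rep k g (rep k g⁻¹ v) = v := by
  rw [← rep_mul_apply, mul_inv_cancel, rep_one_apply]

theorem hForm_rep_left {k : ℕ} (g : SL(2, ℤ)) (v w : Coeff k) :
    hForm (rep k g v) w = hForm v (rep k g⁻¹ w) := by
  rw [← hForm_rep g⁻¹, rep_inv_rep]

/-! ### The sign, and the groups `± Γ` -/

theorem toReal_neg_one : toReal (-1) = -1 := by
  ext i j
  simp [toReal, Matrix.one_apply]

theorem conj_neg (g : SL(2, ℝ)) (x : Matrix (Fin 2) (Fin 2) ℝ) : conj (-g) x = conj g x := by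
  have h : (-g)⁻¹ = -g⁻¹ := by rw [inv_eq_iff_mul_eq_one]; simp
  simp only [conj, h, Matrix.SpecialLinearGroup.coe_neg]
  simp

theorem harmRep_neg {k : ℕ} (g : SL(2, ℝ)) : harmRep k (-g) = harmRep k g := by
  refine LinearMap.ext fun v => incl_injective k ?_
  rw [incl_harmRep, incl_harmRep]
  ext β
  simp only [tensorAct_apply, adMatrix, conj_neg]

theorem toReal_neg (g : SL(2, ℤ)) : toReal (-g) = -toReal g := by
  rw [← neg_one_mul, map_mul, toReal_neg_one, neg_one_mul]

theorem rep_neg {k : ℕ} (g : SL(2, ℤ)) : rep k (-g) = rep k g := by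
  change harmRep k (toReal (-g)) = harmRep k (toReal g)
  rw [toReal_neg, harmRep_neg]

theorem conjQ_neg (g : SL(2, ℤ)) (x : Matrix (Fin 2) (Fin 2) ℚ) : conjQ (-g) x = conjQ g x := by
  have h : (-g)⁻¹ = -g⁻¹ := by rw [inv_eq_iff_mul_eq_one]; simp
  have e : ∀ A : Matrix (Fin 2) (Fin 2) ℤ, (-A).map (fun n : ℤ => (n : ℚ)) =
      -A.map (fun n : ℤ => (n : ℚ)) := fun A => by ext i j; simp
  simp only [conjQ, h, Matrix.SpecialLinearGroup.coe_neg, e]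
  simp

theorem smul_bdry (g σ : SL(2, ℤ)) (x : ℝ) : g • bdry σ x = bdry (g * σ) x := rfl

theorem bdry_neg (σ : SL(2, ℤ)) (x : ℝ) : bdry (-σ) x = bdry σ x :=
  Quotient.sound ⟨0, Or.inr (by simp), by simp⟩

theorem bdry_mul_T_zpow (σ : SL(2, ℤ)) (m : ℤ) (x : ℝ) :
    bdry (σ * ModularGroup.T ^ m) x = bdry σ (x + m) :=
  (Quotient.sound ⟨m, Or.inl rfl, rfl⟩ : bdry σ (x + m) = _).symm

theorem neg_smul_boundary (g : SL(2, ℤ)) (q : Boundary) : (-g) • q = g • q := by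
  induction q using Quotient.inductionOn with
  | h p =>
    change bdry (-g * p.1) p.2 = bdry (g * p.1) p.2
    rw [neg_mul, bdry_neg]

theorem neg_smul_dbar (g : SL(2, ℤ)) (q : Dbar) : (-g) • q = g • q := by
  rcases q with z | q
  · exact congrArg Sum.inl (ModularGroup.SL_neg_smul g z)
  · exact congrArg Sum.inr (neg_smul_boundary g q)

theorem mem_plusMinus {Γ : Subgroup SL(2, ℤ)} {g : SL(2, ℤ)} :
    g ∈ plusMinus Γ ↔ g ∈ Γ ∨ -g ∈ Γ := by
  constructor
  · intro h
    rw [plusMinus] at h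
    refine Subgroup.closure_induction (k := (Γ : Set SL(2, ℤ)) ∪ {-1})
      (p := fun g _ => g ∈ Γ ∨ -g ∈ Γ) ?_ ?_ ?_ ?_ (x := g) ?_
    · rintro x (hx | hx)
      · exact Or.inl hx
      · rw [Set.mem_singleton_iff.1 hx]; right; simp
    · exact Or.inl (one_mem _)
    · rintro x y - - (hx | hx) (hy | hy)
      · exact Or.inl (mul_mem hx hy)
      · right; have := mul_mem hx hy; rwa [mul_neg] at this
      · right; have := mul_mem hx hy; rwa [neg_mul] at this
      · left; have := mul_mem hx hy; rwa [neg_mul_neg] at this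
    · rintro x - (hx | hx)
      · exact Or.inl (inv_mem hx)
      · right
        have : (-x)⁻¹ = -x⁻¹ := by rw [inv_eq_iff_mul_eq_one]; simp
        rw [← this]; exact inv_mem hx
    · rw [Subgroup.closure_union, Subgroup.closure_eq]; exact h
  · have h1 : (-1 : SL(2, ℤ)) ∈ plusMinus Γ :=
      (le_sup_right : _ ≤ plusMinus Γ) (Subgroup.subset_closure rfl)
    have h2 : Γ ≤ plusMinus Γ := le_sup_left
    rintro (h | h)
    · exact h2 h
    · have := mul_mem h1 (h2 h)
      simpa using this

theorem le_plusMinus (Γ : Subgroup SL(2, ℤ)) : Γ ≤ plusMinus Γ := le_sup_left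

theorem plusMinus_mono {Γ Γ' : Subgroup SL(2, ℤ)} (h : Γ' ≤ Γ) : plusMinus Γ' ≤ plusMinus Γ :=
  sup_le_sup_right h _

/-- A property of elements that does not depend on the sign holds on `± Γ` if it holds on `Γ`. -/
theorem plusMinus_induction {Γ : Subgroup SL(2, ℤ)} {P : SL(2, ℤ) → Prop}
    (hP : ∀ g, P (-g) → P g) (h : ∀ g ∈ Γ, P g) {g : SL(2, ℤ)} (hg : g ∈ plusMinus Γ) : P g := by
  rcases mem_plusMinus.1 hg with h' | h'
  · exact h g h'
  · exact hP g (h _ h')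

/-! ### Isotropy groups of points of the enlarged upper half plane -/

theorem bdry_eq_iff {σ σ' : SL(2, ℤ)} {x x' : ℝ} : bdry σ x = bdry σ' x' ↔
    ∃ m : ℤ, (σ' = σ * ModularGroup.T ^ m ∨ σ' = -(σ * ModularGroup.T ^ m)) ∧ x = x' + m :=
  ⟨fun h => Quotient.exact h, fun h => Quotient.sound h⟩

theorem stabilizer_bdry {σ g : SL(2, ℤ)} {x : ℝ} :
    g • bdry σ x = bdry σ x ↔ g = 1 ∨ g = -1 := by
  rw [smul_bdry, bdry_eq_iff]
  constructor
  · rintro ⟨m, h, h'⟩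
    have hm : m = 0 := by
      have : (m : ℝ) = 0 := by linarith
      exact_mod_cast this
    subst hm
    rcases h with h | h
    · left; simpa [mul_assoc] using h.symm
    · right
      rw [zpow_zero, mul_one] at h
      have : -g = 1 := by
        have h2 : (-g) * σ = 1 * σ := by rw [neg_mul, one_mul, ← h]
        exact mul_right_cancel h2
      rw [← this, neg_neg]
  · rintro (rfl | rfl)
    · exact ⟨0, by simp⟩
    · exact ⟨0, by simp⟩

/-- The isotropy group of `p` in `SL₂(ℤ)` is `±1`. -/
def HasTrivialIsotropy (p : Dbar) : Prop := ∀ g : SL(2, ℤ), g • p = p → g = 1 ∨ g = -1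

theorem hasTrivialIsotropy_bdry (σ : SL(2, ℤ)) (x : ℝ) : HasTrivialIsotropy (.inr (bdry σ x)) :=
  fun _ h => stabilizer_bdry.1 (Sum.inr_injective h)

theorem IsGeneric.hasTrivialIsotropy {z : ℍ} (hz : IsGeneric z) : HasTrivialIsotropy (.inl z) :=
  fun g h => hz g (Sum.inl_injective h)

theorem adj_of_hasTrivialIsotropy (Γ : Subgroup SL(2, ℤ)) {p q : Dbar} (h : p ≠ q)
    (hp : HasTrivialIsotropy p) : (simplices Γ).Adj p q := by
  refine ⟨h, fun g hg => ?_⟩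
  rw [MulAction.mem_stabilizer_iff]
  rcases hp g hg with rfl | rfl
  · exact one_smul _ _
  · rw [neg_smul_dbar, one_smul]

/-! ### Pulling back forms and functions -/

theorem denom_mul (γ δ : SL(2, ℤ)) (z : ℍ) :
    denom (γ * δ : SL(2, ℤ)) z = denom γ (δ • z : ℍ) * denom δ z := by
  have h := denom_cocycle' (γ : GL (Fin 2) ℝ) (δ : GL (Fin 2) ℝ) z
  rw [ModularGroup.sl_moeb]
  simp only [map_mul]
  rw [denom_cocycle (γ : GL (Fin 2) ℝ) (δ : GL (Fin 2) ℝ) z.im_ne_zero, ← coe_smul_of_det_pos]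
  simp

/-- Multiplication by `c`, as a real linear map. -/
def dil (c : ℂ) : ℂ →L[ℝ] ℂ := ContinuousLinearMap.mul ℝ ℂ c

theorem dil_apply (c u : ℂ) : dil c u = c * u := rfl

theorem hasDerivAt_smul_ofComplex (γ : SL(2, ℤ)) (z : ℍ) :
    HasDerivAt (fun w : ℂ => ((γ • ofComplex w : ℍ) : ℂ)) (1 / denom γ z ^ 2) z := by
  have hdet : (γ : GL (Fin 2) ℝ).val.det = 1 :=
    (Matrix.SpecialLinearGroup.map (Int.castRingHom ℝ) γ).det_coe
  have h := (hasStrictDerivAt_smul (g := (γ : GL (Fin 2) ℝ)) (by rw [hdet]; exact one_pos)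
    z).hasDerivAt
  rw [hdet, Complex.ofReal_one] at h
  exact h

theorem hasFDerivAt_smul_ofComplex (γ : SL(2, ℤ)) (z : ℍ) :
    HasFDerivAt (fun w : ℂ => ((γ • ofComplex w : ℍ) : ℂ)) (dil (1 / denom γ z ^ 2)) z := by
  have h := (hasDerivAt_smul_ofComplex γ z).hasFDerivAt.restrictScalars ℝ
  refine h.congr_fderiv (ContinuousLinearMap.ext fun u => ?_)
  simp [dil_apply, mul_comm]

/-- The action of `SL₂(ℤ)` on the coefficients, as a continuous real linear map. -/
def repCLM (k : ℕ) (γ : SL(2, ℤ)) : Coeff k →L[ℝ] Coeff k :=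
  (LinearMap.toContinuousLinearMap (rep k γ)).restrictScalars ℝ

theorem repCLM_apply {k : ℕ} (γ : SL(2, ℤ)) (v : Coeff k) : repCLM k γ v = rep k γ v := rfl

/-- The pullback of a form with coefficients: `(γ^* ξ)_z = ρ(γ)⁻¹ ξ_{γ z} ∘ dγ_z`. -/
def pullForm {k : ℕ} (γ : SL(2, ℤ)) (ξ : OneForm k) : OneForm k :=
  fun z => (repCLM k γ⁻¹).comp ((ξ (γ • z)).comp (dil (1 / denom γ z ^ 2)))

theorem pullForm_apply {k : ℕ} (γ : SL(2, ℤ)) (ξ : OneForm k) (z : ℍ) (u : ℂ) :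
    pullForm γ ξ z u = rep k γ⁻¹ (ξ (γ • z) (u / denom γ z ^ 2)) := by
  change rep k γ⁻¹ (ξ (γ • z) (1 / denom γ z ^ 2 * u)) = _
  rw [one_div_mul_eq_div]

/-- The pullback of a function with coefficients. -/
def pullFun {k : ℕ} {X : Type} [SMul SL(2, ℤ) X] (γ : SL(2, ℤ)) (f : X → Coeff k) : X → Coeff k :=
  fun q => rep k γ⁻¹ (f (γ • q))

theorem pullForm_mul {k : ℕ} (γ δ : SL(2, ℤ)) (ξ : OneForm k) :
    pullForm (γ * δ) ξ = pullForm δ (pullForm γ ξ) := by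
  funext z
  ext1 u
  rw [pullForm_apply, pullForm_apply, pullForm_apply, _root_.mul_inv_rev, rep_mul_apply, mul_smul,
    denom_mul, mul_pow, div_div, mul_comm (denom γ _ ^ 2)]

theorem pullFun_mul {k : ℕ} {X : Type} [MulAction SL(2, ℤ) X] (γ δ : SL(2, ℤ)) (f : X → Coeff k) :
    pullFun (γ * δ) f = pullFun δ (pullFun γ f) := by
  funext q
  simp only [pullFun]
  rw [_root_.mul_inv_rev, rep_mul_apply, mul_smul]

theorem pullForm_eq_iff {k : ℕ} {γ : SL(2, ℤ)} {ξ : OneForm k} :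
    pullForm γ ξ = ξ ↔ ∀ z u, ξ (γ • z) (u / denom γ z ^ 2) = rep k γ (ξ z u) := by
  constructor
  · intro h z u
    conv_rhs => rw [← h]
    rw [pullForm_apply, rep_rep_inv]
  · intro h
    funext z
    ext1 u
    rw [pullForm_apply, h, rep_inv_rep]

theorem pullFun_eq_iff {k : ℕ} {X : Type} [SMul SL(2, ℤ) X] {γ : SL(2, ℤ)} {f : X → Coeff k} :
    pullFun γ f = f ↔ ∀ q, f (γ • q) = rep k γ (f q) := by
  constructor
  · intro h q
    conv_rhs => rw [← h]
    rw [pullFun, rep_rep_inv]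
  · intro h
    funext q
    rw [pullFun, h, rep_inv_rep]

theorem denom_neg_sq (γ : SL(2, ℤ)) (z : ℂ) : denom (-γ : SL(2, ℤ)) z ^ 2 = denom γ z ^ 2 := by
  have : denom (-γ : SL(2, ℤ)) z = -denom γ z := by
    simp [denom]; ring
  rw [this, neg_sq]

theorem pullForm_neg {k : ℕ} (γ : SL(2, ℤ)) (ξ : OneForm k) :
    pullForm (-γ) ξ = pullForm γ ξ := by
  funext z
  ext1 u
  have h : (-γ)⁻¹ = -γ⁻¹ := by rw [inv_eq_iff_mul_eq_one]; simp
  rw [pullForm_apply, pullForm_apply, h, rep_neg, denom_neg_sq, ModularGroup.SL_neg_smul]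

theorem pullForm_plusMinus {k : ℕ} {Γ : Subgroup SL(2, ℤ)} {ξ : OneForm k}
    (h : ∀ γ ∈ Γ, pullForm γ ξ = ξ) {γ : SL(2, ℤ)} (hγ : γ ∈ plusMinus Γ) : pullForm γ ξ = ξ :=
  plusMinus_induction (P := fun γ => pullForm γ ξ = ξ) (fun g hg => by rwa [pullForm_neg] at hg)
    h hγ

theorem pullFun_neg {k : ℕ} (γ : SL(2, ℤ)) (f : Boundary → Coeff k) :
    pullFun (-γ) f = pullFun γ f := by
  funext q
  have h : (-γ)⁻¹ = -γ⁻¹ := by rw [inv_eq_iff_mul_eq_one]; simp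
  rw [pullFun, pullFun, h, rep_neg, neg_smul_boundary]

theorem pullFun_plusMinus {k : ℕ} {Γ : Subgroup SL(2, ℤ)} {f : Boundary → Coeff k}
    (h : ∀ γ ∈ Γ, pullFun γ f = f) {γ : SL(2, ℤ)} (hγ : γ ∈ plusMinus Γ) : pullFun γ f = f :=
  plusMinus_induction (P := fun γ => pullFun γ f = f) (fun g hg => by rwa [pullFun_neg] at hg)
    h hγ

/-! ### Charts at the cusps -/

theorem smul_frame (γ σ : SL(2, ℤ)) (x y : ℝ) : γ • frame σ x y = frame (γ * σ) x y :=
  (mul_smul γ σ _).symm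

theorem smul_chart (γ σ : SL(2, ℤ)) (p : ℝ × ℝ) : γ • chart σ p = chart (γ * σ) p := by
  rw [chart, chart]
  split_ifs
  · exact congrArg Sum.inl (smul_frame γ σ _ _)
  · rfl

/-- The differential of `(x, t) ↦ x + i / t`. -/
def stripDeriv (t : ℝ) : ℝ × ℝ →L[ℝ] ℂ :=
  Complex.ofRealCLM.comp (ContinuousLinearMap.fst ℝ ℝ ℝ)
    + (ContinuousLinearMap.snd ℝ ℝ ℝ).smulRight (-((t : ℂ) ^ 2)⁻¹ * Complex.I)

theorem stripDeriv_apply (t a b : ℝ) :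
    stripDeriv t (a, b) = a + b * (-((t : ℂ) ^ 2)⁻¹ * Complex.I) := by
  simp [stripDeriv]

theorem im_strip {x y : ℝ} (hy : 0 < y) : 0 < ((x : ℂ) + y * Complex.I).im := by simpa using hy

theorem coe_ofComplex_strip {x y : ℝ} (hy : 0 < y) :
    ((ofComplex ((x : ℂ) + y * Complex.I) : ℍ) : ℂ) = x + y * Complex.I := by
  rw [ofComplex_apply_of_im_pos (im_strip hy)]

theorem hasFDerivAt_frame (σ : SL(2, ℤ)) {p : ℝ × ℝ} (hp : 0 < p.2) :
    HasFDerivAt (fun p : ℝ × ℝ => (frame σ p.1 p.2⁻¹ : ℂ))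
      ((dil (1 / denom σ (p.1 + (p.2⁻¹ : ℝ) * Complex.I) ^ 2)).comp (stripDeriv p.2)) p := by
  have h1 : HasFDerivAt (fun p : ℝ × ℝ => (p.1 : ℂ) + (p.2⁻¹ : ℝ) * Complex.I)
      (stripDeriv p.2) p := by
    have hx : HasFDerivAt (fun p : ℝ × ℝ => (p.1 : ℂ))
        (Complex.ofRealCLM.comp (ContinuousLinearMap.fst ℝ ℝ ℝ)) p :=
      Complex.ofRealCLM.hasFDerivAt.comp p hasFDerivAt_fst
    have ht : HasFDerivAt (fun p : ℝ × ℝ => ((p.2⁻¹ : ℝ) : ℂ))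
        (Complex.ofRealCLM.comp ((ContinuousLinearMap.toSpanSingleton ℝ (-(p.2 ^ 2)⁻¹)).comp
          (ContinuousLinearMap.snd ℝ ℝ ℝ))) p :=
      Complex.ofRealCLM.hasFDerivAt.comp p
        ((hasFDerivAt_inv hp.ne').comp p hasFDerivAt_snd)
    have := hx.add (ht.mul_const Complex.I)
    refine this.congr_fderiv (ContinuousLinearMap.ext fun u => ?_)
    simp [stripDeriv]
    ring
  have hz := coe_ofComplex_strip (x := p.1) (inv_pos.2 hp)
  have h2 := hasFDerivAt_smul_ofComplex σ (ofComplex ((p.1 : ℂ) + (p.2⁻¹ : ℝ) * Complex.I))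
  rw [hz] at h2
  exact HasFDerivAt.comp (f := fun p : ℝ × ℝ => (p.1 : ℂ) + (p.2⁻¹ : ℝ) * Complex.I) p h2 h1

theorem fderiv_frame (σ : SL(2, ℤ)) {p : ℝ × ℝ} (hp : 0 < p.2) :
    fderiv ℝ (fun p : ℝ × ℝ => (frame σ p.1 p.2⁻¹ : ℂ)) p =
      (dil (1 / denom σ (p.1 + (p.2⁻¹ : ℝ) * Complex.I) ^ 2)).comp (stripDeriv p.2) :=
  (hasFDerivAt_frame σ hp).fderiv

/-! ### Primitives -/

theorem SmoothFun.tendsto {k : ℕ} {f : Dbar → Coeff k} (hf : SmoothFun f) (σ : SL(2, ℤ)) (x : ℝ) :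
    Tendsto (fun y : ℝ => f (.inl (frame σ x y))) atTop (𝓝 (f (.inr (bdry σ x)))) := by
  have h1 : ContinuousWithinAt (f ∘ chart σ) {p | 0 ≤ p.2} (x, 0) :=
    (hf σ).continuousOn _ (by simp)
  have h2 : Tendsto (fun y : ℝ => (x, y⁻¹)) atTop (𝓝[{p | 0 ≤ p.2}] ((x, 0) : ℝ × ℝ)) := by
    refine tendsto_nhdsWithin_iff.2 ⟨?_, ?_⟩
    · exact tendsto_const_nhds.prodMk_nhds tendsto_inv_atTop_zero
    · filter_upwards [eventually_gt_atTop 0] with y hy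
      exact (inv_pos.2 hy).le
  have h3 := h1.tendsto.comp h2
  have e : (f ∘ chart σ) (x, 0) = f (.inr (bdry σ x)) := by simp [chart]
  rw [e] at h3
  refine h3.congr' ?_
  filter_upwards [eventually_gt_atTop 0] with y hy
  simp [chart, hy]

/-- Two primitives of the same form differ by a constant, also on the boundary. -/
theorem IsPrimitive.sub_eq_sub {k : ℕ} {f f' : Dbar → Coeff k} {ξ : OneForm k}
    (hf : IsPrimitive f ξ) (hf' : IsPrimitive f' ξ) (p q : Dbar) : f p - f q = f' p - f' q := by
  set d : Dbar → Coeff k := fun p => f p - f' p with hd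
  have h1 : ∀ z w : ℍ, d (.inl z) = d (.inl w) := by
    intro z w
    have hopen : IsOpen {z : ℂ | 0 < z.im} := isOpen_upperHalfPlaneSet
    have hconv : Convex ℝ {z : ℂ | 0 < z.im} := convex_halfSpace_im_gt 0
    have hder : ∀ u : ℂ, 0 < u.im →
        HasFDerivAt (𝕜 := ℝ) (fun w : ℂ => d (.inl (ofComplex w))) 0 u := by
      intro u hu
      have := (hf.2 ⟨u, hu⟩).sub (hf'.2 ⟨u, hu⟩)
      rwa [sub_self] at this
    have := hopen.is_const_of_fderiv_eq_zero (𝕜 := ℝ) hconv.isPreconnected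
      (f := fun w : ℂ => d (.inl (ofComplex w)))
      (fun u hu => (hder u hu).differentiableAt.differentiableWithinAt)
      (fun u hu => (hder u hu).fderiv) z.im_pos w.im_pos
    simpa using this
  have h2 : ∀ p : Dbar, d p = d (.inl I) := by
    rintro (z | q)
    · exact h1 z I
    · induction q using Quotient.inductionOn with
      | h s =>
        obtain ⟨σ, x⟩ := s
        have ht := (hf.1.tendsto σ x).sub (hf'.1.tendsto σ x)
        have ht' : Tendsto (fun y : ℝ => d (.inl (frame σ x y))) atTop (𝓝 (d (.inr (bdry σ x)))) := ht
        have hc : (fun y : ℝ => d (.inl (frame σ x y))) = fun _ => d (.inl I) :=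
          funext fun y => h1 _ _
        rw [hc] at ht'
        exact tendsto_nhds_unique ht' tendsto_const_nhds |>.symm ▸ rfl
  have h3 : d p = d q := (h2 p).trans (h2 q).symm
  simp only [hd] at h3
  rw [sub_eq_sub_iff_add_eq_add] at h3 ⊢
  rw [h3, add_comm]

theorem IsPrimitive.pull {k : ℕ} {f : Dbar → Coeff k} {ξ : OneForm k} (hf : IsPrimitive f ξ)
    (γ : SL(2, ℤ)) : IsPrimitive (pullFun γ f) (pullForm γ ξ) := by
  refine ⟨fun σ => ?_, fun z => ?_⟩
  · have : pullFun γ f ∘ chart σ = repCLM k γ⁻¹ ∘ (f ∘ chart (γ * σ)) := by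
      funext p
      simp only [Function.comp_apply, pullFun, smul_chart, repCLM_apply]
    rw [this]
    exact (repCLM k γ⁻¹).contDiff.comp_contDiffOn (hf.1 (γ * σ))
  · have h1 := hf.2 (γ • z)
    have hz : ((γ • ofComplex (z : ℂ) : ℍ) : ℂ) = ((γ • z : ℍ) : ℂ) := by rw [ofComplex_apply]
    rw [← hz] at h1
    have h2 := h1.comp (z : ℂ) (hasFDerivAt_smul_ofComplex γ z)
    have h3 := (repCLM k γ⁻¹).hasFDerivAt.comp (z : ℂ) h2
    refine h3.congr_of_eventuallyEq (Eventually.of_forall fun w => ?_)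
    change rep k γ⁻¹ (f (γ • .inl (ofComplex w))) = rep k γ⁻¹ (f (.inl (ofComplex _)))
    rw [ofComplex_apply]
    rfl

/-- A primitive of an invariant form is equivariant up to constants. -/
theorem IsPrimitive.smul_sub_smul {k : ℕ} {f : Dbar → Coeff k} {ξ : OneForm k}
    (hf : IsPrimitive f ξ) {γ : SL(2, ℤ)} (h : pullForm γ ξ = ξ) (p q : Dbar) :
    f (γ • p) - f (γ • q) = rep k γ (f p - f q) := by
  have h1 := hf.pull γ
  rw [h] at h1
  rw [← hf.sub_eq_sub h1 p q |>.symm, pullFun, pullFun, ← map_sub, rep_rep_inv]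

/-! ### Closed forms and cone cocycles under pullback -/

theorem exists_hasDerivAt_denom (γ : SL(2, ℤ)) (z : ℍ) :
    ∃ D : ℂ, HasDerivAt (fun w : ℂ => 1 / denom γ (ofComplex w : ℍ) ^ 2) D z := by
  refine ⟨_, ((hasDerivAt_denom_zpow (γ : GL (Fin 2) ℝ) (-2) z)).congr_of_eventuallyEq ?_⟩
  filter_upwards [eventuallyEq_coe_comp_ofComplex z.im_pos] with w hw
  simp only [Function.comp_apply, id_eq] at hw
  rw [hw, _root_.zpow_neg, one_div]
  rfl

theorem IsClosedForm.of_bot {k : ℕ} {Γ : Subgroup SL(2, ℤ)} {ξ : OneForm k}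
    (h : IsClosedForm ⊥ ξ) (hinv : ∀ γ ∈ Γ, pullForm γ ξ = ξ) : IsClosedForm Γ ξ :=
  ⟨h.smooth, h.closed, fun γ hγ => pullForm_eq_iff.1 (hinv γ hγ)⟩

theorem IsClosedForm.pullForm_eq {k : ℕ} {Γ : Subgroup SL(2, ℤ)} {ξ : OneForm k}
    (h : IsClosedForm Γ ξ) : ∀ γ ∈ Γ, pullForm γ ξ = ξ :=
  fun γ hγ => pullForm_eq_iff.2 (h.equivariant γ hγ)

theorem IsClosedForm.mono {k : ℕ} {Γ Γ' : Subgroup SL(2, ℤ)} {ξ : OneForm k}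
    (h : IsClosedForm Γ ξ) (hle : Γ' ≤ Γ) : IsClosedForm Γ' ξ :=
  ⟨h.smooth, h.closed, fun γ hγ => h.equivariant γ (hle hγ)⟩

theorem IsClosedForm.pull {k : ℕ} {ξ : OneForm k} (h : IsClosedForm ⊥ ξ) (γ : SL(2, ℤ)) :
    IsClosedForm ⊥ (pullForm γ ξ) := by
  refine ⟨fun σ => ?_, fun z => ?_, fun δ hδ => ?_⟩
  · obtain ⟨A, hA, hA'⟩ := h.smooth (γ * σ)
    refine ⟨fun p => (repCLM k γ⁻¹).comp (A p), ?_, fun p hp => ?_⟩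
    · exact ((ContinuousLinearMap.compL ℝ (ℝ × ℝ) (Coeff k) (Coeff k)
        (repCLM k γ⁻¹)).contDiff.comp_contDiffOn hA)
    · have hz := coe_ofComplex_strip (x := p.1) (inv_pos.2 hp)
      have hd := denom_mul γ σ (ofComplex (p.1 + (p.2⁻¹ : ℝ) * Complex.I))
      rw [hz] at hd
      simp only [hA' p hp, fderiv_frame _ hp, hd]
      refine ContinuousLinearMap.ext fun v => ?_
      simp only [pullForm, ContinuousLinearMap.comp_apply, dil_apply, ← smul_frame]
      congr 2
      rw [← mul_assoc, mul_pow, one_div_mul_one_div]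
      rfl
  · obtain ⟨A, hA, hsymm⟩ := h.closed (γ • z)
    obtain ⟨D, hD⟩ := exists_hasDerivAt_denom γ z
    have hz : ((γ • ofComplex (z : ℂ) : ℍ) : ℂ) = ((γ • z : ℍ) : ℂ) := by rw [ofComplex_apply]
    have h1 : HasFDerivAt (fun w : ℂ => ξ (γ • ofComplex w)) (A.comp (dil (1 / denom γ z ^ 2)))
        (z : ℂ) := by
      rw [← hz] at hA
      refine (hA.comp (z : ℂ) (hasFDerivAt_smul_ofComplex γ z)).congr_of_eventuallyEq
        (Eventually.of_forall fun w => ?_)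
      simp only [Function.comp_apply, ofComplex_apply]
    have h2 : HasFDerivAt (fun w : ℂ => dil (1 / denom γ (ofComplex w : ℍ) ^ 2))
        ((ContinuousLinearMap.mul ℝ ℂ).comp (dil D)) (z : ℂ) := by
      have h3 : HasFDerivAt (fun w : ℂ => 1 / denom γ (ofComplex w : ℍ) ^ 2) (dil D) (z : ℂ) :=
        (hD.hasFDerivAt.restrictScalars ℝ).congr_fderiv
          (ContinuousLinearMap.ext fun u => by simp [dil_apply, mul_comm])
      exact (ContinuousLinearMap.mul ℝ ℂ).hasFDerivAt.comp (z : ℂ) h3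
    have h4 := (hasFDerivAt_const (repCLM k γ⁻¹) (z : ℂ)).clm_comp (h1.clm_comp h2)
    refine ⟨_, h4, fun u v => ?_⟩
    simp only [ofComplex_apply, ContinuousLinearMap.comp_zero, add_zero,
      ContinuousLinearMap.comp_apply, _root_.add_apply,
      ContinuousLinearMap.compL_apply, ContinuousLinearMap.flip_apply, map_add, dil_apply,
      ContinuousLinearMap.mul_apply', hsymm (1 / denom γ z ^ 2 * u)]
    rw [mul_right_comm]
  · rw [Subgroup.mem_bot.1 hδ]
    intro z u
    simp [denom]

theorem RestrictsTo.pull {k : ℕ} {ξ : OneForm k} {γ σ : SL(2, ℤ)} {x : ℝ} {v : Coeff k}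
    (h : RestrictsTo ξ (γ * σ) x v) : RestrictsTo (pullForm γ ξ) σ x (rep k γ⁻¹ v) := by
  refine (((repCLM k γ⁻¹).continuous.tendsto _).comp h).congr' ?_
  filter_upwards [eventually_gt_atTop 0] with y hy
  have hd := denom_mul γ σ (ofComplex (x + y * Complex.I))
  rw [coe_ofComplex_strip hy] at hd
  rw [Function.comp_apply, pullForm_apply, repCLM_apply, smul_frame, hd, div_div, mul_pow,
    mul_comm (denom σ _ ^ 2)]
  rfl

/-- The pullback of pairs of a form and a function on the boundary. -/
def pullPair (k : ℕ) (γ : SL(2, ℤ)) :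
    (OneForm k × (Boundary → Coeff k)) →ₗ[ℂ] (OneForm k × (Boundary → Coeff k)) where
  toFun p := (pullForm γ p.1, pullFun γ p.2)
  map_add' p q := by
    refine Prod.ext (funext fun z => ContinuousLinearMap.ext fun u => ?_) (funext fun x => ?_)
    · simp [pullForm_apply]
    · simp [pullFun]
  map_smul' c p := by
    refine Prod.ext (funext fun z => ContinuousLinearMap.ext fun u => ?_) (funext fun x => ?_)
    · simp [pullForm_apply]
    · simp [pullFun]

theorem pullPair_apply {k : ℕ} (γ : SL(2, ℤ)) (p : OneForm k × (Boundary → Coeff k)) :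
    pullPair k γ p = (pullForm γ p.1, pullFun γ p.2) := rfl

theorem pullPair_mul {k : ℕ} (γ δ : SL(2, ℤ)) (p : OneForm k × (Boundary → Coeff k)) :
    pullPair k (γ * δ) p = pullPair k δ (pullPair k γ p) := by
  simp only [pullPair_apply, pullForm_mul, pullFun_mul]

/-- The conditions on a cocycle other than equivariance do not involve the group. -/
theorem mem_coneCocycles_iff {k : ℕ} {Γ : Subgroup SL(2, ℤ)}
    {p : OneForm k × (Boundary → Coeff k)} :
    p ∈ coneCocycles k Γ ↔ p ∈ coneCocycles k ⊥ ∧ ∀ γ ∈ Γ, pullPair k γ p = p := by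
  constructor
  · rintro ⟨h1, h2, h3⟩
    refine ⟨⟨h1.mono bot_le, fun γ hγ => h2 γ ((bot_le : ⊥ ≤ Γ) hγ), h3⟩, fun γ hγ => ?_⟩
    exact Prod.ext (h1.pullForm_eq γ hγ) (pullFun_eq_iff.2 (h2 γ hγ))
  · rintro ⟨⟨h1, h2, h3⟩, h4⟩
    exact ⟨h1.of_bot fun γ hγ => congrArg Prod.fst (h4 γ hγ),
      fun γ hγ => pullFun_eq_iff.1 (congrArg Prod.snd (h4 γ hγ)), h3⟩

theorem pullPair_mem {k : ℕ} (γ : SL(2, ℤ)) {p : OneForm k × (Boundary → Coeff k)}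
    (hp : p ∈ coneCocycles k ⊥) : pullPair k γ p ∈ coneCocycles k ⊥ := by
  obtain ⟨h1, h2, h3⟩ := hp
  refine ⟨h1.pull γ, fun δ hδ q => ?_, fun σ x => ?_⟩
  · rw [Subgroup.mem_bot.1 hδ, one_smul, rep_one_apply]
  · obtain ⟨v, hv, hv'⟩ := h3 (γ * σ) x
    exact ⟨rep k γ⁻¹ v, hv.pull, (repCLM k γ⁻¹).hasFDerivAt.comp_hasDerivAt x hv'⟩

theorem IsPrimitive.sum {k : ℕ} {ι : Type*} {s : Finset ι} {f : ι → Dbar → Coeff k}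
    {ξ : ι → OneForm k} (h : ∀ i ∈ s, IsPrimitive (f i) (ξ i)) :
    IsPrimitive (∑ i ∈ s, f i) (∑ i ∈ s, ξ i) := by
  refine ⟨fun σ => ?_, fun z => ?_⟩
  · have : (∑ i ∈ s, f i) ∘ chart σ = fun p => ∑ i ∈ s, (f i ∘ chart σ) p := by
      funext p; simp
    rw [this]
    exact ContDiffOn.sum fun i hi => (h i hi).1 σ
  · have := HasFDerivAt.fun_sum fun i hi => (h i hi).2 z
    simpa using this

theorem coneCocycles_mono {k : ℕ} {Γ Γ' : Subgroup SL(2, ℤ)} (hle : Γ' ≤ Γ) :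
    coneCocycles k Γ ≤ coneCocycles k Γ' :=
  fun _ hp => mem_coneCocycles_iff.2 ⟨(mem_coneCocycles_iff.1 hp).1,
    fun γ hγ => (mem_coneCocycles_iff.1 hp).2 γ (hle hγ)⟩

theorem coneCoboundaries_mono {k : ℕ} {Γ Γ' : Subgroup SL(2, ℤ)} (hle : Γ' ≤ Γ) :
    coneCoboundaries k Γ ≤ coneCoboundaries k Γ' := by
  rintro p ⟨f, h1, h2, h3⟩
  exact ⟨f, h1, fun γ hγ => h2 γ (hle hγ), h3⟩

/-! ### Averaging over the cosets of a normal subgroup -/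

section Transfer

theorem apply_out_eq {M : Type*} {Γ Γ' : Subgroup SL(2, ℤ)} [hnormal : (Γ'.subgroupOf Γ).Normal]
    {φ : Γ → M} (hφ : ∀ δ ∈ Γ'.subgroupOf Γ, ∀ g, φ (δ * g) = φ g)
    (g : Γ) : φ (g : Γ ⧸ Γ'.subgroupOf Γ).out = φ g := by
  have h : (g : Γ ⧸ Γ'.subgroupOf Γ).out * g⁻¹ ∈ Γ'.subgroupOf Γ := by
    refine (hnormal.mem_comm_iff).1 ?_
    exact QuotientGroup.eq.1 (QuotientGroup.out_eq' (g : Γ ⧸ Γ'.subgroupOf Γ)).symm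
  rw [← hφ _ h g, inv_mul_cancel_right]

/-- A sum over cosets may be shifted by a group element. -/
theorem sum_out_mul {M : Type*} [AddCommMonoid M] {Γ Γ' : Subgroup SL(2, ℤ)}
    [(Γ'.subgroupOf Γ).Normal] [Fintype (Γ ⧸ Γ'.subgroupOf Γ)] {φ : Γ → M}
    (hφ : ∀ δ ∈ Γ'.subgroupOf Γ, ∀ g, φ (δ * g) = φ g) (γ : Γ) :
    ∑ q : Γ ⧸ Γ'.subgroupOf Γ, φ (q.out * γ) = ∑ q : Γ ⧸ Γ'.subgroupOf Γ, φ q.out := by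
  refine Fintype.sum_equiv (Equiv.mulRight (γ : Γ ⧸ Γ'.subgroupOf Γ)) _ _ fun q => ?_
  rw [← apply_out_eq hφ (q.out * γ), QuotientGroup.mk_mul, QuotientGroup.out_eq',
    Equiv.coe_mulRight]

/-- The average of the pullbacks of a pair under representatives of `Γ / Γ'`. -/
def averagePair (k : ℕ) (Γ Γ' : Subgroup SL(2, ℤ)) [Fintype (Γ ⧸ Γ'.subgroupOf Γ)] :
    (OneForm k × (Boundary → Coeff k)) →ₗ[ℂ] (OneForm k × (Boundary → Coeff k)) :=
  ((Fintype.card (Γ ⧸ Γ'.subgroupOf Γ) : ℂ)⁻¹) •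
    ∑ q : Γ ⧸ Γ'.subgroupOf Γ, pullPair k (q.out : SL(2, ℤ))

variable {k : ℕ} {Γ Γ' : Subgroup SL(2, ℤ)} [Fintype (Γ ⧸ Γ'.subgroupOf Γ)]

theorem averagePair_apply (p : OneForm k × (Boundary → Coeff k)) :
    averagePair k Γ Γ' p = ((Fintype.card (Γ ⧸ Γ'.subgroupOf Γ) : ℂ)⁻¹) •
      ∑ q : Γ ⧸ Γ'.subgroupOf Γ, pullPair k (q.out : SL(2, ℤ)) p := by
  rw [averagePair, LinearMap.smul_apply, LinearMap.sum_apply]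

theorem card_quotient_ne_zero : (Fintype.card (Γ ⧸ Γ'.subgroupOf Γ) : ℂ) ≠ 0 :=
  Nat.cast_ne_zero.2 Fintype.card_ne_zero

theorem averagePair_mem [(Γ'.subgroupOf Γ).Normal] {p : OneForm k × (Boundary → Coeff k)}
    (hp : p ∈ coneCocycles k Γ') : averagePair k Γ Γ' p ∈ coneCocycles k Γ := by
  obtain ⟨h1, h2⟩ := mem_coneCocycles_iff.1 hp
  rw [averagePair_apply]
  refine mem_coneCocycles_iff.2 ⟨Submodule.smul_mem _ _ (Submodule.sum_mem _ fun q _ =>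
    pullPair_mem _ h1), fun γ hγ => ?_⟩
  rw [LinearMap.map_smul, map_sum]
  have := sum_out_mul (Γ := Γ) (Γ' := Γ') (φ := fun g : Γ => pullPair k (g : SL(2, ℤ)) p)
    (fun δ hδ g => by
      rw [Subgroup.coe_mul, pullPair_mul, h2 _ (Subgroup.mem_subgroupOf.1 hδ)]) ⟨γ, hγ⟩
  exact congrArg _ ((Finset.sum_congr rfl fun q _ => (pullPair_mul _ _ p).symm).trans this)

theorem averagePair_eq_self {p : OneForm k × (Boundary → Coeff k)} (hp : p ∈ coneCocycles k Γ) :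
    averagePair k Γ Γ' p = p := by
  have h : ∑ q : Γ ⧸ Γ'.subgroupOf Γ, pullPair k (q.out : SL(2, ℤ)) p =
      (Fintype.card (Γ ⧸ Γ'.subgroupOf Γ) : ℂ) • p := by
    rw [Finset.sum_congr rfl fun q _ => (mem_coneCocycles_iff.1 hp).2 _ q.out.2, Finset.sum_const,
      Finset.card_univ, Nat.cast_smul_eq_nsmul]
  rw [averagePair_apply, h, smul_smul, inv_mul_cancel₀ card_quotient_ne_zero, one_smul]

theorem averagePair_mem_coboundaries [(Γ'.subgroupOf Γ).Normal]
    {p : OneForm k × (Boundary → Coeff k)} (hp : p ∈ coneCoboundaries k Γ') :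
    averagePair k Γ Γ' p ∈ coneCoboundaries k Γ := by
  obtain ⟨f, h1, h2, h3⟩ := hp
  rw [averagePair_apply]
  refine Submodule.smul_mem _ _ ⟨∑ q : Γ ⧸ Γ'.subgroupOf Γ, pullFun (q.out : SL(2, ℤ)) f,
    ?_, fun γ hγ => ?_, fun q => ?_⟩
  · rw [Prod.fst_sum]
    exact IsPrimitive.sum fun q _ => h1.pull _
  · refine pullFun_eq_iff.1 ?_
    have := sum_out_mul (Γ := Γ) (Γ' := Γ') (φ := fun g : Γ => pullFun (g : SL(2, ℤ)) f)
      (fun δ hδ g => by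
        rw [Subgroup.coe_mul, pullFun_mul,
          pullFun_eq_iff.2 (h2 _ (Subgroup.mem_subgroupOf.1 hδ))]) ⟨γ, hγ⟩
    refine Eq.trans ?_ this
    funext x
    simp only [pullFun, Finset.sum_apply, map_sum, Subgroup.coe_mul, _root_.mul_inv_rev,
      rep_mul_apply, mul_smul]
  · simp only [Prod.snd_sum, Finset.sum_apply, pullPair_apply, pullFun, h3]
    rfl

variable (k Γ Γ') in
/-- The transfer `H¹_c(Γ') → H¹_c(Γ)`, normalised by the index. -/
def transfer [(Γ'.subgroupOf Γ).Normal] : ConeCohomology k Γ' →ₗ[ℂ] ConeCohomology k Γ :=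
  Submodule.mapQ _ _ ((averagePair k Γ Γ').restrict fun _ hp => averagePair_mem hp)
    fun _ hp => averagePair_mem_coboundaries hp

theorem transfer_coneClass [(Γ'.subgroupOf Γ).Normal] (p : coneCocycles k Γ') :
    transfer k Γ Γ' (coneClass p) = coneClass ⟨averagePair k Γ Γ' p, averagePair_mem p.2⟩ := rfl

theorem continuous_transfer [(Γ'.subgroupOf Γ).Normal] : Continuous (transfer k Γ Γ') := by
  have : IsModuleTopology ℂ (ConeCohomology k Γ') := ⟨rfl⟩
  have : IsModuleTopology ℂ (ConeCohomology k Γ) := ⟨rfl⟩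
  have : ContinuousAdd (ConeCohomology k Γ) := IsModuleTopology.toContinuousAdd ℂ _
  have : ContinuousSMul ℂ (ConeCohomology k Γ) := IsModuleTopology.toContinuousSMul ℂ _
  exact IsModuleTopology.continuous_of_linearMap _

/-- A cocycle whose class is a transfer is itself an average of a cocycle of the given class. -/
theorem exists_averagePair_eq [(Γ'.subgroupOf Γ).Normal] (hle : Γ' ≤ Γ) (P : ConeCohomology k Γ')
    (p : coneCocycles k Γ) (hp : coneClass p = transfer k Γ Γ' P) :
    ∃ p' : coneCocycles k Γ', coneClass p' = P ∧ averagePair k Γ Γ' p' = p := by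
  obtain ⟨p₁, rfl⟩ := Submodule.Quotient.mk_surjective _ P
  have hd := (Submodule.Quotient.eq _).1 (hp.trans (transfer_coneClass p₁))
  set d : OneForm k × (Boundary → Coeff k) := p.1 - averagePair k Γ Γ' p₁ with hdef
  have hd' : d ∈ coneCoboundaries k Γ := hd
  have hd1 : d ∈ coneCocycles k Γ := sub_mem p.2 (averagePair_mem p₁.2)
  refine ⟨p₁ + ⟨d, coneCocycles_mono hle hd1⟩, ?_, ?_⟩
  · refine (Submodule.Quotient.eq _).2 ?_
    have : (p₁ + ⟨d, coneCocycles_mono hle hd1⟩ : coneCocycles k Γ') - p₁ =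
        ⟨d, coneCocycles_mono hle hd1⟩ := add_sub_cancel_left _ _
    rw [this]
    exact coneCoboundaries_mono hle hd'
  · rw [Submodule.coe_add, map_add, averagePair_eq_self hd1, hdef, add_sub_cancel]

end Transfer

/-! ### Integrability on the standard fundamental domain -/

theorem volume_fd_lt_top : volume ModularGroup.fd < ⊤ := by
  have hsub : ((↑) '' ModularGroup.fd : Set ℂ) ⊆
      Complex.measurableEquivRealProd ⁻¹' (Set.Icc (-1 : ℝ) 1 ×ˢ Set.Ioi (1 / 2 : ℝ)) := by
    rintro _ ⟨z, hz, rfl⟩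
    have h1 := ModularGroup.three_le_four_mul_im_sq_of_mem_fd hz
    have h2 : |z.re| ≤ 1 / 2 := hz.2
    have h3 := z.im_pos
    rw [abs_le] at h2
    refine ⟨⟨?_, ?_⟩, ?_⟩
    · change -1 ≤ z.re; linarith
    · change z.re ≤ 1; linarith
    · change 1 / 2 < z.im; nlinarith
  rw [volume_eq_lintegral]
  refine (lintegral_mono_set hsub).trans_lt ?_
  have hmp := Complex.volume_preserving_equiv_real_prod
  have e := hmp.setLIntegral_comp_preimage_emb
    Complex.measurableEquivRealProd.measurableEmbedding
    (fun p : ℝ × ℝ => (((1 / ‖p.2‖₊) ^ 2 : NNReal) : ENNReal))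
    (Set.Icc (-1 : ℝ) 1 ×ˢ Set.Ioi (1 / 2 : ℝ))
  refine e.trans_lt ?_
  rw [Measure.volume_eq_prod, ← Measure.prod_restrict]
  have hmeas : Measurable fun y : ℝ => (((1 / ‖y‖₊) ^ 2 : NNReal) : ENNReal) := by fun_prop
  have hprod := lintegral_prod_mul (μ := volume.restrict (Set.Icc (-1 : ℝ) 1))
    (ν := volume.restrict (Set.Ioi (1 / 2 : ℝ))) (f := fun _ => (1 : ENNReal))
    (g := fun y : ℝ => (((1 / ‖y‖₊) ^ 2 : NNReal) : ENNReal)) aemeasurable_const hmeas.aemeasurable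
  simp only [one_mul] at hprod
  rw [hprod]
  refine ENNReal.mul_lt_top (by simp) ?_
  have hint : IntegrableOn (fun y : ℝ => y ^ (-2 : ℝ)) (Set.Ioi (1 / 2)) :=
    integrableOn_Ioi_rpow_of_lt (by norm_num) (by norm_num)
  refine lt_of_le_of_lt (le_of_eq ?_) hint.2
  refine setLIntegral_congr_fun measurableSet_Ioi fun y hy => ?_
  have hy' : (0 : ℝ) < y := lt_trans (by norm_num) hy
  have : y ^ (-2 : ℝ) = (1 / y) ^ 2 := by
    rw [Real.rpow_neg hy'.le, one_div, inv_pow]; norm_cast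
  simp only [this]
  rw [enorm_eq_nnnorm, nnnorm_pow, nnnorm_div, nnnorm_one]

theorem continuous_hForm (k : ℕ) : Continuous fun p : Coeff k × Coeff k => hForm p.1 p.2 := by
  have h1 : Continuous (incl k) := (incl k).continuous_of_finiteDimensional
  simp only [hForm, tForm_apply]
  refine continuous_finsetSum _ fun β _ => ?_
  exact (continuous_const.mul ((continuous_apply β).comp (h1.comp continuous_fst))).mul
    ((continuous_apply β).comp (h1.comp continuous_snd))

theorem continuousOn_hForm {k : ℕ} {X : Type*} [TopologicalSpace X] {f g : X → Coeff k} {s : Set X}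
    (hf : ContinuousOn f s) (hg : ContinuousOn g s) :
    ContinuousOn (fun x => hForm (f x) (g x)) s :=
  (continuous_hForm k).comp_continuousOn (f := fun x => (f x, g x)) (hf.prodMk hg)

theorem IsClosedForm.continuous {k : ℕ} {ξ : OneForm k} (h : IsClosedForm ⊥ ξ) : Continuous ξ := by
  refine continuous_iff_continuousAt.2 fun z => ?_
  obtain ⟨A, hA, -⟩ := h.closed z
  have := hA.continuousAt.comp (f := ((↑) : ℍ → ℂ)) continuous_coe.continuousAt
  refine this.congr (Eventually.of_forall fun w => ?_)
  simp only [Function.comp_apply, ofComplex_apply]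

theorem hForm_neg_left {k : ℕ} (v w : Coeff k) : hForm (-v) w = -hForm v w := by simp [hForm]

theorem hForm_neg_right {k : ℕ} (v w : Coeff k) : hForm v (-w) = -hForm v w := by simp [hForm]

theorem hForm_real_smul_left {k : ℕ} (c : ℝ) (v w : Coeff k) :
    hForm (c • v) w = c * hForm v w := by
  rw [← hForm_smul_left]; rfl

theorem hForm_real_smul_right {k : ℕ} (c : ℝ) (v w : Coeff k) :
    hForm v (c • w) = c * hForm v w := by
  rw [← hForm_smul_right]; rfl

theorem frame_one (x : ℝ) {y : ℝ} (hy : 0 < y) : (frame 1 x y : ℂ) = x + y * Complex.I := by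
  rw [frame, one_smul, coe_ofComplex_strip hy]

/-- In the coordinates `x`, `t = 1 / y` the area form is `d x d t`, so `η ∧ a` is bounded on the
fundamental domain with respect to the invariant measure. -/
theorem exists_norm_wedge_le {k : ℕ} {η a : OneForm k} (hη : IsClosedForm ⊥ η)
    (ha : IsClosedForm ⊥ a) :
    ∃ C : ℝ, ∀ w ∈ ModularGroup.fd, ‖((w : ℍ).im : ℂ) ^ 2 * wedge η a w‖ ≤ C := by
  obtain ⟨A, hA, hA'⟩ := hη.smooth 1
  obtain ⟨B, hB, hB'⟩ := ha.smooth 1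
  set Φ : ℝ × ℝ → ℂ := fun p =>
    hForm (A p (0, 1)) (B p (1, 0)) - hForm (A p (1, 0)) (B p (0, 1)) with hΦ
  have hcont : ContinuousOn Φ {p | 0 ≤ p.2} := by
    have e1 : ∀ v, ContinuousOn (fun p => A p v) {p | 0 ≤ p.2} := fun v =>
      hA.continuousOn.clm_apply continuousOn_const
    have e2 : ∀ v, ContinuousOn (fun p => B p v) {p | 0 ≤ p.2} := fun v =>
      hB.continuousOn.clm_apply continuousOn_const
    exact (continuousOn_hForm (e1 (0, 1)) (e2 (1, 0))).sub
      (continuousOn_hForm (e1 (1, 0)) (e2 (0, 1)))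
  have hK : IsCompact (Set.Icc (-1 / 2 : ℝ) (1 / 2) ×ˢ Set.Icc (0 : ℝ) 2) :=
    isCompact_Icc.prod isCompact_Icc
  obtain ⟨C, hC⟩ := hK.exists_bound_of_continuousOn (hcont.mono fun p hp => hp.2.1)
  refine ⟨C, fun w hw => ?_⟩
  have h1 := ModularGroup.three_le_four_mul_im_sq_of_mem_fd hw
  have h2 : |w.re| ≤ 1 / 2 := hw.2
  have h3 := w.im_pos
  rw [abs_le] at h2
  have h4 : (w.re, w.im⁻¹) ∈ Set.Icc (-1 / 2 : ℝ) (1 / 2) ×ˢ Set.Icc (0 : ℝ) 2 := by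
    refine ⟨⟨by simp only; linarith, h2.2⟩, (inv_pos.2 h3).le, ?_⟩
    change w.im⁻¹ ≤ 2
    rw [inv_le_comm₀ h3 two_pos]
    nlinarith
  refine le_of_eq_of_le (congrArg norm ?_) (hC _ h4)
  have hw' : frame 1 w.re w.im⁻¹⁻¹ = w := by
    rw [inv_inv]
    ext
    rw [frame_one _ h3]
    exact Complex.re_add_im _
  have key : ∀ {ξ : OneForm k} {A : ℝ × ℝ → (ℝ × ℝ →L[ℝ] Coeff k)},
      (∀ p : ℝ × ℝ, 0 < p.2 → A p = (ξ (frame 1 p.1 p.2⁻¹)).comp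
        (fderiv ℝ (fun p : ℝ × ℝ => (frame 1 p.1 p.2⁻¹ : ℂ)) p)) →
      ξ w 1 = A (w.re, w.im⁻¹) (1, 0) ∧
        ξ w Complex.I = (-(w.im ^ 2)⁻¹ : ℝ) • A (w.re, w.im⁻¹) (0, 1) := by
    intro ξ A hA
    have e := hA (w.re, w.im⁻¹) (inv_pos.2 h3)
    rw [fderiv_frame _ (inv_pos.2 h3), hw'] at e
    rw [e]
    simp only [ContinuousLinearMap.comp_apply, stripDeriv_apply, dil_apply, ← map_smul]
    have hy : (w.im : ℂ) ≠ 0 := by exact_mod_cast h3.ne'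
    constructor
    · congr 1; simp [denom]
    · congr 1
      simp [denom]
      field_simp
  obtain ⟨hη1, hη2⟩ := key hA'
  obtain ⟨ha1, ha2⟩ := key hB'
  have hy : (w.im : ℂ) ≠ 0 := by exact_mod_cast h3.ne'
  rw [wedge, hη1, hη2, ha1, ha2, hForm_real_smul_left, hForm_real_smul_right, hΦ]
  push_cast
  field_simp
  ring

theorem integrableOn_wedge {k : ℕ} {η a : OneForm k} (hη : IsClosedForm ⊥ η)
    (ha : IsClosedForm ⊥ a) :
    IntegrableOn (fun w : ℍ => (w.im : ℂ) ^ 2 * wedge η a w) ModularGroup.fd := by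
  obtain ⟨C, hC⟩ := exists_norm_wedge_le hη ha
  have hcont : Continuous fun w : ℍ => (w.im : ℂ) ^ 2 * wedge η a w := by
    have e1 : ∀ u, ContinuousOn (fun z => η z u) Set.univ := fun u =>
      (hη.continuous.clm_apply continuous_const).continuousOn
    have e2 : ∀ u, ContinuousOn (fun z => a z u) Set.univ := fun u =>
      (ha.continuous.clm_apply continuous_const).continuousOn
    refine ((Complex.continuous_ofReal.comp continuous_im).pow 2).mul ?_
    exact continuousOn_univ.1
      ((continuousOn_hForm (e1 1) (e2 Complex.I)).sub (continuousOn_hForm (e1 Complex.I) (e2 1)))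
  refine Measure.integrableOn_of_bounded volume_fd_lt_top.ne hcont.aestronglyMeasurable (M := C) ?_
  exact (ae_restrict_iff' ModularGroup.isClosed_fd.measurableSet).2 (Eventually.of_forall hC)

theorem wedge_pullForm {k : ℕ} (γ : SL(2, ℤ)) (η a : OneForm k) (z : ℍ) :
    (z.im : ℂ) ^ 2 * wedge (pullForm γ η) (pullForm γ a) z =
      ((γ • z).im : ℂ) ^ 2 * wedge η a (γ • z) := by
  set j : ℂ := 1 / denom γ z ^ 2 with hj
  have hd : denom γ (z : ℂ) ≠ 0 := denom_ne_zero _ z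
  have him : (γ • z).im = z.im / Complex.normSq (denom γ z) :=
    ModularGroup.im_smul_eq_div_normSq γ z
  have hnorm : j.re ^ 2 + j.im ^ 2 = (Complex.normSq (denom γ z))⁻¹ ^ 2 := by
    have : Complex.normSq j = (Complex.normSq (denom γ z))⁻¹ ^ 2 := by
      rw [hj, map_div₀, map_one, map_pow, one_div, inv_pow]
    rw [← this, Complex.normSq_apply]; ring
  have e1 : ∀ ξ : OneForm k, pullForm γ ξ z 1 =
      rep k γ⁻¹ (j.re • ξ (γ • z) 1 + j.im • ξ (γ • z) Complex.I) := by
    intro ξ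
    rw [pullForm_apply, ← hj, ← map_smul, ← map_smul, ← map_add]
    congr 2
    apply Complex.ext <;> simp
  have e2 : ∀ ξ : OneForm k, pullForm γ ξ z Complex.I =
      rep k γ⁻¹ (-(j.im • ξ (γ • z) 1) + j.re • ξ (γ • z) Complex.I) := by
    intro ξ
    have : Complex.I / denom γ z ^ 2 = Complex.I * j := by rw [hj]; ring
    rw [pullForm_apply, this, ← map_smul, ← map_smul, ← map_neg, ← map_add]
    congr 2
    apply Complex.ext <;> simp
  rw [wedge, e1, e1, e2, e2, hForm_rep, hForm_rep, wedge, him]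
  simp only [hForm_add_left, hForm_add_right, hForm_neg_left, hForm_neg_right,
    hForm_real_smul_left, hForm_real_smul_right]
  have hnorm' : (j.re : ℂ) ^ 2 + (j.im : ℂ) ^ 2 =
      ((Complex.normSq (denom γ z) : ℝ) : ℂ)⁻¹ ^ 2 := by exact_mod_cast hnorm
  rw [Complex.ofReal_div, div_pow, div_eq_mul_inv, ← inv_pow, ← hnorm']
  ring

/-! ### Boundary values -/

theorem IsClosedForm.exists_boundaryValue {k : ℕ} {ξ : OneForm k} (h : IsClosedForm ⊥ ξ)
    (σ : SL(2, ℤ)) : ∃ b : ℝ → Coeff k, Continuous b ∧ ∀ x, RestrictsTo ξ σ x (b x) := by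
  obtain ⟨A, hA, hA'⟩ := h.smooth σ
  refine ⟨fun x => A (x, 0) (1, 0), ?_, fun x => ?_⟩
  · have h1 : Continuous fun x : ℝ => A (x, 0) :=
      hA.continuousOn.comp_continuous (by fun_prop) fun x => by simp
    exact h1.clm_apply continuous_const
  · have h1 : ContinuousWithinAt A {p | 0 ≤ p.2} (x, 0) := hA.continuousOn _ (by simp)
    have h2 : Tendsto (fun y : ℝ => (x, y⁻¹)) atTop (𝓝[{p | 0 ≤ p.2}] ((x, 0) : ℝ × ℝ)) := by
      refine tendsto_nhdsWithin_iff.2 ⟨?_, ?_⟩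
      · exact tendsto_const_nhds.prodMk_nhds tendsto_inv_atTop_zero
      · filter_upwards [eventually_gt_atTop 0] with y hy
        exact (inv_pos.2 hy).le
    have h3 : Tendsto (fun y : ℝ => A (x, y⁻¹) (1, 0)) atTop (𝓝 (A (x, 0) (1, 0))) :=
      ((ContinuousLinearMap.apply ℝ (Coeff k) ((1, 0) : ℝ × ℝ)).continuous.tendsto _).comp
        (h1.tendsto.comp h2)
    refine h3.congr' ?_
    filter_upwards [eventually_gt_atTop 0] with y hy
    have e := hA' (x, y⁻¹) (inv_pos.2 hy)
    rw [fderiv_frame _ (inv_pos.2 hy)] at e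
    rw [e]
    simp only [ContinuousLinearMap.comp_apply, stripDeriv_apply, dil_apply, inv_inv]
    congr 1
    simp

theorem RestrictsTo.boundaryValue_eq {k : ℕ} {ξ : OneForm k} {σ : SL(2, ℤ)} {x : ℝ} {v : Coeff k}
    (h : RestrictsTo ξ σ x v) : boundaryValue ξ σ x = v := h.limUnder_eq

theorem boundaryValue_pullForm {k : ℕ} {ξ : OneForm k} (h : IsClosedForm ⊥ ξ) (γ σ : SL(2, ℤ))
    (x : ℝ) : boundaryValue (pullForm γ ξ) σ x = rep k γ⁻¹ (boundaryValue ξ (γ * σ) x) := by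
  obtain ⟨b, -, hb⟩ := h.exists_boundaryValue (γ * σ)
  rw [(hb x).boundaryValue_eq, (hb x).pull.boundaryValue_eq]

theorem continuous_boundaryValue {k : ℕ} {ξ : OneForm k} (h : IsClosedForm ⊥ ξ) (σ : SL(2, ℤ)) :
    Continuous (boundaryValue ξ σ) := by
  obtain ⟨b, hb, hb'⟩ := h.exists_boundaryValue σ
  rwa [funext fun x => (hb' x).boundaryValue_eq]

/-! ### Sums over right cosets -/

section CosetSum

variable {G : Type*} [Group G]

/-- The sum over the right cosets `H g` of a function on `G` (meant to be invariant under `H` from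
the left). -/
def cosetSum (H : Subgroup G) (f : G → ℂ) : ℂ :=
  ∑ᶠ q : Quotient (QuotientGroup.rightRel H), f q.out

theorem apply_rightRel_out {H : Subgroup G} {α : Type*} {f : G → α}
    (hf : ∀ h ∈ H, ∀ g, f (h * g) = f g)
    (g : G) : f (Quotient.mk (QuotientGroup.rightRel H) g).out = f g := by
  have h : g * (Quotient.mk (QuotientGroup.rightRel H) g).out⁻¹ ∈ H :=
    QuotientGroup.rightRel_apply.1 (Quotient.exact (Quotient.out_eq _))
  rw [← hf _ h, inv_mul_cancel_right]

/-- A sum over right cosets of `H` is unchanged by translation by an element that normalises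
`H`. -/
theorem cosetSum_mul_left {H : Subgroup G} {f : G → ℂ} (hf : ∀ h ∈ H, ∀ g, f (h * g) = f g) {s : G}
    (hs : ∀ h, h ∈ H ↔ s * h * s⁻¹ ∈ H) : cosetSum H (fun g => f (s * g)) = cosetSum H f := by
  have hmap : ∀ t : G, (∀ h, h ∈ H → t * h * t⁻¹ ∈ H) → ∀ a b : G,
      (QuotientGroup.rightRel H) a b → (QuotientGroup.rightRel H) (t * a) (t * b) := by
    intro t ht a b hab
    rw [QuotientGroup.rightRel_apply] at hab ⊢
    have := ht _ hab
    simpa [mul_assoc] using this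
  let e : Quotient (QuotientGroup.rightRel H) ≃ Quotient (QuotientGroup.rightRel H) :=
    { toFun := Quotient.map (s * ·) (hmap s fun h hh => (hs h).1 hh)
      invFun := Quotient.map (s⁻¹ * ·) (hmap s⁻¹ fun h hh => by
        rw [hs]; simpa [mul_assoc] using hh)
      left_inv := by rintro ⟨a⟩; exact congrArg (Quotient.mk _) (by simp)
      right_inv := by rintro ⟨a⟩; exact congrArg (Quotient.mk _) (by simp) }
  refine finsum_eq_of_bijective e e.bijective fun q => ?_
  rw [← Quotient.out_eq q]
  change f (s * (Quotient.mk _ q.out).out) =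
    f (Quotient.mk (QuotientGroup.rightRel H) (s * q.out)).out
  rw [apply_rightRel_out hf, Quotient.out_eq]

/-- The sum over the right cosets as a sum over left cosets. -/
theorem cosetSum_eq_finsum {H : Subgroup G} {f : G → ℂ} (hf : ∀ h ∈ H, ∀ g, f (h * g) = f g) :
    cosetSum H f = ∑ᶠ q : G ⧸ H, f q.out⁻¹ := by
  refine finsum_eq_of_bijective (QuotientGroup.quotientRightRelEquivQuotientLeftRel H)
    (Equiv.bijective _) fun q => ?_
  have hq : QuotientGroup.quotientRightRelEquivQuotientLeftRel H q =
      QuotientGroup.mk (s := H) q.out⁻¹ := by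
    conv_lhs => rw [← Quotient.out_eq q]
    rfl
  rw [hq]
  have h : (QuotientGroup.mk (s := H) q.out⁻¹).out⁻¹ * q.out⁻¹ ∈ H :=
    QuotientGroup.eq.1 (QuotientGroup.out_eq' _)
  have h2 := hf _ h q.out
  rw [inv_mul_cancel_right] at h2
  exact h2.symm

/-- The coset sum of an `H`-invariant function counts each coset of `H` as often as it contains
cosets of `K`. -/
theorem cosetSum_of_le {H K : Subgroup G} (hle : K ≤ H) [K.FiniteIndex] {f : G → ℂ}
    (hf : ∀ h ∈ H, ∀ g, f (h * g) = f g) : cosetSum K f = K.relIndex H * cosetSum H f := by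
  have : H.FiniteIndex := Subgroup.finiteIndex_of_le hle
  have : Finite (G ⧸ K) := inferInstance
  have : Finite (G ⧸ H) := inferInstance
  have := Fintype.ofFinite (G ⧸ K)
  have := Fintype.ofFinite (G ⧸ H)
  have : Finite (H ⧸ K.subgroupOf H) := inferInstance
  have := Fintype.ofFinite (H ⧸ K.subgroupOf H)
  rw [cosetSum_eq_finsum hf, cosetSum_eq_finsum fun h hh => hf h (hle hh),
    finsum_eq_sum_of_fintype, finsum_eq_sum_of_fintype]
  have key : ∀ x : G ⧸ K, f x.out⁻¹ =
      (fun q : (G ⧸ H) × (H ⧸ K.subgroupOf H) => f q.1.out⁻¹)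
        (Subgroup.quotientEquivProdOfLE hle x) := by
    intro x
    have hx : (Subgroup.quotientEquivProdOfLE hle x).1 = QuotientGroup.mk x.out := by
      conv_lhs => rw [← QuotientGroup.out_eq' x]
      rfl
    have h : (QuotientGroup.mk (s := H) x.out).out⁻¹ * x.out ∈ H :=
      QuotientGroup.eq.1 (QuotientGroup.out_eq' _)
    have h2 := hf _ h x.out⁻¹
    rw [mul_inv_cancel_right] at h2
    simp only [hx, h2]
  rw [Finset.sum_congr rfl fun x _ => key x, Equiv.sum_comp (Subgroup.quotientEquivProdOfLE hle)
    (fun q : (G ⧸ H) × (H ⧸ K.subgroupOf H) => f q.1.out⁻¹), Fintype.sum_prod_type]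
  simp only [Finset.sum_const, nsmul_eq_mul, ← Finset.mul_sum, Finset.card_univ,
    Subgroup.relIndex, Subgroup.index, Nat.card_eq_fintype_card]

theorem cosetSum_add {H : Subgroup G} [H.FiniteIndex] (f f' : G → ℂ) :
    cosetSum H (fun g => f g + f' g) = cosetSum H f + cosetSum H f' := by
  have : Finite (G ⧸ H) := inferInstance
  have : Finite (Quotient (QuotientGroup.rightRel H)) :=
    Finite.of_equiv _ (QuotientGroup.quotientRightRelEquivQuotientLeftRel H).symm
  exact finsum_add_distrib (Set.toFinite _) (Set.toFinite _)

theorem cosetSum_const_mul {H : Subgroup G} [H.FiniteIndex] (c : ℂ) (f : G → ℂ) :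
    cosetSum H (fun g => c * f g) = c * cosetSum H f := by
  have : Finite (G ⧸ H) := inferInstance
  have : Finite (Quotient (QuotientGroup.rightRel H)) :=
    Finite.of_equiv _ (QuotientGroup.quotientRightRelEquivQuotientLeftRel H).symm
  exact (mul_finsum _ _).symm

theorem cosetSum_sum {H : Subgroup G} [H.FiniteIndex] {ι : Type*} (s : Finset ι)
    (f : ι → G → ℂ) : cosetSum H (fun g => ∑ i ∈ s, f i g) = ∑ i ∈ s, cosetSum H (f i) := by
  classical
  induction s using Finset.induction_on with
  | empty => simp [cosetSum]
  | insert a s ha ih => simp only [Finset.sum_insert ha, cosetSum_add, ih]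

end CosetSum

/-! ### The pairing and averages -/

/-- The contribution of the standard fundamental domain and its boundary segment to the pairing. -/
def cell {k : ℕ} (η : OneForm k) (p : OneForm k × (Boundary → Coeff k)) : ℂ :=
  (∫ w in ModularGroup.fd, ((w.im : ℝ) : ℂ) ^ 2 * wedge η p.1 w)
    - ∫ x in (-1 / 2 : ℝ)..(1 / 2 : ℝ), hForm (boundaryValue η 1 x) (p.2 (bdry 1 x))

/-- The fundamental domain of `Γ` is tiled by the translates of the standard one, and pulling back
to the standard one turns the pairing into a sum over the cosets of `± Γ`. -/
theorem pairing_eq_cosetSum {k : ℕ} {Γ : Subgroup SL(2, ℤ)} {η : OneForm k}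
    (hη : IsClosedForm ⊥ η) (p : OneForm k × (Boundary → Coeff k)) :
    pairing Γ η p = cosetSum (plusMinus Γ) fun g => cell (pullForm g η) (pullPair k g p) := by
  refine finsum_congr fun q => ?_
  simp only [cell]
  congr 1
  · refine setIntegral_congr_fun ModularGroup.isClosed_fd.measurableSet fun w _ => ?_
    exact (wedge_pullForm _ _ _ _).symm
  · refine intervalIntegral.integral_congr fun x _ => ?_
    simp only [boundaryValue_pullForm hη, mul_one, pullPair_apply, pullFun, smul_bdry, hForm_rep]

theorem cell_add {k : ℕ} {η : OneForm k} (hη : IsClosedForm ⊥ η)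
    {p p' : OneForm k × (Boundary → Coeff k)} (hp : p ∈ coneCocycles k ⊥)
    (hp' : p' ∈ coneCocycles k ⊥) : cell η (p + p') = cell η p + cell η p' := by
  have hb : ∀ {q : OneForm k × (Boundary → Coeff k)}, q ∈ coneCocycles k ⊥ →
      Continuous fun x => hForm (boundaryValue η 1 x) (q.2 (bdry 1 x)) := by
    intro q hq
    have : Continuous fun x => q.2 (bdry 1 x) :=
      continuous_iff_continuousAt.2 fun x => by
        obtain ⟨v, -, hv⟩ := hq.2.2 1 x
        exact hv.continuousAt
    exact continuousOn_univ.1 (continuousOn_hForm (continuous_boundaryValue hη 1).continuousOn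
      this.continuousOn)
  simp only [cell]
  have e1 : ∀ w : ℍ, ((w.im : ℝ) : ℂ) ^ 2 * wedge η (p + p').1 w =
      ((w.im : ℝ) : ℂ) ^ 2 * wedge η p.1 w + ((w.im : ℝ) : ℂ) ^ 2 * wedge η p'.1 w := by
    intro w
    simp only [wedge, Prod.fst_add, Pi.add_apply, _root_.add_apply, hForm_add_right]
    ring
  have e2 : ∀ x : ℝ, hForm (boundaryValue η 1 x) ((p + p').2 (bdry 1 x)) =
      hForm (boundaryValue η 1 x) (p.2 (bdry 1 x)) +
        hForm (boundaryValue η 1 x) (p'.2 (bdry 1 x)) := by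
    intro x
    simp only [Prod.snd_add, Pi.add_apply, hForm_add_right]
  simp only [e1, e2]
  rw [integral_add (integrableOn_wedge hη hp.1) (integrableOn_wedge hη hp'.1),
    intervalIntegral.integral_add ((hb hp).intervalIntegrable _ _)
      ((hb hp').intervalIntegrable _ _)]
  ring

theorem cell_smul {k : ℕ} (η : OneForm k) (c : ℂ) (p : OneForm k × (Boundary → Coeff k)) :
    cell η (c • p) = c * cell η p := by
  simp only [cell]
  have e1 : ∀ w : ℍ, ((w.im : ℝ) : ℂ) ^ 2 * wedge η (c • p).1 w =
      c * (((w.im : ℝ) : ℂ) ^ 2 * wedge η p.1 w) := by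
    intro w
    simp only [wedge, Prod.smul_fst, Pi.smul_apply, _root_.smul_apply, hForm_smul_right]
    ring
  have e2 : ∀ x : ℝ, hForm (boundaryValue η 1 x) ((c • p).2 (bdry 1 x)) =
      c * hForm (boundaryValue η 1 x) (p.2 (bdry 1 x)) := by
    intro x
    simp only [Prod.smul_snd, Pi.smul_apply, hForm_smul_right]
  simp only [e1, e2, integral_const_mul, intervalIntegral.integral_const_mul]
  ring

theorem cell_sum {k : ℕ} {η : OneForm k} (hη : IsClosedForm ⊥ η) {ι : Type*} (s : Finset ι)
    {p : ι → OneForm k × (Boundary → Coeff k)} (hp : ∀ i, p i ∈ coneCocycles k ⊥) :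
    cell η (∑ i ∈ s, p i) = ∑ i ∈ s, cell η (p i) := by
  classical
  induction s using Finset.induction_on with
  | empty => simpa using cell_smul η 0 0
  | insert a s ha ih =>
    rw [Finset.sum_insert ha, Finset.sum_insert ha, cell_add hη (hp a)
      (Submodule.sum_mem _ fun i _ => hp i), ih]

theorem pullPair_plusMinus {k : ℕ} {Γ : Subgroup SL(2, ℤ)} {p : OneForm k × (Boundary → Coeff k)}
    (hp : p ∈ coneCocycles k Γ) {g : SL(2, ℤ)} (hg : g ∈ plusMinus Γ) : pullPair k g p = p :=
  Prod.ext
    (pullForm_plusMinus (fun γ hγ => congrArg Prod.fst ((mem_coneCocycles_iff.1 hp).2 γ hγ)) hg)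
    (pullFun_plusMinus (fun γ hγ => congrArg Prod.snd ((mem_coneCocycles_iff.1 hp).2 γ hγ)) hg)

/-- The integrand of the pairing is invariant under `± Γ`. -/
theorem cell_pull_mul {k : ℕ} {Γ : Subgroup SL(2, ℤ)} {η : OneForm k} (hη : IsClosedForm Γ η)
    {p : OneForm k × (Boundary → Coeff k)} (hp : p ∈ coneCocycles k Γ) :
    ∀ h ∈ plusMinus Γ, ∀ g, cell (pullForm (h * g) η) (pullPair k (h * g) p) =
      cell (pullForm g η) (pullPair k g p) := by
  intro h hh g
  rw [pullForm_mul, pullPair_mul, pullPair_plusMinus hp hh,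
    pullForm_plusMinus (fun γ hγ => hη.pullForm_eq γ hγ) hh]

instance plusMinus_finiteIndex (Γ : Subgroup SL(2, ℤ)) [Γ.FiniteIndex] :
    (plusMinus Γ).FiniteIndex := Subgroup.finiteIndex_of_le (le_plusMinus Γ)

theorem pairing_of_le {k : ℕ} {Γ Γ' : Subgroup SL(2, ℤ)} [Γ'.FiniteIndex] (hle : Γ' ≤ Γ)
    {η : OneForm k} (hη : IsClosedForm Γ η) {p : OneForm k × (Boundary → Coeff k)}
    (hp : p ∈ coneCocycles k Γ) :
    pairing Γ' η p = (plusMinus Γ').relIndex (plusMinus Γ) * pairing Γ η p := by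
  have h0 := hη.mono (bot_le : ⊥ ≤ Γ)
  rw [pairing_eq_cosetSum h0, pairing_eq_cosetSum h0]
  exact cosetSum_of_le (plusMinus_mono hle) (cell_pull_mul hη hp)

theorem mem_plusMinus_conj {Γ Γ' : Subgroup SL(2, ℤ)} (hle : Γ' ≤ Γ)
    [hn : (Γ'.subgroupOf Γ).Normal] {s : SL(2, ℤ)} (hs : s ∈ plusMinus Γ) (g : SL(2, ℤ)) :
    g ∈ plusMinus Γ' ↔ s * g * s⁻¹ ∈ plusMinus Γ' := by
  have key : ∀ t ∈ Γ, ∀ g ∈ Γ', t * g * t⁻¹ ∈ Γ' := fun t ht g hg =>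
    hn.conj_mem ⟨g, hle hg⟩ hg ⟨t, ht⟩
  have key2 : ∀ t ∈ plusMinus Γ, ∀ g ∈ plusMinus Γ', t * g * t⁻¹ ∈ plusMinus Γ' := by
    intro t ht g hg
    rw [mem_plusMinus] at ht hg ⊢
    rcases ht with ht | ht <;> rcases hg with hg | hg
    · exact .inl (key _ ht _ hg)
    · exact .inr (by simpa using key _ ht _ hg)
    · exact .inl (by simpa using key _ ht _ hg)
    · exact .inr (by simpa using key _ ht _ hg)
  refine ⟨key2 s hs g, fun h => ?_⟩
  have := key2 _ (inv_mem hs) _ h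
  simpa [mul_assoc] using this

/-- The translates of a cocycle by representatives of `Γ / Γ'` have the same pairing with a
`Γ`-equivariant form, because left multiplication by a representative permutes the cosets of
`± Γ'`. -/
theorem pairing_averagePair {k : ℕ} {Γ Γ' : Subgroup SL(2, ℤ)} [Γ'.FiniteIndex] (hle : Γ' ≤ Γ)
    [Fintype (Γ ⧸ Γ'.subgroupOf Γ)]
    [(Γ'.subgroupOf Γ).Normal] {η : OneForm k} (hη : IsClosedForm Γ η)
    {p : OneForm k × (Boundary → Coeff k)} (hp : p ∈ coneCocycles k Γ') :
    pairing Γ' η (averagePair k Γ Γ' p) = pairing Γ' η p := by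
  have h0 := hη.mono (bot_le : ⊥ ≤ Γ)
  have hp0 := (mem_coneCocycles_iff.1 hp).1
  have hinv := cell_pull_mul (hη.mono hle) hp
  have e : ∀ g, cell (pullForm g η) (pullPair k g (averagePair k Γ Γ' p)) =
      (Fintype.card (Γ ⧸ Γ'.subgroupOf Γ) : ℂ)⁻¹ * ∑ q : Γ ⧸ Γ'.subgroupOf Γ,
        cell (pullForm ((q.out : SL(2, ℤ)) * g) η) (pullPair k ((q.out : SL(2, ℤ)) * g) p) := by
    intro g
    rw [averagePair_apply, map_smul, map_sum, cell_smul, cell_sum (h0.pull g) _ fun q =>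
      pullPair_mem _ (pullPair_mem _ hp0)]
    refine congrArg _ (Finset.sum_congr rfl fun q _ => ?_)
    rw [pullForm_mul, pullPair_mul, hη.pullForm_eq _ q.out.2]
  rw [pairing_eq_cosetSum h0, pairing_eq_cosetSum h0]
  simp only [e]
  rw [cosetSum_const_mul, cosetSum_sum]
  have e2 : ∀ q : Γ ⧸ Γ'.subgroupOf Γ, (cosetSum (plusMinus Γ') fun g =>
      cell (pullForm ((q.out : SL(2, ℤ)) * g) η) (pullPair k ((q.out : SL(2, ℤ)) * g) p)) =
      cosetSum (plusMinus Γ') fun g => cell (pullForm g η) (pullPair k g p) := fun q =>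
    cosetSum_mul_left (f := fun g => cell (pullForm g η) (pullPair k g p)) hinv fun h =>
      mem_plusMinus_conj hle (le_plusMinus Γ q.out.2) h
  rw [Finset.sum_congr rfl fun q _ => e2 q, Finset.sum_const, Finset.card_univ, nsmul_eq_mul,
    inv_mul_cancel_left₀ card_quotient_ne_zero]

/-! ### Periods -/

/-- `Λ` is the map that integrates the form with primitive `F` over homology classes. -/
def IsPeriodMap {k : ℕ} (Γ : Subgroup SL(2, ℤ)) (F : Dbar → Coeff k)
    (Λ : Homology k Γ →ₗ[ℂ] ℂ) : Prop :=
  ∀ (c : Chain k Γ)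
    (hc : pushforward (simplices Γ) (repSub k Γ) c ∈
      LinearMap.ker (quotientSystem (simplices Γ) (repSub k Γ)).d1),
    Λ (Submodule.Quotient.mk ⟨_, hc⟩) = period Γ F c

/-- Increments of `F` are equivariant under `± Γ`. -/
def IsIncrementEquivariant {k : ℕ} (Γ : Subgroup SL(2, ℤ)) (F : Dbar → Coeff k) : Prop :=
  ∀ γ ∈ plusMinus Γ, ∀ p q : Dbar, F (γ • p) - F (γ • q) = rep k γ (F p - F q)

theorem IsPrimitive.isIncrementEquivariant {k : ℕ} {Γ : Subgroup SL(2, ℤ)} {η : OneForm k}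
    (hη : IsClosedForm Γ η) {F : Dbar → Coeff k} (hF : IsPrimitive F η) :
    IsIncrementEquivariant Γ F := fun _ hγ =>
  hF.smul_sub_smul (pullForm_plusMinus (fun γ hγ => hη.pullForm_eq γ hγ) hγ)

theorem IsIncrementEquivariant.mono {k : ℕ} {Γ Γ' : Subgroup SL(2, ℤ)} {F : Dbar → Coeff k}
    (hF : IsIncrementEquivariant Γ F) (hle : Γ' ≤ Γ) : IsIncrementEquivariant Γ' F :=
  fun γ hγ => hF γ (plusMinus_mono hle hγ)

theorem IsIncrementEquivariant.hForm_smul_sub_smul {k : ℕ} {Γ : Subgroup SL(2, ℤ)}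
    {F : Dbar → Coeff k} (hF : IsIncrementEquivariant Γ F) {γ : SL(2, ℤ)} (hγ : γ ∈ plusMinus Γ)
    (p q : Dbar) (v : Coeff k) :
    hForm (F (γ • p) - F (γ • q)) (rep k γ v) = hForm (F p - F q) v := by
  rw [hF γ hγ, hForm_rep]

theorem exists_isPeriodMap {k : ℕ} {Γ : Subgroup SL(2, ℤ)} {F : Dbar → Coeff k}
    (hF : IsIncrementEquivariant Γ F) : ∃ Λ : Homology k Γ →ₗ[ℂ] ℂ, IsPeriodMap Γ F Λ := by
  refine exists_functional (simplices Γ) (repSub k Γ)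
    (ψ := fun a b => tForm k (incl k (F b - F a)) ∘ₗ incl k) (fun a b c => ?_) (fun γ a b v => ?_)
  · refine LinearMap.ext fun v => ?_
    change hForm (F c - F a) v = hForm (F b - F a) v + hForm (F c - F b) v
    rw [← hForm_add_left]
    congr 1
    abel
  · exact hF.hForm_smul_sub_smul (le_plusMinus Γ γ.2) b a v

theorem seg_self {k : ℕ} (Γ : Subgroup SL(2, ℤ)) (p : Dbar) (v : Coeff k) : seg Γ p p v = 0 :=
  dif_neg fun h => h.1 rfl

theorem period_seg {k : ℕ} (Γ : Subgroup SL(2, ℤ)) (F : Dbar → Coeff k) {p : Dbar}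
    (hp : HasTrivialIsotropy p) (q : Dbar) (v : Coeff k) :
    period Γ F (seg Γ p q v) = hForm (F q - F p) v := by
  classical
  by_cases h : p = q
  · subst h
    rw [seg_self, map_zero, sub_self, hForm, map_zero, map_zero]
    rfl
  · have h1 := adj_of_hasTrivialIsotropy Γ h hp
    have h2 : seg Γ p q v = DirectSum.lof ℂ (LocalSystem.E1 (simplices Γ).toComplex)
        (fun _ => Coeff k) ⟨p, q, ⟨h1⟩⟩ v := dif_pos h1
    rw [h2, period]
    exact (DirectSum.toModule_lof ..).trans rfl

theorem d1_pushforward_seg {k : ℕ} (Γ : Subgroup SL(2, ℤ)) {p : Dbar}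
    (hp : HasTrivialIsotropy p) (q : Dbar) (v : Coeff k) :
    (quotientSystem (simplices Γ) (repSub k Γ)).d1
        (pushforward (simplices Γ) (repSub k Γ) (seg Γ p q v)) =
      pushVertex (simplices Γ) (repSub k Γ) q v - pushVertex (simplices Γ) (repSub k Γ) p v := by
  classical
  by_cases h : p = q
  · subst h
    rw [seg_self, map_zero, map_zero, sub_self]
  · exact d1_pushforward_edgeChain _ _ (adj_of_hasTrivialIsotropy Γ h hp) v

theorem pushVertex_plusMinus {k : ℕ} {Γ : Subgroup SL(2, ℤ)} {γ : SL(2, ℤ)} (hγ : γ ∈ plusMinus Γ)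
    (p : Dbar) (v : Coeff k) : pushVertex (simplices Γ) (repSub k Γ) (γ • p) (rep k γ v) =
      pushVertex (simplices Γ) (repSub k Γ) p v := by
  refine plusMinus_induction (Γ := Γ) (P := fun γ => pushVertex (simplices Γ) (repSub k Γ) (γ • p)
    (rep k γ v) = pushVertex (simplices Γ) (repSub k Γ) p v) (fun g h => ?_) (fun g hg => ?_) hγ
  · rwa [neg_smul_dbar, rep_neg] at h
  · exact pushVertex_smul (simplices Γ) (repSub k Γ) ⟨g, hg⟩ p v

theorem IsPeriodMap.apply_homClass {k : ℕ} {Γ : Subgroup SL(2, ℤ)} {F : Dbar → Coeff k}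
    {Λ : Homology k Γ →ₗ[ℂ] ℂ} (hΛ : IsPeriodMap Γ F Λ) {c : Chain k Γ}
    (hc : (quotientSystem (simplices Γ) (repSub k Γ)).d1
      (pushforward (simplices Γ) (repSub k Γ) c) = 0) :
    Λ (homClass (simplices Γ) (repSub k Γ) c) = period Γ F c := by
  rw [homClass, dif_pos (LinearMap.mem_ker.2 hc)]
  exact hΛ c _

/-- If the periods over `C'` are the periods over `C` times the index of `± Γ'` in `± Γ`, then the
transfer of a Poincaré dual of `C'` is Poincaré dual to `C`. -/
theorem IsPoincareDual.transfer {k : ℕ} {Γ Γ' : Subgroup SL(2, ℤ)} [Γ'.FiniteIndex] (hle : Γ' ≤ Γ)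
    [Fintype (Γ ⧸ Γ'.subgroupOf Γ)] [(Γ'.subgroupOf Γ).Normal] {C : Homology k Γ}
    {C' : Homology k Γ'} {P : ConeCohomology k Γ'} (hP : IsPoincareDual C' P)
    (hC : ∀ F : Dbar → Coeff k, IsIncrementEquivariant Γ F → ∀ Λ Λ', IsPeriodMap Γ F Λ →
      IsPeriodMap Γ' F Λ' → Λ' C' = (plusMinus Γ').relIndex (plusMinus Γ) * Λ C) :
    IsPoincareDual C (transfer k Γ Γ' P) := by
  intro η hη F hF p hp c hc hcC
  have hFΓ := hF.isIncrementEquivariant hη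
  obtain ⟨Λ, hΛ⟩ := exists_isPeriodMap hFΓ
  obtain ⟨Λ', hΛ'⟩ := exists_isPeriodMap (hFΓ.mono hle)
  obtain ⟨p', hp', hpp'⟩ := exists_averagePair_eq hle P p hp
  obtain ⟨c', hc', hcC'⟩ := exists_pushforward_eq (simplices Γ') (repSub k Γ') C'
  have h1 := hP η (hη.mono hle) F hF p' hp' c' hc' hcC'
  have hN : ((plusMinus Γ').relIndex (plusMinus Γ) : ℂ) ≠ 0 := by
    exact Nat.cast_ne_zero.2 (Subgroup.FiniteIndex.index_ne_zero
      (H := (plusMinus Γ').subgroupOf (plusMinus Γ)))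
  refine mul_left_cancel₀ hN ?_
  rw [← pairing_of_le hle hη p.2, ← hpp', pairing_averagePair hle hη p'.2, h1, ← hΛ' c' hc',
    ← hΛ c hc, hcC, hcC', hC F hFΓ Λ Λ' hΛ hΛ']

/-! ### The lattice and the action of `± Γ` -/

theorem ratReal_conjQ (γ : SL(2, ℤ)) (x : Matrix (Fin 2) (Fin 2) ℚ) :
    ratReal (conjQ γ x) = conj (toReal γ) (ratReal x) := by
  have e : ∀ A B : Matrix (Fin 2) (Fin 2) ℚ, ratReal (A * B) = ratReal A * ratReal B :=
    fun A B => Matrix.map_mul (f := Rat.castHom ℝ)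
  have e2 : ∀ g : SL(2, ℤ), ratReal ((g : Matrix (Fin 2) (Fin 2) ℤ).map (fun n : ℤ => (n : ℚ))) =
      ((toReal g : SL(2, ℝ)) : Matrix (Fin 2) (Fin 2) ℝ) := by
    intro g
    ext i j
    simp [ratReal, toReal]
  rw [conjQ, e, e, e2, e2, map_inv]
  rfl

theorem uAt_mul (γ σ : SL(2, ℤ)) : uAt (γ * σ) = conj (toReal γ) (uAt σ) := by
  rw [uAt, uAt, map_mul, conj_mul]

theorem uAt_neg (σ : SL(2, ℤ)) : uAt (-σ) = uAt σ := by
  rw [uAt, toReal_neg, conj_neg, uAt]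

theorem trace_uMat : uMat.trace = 0 := by simp [uMat, Matrix.trace_fin_two]

theorem trace_uAt (σ : SL(2, ℤ)) : (uAt σ).trace = 0 := by
  rw [uAt, trace_conj, trace_uMat]

theorem toReal_T_zpow (m : ℤ) : toReal (ModularGroup.T ^ m) = nMat m := by
  ext i j
  have h := congrFun (congrFun (ModularGroup.coe_T_zpow m) i) j
  have h2 : (toReal (ModularGroup.T ^ m)) i j = (((ModularGroup.T ^ m) i j : ℤ) : ℝ) := rfl
  rw [h2, h]
  fin_cases i <;> fin_cases j <;> simp [nMat]

theorem coe_nMat_inv (x : ℝ) : (((nMat x)⁻¹ : SL(2, ℝ)) : Matrix (Fin 2) (Fin 2) ℝ) =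
    !![1, -x; 0, 1] := by
  rw [Matrix.SpecialLinearGroup.coe_inv, nMat, Matrix.adjugate_fin_two_of]
  simp

theorem conj_nMat_uMat (x : ℝ) : conj (nMat x) uMat = uMat := by
  rw [conj, coe_nMat_inv, nMat, uMat]
  ext i j
  fin_cases i <;> fin_cases j <;> simp [Matrix.mul_apply, Fin.sum_univ_two]

theorem uAt_mul_T_zpow (σ : SL(2, ℤ)) (m : ℤ) : uAt (σ * ModularGroup.T ^ m) = uAt σ := by
  rw [uAt_mul, uAt, toReal_T_zpow, conj_nMat_uMat, uAt]

section Lattice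

variable {L : AddSubgroup (Matrix (Fin 2) (Fin 2) ℚ)} {h : Matrix (Fin 2) (Fin 2) ℚ}
  {Γ : Subgroup SL(2, ℤ)}

theorem conjQ_sub (γ : SL(2, ℤ)) (x y : Matrix (Fin 2) (Fin 2) ℚ) :
    conjQ γ (x - y) = conjQ γ x - conjQ γ y := by
  simp [conjQ, Matrix.mul_sub, Matrix.sub_mul]

theorem conjQ_coset_plusMinus
    (hΓL : ∀ γ ∈ Γ, ∀ x : Matrix (Fin 2) (Fin 2) ℚ, x - h ∈ L → conjQ γ x - h ∈ L) :
    ∀ γ ∈ plusMinus Γ, ∀ x : Matrix (Fin 2) (Fin 2) ℚ, x - h ∈ L → conjQ γ x - h ∈ L := by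
  intro γ hγ
  refine plusMinus_induction (Γ := Γ) (P := fun γ => ∀ x, x - h ∈ L → conjQ γ x - h ∈ L)
    (fun g hg x hx => ?_) hΓL hγ
  rw [← conjQ_neg]
  exact hg x hx

theorem conjQ_mem_lattice
    (hΓL : ∀ γ ∈ Γ, ∀ x : Matrix (Fin 2) (Fin 2) ℚ, x - h ∈ L → conjQ γ x - h ∈ L) :
    ∀ γ ∈ plusMinus Γ, ∀ x ∈ L, conjQ γ x ∈ L := by
  intro γ hγ x hx
  have h1 := conjQ_coset_plusMinus hΓL γ hγ (x + h) (by simpa using hx)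
  have h2 := conjQ_coset_plusMinus hΓL γ hγ h (by simp)
  have h3 := sub_mem h1 h2
  rw [sub_sub_sub_cancel_right, ← conjQ_sub, add_sub_cancel_right] at h3
  exact h3

/-- A subset of the rationals `x` with `x - h ∈ L` that is described relative to the cusp
`σ ∞` is unchanged if `σ` is moved by `± Γ`, provided that the description is invariant. -/
theorem setOf_exists_smul_eq {X : Set (Matrix (Fin 2) (Fin 2) ℚ)} {α : Type*}
    (hX : ∀ γ ∈ plusMinus Γ, ∀ x ∈ X, conjQ γ x ∈ X)
    {R : SL(2, ℤ) → Matrix (Fin 2) (Fin 2) ℚ → α → Prop}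
    (hR : ∀ γ σ x a, R σ x a → R (γ * σ) (conjQ γ x) a) {γ : SL(2, ℤ)} (hγ : γ ∈ plusMinus Γ)
    (σ : SL(2, ℤ)) : {a | ∃ x ∈ X, R (γ * σ) x a} = {a | ∃ x ∈ X, R σ x a} := by
  ext a
  constructor
  · rintro ⟨x, hx, hxa⟩
    refine ⟨conjQ γ⁻¹ x, hX _ (inv_mem hγ) x hx, ?_⟩
    have := hR γ⁻¹ _ _ _ hxa
    rwa [inv_mul_cancel_left] at this
  · rintro ⟨x, hx, hxa⟩
    exact ⟨conjQ γ x, hX _ hγ x hx, hR _ _ _ _ hxa⟩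

theorem ratReal_conjQ_eq_smul_uAt {σ : SL(2, ℤ)} {x : Matrix (Fin 2) (Fin 2) ℚ} {r : ℝ}
    (γ : SL(2, ℤ)) (hx : ratReal x = r • uAt σ) : ratReal (conjQ γ x) = r • uAt (γ * σ) := by
  rw [ratReal_conjQ, hx, uAt_mul, conj, conj, Matrix.mul_smul, Matrix.smul_mul]

theorem latGen_mul
    (hΓL : ∀ γ ∈ Γ, ∀ x : Matrix (Fin 2) (Fin 2) ℚ, x - h ∈ L → conjQ γ x - h ∈ L)
    {γ : SL(2, ℤ)} (hγ : γ ∈ plusMinus Γ) (σ : SL(2, ℤ)) : latGen L (γ * σ) = latGen L σ := by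
  have := setOf_exists_smul_eq (X := (L : Set _)) (conjQ_mem_lattice hΓL)
    (R := fun σ x r => ratReal x = r • uAt σ) (fun γ _ _ _ hx => ratReal_conjQ_eq_smul_uAt γ hx)
    hγ σ
  have e : ∀ σ, {r : ℝ | 0 < r ∧ ∃ x ∈ L, ratReal x = r • uAt σ} =
      {r : ℝ | 0 < r} ∩ {r : ℝ | ∃ x ∈ (L : Set _), ratReal x = r • uAt σ} := fun _ => rfl
  rw [latGen, latGen, e, e, this]

theorem cuspCoeff_mul (k : ℕ)
    (hΓL : ∀ γ ∈ Γ, ∀ x : Matrix (Fin 2) (Fin 2) ℚ, x - h ∈ L → conjQ γ x - h ∈ L)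
    {γ : SL(2, ℤ)} (hγ : γ ∈ plusMinus Γ) (σ : SL(2, ℤ)) :
    cuspCoeff k L h (γ * σ) = cuspCoeff k L h σ := by
  have := setOf_exists_smul_eq (X := {x | x - h ∈ L}) (conjQ_coset_plusMinus hΓL)
    (R := fun σ x r => ratReal x = r • uAt σ) (fun γ _ _ _ hx => ratReal_conjQ_eq_smul_uAt γ hx)
    hγ σ
  have e : ∀ σ, {r : ℝ | 0 ≤ r ∧ ∃ x : Matrix (Fin 2) (Fin 2) ℚ, x - h ∈ L ∧
      ratReal x = r • uAt σ} = {r : ℝ | 0 ≤ r} ∩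
        {r : ℝ | ∃ x ∈ {x | x - h ∈ L}, ratReal x = r • uAt σ} := fun _ => rfl
  simp only [cuspCoeff]
  rw [e, e, this, latGen_mul hΓL hγ]

theorem latGen_congr {σ σ' : SL(2, ℤ)} (hu : uAt σ = uAt σ') : latGen L σ = latGen L σ' := by
  rw [latGen, latGen, hu]

theorem cuspCoeff_congr {k : ℕ} {σ σ' : SL(2, ℤ)} (hu : uAt σ = uAt σ') :
    cuspCoeff k L h σ = cuspCoeff k L h σ' := by
  unfold cuspCoeff
  rw [latGen_congr hu, hu]

end Lattice

/-! ### Widths of cusps -/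

theorem width_spec (Γ : Subgroup SL(2, ℤ)) [Γ.FiniteIndex] (σ : SL(2, ℤ)) :
    0 < width Γ σ ∧ σ * ModularGroup.T ^ width Γ σ * σ⁻¹ ∈ plusMinus Γ := by
  refine Nat.sInf_mem (s := {m : ℕ | 0 < m ∧ σ * ModularGroup.T ^ m * σ⁻¹ ∈ plusMinus Γ}) ?_
  obtain ⟨n, hn, -, hn'⟩ := Subgroup.exists_pow_mem_of_index_ne_zero
    (Subgroup.FiniteIndex.index_ne_zero (H := plusMinus Γ)) (σ * ModularGroup.T * σ⁻¹)
  rw [conj_pow] at hn'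
  exact ⟨n, hn, hn'⟩

theorem cuspGen_mem (Γ : Subgroup SL(2, ℤ)) [Γ.FiniteIndex] (σ : SL(2, ℤ)) :
    cuspGen Γ σ ∈ plusMinus Γ := (width_spec Γ σ).2

theorem cuspGen_zpow (Γ : Subgroup SL(2, ℤ)) (σ : SL(2, ℤ)) (n : ℤ) :
    cuspGen Γ σ ^ n = σ * ModularGroup.T ^ (width Γ σ * n) * σ⁻¹ := by
  rw [cuspGen, conj_zpow, _root_.zpow_mul, zpow_natCast]

/-- The powers of `T` at the cusp `σ ∞` that lie in `± Γ` are the multiples of the width. -/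
theorem conj_T_zpow_mem_iff {Γ : Subgroup SL(2, ℤ)} [Γ.FiniteIndex] {σ : SL(2, ℤ)} {n : ℤ} :
    σ * ModularGroup.T ^ n * σ⁻¹ ∈ plusMinus Γ ↔ (width Γ σ : ℤ) ∣ n := by
  obtain ⟨h0, h1⟩ := width_spec Γ σ
  constructor
  · intro hn
    have hr : σ * ModularGroup.T ^ (n % width Γ σ) * σ⁻¹ ∈ plusMinus Γ := by
      have h2 := mul_mem hn (zpow_mem (cuspGen_mem Γ σ) (-(n / width Γ σ)))
      rw [cuspGen_zpow] at h2
      convert h2 using 1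
      rw [show n % (width Γ σ : ℤ) = n + width Γ σ * -(n / width Γ σ) by
        rw [Int.emod_def]; ring, _root_.zpow_add]
      group
    by_contra hdvd
    have hpos : 0 < n % (width Γ σ : ℤ) :=
      lt_of_le_of_ne (Int.emod_nonneg _ (by omega)) fun h => hdvd (Int.dvd_of_emod_eq_zero h.symm)
    have hlt : n % (width Γ σ : ℤ) < width Γ σ := Int.emod_lt_of_pos _ (by omega)
    obtain ⟨j, hj⟩ := Int.eq_ofNat_of_zero_le hpos.le
    rw [hj] at hr hpos hlt
    rw [zpow_natCast] at hr
    have : width Γ σ ≤ j := Nat.sInf_le ⟨by omega, hr⟩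
    omega
  · rintro ⟨j, rfl⟩
    rw [← cuspGen_zpow]
    exact zpow_mem (cuspGen_mem Γ σ) j

theorem cuspGen_smul_bdry (Γ : Subgroup SL(2, ℤ)) (σ : SL(2, ℤ)) (r : ℝ) :
    cuspGen Γ σ • bdry σ r = bdry σ (r + width Γ σ) := by
  rw [smul_bdry, cuspGen, inv_mul_cancel_right, ← zpow_natCast, bdry_mul_T_zpow]
  simp

theorem rep_harmPow {k : ℕ} (γ : SL(2, ℤ)) {x : Matrix (Fin 2) (Fin 2) ℝ} (hx : x.trace = 0) :
    rep k γ (harmPow k x) = harmPow k (conj (toReal γ) x) := (harmPow_conj _ hx).symm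

theorem rep_cuspGen_uAt {k : ℕ} (Γ : Subgroup SL(2, ℤ)) (σ : SL(2, ℤ)) :
    rep k (cuspGen Γ σ) (harmPow k (uAt σ)) = harmPow k (uAt σ) := by
  rw [rep_harmPow _ (trace_uAt σ), ← uAt_mul, cuspGen, inv_mul_cancel_right, ← zpow_natCast,
    uAt_mul_T_zpow]

/-- The chain `X_ℓ ⊗ w` has boundary `c ⊗ (g⁻¹ w - w)` on the quotient. -/
theorem d1_pushforward_circle {k : ℕ} (Γ : Subgroup SL(2, ℤ)) [Γ.FiniteIndex] (σ : SL(2, ℤ))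
    (r : ℝ) (w : Coeff k) :
    (quotientSystem (simplices Γ) (repSub k Γ)).d1
        (pushforward (simplices Γ) (repSub k Γ) (circle Γ σ r w)) =
      pushVertex (simplices Γ) (repSub k Γ) (.inr (bdry σ r)) (rep k (cuspGen Γ σ)⁻¹ w - w) := by
  rw [circle, d1_pushforward_seg _ (hasTrivialIsotropy_bdry σ r), map_sub]
  congr 1
  have := pushVertex_plusMinus (cuspGen_mem Γ σ) (.inr (bdry σ r)) (rep k (cuspGen Γ σ)⁻¹ w)
  rwa [rep_rep_inv] at this

theorem period_circle {k : ℕ} (Γ : Subgroup SL(2, ℤ)) (F : Dbar → Coeff k) (σ : SL(2, ℤ))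
    (r : ℝ) (w : Coeff k) : period Γ F (circle Γ σ r w) =
      hForm (F (.inr (bdry σ (r + width Γ σ))) - F (.inr (bdry σ r))) w := by
  rw [circle, period_seg _ _ (hasTrivialIsotropy_bdry σ r), cuspGen_smul_bdry]

/-! ### The boundary cycles -/

/-- The contribution of the boundary segment at `σ ∞` to the period over the cycle of index `0`. -/
def cuspTerm (k : ℕ) (L : AddSubgroup (Matrix (Fin 2) (Fin 2) ℚ))
    (h : Matrix (Fin 2) (Fin 2) ℚ) (F : Dbar → Coeff k) (σ : SL(2, ℤ)) : ℂ :=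
  cuspCoeff k L h σ *
    hForm (F (.inr (bdry σ 1)) - F (.inr (bdry σ 0))) (harmPow k (uAt σ))

theorem cuspTerm_mul {k : ℕ} {L : AddSubgroup (Matrix (Fin 2) (Fin 2) ℚ)}
    {h : Matrix (Fin 2) (Fin 2) ℚ} {Γ : Subgroup SL(2, ℤ)}
    (hΓL : ∀ γ ∈ Γ, ∀ x : Matrix (Fin 2) (Fin 2) ℚ, x - h ∈ L → conjQ γ x - h ∈ L)
    {F : Dbar → Coeff k} (hF : IsIncrementEquivariant Γ F) :
    ∀ γ ∈ plusMinus Γ, ∀ σ, cuspTerm k L h F (γ * σ) = cuspTerm k L h F σ := by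
  intro γ hγ σ
  rw [cuspTerm, cuspTerm, cuspCoeff_mul k hΓL hγ, uAt_mul, ← rep_harmPow _ (trace_uAt σ)]
  exact congrArg _ (hF.hForm_smul_sub_smul hγ (.inr (bdry σ 1)) (.inr (bdry σ 0)) _)

theorem apply_circle {k : ℕ} (L : AddSubgroup (Matrix (Fin 2) (Fin 2) ℚ))
    (h : Matrix (Fin 2) (Fin 2) ℚ) (Γ : Subgroup SL(2, ℤ)) [Γ.FiniteIndex] {F : Dbar → Coeff k}
    {Λ : Homology k Γ →ₗ[ℂ] ℂ} (hΛ : IsPeriodMap Γ F Λ) (σ : SL(2, ℤ)) :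
    Λ ((cuspCoeff k L h σ : ℂ) • homClass (simplices Γ) (repSub k Γ)
      (circle Γ σ 0 (harmPow k (uAt σ)))) =
      ∑ i ∈ Finset.range (width Γ σ), cuspTerm k L h F (σ * ModularGroup.T ^ (i : ℤ)) := by
  have h0 : rep k (cuspGen Γ σ)⁻¹ (harmPow k (uAt σ)) = harmPow k (uAt σ) := by
    conv_lhs => rw [← rep_cuspGen_uAt Γ σ, rep_inv_rep]
  rw [map_smul, hΛ.apply_homClass (by rw [d1_pushforward_circle, h0, sub_self, map_zero]),
    period_circle, smul_eq_mul]
  have e : ∀ i : ℕ, cuspTerm k L h F (σ * ModularGroup.T ^ (i : ℤ)) = cuspCoeff k L h σ *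
      hForm (F (.inr (bdry σ ((i + 1 : ℕ) : ℝ))) - F (.inr (bdry σ (i : ℕ)))) (harmPow k (uAt σ)) := by
    intro i
    rw [cuspTerm, cuspCoeff_congr (uAt_mul_T_zpow σ i), uAt_mul_T_zpow, bdry_mul_T_zpow,
      bdry_mul_T_zpow]
    simp [add_comm]
  simp only [e]
  rw [← Finset.mul_sum, ← hForm_sum_left,
    Finset.sum_range_sub (fun i : ℕ => F (.inr (bdry σ (i : ℝ))))]
  simp

theorem mem_closure_T_neg_one {g : SL(2, ℤ)} (hg : g ∈ Subgroup.closure {ModularGroup.T, -1}) :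
    ∃ n : ℤ, g = ModularGroup.T ^ n ∨ g = -ModularGroup.T ^ n := by
  induction hg using Subgroup.closure_induction with
  | mem x hx =>
    rcases hx with rfl | rfl
    · exact ⟨1, by simp⟩
    · exact ⟨0, by simp⟩
  | one => exact ⟨0, by simp⟩
  | mul x y _ _ hx hy =>
    obtain ⟨m, hm⟩ := hx
    obtain ⟨n, hn⟩ := hy
    refine ⟨m + n, ?_⟩
    rw [_root_.zpow_add]
    rcases hm with rfl | rfl <;> rcases hn with rfl | rfl <;> simp
  | inv x _ hx =>
    obtain ⟨m, hm⟩ := hx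
    refine ⟨-m, ?_⟩
    rw [_root_.zpow_neg]
    rcases hm with rfl | rfl
    · exact .inl rfl
    · right
      rw [inv_eq_iff_mul_eq_one]
      simp

theorem cusps_mk_eq_iff {Γ : Subgroup SL(2, ℤ)} {a b : SL(2, ℤ)} :
    (DoubleCoset.mk Γ (Subgroup.closure {ModularGroup.T, -1}) a : Cusps Γ) =
        DoubleCoset.mk Γ (Subgroup.closure {ModularGroup.T, -1}) b ↔
      ∃ γ ∈ plusMinus Γ, ∃ n : ℤ, b = γ * a * ModularGroup.T ^ n := by
  rw [DoubleCoset.eq]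
  constructor
  · rintro ⟨γ, hγ, t, ht, rfl⟩
    obtain ⟨n, rfl | rfl⟩ := mem_closure_T_neg_one ht
    · exact ⟨γ, le_plusMinus Γ hγ, n, rfl⟩
    · exact ⟨-γ, mem_plusMinus.2 (.inr (by simpa using hγ)), n, by simp⟩
  · rintro ⟨γ, hγ, n, rfl⟩
    have hT : ModularGroup.T ^ n ∈ Subgroup.closure {ModularGroup.T, -1} :=
      zpow_mem (Subgroup.subset_closure (by simp)) n
    rcases mem_plusMinus.1 hγ with h | h
    · exact ⟨γ, h, _, hT, rfl⟩
    · refine ⟨-γ, h, -ModularGroup.T ^ n, ?_, by simp⟩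
      have : (-1 : SL(2, ℤ)) ∈ Subgroup.closure {ModularGroup.T, -1} :=
        Subgroup.subset_closure (by simp)
      simpa using mul_mem this hT

/-- A sum over the cosets of `± Γ` as a sum over cusps and over the translations modulo the width. -/
theorem cosetSum_eq_sum_cusps {Γ : Subgroup SL(2, ℤ)} [Γ.FiniteIndex] {f : SL(2, ℤ) → ℂ}
    (hf : ∀ γ ∈ plusMinus Γ, ∀ g, f (γ * g) = f g) :
    Finite (Cusps Γ) ∧ cosetSum (plusMinus Γ) f = ∑ᶠ q : Cusps Γ,
      ∑ i ∈ Finset.range (width Γ q.out), f (q.out * ModularGroup.T ^ (i : ℤ)) := by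
  classical
  have hfin : Finite (SL(2, ℤ) ⧸ plusMinus Γ) := inferInstance
  have : Finite (Quotient (QuotientGroup.rightRel (plusMinus Γ))) :=
    Finite.of_equiv _ (QuotientGroup.quotientRightRelEquivQuotientLeftRel _).symm
  have := Fintype.ofFinite (Quotient (QuotientGroup.rightRel (plusMinus Γ)))
  set mk : SL(2, ℤ) → Cusps Γ := fun g =>
    DoubleCoset.mk Γ (Subgroup.closure {ModularGroup.T, -1}) g with hmk
  have hout : ∀ c : Cusps Γ, mk c.out = c := fun c => Quotient.out_eq _
  have hrel : ∀ {a b : SL(2, ℤ)}, b * a⁻¹ ∈ plusMinus Γ →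
      (Quotient.mk (QuotientGroup.rightRel (plusMinus Γ)) a) = Quotient.mk _ b := fun h =>
    Quotient.sound (QuotientGroup.rightRel_apply.2 h)
  have hrel' : ∀ {a b : SL(2, ℤ)},
      (Quotient.mk (QuotientGroup.rightRel (plusMinus Γ)) a) = Quotient.mk _ b →
      b * a⁻¹ ∈ plusMinus Γ := fun h => QuotientGroup.rightRel_apply.1 (Quotient.exact h)
  let π : Quotient (QuotientGroup.rightRel (plusMinus Γ)) → Cusps Γ := fun q => mk q.out
  have hπ : ∀ g : SL(2, ℤ), π (Quotient.mk _ g) = mk g := by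
    intro g
    exact cusps_mk_eq_iff.2 ⟨g * (Quotient.mk (QuotientGroup.rightRel (plusMinus Γ)) g).out⁻¹,
      hrel' (Quotient.out_eq _), 0, by simp⟩
  have hsurj : Function.Surjective π := fun c => ⟨Quotient.mk _ c.out, by rw [hπ, hout]⟩
  have hC : Finite (Cusps Γ) := Finite.of_surjective π hsurj
  refine ⟨hC, ?_⟩
  have := Fintype.ofFinite (Cusps Γ)
  rw [cosetSum, finsum_eq_sum_of_fintype, finsum_eq_sum_of_fintype,
    ← Finset.sum_fiberwise Finset.univ π]
  refine Finset.sum_congr rfl fun c _ => Eq.symm ?_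
  refine Finset.sum_bij (fun i _ => Quotient.mk _ (c.out * ModularGroup.T ^ (i : ℤ))) ?_ ?_ ?_ ?_
  · intro i _
    rw [Finset.mem_filter]
    refine ⟨Finset.mem_univ _, ?_⟩
    rw [hπ]
    conv_rhs => rw [← hout c]
    exact (cusps_mk_eq_iff.2 ⟨1, one_mem _, i, by simp⟩).symm
  · intro i hi j hj hij
    have h1 := hrel' hij
    have h2 : c.out * ModularGroup.T ^ (j : ℤ) * (c.out * ModularGroup.T ^ (i : ℤ))⁻¹ =
        c.out * ModularGroup.T ^ ((j : ℤ) - i) * c.out⁻¹ := by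
      rw [_root_.zpow_sub]; group
    rw [h2, conj_T_zpow_mem_iff] at h1
    rw [Finset.mem_range] at hi hj
    have h3 := Int.eq_zero_of_abs_lt_dvd h1 (by rw [abs_lt]; omega)
    omega
  · intro q hq
    have hq' : mk q.out = mk c.out := by rw [hout]; exact (Finset.mem_filter.1 hq).2
    obtain ⟨γ, hγ, n, hn⟩ := cusps_mk_eq_iff.1 hq'.symm
    obtain ⟨h0, -⟩ := width_spec Γ c.out
    have hm : (0 : ℤ) < width Γ c.out := by omega
    refine ⟨(n % width Γ c.out).toNat, ?_, ?_⟩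
    · have := Int.emod_lt_of_pos n hm
      have := Int.emod_nonneg n hm.ne'
      rw [Finset.mem_range]
      omega
    · rw [← Quotient.out_eq q]
      refine hrel ?_
      rw [Int.toNat_of_nonneg (Int.emod_nonneg n hm.ne'), hn]
      have h2 : γ * c.out * ModularGroup.T ^ n * (c.out * ModularGroup.T ^ (n % width Γ c.out))⁻¹ =
          γ * (c.out * ModularGroup.T ^ (n - n % width Γ c.out) * c.out⁻¹) := by
        rw [_root_.zpow_sub]; group
      rw [h2]
      exact mul_mem hγ (conj_T_zpow_mem_iff.2 (Int.dvd_self_sub_emod))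
  · intro i _
    exact (apply_rightRel_out hf _).symm

theorem apply_specialClass_zero {k : ℕ} {L : AddSubgroup (Matrix (Fin 2) (Fin 2) ℚ)}
    {h : Matrix (Fin 2) (Fin 2) ℚ} {Γ : Subgroup SL(2, ℤ)} [Γ.FiniteIndex]
    (hΓL : ∀ γ ∈ Γ, ∀ x : Matrix (Fin 2) (Fin 2) ℚ, x - h ∈ L → conjQ γ x - h ∈ L)
    {F : Dbar → Coeff k} (hF : IsIncrementEquivariant Γ F)
    {Λ : Homology k Γ →ₗ[ℂ] ℂ} (hΛ : IsPeriodMap Γ F Λ) :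
    Λ (specialClass k L h Γ 0) = cosetSum (plusMinus Γ) (cuspTerm k L h F) := by
  obtain ⟨hfin, h1⟩ := cosetSum_eq_sum_cusps (cuspTerm_mul hΓL hF)
  rw [h1, specialClass, if_pos rfl]
  refine (AddMonoidHom.map_finsum Λ.toAddMonoidHom (Set.toFinite _)).trans ?_
  exact finsum_congr fun q => apply_circle L h Γ hΛ q.out

/-- Both periods are coset sums of the same `± Γ`-invariant function, which only depends on the
lattice and on `F`. -/
theorem apply_specialClass_zero_of_le {k : ℕ} {L : AddSubgroup (Matrix (Fin 2) (Fin 2) ℚ)}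
    {h : Matrix (Fin 2) (Fin 2) ℚ} {Γ Γ' : Subgroup SL(2, ℤ)} [Γ.FiniteIndex] [Γ'.FiniteIndex]
    (hle : Γ' ≤ Γ)
    (hΓL : ∀ γ ∈ Γ, ∀ x : Matrix (Fin 2) (Fin 2) ℚ, x - h ∈ L → conjQ γ x - h ∈ L)
    {F : Dbar → Coeff k} (hF : IsIncrementEquivariant Γ F)
    {Λ : Homology k Γ →ₗ[ℂ] ℂ} (hΛ : IsPeriodMap Γ F Λ)
    {Λ' : Homology k Γ' →ₗ[ℂ] ℂ} (hΛ' : IsPeriodMap Γ' F Λ') :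
    Λ' (specialClass k L h Γ' 0) =
      (plusMinus Γ').relIndex (plusMinus Γ) * Λ (specialClass k L h Γ 0) := by
  rw [apply_specialClass_zero hΓL hF hΛ,
    apply_specialClass_zero (fun γ hγ => hΓL γ (hle hγ)) (hF.mono hle) hΛ']
  exact cosetSum_of_le (plusMinus_mono hle) (cuspTerm_mul hΓL hF)

/-! ### Unipotent elements on harmonic tensors -/

theorem coe_nMat (x : ℝ) : ((nMat x : SL(2, ℝ)) : Matrix (Fin 2) (Fin 2) ℝ) = !![1, x; 0, 1] := rfl

theorem nMat_add (x y : ℝ) : nMat (x + y) = nMat x * nMat y := by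
  ext i j
  rw [Matrix.SpecialLinearGroup.coe_mul, coe_nMat, coe_nMat, coe_nMat]
  fin_cases i <;> fin_cases j <;> simp [Matrix.mul_apply, Fin.sum_univ_two, add_comm]

theorem nMat_zero : nMat 0 = 1 := by
  ext i j
  rw [coe_nMat, Matrix.SpecialLinearGroup.coe_one]
  fin_cases i <;> fin_cases j <;> simp

theorem nMat_neg (x : ℝ) : nMat (-x) = (nMat x)⁻¹ := by
  rw [eq_inv_iff_mul_eq_one, ← nMat_add, neg_add_cancel, nMat_zero]

theorem conj_nMat_apply (x : Matrix (Fin 2) (Fin 2) ℝ) (t : ℝ) :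
    conj (nMat t) x = !![x 0 0 + t * x 1 0, x 0 1 + t * (x 1 1 - x 0 0) - t ^ 2 * x 1 0;
      x 1 0, x 1 1 - t * x 1 0] := by
  rw [conj, coe_nMat_inv, coe_nMat]
  ext i j
  fin_cases i <;> fin_cases j <;>
    simp [Matrix.mul_apply, Matrix.vecMul, dotProduct, Fin.sum_univ_two] <;> ring

/-- The matrix coefficients of the unipotent group are polynomials. -/
theorem exists_polynomial_adMatrix_nMat (i j : Fin 3) :
    ∃ P : Polynomial ℂ, ∀ t : ℝ, adMatrix (nMat t) i j = P.eval (t : ℂ) := by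
  have key : ∀ x : Matrix (Fin 2) (Fin 2) ℝ,
      ∃ a b c : ℝ, ∀ t : ℝ, coord (conj (nMat t) x) i = a + b * t + c * t ^ 2 := by
    intro x
    fin_cases i
    · refine ⟨(x 0 1 + x 1 0) / √2, (x 1 1 - x 0 0) / √2, -x 1 0 / √2, fun t => ?_⟩
      simp [coord, conj_nMat_apply]; ring
    · refine ⟨(x 0 0 - x 1 1) / √2, 2 * x 1 0 / √2, 0, fun t => ?_⟩
      simp [coord, conj_nMat_apply]; ring
    · refine ⟨(x 0 1 - x 1 0) / √2, (x 1 1 - x 0 0) / √2, -x 1 0 / √2, fun t => ?_⟩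
      simp [coord, conj_nMat_apply]; ring
  obtain ⟨a, b, c, h⟩ := key (basisMat j)
  refine ⟨Polynomial.C (a : ℂ) + Polynomial.C (b : ℂ) * Polynomial.X +
    Polynomial.C (c : ℂ) * Polynomial.X ^ 2, fun t => ?_⟩
  rw [adMatrix, Matrix.of_apply, h]
  simp

theorem exists_polynomial_harmRep_nMat {k : ℕ} (v : Coeff k) (β : Fin k → Fin 3) :
    ∃ P : Polynomial ℂ, ∀ t : ℝ, incl k (harmRep k (nMat t) v) β = P.eval (t : ℂ) := by
  choose P hP using exists_polynomial_adMatrix_nMat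
  refine ⟨∑ α : Fin k → Fin 3, (∏ i, P (β i) (α i)) * Polynomial.C (incl k v α), fun t => ?_⟩
  rw [incl_harmRep, tensorAct_apply, Polynomial.eval_finsetSum]
  simp [hP, Polynomial.eval_prod]

/-- A vector fixed by one nontrivial unipotent translation is fixed by all of them. -/
theorem harmRep_nMat_eq_self {k : ℕ} {v : Coeff k} {t₀ : ℝ} (ht₀ : t₀ ≠ 0)
    (hv : harmRep k (nMat t₀) v = v) (t : ℝ) : harmRep k (nMat t) v = v := by
  have hm : ∀ m : ℕ, harmRep k (nMat (m * t₀)) v = v := by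
    intro m
    induction m with
    | zero => simp [nMat_zero]
    | succ m ih =>
      rw [Nat.cast_succ, add_mul, one_mul, nMat_add, map_mul, Module.End.mul_apply, hv, ih]
  refine incl_injective k (funext fun β => ?_)
  obtain ⟨P, hP⟩ := exists_polynomial_harmRep_nMat v β
  have h0 : P - Polynomial.C (incl k v β) = 0 := by
    refine Polynomial.eq_zero_of_infinite_isRoot _ (Set.Infinite.mono ?_ (Set.infinite_range_of_injective
      (f := fun m : ℕ => ((m * t₀ : ℝ) : ℂ)) fun m n h => ?_))
    · rintro _ ⟨m, rfl⟩
      simp only [Set.mem_ofPred_eq, Polynomial.IsRoot.def, Polynomial.eval_sub, Polynomial.eval_C]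
      rw [← hP, hm, sub_self]
    · have h' := Complex.ofReal_injective h
      exact_mod_cast mul_right_cancel₀ ht₀ h'
  rw [hP, sub_eq_zero.1 h0, Polynomial.eval_C]

/-! ### Harmonic tensors are determined by their values on the null cone -/

/-- A sum over pairs of equal indices vanishes on traceless tensors. -/
theorem sum_trace_mul {k : ℕ} {T : Tensor k} (hT : T ∈ Harm k) {i j : Fin k} (hij : i ≠ j)
    (R : (Fin k → Fin 3) → ℂ)
    (hR : ∀ α p q, R (Function.update (Function.update α i p) j q) = R α) :
    ∑ α : Fin k → Fin 3, (if α i = α j then eps (α i) else 0) * (R α * T α) = 0 := by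
  have h9 : (3 : ℂ) * (3 * ∑ α : Fin k → Fin 3,
      (if α i = α j then eps (α i) else 0) * (R α * T α)) = 0 := by
    rw [← sum_update j, ← sum_update i]
    refine Finset.sum_eq_zero fun α _ => ?_
    simp only [hR, Function.update_self, Function.update_of_ne hij, ite_mul, zero_mul,
      Finset.sum_ite_eq, Finset.mem_univ, if_true]
    calc _ = R α * ∑ a, eps a * T (Function.update (Function.update α i a) j a) := by
          rw [Finset.mul_sum]; exact Finset.sum_congr rfl fun a _ => by ring
      _ = 0 := by rw [hT.2 i j hij α, mul_zero]
  simpa using h9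

/-- The null basis `u'`, `-h`, `u` of the quadratic space; the null vectors
`n(t) u' n(-t) = u' - t h + t² u` span the null cone. -/
def nullBasis : Fin 3 → Matrix (Fin 2) (Fin 2) ℝ := ![uMat', !![-1, 0; 0, 1], uMat]

/-- The functional on `V` dual to a vector of the null basis. -/
def nullCoeff (b a : Fin 3) : ℂ := eps a * (coord (nullBasis b) a : ℝ)

/-- The components of a tensor with respect to the null basis. -/
def nullComp {k : ℕ} (T : Tensor k) (β : Fin k → Fin 3) : ℂ :=
  ∑ α : Fin k → Fin 3, (∏ i, nullCoeff (β i) (α i)) * T α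

theorem conj_nMat_uMat' (t : ℝ) : conj (nMat t) uMat' = ∑ b : Fin 3, t ^ (b : ℕ) • nullBasis b := by
  rw [conj_nMat_apply, Fin.sum_univ_three]
  ext i j
  fin_cases i <;> fin_cases j <;> simp [nullBasis, uMat', uMat]

theorem tForm_purePow_conj_nMat {k : ℕ} (T : Tensor k) (t : ℝ) :
    tForm k (purePow k (conj (nMat t) uMat')) T =
      ∑ β : Fin k → Fin 3, (t : ℂ) ^ (∑ i, (β i : ℕ)) * nullComp T β := by
  have e : ∀ a, eps a * ((coord (conj (nMat t) uMat') a : ℝ) : ℂ) =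
      ∑ b : Fin 3, (t : ℂ) ^ (b : ℕ) * nullCoeff b a := by
    intro a
    rw [conj_nMat_uMat', coord_linear]
    push_cast
    rw [Finset.mul_sum]
    exact Finset.sum_congr rfl fun b _ => by rw [nullCoeff]; ring
  rw [tForm_apply]
  simp only [purePow, ← Finset.prod_mul_distrib, e, Finset.prod_univ_sum, Fintype.piFinset_univ,
    Finset.sum_mul, nullComp, Finset.mul_sum]
  rw [Finset.sum_comm]
  refine Finset.sum_congr rfl fun β _ => Finset.sum_congr rfl fun α _ => ?_
  rw [Finset.prod_mul_distrib, Finset.prod_pow_eq_pow_sum]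
  ring

theorem nullComp_comp_perm {k : ℕ} {T : Tensor k} (hT : T ∈ Harm k) (s : Equiv.Perm (Fin k))
    (β : Fin k → Fin 3) : nullComp T (β ∘ s) = nullComp T β := by
  refine Fintype.sum_equiv (Equiv.arrowCongr s (Equiv.refl (Fin 3))) _ _ fun α => ?_
  have e1 : (Equiv.arrowCongr s (Equiv.refl (Fin 3))) α = α ∘ s.symm := rfl
  rw [e1, hT.1 s.symm α, ← Equiv.prod_comp s (fun l => nullCoeff (β l) ((α ∘ s.symm) l))]
  simp

theorem nullComp_swap {k : ℕ} {T : Tensor k} (hT : T ∈ Harm k) {i j : Fin k} (hij : i ≠ j)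
    (β : Fin k → Fin 3) (a b : Fin 3) :
    nullComp T (Function.update (Function.update β i a) j b) =
      nullComp T (Function.update (Function.update β i b) j a) := by
  rw [← nullComp_comp_perm hT (Equiv.swap i j)]
  congr 1
  ext l
  by_cases h1 : l = i
  · subst h1; simp [Function.update_of_ne hij]
  · by_cases h2 : l = j
    · subst h2; simp [Function.update_of_ne hij]
    · simp [Equiv.swap_apply_of_ne_of_ne h1 h2, h1, h2]

/-- The trace condition in the null basis: `T(h, h, …) = 4 T(u', u, …)`. -/
theorem nullComp_one_one {k : ℕ} {T : Tensor k} (hT : T ∈ Harm k) {i j : Fin k} (hij : i ≠ j)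
    (β : Fin k → Fin 3) : nullComp T (Function.update (Function.update β i 1) j 1) =
      4 * nullComp T (Function.update (Function.update β i 0) j 2) := by
  set R : (Fin k → Fin 3) → ℂ :=
    fun α => ∏ l ∈ (Finset.univ.erase j).erase i, nullCoeff (β l) (α l) with hR
  have hsplit : ∀ a b, nullComp T (Function.update (Function.update β i a) j b) =
      ∑ α, nullCoeff a (α i) * nullCoeff b (α j) * (R α * T α) := by
    intro a b
    refine Finset.sum_congr rfl fun α _ => ?_
    rw [← Finset.mul_prod_erase _ _ (Finset.mem_univ j),
      ← Finset.mul_prod_erase (Finset.univ.erase j) _ (Finset.mem_erase.2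
        ⟨hij, Finset.mem_univ i⟩)]
    have : (∏ l ∈ (Finset.univ.erase j).erase i,
        nullCoeff (Function.update (Function.update β i a) j b l) (α l)) = R α := by
      refine Finset.prod_congr rfl fun l hl => ?_
      have h1 : l ≠ i := Finset.ne_of_mem_erase hl
      have h2 : l ≠ j := Finset.ne_of_mem_erase (Finset.mem_of_mem_erase hl)
      rw [Function.update_of_ne h2, Function.update_of_ne h1]
    rw [this]
    simp only [Function.update_self, Function.update_of_ne hij]
    ring
  have hRupd : ∀ α p q, R (Function.update (Function.update α i p) j q) = R α := by
    intro α p q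
    refine Finset.prod_congr rfl fun l hl => ?_
    have h1 : l ≠ i := Finset.ne_of_mem_erase hl
    have h2 : l ≠ j := Finset.ne_of_mem_erase (Finset.mem_of_mem_erase hl)
    rw [Function.update_of_ne h2, Function.update_of_ne h1]
  have hswap := nullComp_swap hT hij β 2 0
  have hcas : ∀ a b, nullCoeff 1 a * nullCoeff 1 b = 2 * (nullCoeff 0 a * nullCoeff 2 b) +
      2 * (nullCoeff 2 a * nullCoeff 0 b) + 2 * (if a = b then eps a else 0) := by
    have h2 : ((√2 : ℝ) : ℂ) * ((√2 : ℝ) : ℂ) = 2 := by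
      rw [← Complex.ofReal_mul]; norm_num
    have h0 : ((√2 : ℝ) : ℂ) ≠ 0 := by
      rw [Complex.ofReal_ne_zero]; positivity
    intro a b
    fin_cases a <;> fin_cases b <;>
      simp [nullCoeff, eps, coord, nullBasis, uMat, uMat'] <;> field_simp <;>
      first | ring1 | linear_combination 2 * h2 | linear_combination -2 * h2
  have h0 := sum_trace_mul hT hij R hRupd
  have h4 : nullComp T (Function.update (Function.update β i 1) j 1) =
      2 * nullComp T (Function.update (Function.update β i 0) j 2) +
      2 * nullComp T (Function.update (Function.update β i 2) j 0) +
      2 * ∑ α : Fin k → Fin 3, (if α i = α j then eps (α i) else 0) * (R α * T α) := by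
    rw [hsplit, hsplit, hsplit, Finset.mul_sum, Finset.mul_sum, Finset.mul_sum,
      ← Finset.sum_add_distrib, ← Finset.sum_add_distrib]
    refine Finset.sum_congr rfl fun α _ => ?_
    rw [hcas]
    ring
  rw [h4, h0, hswap]
  ring

/-- The factor by which a null component of a harmonic tensor differs from a function of its
weight. -/
def nullFactor : Fin 3 → ℂ := ![1, 2, 1]

theorem nullFactor_ne_zero (a : Fin 3) : nullFactor a ≠ 0 := by
  fin_cases a <;> simp [nullFactor]

/-- Moving weight from one index to another. -/
theorem nullComp_move {k : ℕ} {T : Tensor k} (hT : T ∈ Harm k) {i j : Fin k} (hij : i ≠ j)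
    (β : Fin k → Fin 3) {a b a' b' : Fin 3} (ha : (a' : ℕ) = a + 1) (hb : (b : ℕ) = b' + 1) :
    nullComp T (Function.update (Function.update β i a) j b) * (nullFactor a' * nullFactor b') =
      nullComp T (Function.update (Function.update β i a') j b') *
        (nullFactor a * nullFactor b) := by
  have h11 := nullComp_one_one hT hij β
  have hs := nullComp_swap hT hij β
  fin_cases a <;> fin_cases a' <;> simp at ha <;> fin_cases b <;> fin_cases b' <;> simp at hb
  · simp [nullFactor]; exact hs 0 1
  · simp [nullFactor, h11]; ring
  · simp [nullFactor, h11, hs 2 0]; ring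
  · simp [nullFactor]; exact hs 1 2

/-- The null components of a harmonic tensor depend only on the weight, up to known factors. -/
theorem nullComp_mul_prod {k : ℕ} {T : Tensor k} (hT : T ∈ Harm k) (β' : Fin k → Fin 3) (d : ℕ) :
    ∀ β : Fin k → Fin 3, ∑ i, ((β i : ℕ) - β' i) = d → ∑ i, (β i : ℕ) = ∑ i, (β' i : ℕ) →
      nullComp T β * ∏ i, nullFactor (β' i) = nullComp T β' * ∏ i, nullFactor (β i) := by
  induction d using Nat.strong_induction_on with
  | _ d ih =>
  intro β hd hw
  by_cases hle : ∀ i, (β i : ℕ) ≤ β' i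
  · have : β = β' := funext fun i => Fin.ext
      ((Finset.sum_eq_sum_iff_of_le fun i _ => hle i).1 hw i (Finset.mem_univ i))
    rw [this]
  · push Not at hle
    obtain ⟨j, hj⟩ := hle
    obtain ⟨i, hi⟩ : ∃ i, (β i : ℕ) < β' i := by
      by_contra! hge
      exact absurd hw (Finset.sum_lt_sum (fun i _ => hge i) ⟨j, Finset.mem_univ j, hj⟩).ne'
    have hij : i ≠ j := by rintro rfl; omega
    set a' : Fin 3 := ⟨β i + 1, by omega⟩ with ha'
    set b' : Fin 3 := ⟨β j - 1, by omega⟩ with hb'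
    set β₂ := Function.update (Function.update β i a') j b' with hβ₂
    have h2i : β₂ i = a' := by rw [hβ₂, Function.update_of_ne hij, Function.update_self]
    have h2j : β₂ j = b' := by rw [hβ₂, Function.update_self]
    have h2l : ∀ l, l ≠ i → l ≠ j → β₂ l = β l := fun l h1 h2 => by
      rw [hβ₂, Function.update_of_ne h2, Function.update_of_ne h1]
    have hupd : Function.update (Function.update β i (β i)) j (β j) = β := by simp
    have hmove := nullComp_move hT hij β (a := β i) (b := β j) (a' := a') (b' := b') rfl
      (by simp only [hb']; omega)
    rw [hupd] at hmove
    have hsplit : ∀ γ : Fin k → Fin 3, ∏ l, nullFactor (γ l) = nullFactor (γ i) * nullFactor (γ j) *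
        ∏ l ∈ (Finset.univ.erase j).erase i, nullFactor (γ l) := by
      intro γ
      rw [← Finset.mul_prod_erase _ _ (Finset.mem_univ j),
        ← Finset.mul_prod_erase (Finset.univ.erase j) _ (Finset.mem_erase.2
          ⟨hij, Finset.mem_univ i⟩)]
      ring
    have hsplit' : ∀ γ : Fin k → Fin 3, ∑ l, (γ l : ℕ) = γ i + γ j +
        ∑ l ∈ (Finset.univ.erase j).erase i, (γ l : ℕ) := by
      intro γ
      rw [← Finset.add_sum_erase _ _ (Finset.mem_univ j),
        ← Finset.add_sum_erase (Finset.univ.erase j) _ (Finset.mem_erase.2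
          ⟨hij, Finset.mem_univ i⟩)]
      ring
    have hrest : ∀ l ∈ (Finset.univ.erase j).erase i, β₂ l = β l := fun l hl =>
      h2l l (Finset.ne_of_mem_erase hl) (Finset.ne_of_mem_erase (Finset.mem_of_mem_erase hl))
    have hprod : nullComp T β * ∏ l, nullFactor (β₂ l) = nullComp T β₂ * ∏ l, nullFactor (β l) := by
      rw [hsplit β₂, hsplit β, h2i, h2j, Finset.prod_congr rfl fun l hl => by rw [hrest l hl],
        ← mul_assoc, hmove]
      ring
    have hw₂ : ∑ l, (β₂ l : ℕ) = ∑ l, (β' l : ℕ) := by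
      rw [← hw, hsplit' β₂, hsplit' β, h2i, h2j, Finset.sum_congr rfl fun l hl => by rw [hrest l hl],
        ha', hb']
      simp only
      omega
    have hd₂ : ∑ l, ((β₂ l : ℕ) - β' l) < d := by
      rw [← hd]
      refine Finset.sum_lt_sum (fun l _ => ?_) ⟨j, Finset.mem_univ j, ?_⟩
      · by_cases h1 : l = i
        · subst h1; rw [h2i, ha']; simp only; omega
        · by_cases h2 : l = j
          · subst h2; rw [h2j, hb']; simp only; omega
          · rw [h2l l h1 h2]
      · rw [h2j, hb']; simp only; omega
    have hih := ih _ hd₂ β₂ rfl hw₂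
    refine mul_right_cancel₀ (Finset.prod_ne_zero_iff.2 fun l _ => nullFactor_ne_zero (β₂ l) :
      ∏ l, nullFactor (β₂ l) ≠ 0) ?_
    calc _ = (nullComp T β * ∏ l, nullFactor (β₂ l)) * ∏ i, nullFactor (β' i) := by ring
      _ = (nullComp T β₂ * ∏ i, nullFactor (β' i)) * ∏ l, nullFactor (β l) := by rw [hprod]; ring
      _ = _ := by rw [hih]; ring

theorem eq_zero_of_nullComp {k : ℕ} {T : Tensor k} (h : ∀ β, nullComp T β = 0) : T = 0 := by
  obtain ⟨B, hB⟩ : ∃ B : Fin 3 → Fin 3 → ℂ, ∀ a c, ∑ b, B a b * nullCoeff b c =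
      if a = c then 1 else 0 := by
    have h2 : ((√2 : ℝ) : ℂ) * ((√2 : ℝ) : ℂ) = 2 := by
      rw [← Complex.ofReal_mul]; norm_num
    have h0 : ((√2 : ℝ) : ℂ) ≠ 0 := by
      rw [Complex.ofReal_ne_zero]; positivity
    refine ⟨![![-1 / √2, 0, 1 / √2], ![0, -1 / √2, 0], ![-1 / √2, 0, -1 / √2]], fun a c => ?_⟩
    fin_cases a <;> fin_cases c <;>
      simp [Fin.sum_univ_three, nullCoeff, eps, coord, nullBasis, uMat, uMat'] <;> field_simp <;>
      first | ring1 | linear_combination h2 | linear_combination -h2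
  ext γ
  have h1 : ∑ β : Fin k → Fin 3, (∏ i, B (γ i) (β i)) * nullComp T β = T γ := by
    simp only [nullComp, Finset.mul_sum]
    rw [Finset.sum_comm]
    have : ∀ α : Fin k → Fin 3, ∑ β : Fin k → Fin 3,
        (∏ i, B (γ i) (β i)) * ((∏ i, nullCoeff (β i) (α i)) * T α) =
        (if γ = α then 1 else 0) * T α := by
      intro α
      have e : ∏ i, ∑ b, B (γ i) b * nullCoeff b (α i) = if γ = α then 1 else 0 := by
        simp only [hB, Finset.prod_ite_zero, Finset.prod_const_one, Finset.mem_univ, true_implies,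
          funext_iff]
      rw [← e, Finset.prod_univ_sum, Fintype.piFinset_univ, Finset.sum_mul]
      exact Finset.sum_congr rfl fun β _ => by rw [Finset.prod_mul_distrib, mul_assoc]
    simp [this]
  rw [← h1]
  simp [h]

/-- A harmonic tensor that is orthogonal to the powers of all null vectors vanishes. -/
theorem eq_zero_of_hForm_null {k : ℕ} {v : Coeff k}
    (h : ∀ t : ℝ, hForm (harmPow k (conj (nMat t) uMat')) v = 0) : v = 0 := by
  have hT := incl_mem v
  refine incl_injective k (Eq.trans (eq_zero_of_nullComp fun β => ?_) (map_zero _).symm)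
  set P : Polynomial ℂ := ∑ β : Fin k → Fin 3,
    Polynomial.monomial (∑ i, (β i : ℕ)) (nullComp (incl k v) β) with hP
  have hP0 : P = 0 := by
    refine Polynomial.eq_zero_of_infinite_isRoot _ (Set.Infinite.mono ?_
      (Set.infinite_range_of_injective Complex.ofReal_injective))
    rintro _ ⟨t, rfl⟩
    simp only [Set.mem_ofPred_eq, Polynomial.IsRoot.def]
    rw [hP, Polynomial.eval_finsetSum, ← h t, harmPow, hForm_harmProj_left,
      tForm_purePow_conj_nMat]
    exact Finset.sum_congr rfl fun β _ => by rw [Polynomial.eval_monomial, mul_comm]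
  have hcoeff := congrArg (fun Q => Polynomial.coeff Q (∑ i, (β i : ℕ))) hP0
  simp only [hP, Polynomial.finsetSum_coeff, Polynomial.coeff_monomial, Polynomial.coeff_zero]
    at hcoeff
  set c := nullComp (incl k v) β * (∏ i, nullFactor (β i))⁻¹ with hc
  have hne : ∀ α : Fin k → Fin 3, ∏ i, nullFactor (α i) ≠ 0 := fun α =>
    Finset.prod_ne_zero_iff.2 fun i _ => nullFactor_ne_zero _
  have hterm : ∀ α : Fin k → Fin 3, (if ∑ i, (α i : ℕ) = ∑ i, (β i : ℕ) then
      nullComp (incl k v) α else 0) = c * (((if ∑ i, (α i : ℕ) = ∑ i, (β i : ℕ) then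
        ∏ i, (![1, 2, 1] : Fin 3 → ℝ) (α i) else 0 : ℝ)) : ℂ) := by
    intro α
    have e : (((∏ i, (![1, 2, 1] : Fin 3 → ℝ) (α i) : ℝ)) : ℂ) = ∏ i, nullFactor (α i) := by
      push_cast
      refine Finset.prod_congr rfl fun i _ => ?_
      generalize α i = a
      fin_cases a <;> simp [nullFactor]
    split_ifs with hα
    · rw [e, hc]
      have := nullComp_mul_prod hT β _ α rfl hα
      field_simp [hne β]
      exact this
    · simp
  rw [Finset.sum_congr rfl fun α _ => hterm α, ← Finset.mul_sum, ← Complex.ofReal_sum] at hcoeff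
  have hpos : 0 < ∑ α : Fin k → Fin 3, (if ∑ i, (α i : ℕ) = ∑ i, (β i : ℕ) then
        ∏ i, (![1, 2, 1] : Fin 3 → ℝ) (α i) else 0) := by
    have hp : ∀ α : Fin k → Fin 3, 0 < ∏ i, (![1, 2, 1] : Fin 3 → ℝ) (α i) := fun α =>
      Finset.prod_pos fun i _ => by
        generalize α i = a
        fin_cases a <;> simp
    refine Finset.sum_pos' (fun α _ => ?_) ⟨β, Finset.mem_univ β, ?_⟩
    · split_ifs
      · exact (hp α).le
      · exact le_rfl
    · rw [if_pos rfl]; exact hp β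
  rcases mul_eq_zero.1 hcoeff with h1 | h1
  · rw [hc] at h1
    rcases mul_eq_zero.1 h1 with h2 | h2
    · exact h2
    · exact absurd h2 (inv_ne_zero (hne β))
  · exact absurd (Complex.ofReal_eq_zero.1 h1) hpos.ne'

theorem trace_uMat' : uMat'.trace = 0 := by simp [uMat', Matrix.trace_fin_two]

/-- A highest weight vector that is orthogonal to the lowest weight vector vanishes. -/
theorem eq_zero_of_fixed_of_hForm {k : ℕ} {v : Coeff k} {t₀ : ℝ} (ht₀ : t₀ ≠ 0)
    (hv : harmRep k (nMat t₀) v = v) (h : hForm (harmPow k uMat') v = 0) : v = 0 := by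
  refine eq_zero_of_hForm_null fun t => ?_
  conv_lhs => rw [← harmRep_nMat_eq_self ht₀ hv t]
  rw [harmPow_conj _ trace_uMat', hForm_harmRep, h]

/-! ### Powers of a deck transformation -/

/-- The operator `∑ g⁻ⁱ`, `0 ≤ i < d`, that turns the coefficient of a path from `p` to `g ^ d p`
into a coefficient of a path from `p` to `g p`. -/
def unroll (k : ℕ) (g : SL(2, ℤ)) (d : ℕ) : Coeff k →ₗ[ℂ] Coeff k :=
  ∑ i ∈ Finset.range d, rep k (g ^ i)⁻¹

theorem unroll_apply {k : ℕ} (g : SL(2, ℤ)) (d : ℕ) (w : Coeff k) :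
    unroll k g d w = ∑ i ∈ Finset.range d, rep k (g ^ i)⁻¹ w := by
  rw [unroll, LinearMap.sum_apply]

theorem rep_inv_unroll_sub {k : ℕ} (g : SL(2, ℤ)) (d : ℕ) (w : Coeff k) :
    rep k g⁻¹ (unroll k g d w) - unroll k g d w = rep k (g ^ d)⁻¹ w - w := by
  rw [unroll_apply, map_sum, ← Finset.sum_sub_distrib]
  have := Finset.sum_range_sub (fun i => rep k (g ^ i)⁻¹ w) d
  rw [pow_zero, inv_one, rep_one_apply] at this
  rw [← this]
  refine Finset.sum_congr rfl fun i _ => ?_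
  rw [pow_succ, _root_.mul_inv_rev, map_mul, Module.End.mul_apply]

theorem unroll_of_fixed {k : ℕ} {g : SL(2, ℤ)} (d : ℕ) {w : Coeff k}
    (h : ∀ i : ℕ, rep k (g ^ i)⁻¹ w = w) : unroll k g d w = (d : ℂ) • w := by
  rw [unroll_apply, Finset.sum_congr rfl fun i _ => h i, Finset.sum_const, Finset.card_range,
    Nat.cast_smul_eq_nsmul]

theorem IsIncrementEquivariant.hForm_pow {k : ℕ} {Γ : Subgroup SL(2, ℤ)} {F : Dbar → Coeff k}
    (hF : IsIncrementEquivariant Γ F) {g : SL(2, ℤ)} (hg : g ∈ plusMinus Γ) (d : ℕ) (p : Dbar)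
    (w : Coeff k) : hForm (F (g ^ d • p) - F p) w = hForm (F (g • p) - F p) (unroll k g d w) := by
  have h1 := Finset.sum_range_sub (fun i => F (g ^ i • p)) d
  simp only [pow_zero, one_smul] at h1
  rw [← h1, hForm_sum_left, unroll_apply, hForm_sum_right]
  refine Finset.sum_congr rfl fun i _ => ?_
  have h2 := hF.hForm_smul_sub_smul (pow_mem hg i) (g • p) p (rep k (g ^ i)⁻¹ w)
  rwa [rep_rep_inv, ← mul_smul, ← pow_succ] at h2

/-! ### Caps -/

theorem hForm_harmRep_mul_nMat {k : ℕ} (σ : SL(2, ℤ)) (t : ℝ) (w : Coeff k) :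
    hForm (harmRep k (toReal σ * nMat t) (harmPow k uMat')) w =
      ∑ β : Fin k → Fin 3, (t : ℂ) ^ (∑ i, (β i : ℕ)) * nullComp (incl k (rep k σ⁻¹ w)) β := by
  rw [map_mul, Module.End.mul_apply, ← tForm_purePow_conj_nMat, ← hForm_harmProj_left]
  change hForm (rep k σ _) w = hForm (harmPow k _) _
  rw [hForm_rep_left, harmPow_conj _ trace_uMat']

theorem continuous_hForm_nMat {k : ℕ} (σ : SL(2, ℤ)) (w : Coeff k) :
    Continuous fun t : ℝ => hForm (harmRep k (toReal σ * nMat t) (harmPow k uMat')) w := by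
  simp only [hForm_harmRep_mul_nMat]
  fun_prop

theorem rep_conj_T_zpow {k : ℕ} (σ : SL(2, ℤ)) (n : ℤ) (w : Coeff k) :
    rep k (σ * ModularGroup.T ^ n * σ⁻¹) w = rep k σ (harmRep k (nMat n) (rep k σ⁻¹ w)) := by
  rw [map_mul, map_mul, Module.End.mul_apply, Module.End.mul_apply, ← toReal_T_zpow]
  rfl

/-- A vector fixed by one nontrivial power of a parabolic element is fixed by all powers. -/
theorem rep_conj_T_zpow_eq_self {k : ℕ} {σ : SL(2, ℤ)} {n : ℤ} (hn : n ≠ 0) {w : Coeff k}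
    (hw : rep k (σ * ModularGroup.T ^ n * σ⁻¹) w = w) :
    (∀ t : ℝ, harmRep k (nMat t) (rep k σ⁻¹ w) = rep k σ⁻¹ w) ∧
      ∀ m : ℤ, rep k (σ * ModularGroup.T ^ m * σ⁻¹) w = w := by
  have h1 : harmRep k (nMat n) (rep k σ⁻¹ w) = rep k σ⁻¹ w := by
    rw [rep_conj_T_zpow] at hw
    conv_rhs => rw [← hw, rep_inv_rep]
  have h2 := harmRep_nMat_eq_self (Int.cast_ne_zero.2 hn) h1
  exact ⟨h2, fun m => by rw [rep_conj_T_zpow, h2, rep_rep_inv]⟩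

theorem cuspGen_inv (Γ : Subgroup SL(2, ℤ)) (σ : SL(2, ℤ)) :
    (cuspGen Γ σ)⁻¹ = σ * ModularGroup.T ^ (-(width Γ σ : ℤ)) * σ⁻¹ := by
  have := cuspGen_zpow Γ σ (-1)
  rwa [_root_.zpow_neg_one, mul_neg_one] at this

/-- The cap vector is unique: a difference of two cap vectors is a highest weight vector at the
cusp, orthogonal to the lowest weight vector. -/
theorem IsCap.unique {k : ℕ} {Γ : Subgroup SL(2, ℤ)} [Γ.FiniteIndex] {σ : SL(2, ℤ)} {r : ℝ}
    {v w₁ w₂ : Coeff k} (h₁ : IsCap Γ σ r v w₁) (h₂ : IsCap Γ σ r v w₂) : w₁ = w₂ := by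
  obtain ⟨hm, -⟩ := width_spec Γ σ
  have hfix : rep k (cuspGen Γ σ)⁻¹ (w₁ - w₂) = w₁ - w₂ := by
    have := h₁.1.trans h₂.1.symm
    rw [map_sub, sub_eq_sub_iff_sub_eq_sub]
    exact this
  rw [cuspGen_inv] at hfix
  obtain ⟨h3, -⟩ := rep_conj_T_zpow_eq_self (by omega) hfix
  have hint : ∫ t in r..(r + width Γ σ),
      hForm (harmRep k (toReal σ * nMat t) (harmPow k uMat')) (w₁ - w₂) = 0 := by
    simp only [hForm_sub_right]
    rw [intervalIntegral.integral_sub ((continuous_hForm_nMat σ w₁).intervalIntegrable _ _)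
      ((continuous_hForm_nMat σ w₂).intervalIntegrable _ _), h₁.2, h₂.2, sub_zero]
  have hconst : ∀ t : ℝ, hForm (harmRep k (toReal σ * nMat t) (harmPow k uMat')) (w₁ - w₂) =
      hForm (harmPow k uMat') (rep k σ⁻¹ (w₁ - w₂)) := by
    intro t
    rw [map_mul, Module.End.mul_apply]
    refine (hForm_rep_left σ _ _).trans ?_
    conv_lhs => rw [← h3 t, hForm_harmRep]
  have h0 : hForm (harmPow k uMat') (rep k σ⁻¹ (w₁ - w₂)) = 0 := by
    simp only [hconst, intervalIntegral.integral_const, add_sub_cancel_left] at hint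
    rcases smul_eq_zero.1 hint with h | h
    · exact absurd h (by positivity)
    · exact h
  have h4 := eq_zero_of_fixed_of_hForm one_ne_zero (h3 1) h0
  rw [← sub_eq_zero, ← rep_rep_inv σ (w₁ - w₂), h4, map_zero]

theorem width_mul {Γ : Subgroup SL(2, ℤ)} {δ : SL(2, ℤ)} (hδ : δ ∈ plusMinus Γ) (σ : SL(2, ℤ)) :
    width Γ (δ * σ) = width Γ σ := by
  have : ∀ m : ℕ, δ * σ * ModularGroup.T ^ m * (δ * σ)⁻¹ ∈ plusMinus Γ ↔
      σ * ModularGroup.T ^ m * σ⁻¹ ∈ plusMinus Γ := by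
    intro m
    have e : δ * σ * ModularGroup.T ^ m * (δ * σ)⁻¹ =
        δ * (σ * ModularGroup.T ^ m * σ⁻¹) * δ⁻¹ := by group
    rw [e, Subgroup.mul_mem_cancel_right _ (inv_mem hδ), Subgroup.mul_mem_cancel_left _ hδ]
  simp only [width, this]

theorem cuspGen_mul {Γ : Subgroup SL(2, ℤ)} {δ : SL(2, ℤ)} (hδ : δ ∈ plusMinus Γ) (σ : SL(2, ℤ)) :
    cuspGen Γ (δ * σ) = δ * cuspGen Γ σ * δ⁻¹ := by
  rw [cuspGen, cuspGen, width_mul hδ]; group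

theorem IsCap.smul {k : ℕ} {Γ : Subgroup SL(2, ℤ)} {σ : SL(2, ℤ)} {r : ℝ}
    {v w : Coeff k} (h : IsCap Γ σ r v w) {δ : SL(2, ℤ)} (hδ : δ ∈ plusMinus Γ) :
    IsCap Γ (δ * σ) r (rep k δ v) (rep k δ w) := by
  refine ⟨?_, ?_⟩
  · rw [cuspGen_mul hδ, ← h.1, map_sub, show (δ * cuspGen Γ σ * δ⁻¹)⁻¹ =
      δ * (cuspGen Γ σ)⁻¹ * δ⁻¹ by group, map_mul, map_mul, Module.End.mul_apply,
      Module.End.mul_apply, rep_inv_rep]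
  · have : ∀ t : ℝ, hForm (harmRep k (toReal (δ * σ) * nMat t) (harmPow k uMat')) (rep k δ w) =
        hForm (harmRep k (toReal σ * nMat t) (harmPow k uMat')) w := by
      intro t
      rw [map_mul toReal, mul_assoc, map_mul (harmRep k), Module.End.mul_apply]
      exact hForm_rep δ _ _
    simp only [this, width_mul hδ]
    exact h.2

theorem width_mul_T_zpow {Γ : Subgroup SL(2, ℤ)} (σ : SL(2, ℤ)) (j : ℤ) :
    width Γ (σ * ModularGroup.T ^ j) = width Γ σ := by
  have : ∀ m : ℕ, σ * ModularGroup.T ^ j * ModularGroup.T ^ m * (σ * ModularGroup.T ^ j)⁻¹ =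
      σ * ModularGroup.T ^ m * σ⁻¹ := by intro m; group
  simp only [width, this]

theorem cuspGen_mul_T_zpow {Γ : Subgroup SL(2, ℤ)} (σ : SL(2, ℤ)) (j : ℤ) :
    cuspGen Γ (σ * ModularGroup.T ^ j) = cuspGen Γ σ := by
  rw [cuspGen, cuspGen, width_mul_T_zpow]; group

theorem IsCap.mul_T_zpow {k : ℕ} {Γ : Subgroup SL(2, ℤ)} {σ : SL(2, ℤ)} {r : ℝ}
    {v w : Coeff k} {j : ℤ} (h : IsCap Γ (σ * ModularGroup.T ^ j) (r - j) v w) :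
    IsCap Γ σ r v w := by
  refine ⟨by rw [← h.1, cuspGen_mul_T_zpow], ?_⟩
  rw [← h.2, width_mul_T_zpow]
  have : ∀ t : ℝ, hForm (harmRep k (toReal (σ * ModularGroup.T ^ j) * nMat t) (harmPow k uMat')) w =
      hForm (harmRep k (toReal σ * nMat (t + j)) (harmPow k uMat')) w := by
    intro t
    rw [map_mul toReal, toReal_T_zpow, mul_assoc, ← nMat_add, add_comm]
  simp only [this]
  rw [intervalIntegral.integral_comp_add_right
    (fun t : ℝ => hForm (harmRep k (toReal σ * nMat t) (harmPow k uMat')) w)]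
  congr 1 <;> ring

theorem IsCap.of_neg {k : ℕ} {Γ : Subgroup SL(2, ℤ)} {σ : SL(2, ℤ)} {r : ℝ}
    {v w : Coeff k} (h : IsCap Γ (-σ) r v w) : IsCap Γ σ r v w := by
  have hδ : (-1 : SL(2, ℤ)) ∈ plusMinus Γ := mem_plusMinus.2 (.inr (by simp [one_mem]))
  have := h.smul hδ
  simpa [rep_neg, rep_one_apply] using this

/-- The width of a cusp of a subgroup is a multiple of the width for the group. -/
theorem exists_width_eq {Γ Γ' : Subgroup SL(2, ℤ)} [Γ.FiniteIndex] [Γ'.FiniteIndex]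
    (hle : Γ' ≤ Γ) (σ : SL(2, ℤ)) : ∃ d : ℕ, 0 < d ∧ width Γ' σ = d * width Γ σ ∧
      cuspGen Γ' σ = cuspGen Γ σ ^ d := by
  obtain ⟨h0, h1⟩ := width_spec Γ' σ
  have h2 := plusMinus_mono hle h1
  rw [← zpow_natCast, conj_T_zpow_mem_iff] at h2
  obtain ⟨d, hd⟩ := Int.natCast_dvd_natCast.1 h2
  have hd' : width Γ' σ = d * width Γ σ := by rw [hd, mul_comm]
  refine ⟨d, Nat.pos_of_ne_zero ?_, hd', ?_⟩
  · rintro rfl; omega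
  · rw [← zpow_natCast, cuspGen_zpow, cuspGen, hd, ← zpow_natCast]
    push_cast
    rfl

/-- A vector in the kernel is fixed by a power of a unipotent element, hence by the element itself,
which acts through polynomials; on such a vector the operator is multiplication by `d`. -/
theorem unroll_cuspGen_bijective {k : ℕ} (Γ : Subgroup SL(2, ℤ)) [Γ.FiniteIndex] (σ : SL(2, ℤ))
    {d : ℕ} (hd : 0 < d) : Function.Bijective (unroll k (cuspGen Γ σ) d) := by
  have hinj : Function.Injective (unroll k (cuspGen Γ σ) d) := by
    refine (injective_iff_map_eq_zero _).2 fun w hw => ?_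
    have h1 := rep_inv_unroll_sub (cuspGen Γ σ) d w
    rw [hw, map_zero, sub_zero, eq_comm, sub_eq_zero] at h1
    have e : ∀ i : ℕ, (cuspGen Γ σ ^ i)⁻¹ =
        σ * ModularGroup.T ^ (width Γ σ * (-i : ℤ)) * σ⁻¹ := by
      intro i
      rw [← cuspGen_zpow, _root_.zpow_neg, zpow_natCast]
    rw [e] at h1
    have hne : (width Γ σ * (-d : ℤ)) ≠ 0 := by
      have := (width_spec Γ σ).1
      exact mul_ne_zero (by omega) (by omega)
    have h2 := (rep_conj_T_zpow_eq_self hne h1).2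
    rw [unroll_of_fixed d fun i => by rw [e, h2]] at hw
    exact (smul_eq_zero.1 hw).resolve_left (Nat.cast_ne_zero.2 hd.ne')
  exact ⟨hinj, LinearMap.injective_iff_surjective.1 hinj⟩

/-- The cap vectors of a subgroup correspond to the cap vectors of the group. -/
theorem isCap_iff_unroll {k : ℕ} {Γ Γ' : Subgroup SL(2, ℤ)} {σ : SL(2, ℤ)} {d : ℕ}
    (hw : width Γ' σ = d * width Γ σ) (hg : cuspGen Γ' σ = cuspGen Γ σ ^ d) (r : ℝ)
    (v w : Coeff k) :
    IsCap Γ' σ r v w ↔ IsCap Γ σ r v (unroll k (cuspGen Γ σ) d w) := by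
  have h1 : rep k (cuspGen Γ' σ)⁻¹ w - w = rep k (cuspGen Γ σ)⁻¹ (unroll k (cuspGen Γ σ) d w) -
      unroll k (cuspGen Γ σ) d w := by rw [rep_inv_unroll_sub, hg]
  have h2 : ∫ t in r..(r + width Γ σ), hForm (harmRep k (toReal σ * nMat t) (harmPow k uMat'))
      (unroll k (cuspGen Γ σ) d w) =
      ∫ t in r..(r + width Γ' σ), hForm (harmRep k (toReal σ * nMat t) (harmPow k uMat')) w := by
    set f : ℝ → ℂ := fun t => hForm (harmRep k (toReal σ * nMat t) (harmPow k uMat')) w with hf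
    have hshift : ∀ (i : ℕ) (t : ℝ), hForm (harmRep k (toReal σ * nMat t) (harmPow k uMat'))
        (rep k (cuspGen Γ σ ^ i)⁻¹ w) = f (t + i * width Γ σ) := by
      intro i t
      have e := hForm_rep (cuspGen Γ σ ^ i) (harmRep k (toReal σ * nMat t) (harmPow k uMat'))
        (rep k (cuspGen Γ σ ^ i)⁻¹ w)
      rw [rep_rep_inv] at e
      rw [← e, hf]
      simp only
      congr 1
      rw [← zpow_natCast, cuspGen_zpow]
      change harmRep k (toReal _) _ = _
      rw [← Module.End.mul_apply, ← map_mul]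
      congr 2
      rw [map_mul, map_mul, map_inv, toReal_T_zpow, mul_assoc, mul_assoc, inv_mul_cancel_left,
        ← nMat_add]
      congr 2
      push_cast
      ring
    have hcont : Continuous f := continuous_hForm_nMat σ w
    simp only [unroll_apply, hForm_sum_right, hshift]
    have hcont' : ∀ i : ℕ, Continuous fun t : ℝ => f (t + i * width Γ σ) := fun i =>
      hcont.comp (by fun_prop)
    rw [intervalIntegral.integral_finsetSum fun i _ => (hcont' i).intervalIntegrable _ _]
    have h3 := intervalIntegral.sum_integral_adjacent_intervals (f := f) (μ := volume)
      (a := fun i : ℕ => r + i * width Γ σ) (n := d) fun i _ => hcont.intervalIntegrable _ _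
    simp only [Nat.cast_zero, zero_mul, add_zero] at h3
    rw [hw, Nat.cast_mul, ← h3]
    refine Finset.sum_congr rfl fun i _ => ?_
    rw [intervalIntegral.integral_comp_add_right f]
    congr 1
    push_cast
    ring
  rw [IsCap, IsCap, h1, h2]

theorem IsIncrementEquivariant.hForm_bdry_width {k : ℕ} {Γ Γ' : Subgroup SL(2, ℤ)}
    [Γ.FiniteIndex] {F : Dbar → Coeff k} (hF : IsIncrementEquivariant Γ F) {σ : SL(2, ℤ)} {d : ℕ}
    (hg : cuspGen Γ' σ = cuspGen Γ σ ^ d) (r : ℝ) (w : Coeff k) :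
    hForm (F (.inr (bdry σ (r + width Γ' σ))) - F (.inr (bdry σ r))) w =
      hForm (F (.inr (bdry σ (r + width Γ σ))) - F (.inr (bdry σ r)))
        (unroll k (cuspGen Γ σ) d w) := by
  have := hF.hForm_pow (cuspGen_mem Γ σ) d (.inr (bdry σ r)) w
  rw [← hg] at this
  rw [← cuspGen_smul_bdry, ← cuspGen_smul_bdry]
  exact this

/-! ### Isotropy groups of vectors of positive norm -/

/-- The isotropy group of a vector in `SL₂(ℤ)`. -/
def vecStab (x : Matrix (Fin 2) (Fin 2) ℚ) : Subgroup SL(2, ℤ) where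
  carrier := {γ | conjQ γ x = x}
  mul_mem' := by
    intro a b ha hb
    change conjQ (a * b) x = x
    rw [conjQ_mul, show conjQ b x = x from hb, show conjQ a x = x from ha]
  one_mem' := conjQ_one x
  inv_mem' := by
    intro a ha
    change conjQ a⁻¹ x = x
    conv_lhs => rw [← show conjQ a x = x from ha, ← conjQ_mul, inv_mul_cancel, conjQ_one]

theorem mem_vecStab {x : Matrix (Fin 2) (Fin 2) ℚ} {γ : SL(2, ℤ)} :
    γ ∈ vecStab x ↔ conjQ γ x = x := Iff.rfl

/-- The matrix of `γ` with rational entries. -/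
abbrev ratMat (γ : SL(2, ℤ)) : Matrix (Fin 2) (Fin 2) ℚ :=
  (γ : Matrix (Fin 2) (Fin 2) ℤ).map fun n : ℤ => (n : ℚ)

theorem ratMat_mul (γ δ : SL(2, ℤ)) : ratMat (γ * δ) = ratMat γ * ratMat δ := by
  rw [ratMat, Matrix.SpecialLinearGroup.coe_mul]
  exact Matrix.map_mul (f := Int.castRingHom ℚ)

theorem ratMat_one : ratMat 1 = 1 := by
  rw [ratMat, Matrix.SpecialLinearGroup.coe_one]
  exact Matrix.map_one _ Int.cast_zero Int.cast_one

theorem ratMat_neg (γ : SL(2, ℤ)) : ratMat (-γ) = -ratMat γ := by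
  ext i j
  simp [ratMat]

theorem ratMat_injective : Function.Injective ratMat := by
  intro γ δ h
  ext i j
  have := congrFun (congrFun h i) j
  simpa [ratMat] using this

theorem ratMat_inv_mul (γ : SL(2, ℤ)) : ratMat γ⁻¹ * ratMat γ = 1 := by
  rw [← ratMat_mul, inv_mul_cancel, ratMat_one]

theorem commute_of_mem_vecStab {x : Matrix (Fin 2) (Fin 2) ℚ} {γ : SL(2, ℤ)}
    (h : γ ∈ vecStab x) : ratMat γ * x = x * ratMat γ := by
  have h1 : ratMat γ * x * ratMat γ⁻¹ = x := h
  conv_rhs => rw [← h1, Matrix.mul_assoc, ratMat_inv_mul, Matrix.mul_one]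

theorem det_ratMat (γ : SL(2, ℤ)) :
    ratMat γ 0 0 * ratMat γ 1 1 - ratMat γ 0 1 * ratMat γ 1 0 = 1 := by
  have h := γ.det_coe
  rw [Matrix.det_fin_two] at h
  simp only [ratMat, Matrix.map_apply]
  exact_mod_cast h

/-- The scalar part of an element that commutes with a traceless `x`. -/
def scalarPart (γ : SL(2, ℤ)) : ℚ := (ratMat γ).trace / 2

/-- The coefficient of `x` in an element that commutes with `x`, where `x² = n`. -/
def vecPart (x : Matrix (Fin 2) (Fin 2) ℚ) (n : ℚ) (γ : SL(2, ℤ)) : ℚ :=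
  (ratMat γ * x).trace / (2 * n)

/-- `x` is traceless with `(x, x) / 2 = n > 0`. -/
structure HasNorm (x : Matrix (Fin 2) (Fin 2) ℚ) (n : ℚ) : Prop where
  trace : x.trace = 0
  pos : 0 < n
  norm : (x * x).trace = 2 * n

namespace HasNorm

variable {x : Matrix (Fin 2) (Fin 2) ℚ} {n : ℚ}

theorem apply_one_one (hx : HasNorm x n) : x 1 1 = -x 0 0 := by
  have := hx.trace
  rw [Matrix.trace_fin_two] at this
  linarith

theorem eq (hx : HasNorm x n) : x 0 0 ^ 2 + x 0 1 * x 1 0 = n := by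
  have h1 := hx.apply_one_one
  have := hx.norm
  rw [Matrix.trace_fin_two, Matrix.mul_apply, Matrix.mul_apply, Fin.sum_univ_two,
    Fin.sum_univ_two, h1] at this
  linarith

theorem conjQ (hx : HasNorm x n) (γ : SL(2, ℤ)) : HasNorm (conjQ γ x) n := by
  refine ⟨?_, hx.pos, ?_⟩
  · rw [Spectacle.conjQ, Matrix.trace_mul_cycle, ratMat_inv_mul, Matrix.one_mul, hx.trace]
  · have : Spectacle.conjQ γ x * Spectacle.conjQ γ x = ratMat γ * (x * x) * ratMat γ⁻¹ := by
      calc _ = ratMat γ * x * (ratMat γ⁻¹ * ratMat γ) * x * ratMat γ⁻¹ := by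
            simp only [Spectacle.conjQ, Matrix.mul_assoc]
        _ = _ := by rw [ratMat_inv_mul, Matrix.mul_one]; simp only [Matrix.mul_assoc]
    rw [this, Matrix.trace_mul_cycle, ratMat_inv_mul, Matrix.one_mul, hx.norm]

/-- An element that commutes with `x` is a combination of `1` and `x`. -/
theorem ratMat_eq (hx : HasNorm x n) {γ : SL(2, ℤ)} (hγ : γ ∈ vecStab x) :
    ratMat γ = scalarPart γ • 1 + vecPart x n γ • x := by
  have h1 := hx.apply_one_one
  have h2 := hx.eq
  have hn := hx.pos.ne'
  have hc := commute_of_mem_vecStab hγ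
  have c00 := congrFun (congrFun hc 0) 0
  have c01 := congrFun (congrFun hc 0) 1
  have c10 := congrFun (congrFun hc 1) 0
  simp only [Matrix.mul_apply, Fin.sum_univ_two, h1] at c00 c01 c10
  have hv : 2 * n * vecPart x n γ = ratMat γ 0 0 * x 0 0 + ratMat γ 0 1 * x 1 0 +
      ratMat γ 1 0 * x 0 1 - ratMat γ 1 1 * x 0 0 := by
    rw [vecPart, mul_div_cancel₀ _ (by positivity), Matrix.trace_fin_two, Matrix.mul_apply,
      Matrix.mul_apply, Fin.sum_univ_two, Fin.sum_univ_two, h1]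
    ring
  have hs : scalarPart γ = (ratMat γ 0 0 + ratMat γ 1 1) / 2 := by
    rw [scalarPart, Matrix.trace_fin_two]
  generalize ratMat γ = g at *
  generalize vecPart x n γ = β at *
  have key : ∀ a b : ℚ, 2 * n * a = 2 * n * b → a = b := fun a b h =>
    mul_left_cancel₀ (by positivity) h
  ext i j
  fin_cases i <;> fin_cases j <;> simp [hs, h1] <;> refine key _ _ ?_
  · linear_combination (-x 0 0) * hv - (g 0 0 - g 1 1) * h2 - x 0 1 * c10 - x 0 0 * c00
  · linear_combination (-x 0 1) * hv - 2 * g 0 1 * h2 - x 0 0 * c01 + x 0 1 * c00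
  · linear_combination (-x 1 0) * hv - 2 * g 1 0 * h2 + x 0 0 * c10 - x 1 0 * c00
  · linear_combination (x 0 0) * hv + (g 0 0 - g 1 1) * h2 + x 0 1 * c10 + x 0 0 * c00

/-- The norm equation `α² - n β² = 1`. -/
theorem pell (hx : HasNorm x n) {γ : SL(2, ℤ)} (hγ : γ ∈ vecStab x) :
    scalarPart γ ^ 2 - n * vecPart x n γ ^ 2 = 1 := by
  have h := det_ratMat γ
  rw [hx.ratMat_eq hγ] at h
  have h1 := hx.apply_one_one
  have h2 := hx.eq
  simp [h1] at h
  linear_combination h + vecPart x n γ ^ 2 * h2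

theorem square (hx : HasNorm x n) : x * x = n • (1 : Matrix (Fin 2) (Fin 2) ℚ) := by
  have h1 := hx.apply_one_one
  have h2 := hx.eq
  ext i j
  fin_cases i <;> fin_cases j <;> simp [Matrix.mul_apply, Fin.sum_univ_two, h1] <;> linarith

theorem scalarPart_mul (hx : HasNorm x n) {γ δ : SL(2, ℤ)} (hγ : γ ∈ vecStab x)
    (hδ : δ ∈ vecStab x) : scalarPart (γ * δ) =
      scalarPart γ * scalarPart δ + n * (vecPart x n γ * vecPart x n δ) := by
  rw [scalarPart, ratMat_mul, hx.ratMat_eq hγ, hx.ratMat_eq hδ]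
  simp only [Matrix.add_mul, Matrix.mul_add, Matrix.smul_mul, Matrix.mul_smul, hx.square,
    Matrix.trace_add, Matrix.trace_smul, hx.trace, Matrix.one_mul, Matrix.mul_one,
    Matrix.trace_one, Fintype.card_fin, smul_eq_mul]
  push_cast
  ring

theorem vecPart_mul (hx : HasNorm x n) {γ δ : SL(2, ℤ)} (hγ : γ ∈ vecStab x)
    (hδ : δ ∈ vecStab x) : vecPart x n (γ * δ) =
      scalarPart γ * vecPart x n δ + vecPart x n γ * scalarPart δ := by
  have hn := hx.pos.ne'
  rw [vecPart, ratMat_mul, hx.ratMat_eq hγ, hx.ratMat_eq hδ]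
  simp only [Matrix.add_mul, Matrix.mul_add, Matrix.smul_mul, Matrix.mul_smul, hx.square,
    Matrix.trace_add, Matrix.trace_smul, hx.trace, Matrix.one_mul, Matrix.mul_one,
    Matrix.trace_one, Fintype.card_fin, smul_eq_mul]
  field_simp
  push_cast
  ring

end HasNorm

/-- The eigenvalue `α + β √n` of an element that commutes with `x`, where `x² = n`. -/
def eigen (x : Matrix (Fin 2) (Fin 2) ℚ) (n : ℚ) (γ : SL(2, ℤ)) : ℝ :=
  scalarPart γ + vecPart x n γ * √(n : ℝ)

namespace HasNorm

variable {x : Matrix (Fin 2) (Fin 2) ℚ} {n : ℚ}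

theorem sqrt_sq (hx : HasNorm x n) : √(n : ℝ) ^ 2 = n :=
  Real.sq_sqrt (by exact_mod_cast hx.pos.le)

theorem sqrt_pos (hx : HasNorm x n) : 0 < √(n : ℝ) :=
  Real.sqrt_pos.2 (by exact_mod_cast hx.pos)

theorem eigen_one (hx : HasNorm x n) : eigen x n 1 = 1 := by
  have h1 : scalarPart 1 = 1 := by simp [scalarPart, ratMat_one]
  have h2 : vecPart x n 1 = 0 := by simp [vecPart, ratMat_one, hx.trace]
  rw [eigen, h1, h2]
  simp

theorem eigen_mul (hx : HasNorm x n) {γ δ : SL(2, ℤ)} (hγ : γ ∈ vecStab x)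
    (hδ : δ ∈ vecStab x) : eigen x n (γ * δ) = eigen x n γ * eigen x n δ := by
  rw [eigen, eigen, eigen, hx.scalarPart_mul hγ hδ, hx.vecPart_mul hγ hδ]
  push_cast
  linear_combination (-(vecPart x n γ * vecPart x n δ : ℝ)) * hx.sqrt_sq

theorem eigen_inv (hx : HasNorm x n) {γ : SL(2, ℤ)} (hγ : γ ∈ vecStab x) :
    eigen x n γ⁻¹ = (eigen x n γ)⁻¹ := by
  refine eq_inv_of_mul_eq_one_left ?_
  rw [← hx.eigen_mul (inv_mem hγ) hγ, inv_mul_cancel, hx.eigen_one]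

theorem eigen_pow (hx : HasNorm x n) {γ : SL(2, ℤ)} (hγ : γ ∈ vecStab x) (m : ℕ) :
    eigen x n (γ ^ m) = eigen x n γ ^ m := by
  induction m with
  | zero => rw [pow_zero, pow_zero, hx.eigen_one]
  | succ m ih => rw [pow_succ, pow_succ, hx.eigen_mul (pow_mem hγ m) hγ, ih]

theorem eigen_zpow (hx : HasNorm x n) {γ : SL(2, ℤ)} (hγ : γ ∈ vecStab x) (m : ℤ) :
    eigen x n (γ ^ m) = eigen x n γ ^ m := by
  obtain ⟨j, rfl | rfl⟩ := m.eq_nat_or_neg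
  · rw [zpow_natCast, zpow_natCast, hx.eigen_pow hγ]
  · rw [_root_.zpow_neg, _root_.zpow_neg, zpow_natCast, zpow_natCast,
      hx.eigen_inv (pow_mem hγ j), hx.eigen_pow hγ]

theorem eigen_neg (γ : SL(2, ℤ)) : eigen x n (-γ) = -eigen x n γ := by
  simp [eigen, scalarPart, vecPart, ratMat_neg]
  ring

theorem eigen_mul_conj (hx : HasNorm x n) {γ : SL(2, ℤ)} (hγ : γ ∈ vecStab x) :
    eigen x n γ * (scalarPart γ - vecPart x n γ * √(n : ℝ)) = 1 := by
  have h : (scalarPart γ : ℝ) ^ 2 - n * vecPart x n γ ^ 2 = 1 := by exact_mod_cast hx.pell hγ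
  rw [eigen]
  linear_combination h - (vecPart x n γ : ℝ) ^ 2 * hx.sqrt_sq

theorem eigen_ne_zero (hx : HasNorm x n) {γ : SL(2, ℤ)} (hγ : γ ∈ vecStab x) :
    eigen x n γ ≠ 0 := left_ne_zero_of_mul_eq_one (hx.eigen_mul_conj hγ)

/-- The sign condition that singles out the generator of the isotropy group. -/
theorem trace_mul_trace_pos_iff (hx : HasNorm x n) {γ : SL(2, ℤ)} (hγ : γ ∈ vecStab x) :
    0 < ((γ : Matrix (Fin 2) (Fin 2) ℤ).trace : ℚ) *
      ((γ : Matrix (Fin 2) (Fin 2) ℤ).map (fun n : ℤ => (n : ℚ)) * x).trace ↔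
      1 < |eigen x n γ| := by
  have hn := hx.pos
  have hs := hx.sqrt_pos
  have e1 : ((γ : Matrix (Fin 2) (Fin 2) ℤ).trace : ℚ) = 2 * scalarPart γ := by
    simp [scalarPart, Matrix.trace_fin_two, ratMat]
    ring
  have e2 : ((γ : Matrix (Fin 2) (Fin 2) ℤ).map (fun n : ℤ => (n : ℚ)) * x).trace =
      2 * n * vecPart x n γ := by
    rw [vecPart, mul_div_cancel₀ _ (by positivity)]
  rw [e1, e2]
  have h3 := hx.eigen_mul_conj hγ
  set α : ℝ := ((scalarPart γ : ℚ) : ℝ) with hα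
  set β : ℝ := ((vecPart x n γ : ℚ) : ℝ) with hβ
  set s := √(n : ℝ) with hsdef
  have he : eigen x n γ = α + β * s := rfl
  have hiff : 0 < 2 * scalarPart γ * (2 * n * vecPart x n γ) ↔ 0 < α * β := by
    have : ((2 * scalarPart γ * (2 * n * vecPart x n γ) : ℚ) : ℝ) = 4 * n * (α * β) := by
      push_cast; ring
    rw [← Rat.cast_pos (K := ℝ), this]
    have hn' : (0 : ℝ) < 4 * n := by
      have : (0 : ℝ) < n := by exact_mod_cast hn
      linarith
    exact mul_pos_iff_of_pos_left hn'
  rw [hiff, ← sq_lt_sq₀ zero_le_one (abs_nonneg _), sq_abs, one_pow, he]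
  rw [he] at h3
  constructor
  · intro h
    have e : (α + β * s) ^ 2 = 1 + 2 * (β * s) ^ 2 + 2 * (α * β * s) := by linear_combination h3
    have := mul_pos h hs
    have := sq_nonneg (β * s)
    linarith
  · intro h
    have h4 : (α - β * s) ^ 2 < 1 := by
      by_contra! h5
      have : (1 : ℝ) < (α + β * s) ^ 2 * (α - β * s) ^ 2 := by nlinarith
      rw [← mul_pow, h3] at this
      norm_num at this
    have h5 : 0 < (α * β) * s := by nlinarith
    exact (mul_pos_iff_of_pos_right hs).1 h5

/-- Only `± 1` have an eigenvalue of absolute value `1`. -/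
theorem eq_one_or_of_vecPart (hx : HasNorm x n) {γ : SL(2, ℤ)} (hγ : γ ∈ vecStab x)
    (h : vecPart x n γ = 0) : γ = 1 ∨ γ = -1 := by
  have h1 := hx.pell hγ
  have h2 := hx.ratMat_eq hγ
  rw [h, zero_smul, add_zero] at h2
  have h3 : scalarPart γ = 1 ∨ scalarPart γ = -1 := by
    rw [h] at h1
    exact sq_eq_one_iff.1 (by linarith)
  rcases h3 with h3 | h3
  · exact .inl (ratMat_injective (by rw [h2, h3, one_smul, ratMat_one]))
  · exact .inr (ratMat_injective (by rw [h2, h3, ratMat_neg, ratMat_one, neg_one_smul]))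

end HasNorm

theorem vecStab_neg {x : Matrix (Fin 2) (Fin 2) ℚ} {γ : SL(2, ℤ)} (h : γ ∈ vecStab x) :
    -γ ∈ vecStab x := by
  rw [mem_vecStab, conjQ_neg]; exact h

theorem rep_harmPow_of_mem_vecStab {k : ℕ} {x : Matrix (Fin 2) (Fin 2) ℚ} (hx : x.trace = 0)
    {γ : SL(2, ℤ)} (h : γ ∈ vecStab x) :
    rep k γ (harmPow k (ratReal x)) = harmPow k (ratReal x) := by
  rw [rep_harmPow, ← ratReal_conjQ, mem_vecStab.1 h]
  rw [Matrix.trace_fin_two] at hx ⊢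
  simp only [ratReal, Matrix.map_apply]
  exact_mod_cast hx

/-! ### Generators of isotropy groups -/

namespace HasNorm

variable {x : Matrix (Fin 2) (Fin 2) ℚ} {n : ℚ}

theorem eq_one_or_of_abs_eigen (hx : HasNorm x n) {γ : SL(2, ℤ)} (hγ : γ ∈ vecStab x)
    (h : |eigen x n γ| = 1) : γ = 1 ∨ γ = -1 := by
  refine hx.eq_one_or_of_vecPart hγ ?_
  have h1 := hx.eigen_mul_conj hγ
  have hs := hx.sqrt_pos
  have h2 : eigen x n γ ^ 2 = 1 := by rw [← sq_abs, h, one_pow]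
  have he : eigen x n γ = ((scalarPart γ : ℚ) : ℝ) + ((vecPart x n γ : ℚ) : ℝ) * √(n : ℝ) := rfl
  have h3 : eigen x n γ = ((scalarPart γ : ℚ) : ℝ) - ((vecPart x n γ : ℚ) : ℝ) * √(n : ℝ) := by
    refine mul_left_cancel₀ (hx.eigen_ne_zero hγ) ?_
    rw [h1, ← sq, h2]
  have h4 : ((vecPart x n γ : ℚ) : ℝ) * √(n : ℝ) = 0 := by linarith
  exact_mod_cast (mul_eq_zero.1 h4).resolve_right hs.ne'

/-- The eigenvalues of the isotropy group are isolated, since traces are integers. -/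
theorem two_le_abs_eigen (hx : HasNorm x n) {γ : SL(2, ℤ)} (hγ : γ ∈ vecStab x)
    (h : 1 < |eigen x n γ|) : 2 ≤ |eigen x n γ| := by
  have h1 := hx.eigen_mul_conj hγ
  have he : eigen x n γ = ((scalarPart γ : ℚ) : ℝ) + ((vecPart x n γ : ℚ) : ℝ) * √(n : ℝ) := rfl
  set e := eigen x n γ with hedef
  set e' := ((scalarPart γ : ℚ) : ℝ) - ((vecPart x n γ : ℚ) : ℝ) * √(n : ℝ) with he'
  have htr : e + e' = (((γ : Matrix (Fin 2) (Fin 2) ℤ).trace : ℤ) : ℝ) := by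
    have : (((γ : Matrix (Fin 2) (Fin 2) ℤ).trace : ℤ) : ℚ) = 2 * scalarPart γ := by
      simp [scalarPart, Matrix.trace_fin_two, ratMat]
      ring
    have h2 : (((γ : Matrix (Fin 2) (Fin 2) ℤ).trace : ℤ) : ℝ) = 2 * ((scalarPart γ : ℚ) : ℝ) := by
      exact_mod_cast this
    rw [h2, he]; ring
  have habs : |e| * |e'| = 1 := by rw [← abs_mul, h1, abs_one]
  have hsum : |e + e'| = |e| + |e'| := by
    rw [abs_add_eq_add_abs_iff]
    rcases pos_and_pos_or_neg_and_neg_of_mul_pos (h1 ▸ one_pos : 0 < e * e') with h | h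
    · exact .inl ⟨h.1.le, h.2.le⟩
    · exact .inr ⟨h.1.le, h.2.le⟩
  have hgt : 2 < |e + e'| := by
    rw [hsum]
    nlinarith [sq_pos_of_pos (sub_pos.2 h)]
  rw [htr] at hgt hsum
  have hge : (3 : ℝ) ≤ |(((γ : Matrix (Fin 2) (Fin 2) ℤ).trace : ℤ) : ℝ)| := by
    have : (2 : ℤ) < |(γ : Matrix (Fin 2) (Fin 2) ℤ).trace| := by exact_mod_cast hgt
    exact_mod_cast (this : (3 : ℤ) ≤ _)
  rw [hsum] at hge
  by_contra! hlt
  nlinarith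

end HasNorm

/-- `γ` generates the isotropy group of `x` in `Γ`, up to sign, and has eigenvalue of absolute value
greater than `1` on the eigenvector of `x` for `√n`. -/
structure IsGenerator (Γ : Subgroup SL(2, ℤ)) (x : Matrix (Fin 2) (Fin 2) ℚ) (n : ℚ)
    (γ : SL(2, ℤ)) : Prop where
  mem : γ ∈ Γ
  mem_vecStab : γ ∈ vecStab x
  one_lt : 1 < |eigen x n γ|
  generates : ∀ δ ∈ Γ, δ ∈ vecStab x → ∃ m : ℤ, δ = γ ^ m ∨ δ = -γ ^ m

theorem abs_eigen_eq {x : Matrix (Fin 2) (Fin 2) ℚ} {n : ℚ} (hx : HasNorm x n) {γ δ : SL(2, ℤ)}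
    (hγ : γ ∈ vecStab x) {m : ℤ} (h : δ = γ ^ m ∨ δ = -γ ^ m) :
    |eigen x n δ| = |eigen x n γ| ^ m := by
  rcases h with rfl | rfl
  · rw [hx.eigen_zpow hγ, abs_zpow]
  · rw [HasNorm.eigen_neg, abs_neg, hx.eigen_zpow hγ, abs_zpow]

/-- An infinite isotropy group has a generator: the logarithms of the eigenvalues form a discrete
subgroup of `ℝ`. -/
theorem exists_isGenerator {Γ : Subgroup SL(2, ℤ)} {x : Matrix (Fin 2) (Fin 2) ℚ} {n : ℚ}
    (hx : HasNorm x n) {γ₀ : SL(2, ℤ)} (h₀ : γ₀ ∈ Γ) (h₀' : γ₀ ∈ vecStab x)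
    (h₁ : 1 < |eigen x n γ₀|) : ∃ γ, IsGenerator Γ x n γ := by
  let H : AddSubgroup ℝ :=
    { carrier := {t | ∃ γ ∈ Γ, γ ∈ vecStab x ∧ t = Real.log |eigen x n γ|}
      add_mem' := by
        rintro _ _ ⟨γ, hγ, hγ', rfl⟩ ⟨δ, hδ, hδ', rfl⟩
        refine ⟨γ * δ, mul_mem hγ hδ, mul_mem hγ' hδ', ?_⟩
        rw [hx.eigen_mul hγ' hδ', abs_mul, Real.log_mul (abs_ne_zero.2 (hx.eigen_ne_zero hγ'))
          (abs_ne_zero.2 (hx.eigen_ne_zero hδ'))]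
      zero_mem' := ⟨1, one_mem _, one_mem _, by rw [hx.eigen_one, abs_one, Real.log_one]⟩
      neg_mem' := by
        rintro _ ⟨γ, hγ, hγ', rfl⟩
        refine ⟨γ⁻¹, inv_mem hγ, inv_mem hγ', ?_⟩
        rw [hx.eigen_inv hγ', abs_inv, Real.log_inv] }
  have hdisc : Disjoint (H : Set ℝ) (Set.Ioo 0 (Real.log 2)) := by
    rw [Set.disjoint_left]
    rintro _ ⟨γ, hγ, hγ', rfl⟩ ⟨hpos, hlt⟩
    have h2 : 1 < |eigen x n γ| := (Real.log_pos_iff (abs_nonneg _)).1 hpos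
    have h3 := hx.two_le_abs_eigen hγ' h2
    exact absurd (Real.log_le_log two_pos h3) (not_le.2 hlt)
  obtain ⟨b, hb⟩ := AddSubgroup.cyclic_of_isolated_zero (Real.log_pos one_lt_two) hdisc
  obtain ⟨c, hc, hcpos⟩ : ∃ c, H = AddSubgroup.zmultiples c ∧ 0 ≤ c := by
    rw [← AddSubgroup.zmultiples_eq_closure] at hb
    rcases le_total 0 b with h | h
    · exact ⟨b, hb, h⟩
    · exact ⟨-b, by rw [hb, AddSubgroup.zmultiples_neg], neg_nonneg.2 h⟩
  obtain ⟨γ, hγ, hγ', hγc⟩ : c ∈ H := by rw [hc]; exact AddSubgroup.mem_zmultiples c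
  have hgen : ∀ δ ∈ Γ, δ ∈ vecStab x → ∃ m : ℤ, Real.log |eigen x n δ| = m * c := by
    intro δ hδ hδ'
    have : Real.log |eigen x n δ| ∈ H := ⟨δ, hδ, hδ', rfl⟩
    rw [hc, AddSubgroup.mem_zmultiples_iff] at this
    obtain ⟨m, hm⟩ := this
    exact ⟨m, by rw [← hm, zsmul_eq_mul]⟩
  have hc0 : 0 < c := by
    refine lt_of_le_of_ne hcpos fun h => ?_
    obtain ⟨m, hm⟩ := hgen γ₀ h₀ h₀'
    rw [← h, mul_zero] at hm
    exact absurd hm (Real.log_pos h₁).ne'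
  refine ⟨γ, hγ, hγ', (Real.log_pos_iff (abs_nonneg _)).1 (hγc ▸ hc0), fun δ hδ hδ' => ?_⟩
  obtain ⟨m, hm⟩ := hgen δ hδ hδ'
  refine ⟨m, ?_⟩
  have h2 : |eigen x n (δ * γ ^ (-m))| = 1 := by
    rw [hx.eigen_mul hδ' (zpow_mem hγ' _), hx.eigen_zpow hγ', abs_mul, abs_zpow]
    refine Real.eq_one_of_pos_of_log_eq_zero (mul_pos (abs_pos.2 (hx.eigen_ne_zero hδ'))
      (zpow_pos (abs_pos.2 (hx.eigen_ne_zero hγ')) _)) ?_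
    rw [Real.log_mul (abs_ne_zero.2 (hx.eigen_ne_zero hδ'))
      (zpow_pos (abs_pos.2 (hx.eigen_ne_zero hγ')) _).ne', Real.log_zpow, ← hγc, hm]
    push_cast; ring
  rcases hx.eq_one_or_of_abs_eigen (mul_mem hδ' (zpow_mem hγ' _)) h2 with h3 | h3
  · left
    rw [_root_.zpow_neg] at h3
    exact mul_inv_eq_one.1 h3
  · right
    rw [_root_.zpow_neg, mul_inv_eq_iff_eq_mul, neg_mul, one_mul] at h3
    exact h3

/-- The generator is unique up to sign. -/
theorem IsGenerator.unique {Γ : Subgroup SL(2, ℤ)} {x : Matrix (Fin 2) (Fin 2) ℚ} {n : ℚ}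
    (hx : HasNorm x n) {γ γ' : SL(2, ℤ)} (h : IsGenerator Γ x n γ) (h' : IsGenerator Γ x n γ') :
    γ' = γ ∨ γ' = -γ := by
  obtain ⟨m, hm⟩ := h.generates γ' h'.mem h'.mem_vecStab
  obtain ⟨l, hl⟩ := h'.generates γ h.mem h.mem_vecStab
  have h1 := abs_eigen_eq hx h.mem_vecStab hm
  have h2 := abs_eigen_eq hx h'.mem_vecStab hl
  have hm0 : 0 < m := (one_lt_zpow_iff_right₀ h.one_lt).1 (h1 ▸ h'.one_lt)
  have hl0 : 0 < l := (one_lt_zpow_iff_right₀ h'.one_lt).1 (h2 ▸ h.one_lt)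
  have h3 : |eigen x n γ| ^ (m * l) = |eigen x n γ| ^ (1 : ℤ) := by
    rw [_root_.zpow_mul, ← h1, ← h2, zpow_one]
  have h4 := zpow_right_injective₀ (by linarith [h.one_lt]) h.one_lt.ne' h3
  have h5 : m = 1 := by nlinarith
  subst h5
  simpa using hm

/-- The generator for a subgroup of finite index is a power of the generator, up to sign. -/
theorem IsGenerator.exists_pow {Γ Γ' : Subgroup SL(2, ℤ)} [Γ'.FiniteIndex] (hle : Γ' ≤ Γ)
    {x : Matrix (Fin 2) (Fin 2) ℚ} {n : ℚ} (hx : HasNorm x n) {γ : SL(2, ℤ)}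
    (h : IsGenerator Γ x n γ) : ∃ (γ' : SL(2, ℤ)) (d : ℕ), 0 < d ∧ IsGenerator Γ' x n γ' ∧
      (γ' = γ ^ d ∨ γ' = -γ ^ d) ∧ ∀ m : ℤ, γ ^ m ∈ plusMinus Γ' ↔ (d : ℤ) ∣ m := by
  obtain ⟨j, hj, -, hj'⟩ := Subgroup.exists_pow_mem_of_index_ne_zero
    (Subgroup.FiniteIndex.index_ne_zero (H := Γ')) γ
  have hstab := h.mem_vecStab
  have h1 : 1 < |eigen x n (γ ^ j)| := by
    rw [hx.eigen_pow hstab, abs_pow]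
    exact one_lt_pow₀ h.one_lt hj.ne'
  obtain ⟨γ', hγ'⟩ := exists_isGenerator hx hj' (pow_mem hstab j) h1
  obtain ⟨m, hm⟩ := h.generates γ' (hle hγ'.mem) hγ'.mem_vecStab
  have h2 := abs_eigen_eq hx hstab hm
  have hm0 : 0 < m := (one_lt_zpow_iff_right₀ h.one_lt).1 (h2 ▸ hγ'.one_lt)
  obtain ⟨d, rfl⟩ := Int.eq_ofNat_of_zero_le hm0.le
  rw [zpow_natCast] at hm
  have hmem : γ ^ d ∈ plusMinus Γ' := by
    rcases hm with hm | hm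
    · exact hm ▸ le_plusMinus Γ' hγ'.mem
    · refine mem_plusMinus.2 (.inr ?_)
      rw [← hm]; exact hγ'.mem
  refine ⟨γ', d, by omega, hγ', hm, fun i => ⟨fun hi => ?_, ?_⟩⟩
  · have key : ∀ δ ∈ Γ', (δ = γ ^ i ∨ δ = -γ ^ i) → (d : ℤ) ∣ i := by
      intro δ hδ hδi
      have hδs : δ ∈ vecStab x := by
        rcases hδi with rfl | rfl
        · exact zpow_mem hstab i
        · exact vecStab_neg (zpow_mem hstab i)
      obtain ⟨l, hl⟩ := hγ'.generates δ hδ hδs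
      have e1 := abs_eigen_eq hx hstab hδi
      have e2 := abs_eigen_eq hx hγ'.mem_vecStab hl
      rw [h2, ← _root_.zpow_mul, e1] at e2
      exact ⟨l, zpow_right_injective₀ (by linarith [h.one_lt]) h.one_lt.ne' e2⟩
    rcases mem_plusMinus.1 hi with hi | hi
    · exact key _ hi (.inl rfl)
    · exact key _ hi (.inr rfl)
  · rintro ⟨l, rfl⟩
    rw [_root_.zpow_mul, zpow_natCast]
    exact zpow_mem hmem l

/-! ### Frames and geodesics -/

theorem gMat_eq_toSL2R (z : ℍ) : gMat z = z.toSL2R := by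
  ext i j
  rw [coe_toSL2R, gMat]
  fin_cases i <;> fin_cases j <;> simp

theorem gMat_smul_I (z : ℍ) : gMat z • I = z := by rw [gMat_eq_toSL2R, toSL2R_smul_I]

theorem toReal_smul (γ : SL(2, ℤ)) (z : ℍ) : toReal γ • z = γ • z := by
  refine UpperHalfPlane.ext ?_
  rw [coe_specialLinearGroup_apply, coe_specialLinearGroup_apply]
  simp [toReal]

/-- An element of `SL₂(ℝ)` that fixes `i` is a rotation. -/
theorem rotation_of_smul_I {g : SL(2, ℝ)} (h : g • I = I) :
    g 1 1 = g 0 0 ∧ g 1 0 = -g 0 1 := by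
  have h1 := congrArg (fun z : ℍ => (z : ℂ)) h
  simp only [coe_specialLinearGroup_apply] at h1
  have hd : ((g 1 0 : ℝ) : ℂ) * Complex.I + ((g 1 1 : ℝ) : ℂ) ≠ 0 := by
    intro h0
    have h10 := congrArg Complex.im h0
    have h11 := congrArg Complex.re h0
    simp at h10 h11
    have := g.det_coe
    rw [Matrix.det_fin_two, h10, h11] at this
    simp at this
  simp only [Algebra.algebraMap_self, RingHom.id_apply, coe_I] at h1
  rw [div_eq_iff hd] at h1
  have h10 := congrArg Complex.im h1
  have h11 := congrArg Complex.re h1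
  simp at h10 h11
  exact ⟨h10.symm, by linarith⟩

/-- The frames at `z` and `γ z` differ by `γ` and a rotation. -/
theorem exists_rotation (γ : SL(2, ℤ)) (z : ℍ) : ∃ κ : SL(2, ℝ), κ 1 1 = κ 0 0 ∧
    κ 1 0 = -κ 0 1 ∧ toReal γ * gMat z = gMat (γ • z) * κ := by
  have h : ((gMat (γ • z))⁻¹ * toReal γ * gMat z) • I = I := by
    rw [mul_smul, mul_smul, gMat_smul_I, toReal_smul, inv_smul_eq_iff, gMat_smul_I]
  obtain ⟨h1, h2⟩ := rotation_of_smul_I h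
  exact ⟨_, h1, h2, by group⟩

theorem negVec_eq (z : ℍ) : negVec z = conj (gMat z) (basisMat 2) := by
  have hy := z.im_pos
  have hs : √z.im ^ 2 = z.im := Real.sq_sqrt hy.le
  have hs0 : √z.im ≠ 0 := (Real.sqrt_pos.2 hy).ne'
  have h2 : (√2 : ℝ) ≠ 0 := by positivity
  have hinv : (((gMat z)⁻¹ : SL(2, ℝ)) : Matrix (Fin 2) (Fin 2) ℝ) =
      !![(√z.im)⁻¹, -(z.re / √z.im); 0, √z.im] := by
    rw [Matrix.SpecialLinearGroup.coe_inv, gMat, Matrix.adjugate_fin_two_of]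
    simp
  rw [conj, hinv, gMat, negVec, Complex.normSq_apply]
  ext i j
  fin_cases i <;> fin_cases j <;>
    simp [basisMat, Matrix.mul_apply, Fin.sum_univ_two] <;> field_simp <;> rw [hs]
  · ring
  · rw [show √z.im ^ 4 = (√z.im ^ 2) ^ 2 by ring, hs]
    ring
  all_goals ring

theorem conj_rotation_basisMat_two {κ : SL(2, ℝ)} (h1 : κ 1 1 = κ 0 0) (h2 : κ 1 0 = -κ 0 1) :
    conj κ (basisMat 2) = basisMat 2 := by
  have hd := κ.det_coe
  rw [Matrix.det_fin_two, h1, h2] at hd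
  rw [conj, Matrix.SpecialLinearGroup.coe_inv, Matrix.adjugate_fin_two]
  ext i j
  fin_cases i <;> fin_cases j <;>
    simp [basisMat, Matrix.mul_apply, Fin.sum_univ_two, h1, h2]
  · ring
  · linear_combination (√2)⁻¹ * hd
  · linear_combination (-(√2)⁻¹) * hd
  · ring

theorem negVec_smul (γ : SL(2, ℤ)) (z : ℍ) : negVec (γ • z) = conj (toReal γ) (negVec z) := by
  obtain ⟨κ, h1, h2, h3⟩ := exists_rotation γ z
  rw [negVec_eq, negVec_eq, ← conj_mul, h3, conj_mul, conj_rotation_basisMat_two h1 h2]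

theorem form_conj (g : SL(2, ℝ)) (x y : Matrix (Fin 2) (Fin 2) ℝ) :
    form (conj g x) (conj g y) = form x y := by
  rw [form, conj_mul_conj, trace_conj, form]

theorem onGeodesic_smul {x : Matrix (Fin 2) (Fin 2) ℚ} {z : ℍ} (h : OnGeodesic x z)
    (γ : SL(2, ℤ)) : OnGeodesic (conjQ γ x) (γ • z) := by
  rw [OnGeodesic, ratReal_conjQ, negVec_smul, form_conj]
  exact h

theorem IsGeneric.smul {z : ℍ} (h : IsGeneric z) (γ : SL(2, ℤ)) : IsGeneric (γ • z) := by
  intro g hg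
  have h1 : (γ⁻¹ * g * γ) • z = z := by rw [mul_smul, mul_smul, hg, inv_smul_smul]
  have h2 : g = γ * (γ⁻¹ * g * γ) * γ⁻¹ := by group
  rcases h _ h1 with h3 | h3
  · left; rw [h2, h3]; group
  · right; rw [h2, h3]; simp

/-! ### Closed geodesics -/

theorem isClosedGeodesicChain_iff {k : ℕ} {Γ : Subgroup SL(2, ℤ)}
    {x : Matrix (Fin 2) (Fin 2) ℚ} {n : ℚ} (hx : HasNorm x n) {c : Chain k Γ} :
    IsClosedGeodesicChain Γ x c ↔ ∃ (γ : SL(2, ℤ)) (z : ℍ), IsGenerator Γ x n γ ∧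
      OnGeodesic x z ∧ IsGeneric z ∧
      c = seg Γ (.inl z) (.inl (γ • z)) (harmPow k (ratReal x)) := by
  constructor
  · rintro ⟨γ, z, h1, h2, h3, h4, h5, h6, h7⟩
    exact ⟨γ, z, ⟨h1, h2, (hx.trace_mul_trace_pos_iff h2).1 (by exact_mod_cast h4), h3⟩, h5, h6, h7⟩
  · rintro ⟨γ, z, ⟨h1, h2, h4, h3⟩, h5, h6, h7⟩
    exact ⟨γ, z, h1, h2, h3, by exact_mod_cast (hx.trace_mul_trace_pos_iff h2).2 h4, h5, h6, h7⟩

theorem IsIncrementEquivariant.closed_period_eq {k : ℕ} {Γ : Subgroup SL(2, ℤ)}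
    {F : Dbar → Coeff k} (hF : IsIncrementEquivariant Γ F) {γ : SL(2, ℤ)} (hγ : γ ∈ plusMinus Γ)
    {v : Coeff k} (hv : rep k γ v = v) (p q : Dbar) :
    hForm (F (γ • p) - F p) v = hForm (F (γ • q) - F q) v := by
  have h := hF.hForm_smul_sub_smul hγ p q v
  rw [hv, hForm_sub_left, hForm_sub_left] at h
  rw [hForm_sub_left, hForm_sub_left]
  linear_combination h

/-- The period over the closed geodesic of `x` is the increment of `F` along any segment `(p, γ p)`,
paired with `x ^ k`, for a generator `γ`; the base point and the generator do not matter. -/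
theorem closedGeodesic_period {k : ℕ} {Γ : Subgroup SL(2, ℤ)} {F : Dbar → Coeff k}
    (hF : IsIncrementEquivariant Γ F) {x : Matrix (Fin 2) (Fin 2) ℚ} {n : ℚ} (hx : HasNorm x n)
    {γ : SL(2, ℤ)} (hγ : IsGenerator Γ x n γ) {c : Chain k Γ} (hc : IsClosedGeodesicChain Γ x c)
    (p : Dbar) : period Γ F c = hForm (F (γ • p) - F p) (harmPow k (ratReal x)) := by
  obtain ⟨γ', z, hγ', -, h2, rfl⟩ := (isClosedGeodesicChain_iff hx).1 hc
  rw [period_seg _ _ h2.hasTrivialIsotropy]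
  have hv := rep_harmPow_of_mem_vecStab (k := k) hx.trace hγ.mem_vecStab
  rw [hF.closed_period_eq (le_plusMinus Γ hγ.mem) hv p (.inl z)]
  rcases hγ.unique hx hγ' with rfl | rfl
  · rfl
  · rw [← neg_smul_dbar γ]; rfl

theorem closedGeodesic_cycle {k : ℕ} {Γ : Subgroup SL(2, ℤ)} {x : Matrix (Fin 2) (Fin 2) ℚ}
    {n : ℚ} (hx : HasNorm x n) {c : Chain k Γ} (hc : IsClosedGeodesicChain Γ x c) :
    (quotientSystem (simplices Γ) (repSub k Γ)).d1
      (pushforward (simplices Γ) (repSub k Γ) c) = 0 := by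
  obtain ⟨γ, z, hγ, -, h2, rfl⟩ := (isClosedGeodesicChain_iff hx).1 hc
  have h := pushVertex_plusMinus (le_plusMinus Γ hγ.mem) (.inl z) (harmPow k (ratReal x))
  rw [rep_harmPow_of_mem_vecStab hx.trace hγ.mem_vecStab] at h
  rw [d1_pushforward_seg _ h2.hasTrivialIsotropy]
  exact sub_eq_zero.2 h

theorem conj_mem_vecStab {x : Matrix (Fin 2) (Fin 2) ℚ} {γ δ : SL(2, ℤ)} :
    γ ∈ vecStab (conjQ δ x) ↔ δ⁻¹ * γ * δ ∈ vecStab x := by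
  rw [mem_vecStab, mem_vecStab, conjQ_mul, conjQ_mul]
  constructor
  · intro h; rw [h, ← conjQ_mul, inv_mul_cancel, conjQ_one]
  · intro h
    have := congrArg (conjQ δ) h
    rwa [← conjQ_mul δ δ⁻¹, mul_inv_cancel, conjQ_one] at this

theorem eigen_conj {x : Matrix (Fin 2) (Fin 2) ℚ} (n : ℚ) (γ δ : SL(2, ℤ)) :
    eigen (conjQ δ x) n (δ * γ * δ⁻¹) = eigen x n γ := by
  have h1 : scalarPart (δ * γ * δ⁻¹) = scalarPart γ := by
    rw [scalarPart, scalarPart, ratMat_mul, ratMat_mul, Matrix.trace_mul_cycle, ratMat_inv_mul,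
      Matrix.one_mul]
  have h2 : vecPart (conjQ δ x) n (δ * γ * δ⁻¹) = vecPart x n γ := by
    have : ratMat (δ * γ * δ⁻¹) * conjQ δ x = ratMat δ * (ratMat γ * x) * ratMat δ⁻¹ := by
      calc _ = ratMat δ * ratMat γ * (ratMat δ⁻¹ * ratMat δ) * x * ratMat δ⁻¹ := by
            simp only [ratMat_mul, conjQ, Matrix.mul_assoc]
        _ = _ := by rw [ratMat_inv_mul, Matrix.mul_one]; simp only [Matrix.mul_assoc]
    rw [vecPart, vecPart, this, Matrix.trace_mul_cycle, ratMat_inv_mul, Matrix.one_mul]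
  rw [eigen, eigen, h1, h2]

theorem IsGenerator.smul {Γ : Subgroup SL(2, ℤ)} {x : Matrix (Fin 2) (Fin 2) ℚ} {n : ℚ}
    {γ : SL(2, ℤ)} (h : IsGenerator Γ x n γ) {δ : SL(2, ℤ)} (hδ : δ ∈ Γ) :
    IsGenerator Γ (conjQ δ x) n (δ * γ * δ⁻¹) := by
  refine ⟨mul_mem (mul_mem hδ h.mem) (inv_mem hδ), ?_, ?_, fun η hη hη' => ?_⟩
  · rw [conj_mem_vecStab]
    simpa [mul_assoc] using h.mem_vecStab
  · rw [eigen_conj]; exact h.one_lt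
  · obtain ⟨m, hm⟩ := h.generates _ (mul_mem (mul_mem (inv_mem hδ) hη) hδ) (conj_mem_vecStab.1 hη')
    refine ⟨m, ?_⟩
    have e : η = δ * (δ⁻¹ * η * δ) * δ⁻¹ := by group
    rw [conj_zpow]
    rcases hm with hm | hm
    · left; rw [e, hm]
    · right; rw [e, hm]; simp

theorem closedGeodesic_smul {k : ℕ} {Γ : Subgroup SL(2, ℤ)} {F : Dbar → Coeff k}
    (hF : IsIncrementEquivariant Γ F) {x : Matrix (Fin 2) (Fin 2) ℚ} {n : ℚ} (hx : HasNorm x n)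
    {c : Chain k Γ} (hc : IsClosedGeodesicChain Γ x c) {δ : SL(2, ℤ)} (hδ : δ ∈ Γ) :
    ∃ c' : Chain k Γ, IsClosedGeodesicChain Γ (conjQ δ x) c' ∧ period Γ F c' = period Γ F c := by
  obtain ⟨γ, z, hγ, h1, h2, h3⟩ := (isClosedGeodesicChain_iff hx).1 hc
  have hc' : IsClosedGeodesicChain Γ (conjQ δ x) (seg Γ (.inl (δ • z))
      (.inl ((δ * γ * δ⁻¹) • δ • z)) (harmPow k (ratReal (conjQ δ x)))) :=
    (isClosedGeodesicChain_iff (hx.conjQ δ)).2 ⟨_, _, hγ.smul hδ, onGeodesic_smul h1 δ, h2.smul δ, rfl⟩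
  refine ⟨_, hc', ?_⟩
  rw [closedGeodesic_period hF (hx.conjQ δ) (hγ.smul hδ) hc' (δ • .inl z),
    closedGeodesic_period hF hx hγ hc (.inl z), ratReal_conjQ, ← rep_harmPow _ (by
      have := hx.trace
      rw [Matrix.trace_fin_two] at this ⊢
      simp only [ratReal, Matrix.map_apply]
      exact_mod_cast this)]
  have e : (δ * γ * δ⁻¹) • δ • (.inl z : Dbar) = δ • γ • .inl z := by
    rw [← mul_smul, ← mul_smul]; group
  rw [e]
  exact hF.hForm_smul_sub_smul (le_plusMinus Γ hδ) _ _ _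
/-! ### Coverings of closed geodesics -/

/-- The index in a group that is cyclic modulo `K`. -/
theorem relIndex_eq_of_zpow {G : Type*} [Group G] {K S : Subgroup G} {γ : G} {d : ℕ} (hd : 0 < d)
    (hγ : γ ∈ S) (hgen : ∀ s ∈ S, ∃ m : ℤ, (γ ^ m)⁻¹ * s ∈ K)
    (hdvd : ∀ m : ℤ, γ ^ m ∈ K ↔ (d : ℤ) ∣ m) : K.relIndex S = d := by
  let f : Fin d → S ⧸ K.subgroupOf S := fun i =>
    QuotientGroup.mk (⟨γ ^ ((i : ℕ) : ℤ), zpow_mem hγ _⟩ : S)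
  have hf : Function.Bijective f := by
    constructor
    · intro i j hij
      have h1 := QuotientGroup.eq.1 hij
      rw [Subgroup.mem_subgroupOf] at h1
      have h2 : γ ^ (-((i : ℕ) : ℤ) + ((j : ℕ) : ℤ)) ∈ K := by
        rw [_root_.zpow_add, _root_.zpow_neg]; exact h1
      rw [hdvd] at h2
      have h3 := Int.eq_zero_of_abs_lt_dvd h2 (by
        have := i.2
        have := j.2
        rw [abs_lt]
        omega)
      exact Fin.ext (by omega)
    · intro q
      obtain ⟨⟨s, hs⟩, rfl⟩ := QuotientGroup.mk_surjective q
      obtain ⟨m, hm⟩ := hgen s hs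
      have hd' : (0 : ℤ) < d := by exact_mod_cast hd
      refine ⟨⟨(m % d).toNat, ?_⟩, ?_⟩
      · have := Int.emod_lt_of_pos m hd'
        omega
      · refine QuotientGroup.eq.2 ?_
        rw [Subgroup.mem_subgroupOf]
        change (γ ^ (((m % d).toNat : ℕ) : ℤ))⁻¹ * s ∈ K
        rw [Int.toNat_of_nonneg (Int.emod_nonneg m hd'.ne')]
        have e : (γ ^ (m % (d : ℤ)))⁻¹ * s = γ ^ (m - m % d) * ((γ ^ m)⁻¹ * s) := by
          rw [_root_.zpow_sub]; group
        rw [e]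
        refine mul_mem ((hdvd _).2 ?_) hm
        exact Int.dvd_self_sub_emod
  rw [Subgroup.relIndex, Subgroup.index, ← Nat.card_eq_of_bijective f hf, Nat.card_fin]

theorem neg_one_mem_plusMinus (Γ : Subgroup SL(2, ℤ)) : -1 ∈ plusMinus Γ :=
  Subgroup.mem_sup_right (Subgroup.subset_closure rfl)

/-- The closed geodesic of `x` for `Γ'` covers the one for `Γ`, with the index of the isotropy
groups as degree. -/
theorem closedGeodesic_of_le {k : ℕ} {Γ Γ' : Subgroup SL(2, ℤ)} [Γ'.FiniteIndex] (hle : Γ' ≤ Γ)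
    {F : Dbar → Coeff k} (hF : IsIncrementEquivariant Γ F) {x : Matrix (Fin 2) (Fin 2) ℚ} {n : ℚ}
    (hx : HasNorm x n) {c : Chain k Γ} (hc : IsClosedGeodesicChain Γ x c) :
    ∃ c' : Chain k Γ', IsClosedGeodesicChain Γ' x c' ∧
      period Γ' F c' = (plusMinus Γ').relIndex (plusMinus Γ ⊓ vecStab x) * period Γ F c := by
  obtain ⟨γ, z, hγ, h1, h2, -⟩ := (isClosedGeodesicChain_iff hx).1 hc
  obtain ⟨γ', d, hd, hγ', hγd, hdvd⟩ := hγ.exists_pow hle hx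
  have hc' : IsClosedGeodesicChain Γ' x (seg (k := k) Γ' (.inl z) (.inl (γ' • z))
      (harmPow k (ratReal x))) := (isClosedGeodesicChain_iff hx).2 ⟨_, _, hγ', h1, h2, rfl⟩
  refine ⟨_, hc', ?_⟩
  have hfix : ∀ i : ℕ, rep k (γ ^ i)⁻¹ (harmPow k (ratReal x)) = harmPow k (ratReal x) :=
    fun i => rep_harmPow_of_mem_vecStab hx.trace (inv_mem (pow_mem hγ.mem_vecStab i))
  have hd' : (plusMinus Γ').relIndex (plusMinus Γ ⊓ vecStab x) = d := by
    refine relIndex_eq_of_zpow (γ := γ) hd ⟨le_plusMinus Γ hγ.mem, hγ.mem_vecStab⟩ ?_ hdvd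
    rintro s ⟨hs, hs'⟩
    refine plusMinus_induction (Γ := Γ)
      (P := fun s => s ∈ vecStab x → ∃ m : ℤ, (γ ^ m)⁻¹ * s ∈ plusMinus Γ')
      (fun g h hg => ?_) (fun g hg hg' => ?_) hs hs'
    · obtain ⟨m, hm⟩ := h (vecStab_neg hg)
      refine ⟨m, ?_⟩
      have := mul_mem hm (neg_one_mem_plusMinus Γ')
      simpa using this
    · obtain ⟨m, rfl | rfl⟩ := hγ.generates g hg hg'
      · exact ⟨m, by simp [one_mem]⟩
      · exact ⟨m, by simpa using neg_one_mem_plusMinus Γ'⟩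
  rw [hd', closedGeodesic_period (hF.mono hle) hx hγ' hc' (.inl z),
    closedGeodesic_period hF hx hγ hc (.inl z)]
  have e : γ' • (.inl z : Dbar) = γ ^ d • .inl z := by
    rcases hγd with h | h
    · rw [h]
    · rw [h, neg_smul_dbar]
  rw [e, hF.hForm_pow (le_plusMinus Γ hγ.mem), unroll_of_fixed d hfix, hForm_smul_right]

theorem exists_closedGeodesic_of_le {k : ℕ} {Γ Γ' : Subgroup SL(2, ℤ)} (hle : Γ' ≤ Γ)
    {x : Matrix (Fin 2) (Fin 2) ℚ} {n : ℚ}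
    (hx : HasNorm x n) {c' : Chain k Γ'} (hc : IsClosedGeodesicChain Γ' x c') :
    ∃ c : Chain k Γ, IsClosedGeodesicChain Γ x c := by
  obtain ⟨γ', z, hγ', h1, h2, -⟩ := (isClosedGeodesicChain_iff hx).1 hc
  obtain ⟨γ, hγ⟩ := exists_isGenerator hx (hle hγ'.mem) hγ'.mem_vecStab hγ'.one_lt
  exact ⟨_, (isClosedGeodesicChain_iff hx).2 ⟨γ, z, hγ, h1, h2, rfl⟩⟩
/-! ### End points of infinite geodesics -/

/-- The eigenspace of `x` for the eigenvalue `a` is the cusp `σ ∞`, and the geodesic `D_x` ends in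
the boundary point `bdry σ r`: after conjugation by `σ (1, r; 0, 1)`, `x` is diagonal. -/
def IsEnd (x : Matrix (Fin 2) (Fin 2) ℚ) (a : ℝ) (σ : SL(2, ℤ)) (r : ℝ) : Prop :=
  ratReal x = conj (toReal σ * nMat r) !![a, 0; 0, -a]

theorem conj_nMat_diag (r a : ℝ) : conj (nMat r) !![a, 0; 0, -a] = !![a, -(2 * a * r); 0, -a] := by
  rw [conj, coe_nMat_inv, coe_nMat]
  ext i j
  fin_cases i <;> fin_cases j <;> simp [Matrix.mul_apply, Fin.sum_univ_two]
  ring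

theorem trace_ratReal {x : Matrix (Fin 2) (Fin 2) ℚ} (hx : x.trace = 0) :
    (ratReal x).trace = 0 := by
  rw [Matrix.trace_fin_two] at hx ⊢
  simp only [ratReal, Matrix.map_apply]
  exact_mod_cast hx

theorem IsEnd.smul {x : Matrix (Fin 2) (Fin 2) ℚ} {a : ℝ} {σ : SL(2, ℤ)} {r : ℝ}
    (h : IsEnd x a σ r) (δ : SL(2, ℤ)) : IsEnd (conjQ δ x) a (δ * σ) r := by
  rw [IsEnd, ratReal_conjQ, h, ← conj_mul, map_mul toReal, mul_assoc]

theorem conj_inj (g : SL(2, ℝ)) {x y : Matrix (Fin 2) (Fin 2) ℝ} (h : conj g x = conj g y) :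
    x = y := by
  have h1 := congrArg (conj g⁻¹) h
  have h2 : ∀ x : Matrix (Fin 2) (Fin 2) ℝ, conj 1 x = x := fun x => by simp [conj]
  rwa [← conj_mul, ← conj_mul, inv_mul_cancel, h2, h2] at h1

theorem diag_of_conj {κ : SL(2, ℝ)} {a b : ℝ} (ha : a ≠ 0)
    (h : conj κ !![a, 0; 0, -a] = !![b, 0; 0, -b]) :
    (b = a → κ 0 1 = 0 ∧ κ 1 0 = 0) ∧ (b = -a → κ 0 0 = 0 ∧ κ 1 1 = 0) := by
  have h1 : ((κ⁻¹ : SL(2, ℝ)) : Matrix (Fin 2) (Fin 2) ℝ) * (κ : Matrix (Fin 2) (Fin 2) ℝ) = 1 := by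
    rw [← Matrix.SpecialLinearGroup.coe_mul]; simp
  have h2 : (κ : Matrix (Fin 2) (Fin 2) ℝ) * !![a, 0; 0, -a] =
      !![b, 0; 0, -b] * (κ : Matrix (Fin 2) (Fin 2) ℝ) := by
    rw [← h, conj, Matrix.mul_assoc _ _ (κ : Matrix (Fin 2) (Fin 2) ℝ), h1, Matrix.mul_one]
  have e00 := congrFun (congrFun h2 0) 0
  have e01 := congrFun (congrFun h2 0) 1
  have e10 := congrFun (congrFun h2 1) 0
  have e11 := congrFun (congrFun h2 1) 1
  simp [Matrix.mul_apply, Fin.sum_univ_two] at e00 e01 e10 e11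
  constructor
  · rintro rfl
    constructor
    · have : κ 0 1 * b = 0 := by linarith
      exact (mul_eq_zero.1 this).resolve_right ha
    · have : κ 1 0 * b = 0 := by linarith
      exact (mul_eq_zero.1 this).resolve_right ha
  · rintro rfl
    constructor
    · have : κ 0 0 * a = 0 := by linarith
      exact (mul_eq_zero.1 this).resolve_right ha
    · have : κ 1 1 * a = 0 := by linarith
      exact (mul_eq_zero.1 this).resolve_right ha

theorem IsEnd.conj_eq {x : Matrix (Fin 2) (Fin 2) ℚ} {a b : ℝ} {σ σ' : SL(2, ℤ)} {r r' : ℝ}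
    (h : IsEnd x a σ r) (h' : IsEnd x b σ' r') :
    conj ((toReal σ' * nMat r')⁻¹ * (toReal σ * nMat r)) !![a, 0; 0, -a] = !![b, 0; 0, -b] := by
  refine conj_inj (toReal σ' * nMat r') ?_
  rw [← conj_mul, mul_inv_cancel_left, ← h, ← h']

theorem toReal_apply (g : SL(2, ℤ)) (i j : Fin 2) : toReal g i j = (g i j : ℝ) := rfl

theorem toReal_inv_mul_apply (σ σ' : SL(2, ℤ)) (r r' : ℝ) (i j : Fin 2) :
    (((σ⁻¹ * σ') i j : ℤ) : ℝ) =
      (nMat r * ((toReal σ * nMat r)⁻¹ * (toReal σ' * nMat r')) * nMat (-r')) i j := by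
  have e : toReal (σ⁻¹ * σ') =
      nMat r * ((toReal σ * nMat r)⁻¹ * (toReal σ' * nMat r')) * nMat (-r') := by
    rw [nMat_neg, map_mul toReal, map_inv toReal]; group
  rw [← e, toReal_apply]

theorem nMat_mul_mul_nMat_apply (r r' : ℝ) (κ : SL(2, ℝ)) :
    (nMat r * κ * nMat r') 0 0 = κ 0 0 + r * κ 1 0 ∧
    (nMat r * κ * nMat r') 0 1 = (κ 0 0 + r * κ 1 0) * r' + (κ 0 1 + r * κ 1 1) ∧
    (nMat r * κ * nMat r') 1 0 = κ 1 0 ∧ (nMat r * κ * nMat r') 1 1 = κ 1 0 * r' + κ 1 1 := by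
  simp only [Matrix.SpecialLinearGroup.coe_mul, coe_nMat, Matrix.mul_apply, Fin.sum_univ_two]
  simp

theorem eq_T_zpow_or_of_apply_one_zero {τ : SL(2, ℤ)} (h : τ 1 0 = 0) :
    ∃ m : ℤ, (τ = ModularGroup.T ^ m ∨ τ = -ModularGroup.T ^ m) ∧ τ 0 1 = τ 0 0 * m := by
  have hdet := τ.det_coe
  rw [Matrix.det_fin_two, h, mul_zero, sub_zero] at hdet
  rcases Int.mul_eq_one_iff_eq_one_or_neg_one.1 hdet with ⟨h0, h1⟩ | ⟨h0, h1⟩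
  · refine ⟨τ 0 1, Or.inl ?_, by rw [h0, one_mul]⟩
    ext i j
    rw [ModularGroup.coe_T_zpow]
    fin_cases i <;> fin_cases j <;> simp [h, h0, h1]
  · refine ⟨-τ 0 1, Or.inr ?_, by rw [h0]; ring⟩
    ext i j
    rw [Matrix.SpecialLinearGroup.coe_neg, ModularGroup.coe_T_zpow]
    fin_cases i <;> fin_cases j <;> simp [h, h0, h1]

/-- The end point for a given eigenvalue is unique. -/
theorem IsEnd.unique {x : Matrix (Fin 2) (Fin 2) ℚ} {a : ℝ} (ha : a ≠ 0) {σ σ' : SL(2, ℤ)}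
    {r r' : ℝ} (h : IsEnd x a σ r) (h' : IsEnd x a σ' r') : ∃ m : ℤ,
      (σ' = σ * ModularGroup.T ^ m ∨ σ' = -(σ * ModularGroup.T ^ m)) ∧ r = r' + m := by
  obtain ⟨h1, h2⟩ := (diag_of_conj ha (h'.conj_eq h)).1 rfl
  have e := toReal_inv_mul_apply σ σ' r r'
  obtain ⟨e00, e01, e10, e11⟩ :=
    nMat_mul_mul_nMat_apply r (-r') ((toReal σ * nMat r)⁻¹ * (toReal σ' * nMat r'))
  rw [← e, h2] at e00 e01 e10 e11
  rw [h1] at e01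
  set τ := σ⁻¹ * σ' with hτ
  have hσ' : σ' = σ * τ := by rw [hτ, mul_inv_cancel_left]
  have e10' : τ 1 0 = 0 := by exact_mod_cast e10
  obtain ⟨m, hm, hm'⟩ := eq_T_zpow_or_of_apply_one_zero e10'
  refine ⟨m, ?_, ?_⟩
  · rcases hm with hm | hm
    · left; rw [hσ', hm]
    · right; rw [hσ', hm, mul_neg]
  · have hdet := τ.det_coe
    rw [Matrix.det_fin_two, e10', mul_zero, sub_zero] at hdet
    have h3 : (τ 0 1 : ℝ) = τ 0 0 * m := by exact_mod_cast hm'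
    rcases Int.mul_eq_one_iff_eq_one_or_neg_one.1 hdet with ⟨h4, h5⟩ | ⟨h4, h5⟩ <;>
    · rw [h4] at e00 h3
      rw [h5] at e11
      push_cast at e00 h3 e11
      rw [h3, zero_add] at e01
      have e0 := e00.symm
      have e1 := e11.symm
      simp only [mul_zero, zero_mul, add_zero, zero_add] at e0 e1
      rw [e0, e1] at e01
      linarith

/-- The two end points are at different cusps. -/
theorem IsEnd.ne {x : Matrix (Fin 2) (Fin 2) ℚ} {a : ℝ} (ha : a ≠ 0) {σ σ' : SL(2, ℤ)}
    {r r' : ℝ} (h : IsEnd x a σ r) (h' : IsEnd x (-a) σ' r') : (σ⁻¹ * σ') 1 0 ≠ 0 := by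
  have h1 := (diag_of_conj (neg_ne_zero.2 ha) (by
    have := h'.conj_eq h
    rwa [neg_neg] at this ⊢)).2 (neg_neg a).symm
  intro h2
  have e := toReal_inv_mul_apply σ σ' r r'
  obtain ⟨-, -, e10, -⟩ :=
    nMat_mul_mul_nMat_apply r (-r') ((toReal σ * nMat r)⁻¹ * (toReal σ' * nMat r'))
  rw [← e, h2] at e10
  have hdet := ((toReal σ * nMat r)⁻¹ * (toReal σ' * nMat r')).det_coe
  rw [Matrix.det_fin_two, h1.1, ← e10] at hdet
  simp at hdet

/-- The matrix of `x` in the frame at the cusp `σ ∞`. -/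
theorem isEnd_iff_conj {x : Matrix (Fin 2) (Fin 2) ℚ} {a : ℝ} {σ : SL(2, ℤ)} {r : ℝ} :
    IsEnd x a σ r ↔ conj (toReal σ)⁻¹ (ratReal x) = !![a, -(2 * a * r); 0, -a] := by
  have h2 : ∀ x : Matrix (Fin 2) (Fin 2) ℝ, conj 1 x = x := fun x => by simp [conj]
  rw [IsEnd, conj_mul, conj_nMat_diag]
  constructor
  · intro h
    rw [h, ← conj_mul, inv_mul_cancel, h2]
  · intro h
    rw [← h, ← conj_mul, mul_inv_cancel, h2]

theorem IsEnd.sq_eq {x : Matrix (Fin 2) (Fin 2) ℚ} {a : ℝ} {σ : SL(2, ℤ)} {r : ℝ}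
    (h : IsEnd x a σ r) : a ^ 2 = (ratReal x * ratReal x).trace / 2 := by
  have h1 : (ratReal x * ratReal x).trace = (!![a, 0; 0, -a] * !![a, 0; 0, -a]).trace := by
    rw [h, conj_mul_conj, trace_conj]
  rw [h1]
  simp [Matrix.trace_fin_two]
  ring

theorem form_uAt_eq (x : Matrix (Fin 2) (Fin 2) ℚ) (σ : SL(2, ℤ)) :
    form (ratReal x) (uAt σ) = conj (toReal σ)⁻¹ (ratReal x) 1 0 := by
  rw [← form_conj (toReal σ)⁻¹, uAt, ← conj_mul, inv_mul_cancel, show conj 1 uMat = uMat by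
    simp [conj]]
  simp [form, uMat, Matrix.trace_fin_two, Matrix.mul_apply, Fin.sum_univ_two]

theorem onGeodesic_frame_iff (x : Matrix (Fin 2) (Fin 2) ℚ) (σ : SL(2, ℤ)) (r : ℝ) {y : ℝ}
    (hy : 0 < y) : OnGeodesic x (frame σ r y) ↔
      conj (toReal σ)⁻¹ (ratReal x) 1 0 * (r ^ 2 + y ^ 2) = conj (toReal σ)⁻¹ (ratReal x) 0 1 +
        (conj (toReal σ)⁻¹ (ratReal x) 0 0 - conj (toReal σ)⁻¹ (ratReal x) 1 1) * r := by
  have h2 : ∀ x : Matrix (Fin 2) (Fin 2) ℝ, conj 1 x = x := fun x => by simp [conj]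
  have him : 0 < ((r : ℂ) + y * Complex.I).im := by simpa using hy
  rw [OnGeodesic, frame, negVec_smul, ← form_conj (toReal σ)⁻¹, ← conj_mul, inv_mul_cancel, h2,
    negVec, ofComplex_apply_of_im_pos him]
  set X := conj (toReal σ)⁻¹ (ratReal x)
  have h0 : (√2 * y : ℝ) ≠ 0 := by positivity
  rw [form, Matrix.mul_smul, Matrix.trace_smul, smul_eq_mul, mul_eq_zero, inv_eq_zero]
  have hre : (⟨_, him⟩ : ℍ).re = r := by simp [UpperHalfPlane.re]
  have him' : (⟨_, him⟩ : ℍ).im = y := by simp [UpperHalfPlane.im]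
  have hn : Complex.normSq ((⟨_, him⟩ : ℍ) : ℂ) = r ^ 2 + y ^ 2 := by
    rw [Complex.normSq_apply, UpperHalfPlane.coe_re, UpperHalfPlane.coe_im, hre, him']
    ring
  rw [hre, him', hn, or_iff_right h0]
  simp only [Matrix.trace_fin_two, Matrix.mul_apply, Fin.sum_univ_two, Matrix.of_apply,
    Matrix.cons_val', Matrix.cons_val_zero, Matrix.cons_val_one, Matrix.cons_val_fin_one]
  constructor
  · intro h; linear_combination h
  · intro h; linear_combination h

theorem isEnd_iff {x : Matrix (Fin 2) (Fin 2) ℚ} (hx : x.trace = 0) {σ : SL(2, ℤ)} {r : ℝ} :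
    (∃ a, IsEnd x a σ r) ↔ form (ratReal x) (uAt σ) = 0 ∧
      ∀ y : ℝ, 0 < y → OnGeodesic x (frame σ r y) := by
  have htr : conj (toReal σ)⁻¹ (ratReal x) 0 0 + conj (toReal σ)⁻¹ (ratReal x) 1 1 = 0 := by
    rw [← Matrix.trace_fin_two, trace_conj, trace_ratReal hx]
  rw [form_uAt_eq]
  simp only [isEnd_iff_conj]
  constructor
  · rintro ⟨a, ha⟩
    refine ⟨by rw [ha]; simp, fun y hy => (onGeodesic_frame_iff x σ r hy).2 ?_⟩
    rw [ha]
    simp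
    ring
  · rintro ⟨h1, h2⟩
    have h3 := (onGeodesic_frame_iff x σ r one_pos).1 (h2 1 one_pos)
    rw [h1, zero_mul] at h3
    refine ⟨conj (toReal σ)⁻¹ (ratReal x) 0 0, ?_⟩
    ext i j
    fin_cases i <;> fin_cases j
    · rfl
    · change conj (toReal σ)⁻¹ (ratReal x) 0 1 = -(2 * conj (toReal σ)⁻¹ (ratReal x) 0 0 * r)
      linear_combination r * htr - h3
    · exact h1
    · exact eq_neg_of_add_eq_zero_right htr

theorem det_coord {x y z : Matrix (Fin 2) (Fin 2) ℝ} (hx : x.trace = 0) (hy : y.trace = 0)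
    (hz : z.trace = 0) :
    (Matrix.of ![coord x, coord y, coord z]).det = √2 * (x * y * z).trace := by
  have h2 : (√2 : ℝ) ^ 2 = 2 := by norm_num
  have h0 : (√2 : ℝ) ≠ 0 := by positivity
  rw [Matrix.trace_fin_two] at *
  rw [Matrix.det_fin_three]
  have hx' : x 1 1 = -x 0 0 := by linarith
  have hy' : y 1 1 = -y 0 0 := by linarith
  have hz' : z 1 1 = -z 0 0 := by linarith
  simp [coord, Matrix.mul_apply, Fin.sum_univ_two, hx', hy', hz']
  field_simp
  rw [show √2 ^ 4 = (√2 ^ 2) ^ 2 by ring, h2]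
  ring

theorem trace_uMat_mul (τ : SL(2, ℤ)) (a b : ℝ) :
    (uMat * !![a, b; 0, -a] * uAt τ).trace = a * (τ 1 0 : ℝ) ^ 2 := by
  have e : uMat * !![a, b; 0, -a] = !![0, -a; 0, 0] := by
    ext i j
    fin_cases i <;> fin_cases j <;> simp [uMat, Matrix.mul_apply, Fin.sum_univ_two]
  have e1 : (uAt τ) 1 0 = -(τ 1 0 : ℝ) ^ 2 := by
    rw [uAt, conj, Matrix.SpecialLinearGroup.coe_inv, Matrix.adjugate_fin_two, uMat]
    simp only [Matrix.mul_apply, Fin.sum_univ_two, toReal_apply]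
    simp
    ring
  rw [e, Matrix.trace_fin_two]
  simp [Matrix.mul_apply, Fin.sum_univ_two, e1]

theorem trace_mul_mul_swap {x y z : Matrix (Fin 2) (Fin 2) ℝ} (hx : x.trace = 0)
    (hy : y.trace = 0) (hz : z.trace = 0) : (x * y * z).trace = -(z * y * x).trace := by
  rw [Matrix.trace_fin_two] at hx hy hz
  have hx' : x 1 1 = -x 0 0 := by linarith
  have hy' : y 1 1 = -y 0 0 := by linarith
  have hz' : z 1 1 = -z 0 0 := by linarith
  rw [Matrix.trace_fin_two, Matrix.trace_fin_two]
  simp only [Matrix.mul_apply, Fin.sum_univ_two, hx', hy', hz']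
  ring

/-- The orientation of the end points of a geodesic, in terms of the eigenvalue. -/
theorem IsEnd.trace_eq {x : Matrix (Fin 2) (Fin 2) ℚ} {a : ℝ} {σ : SL(2, ℤ)} {r : ℝ}
    (h : IsEnd x a σ r) (σ' : SL(2, ℤ)) :
    (uAt σ * ratReal x * uAt σ').trace = a * ((σ⁻¹ * σ') 1 0 : ℝ) ^ 2 := by
  have h2 : conj 1 uMat = uMat := by simp [conj]
  rw [← trace_conj (toReal σ)⁻¹, ← conj_mul_conj, ← conj_mul_conj, isEnd_iff_conj.1 h,
    ← map_inv toReal, ← uAt_mul, uAt, ← uAt_mul, inv_mul_cancel, map_one, h2, trace_uMat_mul]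

/-- The chains of infinite geodesics, with both end points described by eigenvalues. -/
theorem isSpectacleChain_iff {k : ℕ} {Γ : Subgroup SL(2, ℤ)}
    {x : Matrix (Fin 2) (Fin 2) ℚ} (hx : x.trace = 0) {c : Chain k Γ} :
    IsSpectacleChain Γ x c ↔ ∃ (a : ℝ) (σ σ' : SL(2, ℤ)) (r r' : ℝ) (w w' : Coeff k) (z : ℍ),
      0 < a ∧ IsEnd x a σ r ∧ IsEnd x (-a) σ' r' ∧ OnGeodesic x z ∧ IsGeneric z ∧
      IsCap Γ σ r (harmPow k (ratReal x)) w ∧ IsCap Γ σ' r' (harmPow k (ratReal x)) w' ∧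
      c = seg Γ (.inl z) (.inr (bdry σ r)) (harmPow k (ratReal x))
        - seg Γ (.inl z) (.inr (bdry σ' r')) (harmPow k (ratReal x))
        - circle Γ σ r w + circle Γ σ' r' w' := by
  have hx' := trace_ratReal hx
  have h2 : 0 < √2 := by positivity
  constructor
  · rintro ⟨σ, σ', r, r', w, w', z, h1, h1', hdet, hr, hr', hz⟩
    obtain ⟨a, ha⟩ := (isEnd_iff hx).2 ⟨h1, hr⟩
    obtain ⟨a', ha'⟩ := (isEnd_iff hx).2 ⟨h1', hr'⟩
    rw [det_coord (trace_uAt _) hx' (trace_uAt _)] at hdet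
    have hpos := pos_of_mul_pos_right hdet h2.le
    have e := trace_mul_mul_swap (trace_uAt σ) hx' (trace_uAt σ')
    rw [e, ha'.trace_eq] at hpos
    rw [ha.trace_eq, ha'.trace_eq] at e
    have hs : ((σ'⁻¹ * σ) 1 0 : ℝ) ≠ 0 := by
      intro h
      rw [h] at hpos
      simp at hpos
    have hsgn : ((σ'⁻¹ * σ) 1 0 : ℝ) ^ 2 = ((σ⁻¹ * σ') 1 0 : ℝ) ^ 2 := by
      have : (σ'⁻¹ * σ) 1 0 = -(σ⁻¹ * σ') 1 0 := by
        have : σ'⁻¹ * σ = (σ⁻¹ * σ')⁻¹ := by group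
        rw [this, Matrix.SpecialLinearGroup.coe_inv, Matrix.adjugate_fin_two]
        rfl
      rw [this]
      push_cast
      ring
    have h0 : 0 < ((σ'⁻¹ * σ) 1 0 : ℝ) ^ 2 := by positivity
    rw [← hsgn, ← neg_mul] at e
    have haa' : a' = -a := by linarith [mul_right_cancel₀ h0.ne' e]
    refine ⟨a, σ, σ', r, r', w, w', z, ?_, ha, haa' ▸ ha', hz⟩
    rw [haa'] at hpos
    nlinarith
  · rintro ⟨a, σ, σ', r, r', w, w', z, hapos, ha, ha', hz⟩
    obtain ⟨h1, hr⟩ := (isEnd_iff hx).1 ⟨a, ha⟩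
    obtain ⟨h1', hr'⟩ := (isEnd_iff hx).1 ⟨-a, ha'⟩
    refine ⟨σ, σ', r, r', w, w', z, h1, h1', ?_, hr, hr', hz⟩
    rw [det_coord (trace_uAt _) hx' (trace_uAt _), ha.trace_eq]
    have hs : ((σ⁻¹ * σ') 1 0 : ℝ) ≠ 0 := by exact_mod_cast ha.ne hapos.ne' ha'
    positivity

/-- A vector whose geodesic runs into cusps has trivial isotropy. -/
theorem IsEnd.eq_one_or {x : Matrix (Fin 2) (Fin 2) ℚ} {a : ℝ} (ha : a ≠ 0) {σ : SL(2, ℤ)} {r : ℝ}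
    (h : IsEnd x a σ r) {γ : SL(2, ℤ)} (hγ : γ ∈ vecStab x) : γ = 1 ∨ γ = -1 := by
  have h1 := h.smul γ
  rw [mem_vecStab.1 hγ] at h1
  obtain ⟨m, hm, hr⟩ := h.unique ha h1
  have hm0 : m = 0 := by
    have : (m : ℝ) = 0 := by linarith
    exact_mod_cast this
  rw [hm0, zpow_zero, mul_one] at hm
  rcases hm with hm | hm
  · left; exact mul_eq_right.1 hm
  · right
    exact mul_right_cancel (b := σ) (hm.trans (by simp))

/-! ### Spectacles -/

/-- The contribution of one end of a spectacle to the period. -/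
def endPeriod {k : ℕ} (Γ : Subgroup SL(2, ℤ)) (F : Dbar → Coeff k) (σ : SL(2, ℤ)) (r : ℝ)
    (v w : Coeff k) : ℂ :=
  hForm (F (.inr (bdry σ r))) v -
    hForm (F (.inr (bdry σ (r + width Γ σ))) - F (.inr (bdry σ r))) w

theorem period_spectacle {k : ℕ} (Γ : Subgroup SL(2, ℤ)) (F : Dbar → Coeff k) {σ σ' : SL(2, ℤ)}
    {r r' : ℝ} {v w w' : Coeff k} {z : ℍ} (hz : IsGeneric z) :
    period Γ F (seg Γ (.inl z) (.inr (bdry σ r)) v - seg Γ (.inl z) (.inr (bdry σ' r')) v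
        - circle Γ σ r w + circle Γ σ' r' w') =
      endPeriod Γ F σ r v w - endPeriod Γ F σ' r' v w' := by
  rw [map_add, map_sub, map_sub, period_seg _ _ hz.hasTrivialIsotropy,
    period_seg _ _ hz.hasTrivialIsotropy, period_circle, period_circle, endPeriod, endPeriod,
    hForm_sub_left _ (F (.inl z)), hForm_sub_left _ (F (.inl z))]
  ring

theorem width_neg (Γ : Subgroup SL(2, ℤ)) (σ : SL(2, ℤ)) : width Γ (-σ) = width Γ σ := by
  have := width_mul (neg_one_mem_plusMinus Γ) σ
  rwa [neg_mul, one_mul] at this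

theorem endPeriod_unique {k : ℕ} {Γ : Subgroup SL(2, ℤ)} [Γ.FiniteIndex] (F : Dbar → Coeff k)
    {x : Matrix (Fin 2) (Fin 2) ℚ} {a : ℝ} (ha : a ≠ 0) {σ σ' : SL(2, ℤ)}
    {r r' : ℝ} (h : IsEnd x a σ r) (h' : IsEnd x a σ' r') {v w w' : Coeff k}
    (hw : IsCap Γ σ r v w) (hw' : IsCap Γ σ' r' v w') :
    endPeriod Γ F σ' r' v w' = endPeriod Γ F σ r v w := by
  obtain ⟨m, hm, hr⟩ := h.unique ha h'
  obtain rfl : r' = r - m := by linarith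
  -- the cap depends on the boundary point only
  have key : ∀ w', IsCap Γ (σ * ModularGroup.T ^ m) (r - m) v w' →
      endPeriod Γ F (σ * ModularGroup.T ^ m) (r - m) v w' = endPeriod Γ F σ r v w := by
    intro w' hw'
    rw [hw'.mul_T_zpow.unique hw, endPeriod, endPeriod, width_mul_T_zpow, bdry_mul_T_zpow,
      bdry_mul_T_zpow, sub_add_cancel, show r - m + (width Γ σ : ℝ) + m = r + width Γ σ by ring]
  rcases hm with rfl | rfl
  · exact key w' hw'
  · rw [← key w' hw'.of_neg, endPeriod, endPeriod, width_neg, bdry_neg, bdry_neg]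

theorem spectacle_period_unique {k : ℕ} {Γ : Subgroup SL(2, ℤ)} [Γ.FiniteIndex]
    (F : Dbar → Coeff k) {x : Matrix (Fin 2) (Fin 2) ℚ} (hx : x.trace = 0) {c c' : Chain k Γ}
    (hc : IsSpectacleChain Γ x c) (hc' : IsSpectacleChain Γ x c') :
    period Γ F c' = period Γ F c := by
  obtain ⟨a, σ, σ', r, r', w, w', z, ha, h, h', -, hz, hw, hw', rfl⟩ :=
    (isSpectacleChain_iff hx).1 hc
  obtain ⟨b, τ, τ', s, s', u, u', y, hb, g, g', -, hy, hu, hu', rfl⟩ :=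
    (isSpectacleChain_iff hx).1 hc'
  -- both `a` and `b` are the positive eigenvalue of `x`
  obtain rfl : b = a := by
    have h1 := h.sq_eq
    rw [← g.sq_eq] at h1
    exact ((pow_left_inj₀ ha.le hb.le two_ne_zero).1 h1).symm
  rw [period_spectacle _ _ hz, period_spectacle _ _ hy, endPeriod_unique F ha.ne' h g hw hu,
    endPeriod_unique F (neg_ne_zero.2 ha.ne') h' g' hw' hu']

theorem spectacle_cycle {k : ℕ} {Γ : Subgroup SL(2, ℤ)} [Γ.FiniteIndex]
    {x : Matrix (Fin 2) (Fin 2) ℚ} {c : Chain k Γ} (hc : IsSpectacleChain Γ x c) :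
    (quotientSystem (simplices Γ) (repSub k Γ)).d1
      (pushforward (simplices Γ) (repSub k Γ) c) = 0 := by
  obtain ⟨σ, σ', r, r', w, w', z, -, -, -, -, -, -, hz, hw, hw', rfl⟩ := hc
  rw [map_add, map_sub, map_sub, map_add, map_sub, map_sub,
    d1_pushforward_seg _ hz.hasTrivialIsotropy, d1_pushforward_seg _ hz.hasTrivialIsotropy,
    d1_pushforward_circle, d1_pushforward_circle, hw.1, hw'.1]
  abel

theorem endPeriod_smul {k : ℕ} {Γ : Subgroup SL(2, ℤ)} {F : Dbar → Coeff k}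
    (hF : IsIncrementEquivariant Γ F) {δ : SL(2, ℤ)} (hδ : δ ∈ plusMinus Γ) (σ σ' : SL(2, ℤ))
    (r r' : ℝ) (v w w' : Coeff k) :
    endPeriod Γ F (δ * σ) r (rep k δ v) (rep k δ w) -
        endPeriod Γ F (δ * σ') r' (rep k δ v) (rep k δ w') =
      endPeriod Γ F σ r v w - endPeriod Γ F σ' r' v w' := by
  have e : ∀ σ r, (.inr (bdry (δ * σ) r) : Dbar) = δ • .inr (bdry σ r) := fun _ _ => rfl
  have h1 := hF.hForm_smul_sub_smul hδ (.inr (bdry σ r)) (.inr (bdry σ' r')) v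
  have h2 := hF.hForm_smul_sub_smul hδ (.inr (bdry σ (r + width Γ σ))) (.inr (bdry σ r)) w
  have h3 := hF.hForm_smul_sub_smul hδ (.inr (bdry σ' (r' + width Γ σ'))) (.inr (bdry σ' r')) w'
  rw [endPeriod, endPeriod, endPeriod, endPeriod, width_mul hδ, width_mul hδ, e, e, e, e, h2, h3]
  rw [hForm_sub_left, hForm_sub_left] at h1
  linear_combination h1

theorem spectacle_smul {k : ℕ} {Γ : Subgroup SL(2, ℤ)} {F : Dbar → Coeff k}
    (hF : IsIncrementEquivariant Γ F) {x : Matrix (Fin 2) (Fin 2) ℚ} {n : ℚ} (hx : HasNorm x n)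
    {c : Chain k Γ} (hc : IsSpectacleChain Γ x c) {δ : SL(2, ℤ)} (hδ : δ ∈ Γ) :
    ∃ c' : Chain k Γ, IsSpectacleChain Γ (conjQ δ x) c' ∧ period Γ F c' = period Γ F c := by
  obtain ⟨a, σ, σ', r, r', w, w', z, ha, h, h', hg, hz, hw, hw', rfl⟩ :=
    (isSpectacleChain_iff hx.trace).1 hc
  have hδ' := le_plusMinus Γ hδ
  have hv : harmPow k (ratReal (conjQ δ x)) = rep k δ (harmPow k (ratReal x)) := by
    rw [ratReal_conjQ, rep_harmPow _ (trace_ratReal hx.trace)]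
  refine ⟨_, (isSpectacleChain_iff (hx.conjQ δ).trace).2 ⟨a, δ * σ, δ * σ', r, r', rep k δ w,
    rep k δ w', δ • z, ha, h.smul δ, h'.smul δ, onGeodesic_smul hg δ, hz.smul δ, ?_, ?_, rfl⟩, ?_⟩
  · rw [hv]; exact hw.smul hδ'
  · rw [hv]; exact hw'.smul hδ'
  · rw [period_spectacle _ _ hz, period_spectacle _ _ (hz.smul δ), hv, endPeriod_smul hF hδ']

theorem endPeriod_of_le {k : ℕ} {Γ Γ' : Subgroup SL(2, ℤ)} [Γ.FiniteIndex] {F : Dbar → Coeff k}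
    (hF : IsIncrementEquivariant Γ F) {σ : SL(2, ℤ)} {d : ℕ}
    (hg : cuspGen Γ' σ = cuspGen Γ σ ^ d) (r : ℝ) (v w : Coeff k) :
    endPeriod Γ' F σ r v w = endPeriod Γ F σ r v (unroll k (cuspGen Γ σ) d w) := by
  rw [endPeriod, endPeriod, hF.hForm_bdry_width hg]

/-- A cap for `Γ` gives a cap for `Γ'`, and conversely, with the same contribution to periods. -/
theorem exists_isCap_of_le {k : ℕ} {Γ Γ' : Subgroup SL(2, ℤ)} [Γ.FiniteIndex] [Γ'.FiniteIndex]
    (hle : Γ' ≤ Γ) {F : Dbar → Coeff k} (hF : IsIncrementEquivariant Γ F) (σ : SL(2, ℤ)) (r : ℝ)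
    (v : Coeff k) :
    (∀ w, IsCap Γ σ r v w →
      ∃ w', IsCap Γ' σ r v w' ∧ endPeriod Γ' F σ r v w' = endPeriod Γ F σ r v w) ∧
    ∀ w', IsCap Γ' σ r v w' → ∃ w, IsCap Γ σ r v w := by
  obtain ⟨d, hd, hwid, hg⟩ := exists_width_eq hle σ
  refine ⟨fun w hw => ?_, fun w' hw' => ⟨_, (isCap_iff_unroll hwid hg r v w').1 hw'⟩⟩
  obtain ⟨w', rfl⟩ := (unroll_cuspGen_bijective Γ σ hd).2 w
  exact ⟨w', (isCap_iff_unroll hwid hg r v w').2 hw, endPeriod_of_le hF hg r v w'⟩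

/-- The isotropy group of `x` is contained in `± Γ'`, so the index is `1`; it is written as an index
to match the case of a closed geodesic. -/
theorem spectacle_of_le {k : ℕ} {Γ Γ' : Subgroup SL(2, ℤ)} [Γ.FiniteIndex] [Γ'.FiniteIndex]
    (hle : Γ' ≤ Γ) {F : Dbar → Coeff k} (hF : IsIncrementEquivariant Γ F)
    {x : Matrix (Fin 2) (Fin 2) ℚ} (hx : x.trace = 0) {c : Chain k Γ}
    (hc : IsSpectacleChain Γ x c) :
    ∃ c' : Chain k Γ', IsSpectacleChain Γ' x c' ∧
      period Γ' F c' = (plusMinus Γ').relIndex (plusMinus Γ ⊓ vecStab x) * period Γ F c := by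
  obtain ⟨a, σ, σ', r, r', w, w', z, ha, h, h', hg, hz, hw, hw', rfl⟩ :=
    (isSpectacleChain_iff hx).1 hc
  obtain ⟨u, hu, hp⟩ := (exists_isCap_of_le hle hF σ r _).1 w hw
  obtain ⟨u', hu', hp'⟩ := (exists_isCap_of_le hle hF σ' r' _).1 w' hw'
  refine ⟨_, (isSpectacleChain_iff hx).2 ⟨a, σ, σ', r, r', u, u', z, ha, h, h', hg, hz, hu, hu',
    rfl⟩, ?_⟩
  have hidx : (plusMinus Γ').relIndex (plusMinus Γ ⊓ vecStab x) = 1 := by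
    rw [Subgroup.relIndex_eq_one]
    rintro γ ⟨-, hγ⟩
    rcases h.eq_one_or ha.ne' hγ with rfl | rfl
    · exact one_mem _
    · exact neg_one_mem_plusMinus Γ'
  rw [period_spectacle _ _ hz, period_spectacle _ _ hz, hp, hp', hidx, Nat.cast_one, one_mul]

theorem exists_spectacle_of_le {k : ℕ} {Γ Γ' : Subgroup SL(2, ℤ)} [Γ.FiniteIndex] [Γ'.FiniteIndex]
    (hle : Γ' ≤ Γ) {F : Dbar → Coeff k} (hF : IsIncrementEquivariant Γ F)
    {x : Matrix (Fin 2) (Fin 2) ℚ} (hx : x.trace = 0) {c' : Chain k Γ'}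
    (hc : IsSpectacleChain Γ' x c') : ∃ c : Chain k Γ, IsSpectacleChain Γ x c := by
  obtain ⟨a, σ, σ', r, r', w, w', z, ha, h, h', hg, hz, hw, hw', rfl⟩ :=
    (isSpectacleChain_iff hx).1 hc
  obtain ⟨u, hu⟩ := (exists_isCap_of_le hle hF σ r _).2 w hw
  obtain ⟨u', hu'⟩ := (exists_isCap_of_le hle hF σ' r' _).2 w' hw'
  exact ⟨_, (isSpectacleChain_iff hx).2 ⟨a, σ, σ', r, r', u, u', z, ha, h, h', hg, hz, hu, hu', rfl⟩⟩

theorem not_isSpectacleChain_of_closed {k : ℕ} {Γ : Subgroup SL(2, ℤ)}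
    {x : Matrix (Fin 2) (Fin 2) ℚ} {n : ℚ} (hx : HasNorm x n) {c c' : Chain k Γ}
    (hc : IsClosedGeodesicChain Γ x c) : ¬ IsSpectacleChain Γ x c' := by
  intro hc'
  obtain ⟨γ, z, hγ, -⟩ := (isClosedGeodesicChain_iff hx).1 hc
  obtain ⟨a, σ, σ', r, r', w, w', y, ha, h, -⟩ := (isSpectacleChain_iff hx.trace).1 hc'
  have h1 := hγ.one_lt
  rcases h.eq_one_or ha.ne' hγ.mem_vecStab with rfl | rfl
  · rw [hx.eigen_one] at h1; simp at h1
  · rw [HasNorm.eigen_neg, hx.eigen_one] at h1; simp at h1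
/-! ### Periods of the classes of single vectors -/

/-- The chains that represent the class of `x`. -/
def IsGeodesicChain {k : ℕ} (Γ : Subgroup SL(2, ℤ)) (x : Matrix (Fin 2) (Fin 2) ℚ)
    (c : Chain k Γ) : Prop := IsClosedGeodesicChain Γ x c ∨ IsSpectacleChain Γ x c

theorem geodesic_period_unique {k : ℕ} {Γ : Subgroup SL(2, ℤ)} [Γ.FiniteIndex] {F : Dbar → Coeff k}
    (hF : IsIncrementEquivariant Γ F) {x : Matrix (Fin 2) (Fin 2) ℚ} {n : ℚ} (hx : HasNorm x n)
    {c c' : Chain k Γ} (hc : IsGeodesicChain Γ x c) (hc' : IsGeodesicChain Γ x c') :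
    period Γ F c' = period Γ F c := by
  rcases hc with hc | hc <;> rcases hc' with hc' | hc'
  · obtain ⟨γ, z, hγ, -⟩ := (isClosedGeodesicChain_iff hx).1 hc
    rw [closedGeodesic_period hF hx hγ hc (.inl z), closedGeodesic_period hF hx hγ hc' (.inl z)]
  · exact absurd hc' (not_isSpectacleChain_of_closed hx hc)
  · exact absurd hc (not_isSpectacleChain_of_closed hx hc')
  · exact spectacle_period_unique F hx.trace hc hc'

theorem IsPeriodMap.apply_cycleClass {k : ℕ} {Γ : Subgroup SL(2, ℤ)} [Γ.FiniteIndex]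
    {F : Dbar → Coeff k} (hF : IsIncrementEquivariant Γ F) {Λ : Homology k Γ →ₗ[ℂ] ℂ}
    (hΛ : IsPeriodMap Γ F Λ) {x : Matrix (Fin 2) (Fin 2) ℚ} {n : ℚ} (hx : HasNorm x n)
    {c : Chain k Γ} (hc : IsGeodesicChain Γ x c) : Λ (cycleClass k Γ x) = period Γ F c := by
  have h : ∃ c : Chain k Γ, IsClosedGeodesicChain Γ x c ∨ IsSpectacleChain Γ x c := ⟨c, hc⟩
  rw [cycleClass, dif_pos h, hΛ.apply_homClass]
  · exact geodesic_period_unique hF hx hc h.choose_spec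
  · rcases h.choose_spec with h1 | h1
    · exact closedGeodesic_cycle hx h1
    · exact spectacle_cycle h1

theorem cycleClass_eq_zero {k : ℕ} {Γ : Subgroup SL(2, ℤ)} {x : Matrix (Fin 2) (Fin 2) ℚ}
    (h : ¬ ∃ c : Chain k Γ, IsGeodesicChain Γ x c) : cycleClass k Γ x = 0 := dif_neg h

theorem geodesic_smul {k : ℕ} {Γ : Subgroup SL(2, ℤ)} {F : Dbar → Coeff k}
    (hF : IsIncrementEquivariant Γ F) {x : Matrix (Fin 2) (Fin 2) ℚ} {n : ℚ} (hx : HasNorm x n)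
    {c : Chain k Γ} (hc : IsGeodesicChain Γ x c) {δ : SL(2, ℤ)} (hδ : δ ∈ Γ) :
    ∃ c' : Chain k Γ, IsGeodesicChain Γ (conjQ δ x) c' ∧ period Γ F c' = period Γ F c := by
  rcases hc with hc | hc
  · obtain ⟨c', h, h'⟩ := closedGeodesic_smul hF hx hc hδ
    exact ⟨c', Or.inl h, h'⟩
  · obtain ⟨c', h, h'⟩ := spectacle_smul hF hx hc hδ
    exact ⟨c', Or.inr h, h'⟩

theorem IsPeriodMap.apply_cycleClass_conjQ {k : ℕ} {Γ : Subgroup SL(2, ℤ)} [Γ.FiniteIndex]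
    {F : Dbar → Coeff k} (hF : IsIncrementEquivariant Γ F) {Λ : Homology k Γ →ₗ[ℂ] ℂ}
    (hΛ : IsPeriodMap Γ F Λ) {x : Matrix (Fin 2) (Fin 2) ℚ} {n : ℚ} (hx : HasNorm x n)
    {δ : SL(2, ℤ)} (hδ : δ ∈ plusMinus Γ) :
    Λ (cycleClass k Γ (conjQ δ x)) = Λ (cycleClass k Γ x) := by
  refine plusMinus_induction (Γ := Γ)
    (P := fun δ => Λ (cycleClass k Γ (conjQ δ x)) = Λ (cycleClass k Γ x))
    (fun g h => ?_) (fun g hg => ?_) hδ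
  · rwa [conjQ_neg] at h
  · by_cases h : ∃ c : Chain k Γ, IsGeodesicChain Γ x c
    · obtain ⟨c, hc⟩ := h
      obtain ⟨c', hc', hp⟩ := geodesic_smul hF hx hc hg
      rw [hΛ.apply_cycleClass hF hx hc, hΛ.apply_cycleClass hF (hx.conjQ g) hc', hp]
    · rw [cycleClass_eq_zero h, cycleClass_eq_zero]
      rintro ⟨c, hc⟩
      obtain ⟨c', hc', -⟩ := geodesic_smul hF (hx.conjQ g) hc (inv_mem hg)
      rw [← conjQ_mul, inv_mul_cancel, conjQ_one] at hc'
      exact h ⟨c', hc'⟩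

/-- The period over the class of `x` for `Γ'` is the one for `Γ`, times the index of the isotropy
groups. -/
theorem IsPeriodMap.apply_cycleClass_of_le {k : ℕ} {Γ Γ' : Subgroup SL(2, ℤ)} [Γ.FiniteIndex]
    [Γ'.FiniteIndex] (hle : Γ' ≤ Γ) {F : Dbar → Coeff k} (hF : IsIncrementEquivariant Γ F)
    {Λ : Homology k Γ →ₗ[ℂ] ℂ} (hΛ : IsPeriodMap Γ F Λ) {Λ' : Homology k Γ' →ₗ[ℂ] ℂ}
    (hΛ' : IsPeriodMap Γ' F Λ') {x : Matrix (Fin 2) (Fin 2) ℚ} {n : ℚ} (hx : HasNorm x n) :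
    Λ' (cycleClass k Γ' x) =
      (plusMinus Γ').relIndex (plusMinus Γ ⊓ vecStab x) * Λ (cycleClass k Γ x) := by
  have hF' := hF.mono hle
  by_cases h : ∃ c : Chain k Γ, IsGeodesicChain Γ x c
  · obtain ⟨c, hc⟩ := h
    obtain ⟨c', hc', hp⟩ : ∃ c' : Chain k Γ', IsGeodesicChain Γ' x c' ∧ period Γ' F c' =
        (plusMinus Γ').relIndex (plusMinus Γ ⊓ vecStab x) * period Γ F c := by
      rcases hc with hc | hc
      · obtain ⟨c', h, h'⟩ := closedGeodesic_of_le hle hF hx hc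
        exact ⟨c', Or.inl h, h'⟩
      · obtain ⟨c', h, h'⟩ := spectacle_of_le hle hF hx.trace hc
        exact ⟨c', Or.inr h, h'⟩
    rw [hΛ.apply_cycleClass hF hx hc, hΛ'.apply_cycleClass hF' hx hc', hp]
  · rw [cycleClass_eq_zero h, cycleClass_eq_zero, map_zero, map_zero, mul_zero]
    rintro ⟨c', hc' | hc'⟩
    · obtain ⟨c, hc⟩ := exists_closedGeodesic_of_le hle hx hc'
      exact h ⟨c, Or.inl hc⟩
    · obtain ⟨c, hc⟩ := exists_spectacle_of_le hle hF hx.trace hc'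
      exact h ⟨c, Or.inr hc⟩

/-! ### Sums over orbits of a subgroup -/

/-- If the values `f' x` on `K`-orbits are the values `f x` on orbits of the whole group, times the
index of isotropy groups, then the sums over all orbits differ by the index of `K`. -/
theorem finsum_orbits {G X : Type*} [Group G] [MulAction G X] (K : Subgroup G) [K.FiniteIndex]
    (s t : Setoid X) (hs : ∀ x y, s x y ↔ ∃ g : G, y = g • x)
    (ht : ∀ x y, t x y ↔ ∃ g ∈ K, y = g • x) [Finite (Quotient t)] {f f' : X → ℂ}
    (hf : ∀ (g : G) x, f (g • x) = f x)
    (hf' : ∀ x, f' x = K.relIndex (MulAction.stabilizer G x) * f x) :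
    Finite (Quotient s) ∧
      ∑ᶠ q : Quotient t, f' q.out = K.index * ∑ᶠ q : Quotient s, f q.out := by
  classical
  let p : Quotient t → Quotient s := Quotient.map' id fun x y h => by
    obtain ⟨g, -, h⟩ := (ht x y).1 h
    exact (hs x y).2 ⟨g, h⟩
  have hp : Function.Surjective p := by
    intro q
    induction q using Quotient.inductionOn with
    | h x => exact ⟨Quotient.mk t x, rfl⟩
  have hfin : Finite (Quotient s) := Finite.of_surjective p hp
  refine ⟨hfin, ?_⟩
  have := Fintype.ofFinite (Quotient s)
  have := Fintype.ofFinite (Quotient t)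
  rw [finsum_eq_sum_of_fintype, finsum_eq_sum_of_fintype, Finset.mul_sum,
    ← Finset.sum_fiberwise Finset.univ p]
  refine Finset.sum_congr rfl fun o _ => ?_
  -- the orbit of `x₀ = o.out` is a quotient of the coset space of `K`
  set x₀ := o.out with hx₀
  have hcoset : Finite (Quotient (QuotientGroup.rightRel K)) :=
    Finite.of_equiv _ (QuotientGroup.quotientRightRelEquivQuotientLeftRel K).symm
  have := Fintype.ofFinite (Quotient (QuotientGroup.rightRel K))
  have hcard : Fintype.card (Quotient (QuotientGroup.rightRel K)) = K.index := by
    rw [← Nat.card_eq_fintype_card, Subgroup.index]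
    exact Nat.card_congr (QuotientGroup.quotientRightRelEquivQuotientLeftRel K)
  let φ : Quotient (QuotientGroup.rightRel K) → Quotient t :=
    Quotient.lift (fun g : G => Quotient.mk t (g • x₀)) fun a b h => Quotient.sound <| by
      refine (ht _ _).2 ⟨b * a⁻¹, QuotientGroup.rightRel_apply.1 h, ?_⟩
      rw [mul_smul, inv_smul_smul]
  have hφ : ∀ g : G, φ (Quotient.mk _ g) = Quotient.mk t (g • x₀) := fun _ => rfl
  have hpφ : ∀ u, p (φ u) = o := by
    intro u
    induction u using Quotient.inductionOn with
    | h g =>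
      rw [hφ]
      change Quotient.mk s (g • x₀) = o
      rw [← Quotient.out_eq o]
      exact (Quotient.sound ((hs _ _).2 ⟨g, rfl⟩)).symm
  have hfib : ∀ q : Quotient t, p q = o →
      (Finset.univ.filter fun u => φ u = q).card = K.relIndex (MulAction.stabilizer G q.out) ∧
      f q.out = f x₀ := by
    intro q hq
    obtain ⟨g₀, hg₀⟩ : ∃ g : G, q.out = g • x₀ := by
      refine (hs _ _).1 (Quotient.exact (s := s) ?_)
      rw [hx₀, Quotient.out_eq, ← hq]
      conv_lhs => rw [← Quotient.out_eq q]
      rfl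
    refine ⟨?_, by rw [hg₀, hf]⟩
    rw [Subgroup.relIndex, Subgroup.index, ← Fintype.card_subtype, ← Nat.card_eq_fintype_card]
    let ψ : MulAction.stabilizer G q.out ⧸ K.subgroupOf (MulAction.stabilizer G q.out) →
        {u // φ u = q} :=
      Quotient.lift (fun a => ⟨Quotient.mk _ ((a : G)⁻¹ * g₀), by
        rw [hφ, mul_smul, ← hg₀, show (a : G)⁻¹ • q.out = q.out from (a⁻¹).2, Quotient.out_eq]⟩)
        fun a b h => by
          have h1 := QuotientGroup.leftRel_apply.1 h
          rw [Subgroup.mem_subgroupOf] at h1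
          refine Subtype.ext (Quotient.sound (QuotientGroup.rightRel_apply.2 ?_))
          have e : (b : G)⁻¹ * g₀ * ((a : G)⁻¹ * g₀)⁻¹ =
              ((a⁻¹ * b : MulAction.stabilizer G q.out) : G)⁻¹ := by
            push_cast
            group
          rw [e]
          exact inv_mem h1
    refine (Nat.card_eq_of_bijective ψ ⟨?_, ?_⟩).symm
    · intro a b
      induction a using Quotient.inductionOn with | h a => ?_
      induction b using Quotient.inductionOn with | h b => ?_
      intro hab
      have h1 := QuotientGroup.rightRel_apply.1 (Quotient.exact (congrArg Subtype.val hab))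
      refine Quotient.sound (QuotientGroup.leftRel_apply.2 ?_)
      rw [Subgroup.mem_subgroupOf]
      have e : (b : G)⁻¹ * g₀ * ((a : G)⁻¹ * g₀)⁻¹ =
          ((a⁻¹ * b : MulAction.stabilizer G q.out) : G)⁻¹ := by
        push_cast
        group
      rw [e] at h1
      exact inv_mem_iff.1 h1
    · rintro ⟨u, hu⟩
      induction u using Quotient.inductionOn with | h g => ?_
      rw [hφ] at hu
      have h1 : t (g • x₀) q.out := Quotient.exact (hu.trans (Quotient.out_eq q).symm)
      obtain ⟨κ, hκ, h2⟩ := (ht _ _).1 h1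
      -- `κ g x₀ = g₀ x₀` up to the isotropy group
      have h3 : g₀ * (κ * g)⁻¹ ∈ MulAction.stabilizer G q.out := by
        rw [MulAction.mem_stabilizer_iff]
        conv_lhs => rw [h2, mul_smul, ← mul_smul κ, inv_smul_smul]
        exact hg₀.symm
      refine ⟨Quotient.mk _ ⟨_, h3⟩, Subtype.ext (Quotient.sound (QuotientGroup.rightRel_apply.2 ?_))⟩
      have e : g * (((⟨_, h3⟩ : MulAction.stabilizer G q.out) : G)⁻¹ * g₀)⁻¹ = κ⁻¹ := by
        change g * ((g₀ * (κ * g)⁻¹)⁻¹ * g₀)⁻¹ = κ⁻¹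
        group
      rw [e]
      exact inv_mem hκ
  have e1 : ∀ q ∈ Finset.univ.filter (fun q => p q = o),
      f' q.out = (Finset.univ.filter fun u => φ u = q).card • f x₀ := by
    intro q hq
    obtain ⟨h1, h2⟩ := hfib q (Finset.mem_filter.1 hq).2
    rw [hf', h2, h1, nsmul_eq_mul]
  rw [Finset.sum_congr rfl e1, ← Finset.sum_smul,
    ← Finset.card_eq_sum_card_fiberwise (f := φ) (s := Finset.univ) (fun u _ => by simpa using hpφ u),
    Finset.card_univ, hcard, nsmul_eq_mul]
/-! ### Finiteness of the number of orbits -/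

/-- `N` is a common denominator of the entries of `x`. -/
def IsDenominator (N : ℕ) (x : Matrix (Fin 2) (Fin 2) ℚ) : Prop :=
  ∃ A : Matrix (Fin 2) (Fin 2) ℤ, (N : ℚ) • x = A.map fun m : ℤ => (m : ℚ)

theorem exists_isDenominator (x : Matrix (Fin 2) (Fin 2) ℚ) :
    ∃ N : ℕ, 0 < N ∧ IsDenominator N x := by
  refine ⟨∏ i, ∏ j, (x i j).den, Finset.prod_pos fun i _ => Finset.prod_pos fun j _ => (x i j).pos,
    ?_⟩
  have h : ∀ i j, ∃ m : ℤ, ((∏ i, ∏ j, (x i j).den : ℕ) : ℚ) * x i j = m := by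
    intro i j
    obtain ⟨e, he⟩ : (x i j).den ∣ ∏ i, ∏ j, (x i j).den :=
      (Finset.dvd_prod_of_mem (fun j => (x i j).den) (Finset.mem_univ j)).trans
        (Finset.dvd_prod_of_mem (fun i => ∏ j, (x i j).den) (Finset.mem_univ i))
    refine ⟨e * (x i j).num, ?_⟩
    rw [he]
    push_cast
    have := Rat.den_mul_eq_num (x i j)
    linear_combination (e : ℚ) * this
  choose A hA using h
  exact ⟨Matrix.of A, by ext i j; simpa using hA i j⟩

theorem IsDenominator.mul_left {N : ℕ} {x : Matrix (Fin 2) (Fin 2) ℚ} (h : IsDenominator N x)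
    (M : ℕ) : IsDenominator (M * N) x := by
  obtain ⟨A, hA⟩ := h
  refine ⟨(M : ℤ) • A, ?_⟩
  rw [Nat.cast_mul, mul_smul, hA]
  ext i j
  simp only [Matrix.smul_apply, Matrix.map_apply, smul_eq_mul]
  push_cast
  rfl

theorem IsDenominator.add {N : ℕ} {x y : Matrix (Fin 2) (Fin 2) ℚ} (h : IsDenominator N x)
    (h' : IsDenominator N y) : IsDenominator N (x + y) := by
  obtain ⟨A, hA⟩ := h
  obtain ⟨B, hB⟩ := h'
  refine ⟨A + B, ?_⟩
  rw [smul_add, hA, hB]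
  ext i j
  simp

theorem IsDenominator.neg {N : ℕ} {x : Matrix (Fin 2) (Fin 2) ℚ} (h : IsDenominator N x) :
    IsDenominator N (-x) := by
  obtain ⟨A, hA⟩ := h
  refine ⟨-A, ?_⟩
  rw [smul_neg, hA]
  ext i j
  simp

theorem IsDenominator.conjQ {N : ℕ} {x : Matrix (Fin 2) (Fin 2) ℚ} (h : IsDenominator N x)
    (γ : SL(2, ℤ)) : IsDenominator N (conjQ γ x) := by
  obtain ⟨A, hA⟩ := h
  have e : ∀ A B : Matrix (Fin 2) (Fin 2) ℤ, (A * B).map (fun n : ℤ => (n : ℚ)) =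
      A.map (fun n : ℤ => (n : ℚ)) * B.map (fun n : ℤ => (n : ℚ)) :=
    fun A B => Matrix.map_mul (f := Int.castRingHom ℚ)
  refine ⟨γ * A * (γ⁻¹ : SL(2, ℤ)), ?_⟩
  rw [e, e, ← hA, Spectacle.conjQ, Matrix.mul_smul, Matrix.smul_mul]

/-- The vectors of a coset of a lattice have bounded denominators. -/
theorem exists_isDenominator_coset {L : AddSubgroup (Matrix (Fin 2) (Fin 2) ℚ)} (hL : L.FG)
    (h : Matrix (Fin 2) (Fin 2) ℚ) : ∃ N : ℕ, 0 < N ∧ ∀ x, x - h ∈ L → IsDenominator N x := by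
  obtain ⟨S, hS⟩ := hL
  have h1 : ∀ T : Finset (Matrix (Fin 2) (Fin 2) ℚ),
      ∃ N : ℕ, 0 < N ∧ ∀ x ∈ T, IsDenominator N x := by
    classical
    intro T
    induction T using Finset.induction with
    | empty => exact ⟨1, one_pos, by simp⟩
    | insert a T _ ih =>
      obtain ⟨N, hN, hT⟩ := ih
      obtain ⟨M, hM, ha⟩ := exists_isDenominator a
      refine ⟨M * N, Nat.mul_pos hM hN, fun x hx => ?_⟩
      rcases Finset.mem_insert.1 hx with rfl | hx
      · rw [mul_comm]; exact ha.mul_left N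
      · exact (hT x hx).mul_left M
  obtain ⟨N, hN, hNS⟩ := h1 S
  obtain ⟨M, hM, hMh⟩ := exists_isDenominator h
  have h2 : ∀ x ∈ L, IsDenominator N x := by
    intro x hx
    rw [← hS] at hx
    induction hx using AddSubgroup.closure_induction with
    | mem x hx => exact hNS x hx
    | zero => exact ⟨0, by ext i j; simp⟩
    | add x y _ _ hx hy => exact hx.add hy
    | neg x _ hx => exact hx.neg
  refine ⟨M * N, Nat.mul_pos hM hN, fun x hx => ?_⟩
  rw [← sub_add_cancel x h]
  exact ((h2 _ hx).mul_left M).add (by rw [mul_comm]; exact hMh.mul_left N)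

theorem conjQ_T_zpow {x : Matrix (Fin 2) (Fin 2) ℚ} (hx : x 1 1 = -x 0 0) (m : ℤ) :
    conjQ (ModularGroup.T ^ m) x = !![x 0 0 + m * x 1 0, x 0 1 - 2 * m * x 0 0 - m ^ 2 * x 1 0;
      x 1 0, -(x 0 0 + m * x 1 0)] := by
  rw [conjQ, ← _root_.zpow_neg, ModularGroup.coe_T_zpow, ModularGroup.coe_T_zpow]
  ext i j
  fin_cases i <;> fin_cases j <;> simp [Matrix.mul_apply, Fin.sum_univ_two, hx] <;> ring

theorem conjQ_S {x : Matrix (Fin 2) (Fin 2) ℚ} (hx : x 1 1 = -x 0 0) :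
    conjQ ModularGroup.S x = !![-x 0 0, -x 1 0; -x 0 1, x 0 0] := by
  rw [conjQ, Matrix.SpecialLinearGroup.coe_inv, ModularGroup.coe_S, Matrix.adjugate_fin_two]
  ext i j
  fin_cases i <;> fin_cases j <;> simp [Matrix.mul_apply, Fin.sum_univ_two, hx]

theorem exists_two_mul_abs_add_le (a : ℤ) {c : ℤ} (hc : c ≠ 0) :
    ∃ m : ℤ, 2 * |a + m * c| ≤ |c| := by
  refine ⟨-round ((a : ℚ) / c), ?_⟩
  have h := abs_sub_round ((a : ℚ) / c)
  have hc' : (c : ℚ) ≠ 0 := by exact_mod_cast hc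
  have h1 : |(a : ℚ) + ((-round ((a : ℚ) / c) : ℤ) : ℚ) * c| =
      |(a : ℚ) / c - round ((a : ℚ) / c)| * |(c : ℚ)| := by
    rw [← abs_mul]
    congr 1
    push_cast
    field_simp
    ring
  have h2 : 2 * |(a : ℚ) + ((-round ((a : ℚ) / c) : ℤ) : ℚ) * c| ≤ |(c : ℚ)| := by
    rw [h1]
    nlinarith [abs_nonneg (c : ℚ)]
  exact_mod_cast h2

/-- Bounds for the entries of an integral matrix of positive norm that is reduced. -/
theorem abs_le_of_reduced {a b c D : ℤ} (hD : a ^ 2 + b * c = D) (hD0 : 0 < D)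
    (h : (c ≠ 0 ∧ 2 * |a| ≤ |c| ∧ |c| ≤ |b|) ∨ (c = 0 ∧ 2 * |b| ≤ |2 * a|)) :
    |a| ≤ D ∧ |b| ≤ D ∧ |c| ≤ D := by
  rcases h with ⟨hc, h1, h2⟩ | ⟨rfl, h1⟩
  · have hc1 : 1 ≤ |c| := Int.one_le_abs hc
    have ha : a ^ 2 = |a| ^ 2 := (sq_abs a).symm
    have hbc : b * c = |b| * |c| := by
      rw [← abs_mul]
      refine (abs_of_nonneg ?_).symm
      by_contra hneg
      have h3 : |b * c| = -(b * c) := abs_of_neg (not_le.1 hneg)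
      rw [abs_mul] at h3
      nlinarith [abs_nonneg a]
    have h4 : |b| * |c| ≤ D := by rw [← hD, hbc]; nlinarith [sq_nonneg a]
    have h5 : |b| ≤ D := by nlinarith [abs_nonneg b]
    refine ⟨?_, h5, h2.trans h5⟩
    linarith [abs_nonneg a]
  · rw [mul_zero, add_zero, ← sq_abs] at hD
    rw [abs_mul, abs_two] at h1
    have ha1 : |a| ≤ D := by nlinarith [abs_nonneg a, Int.le_self_sq |a|]
    refine ⟨ha1, by linarith, by simpa using hD0.le⟩

/-- Reduction theory: every vector of positive norm is equivalent to one with bounded entries. -/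
theorem HasNorm.exists_reduced {x : Matrix (Fin 2) (Fin 2) ℚ} {n : ℚ} (hx : HasNorm x n) {N : ℕ}
    (hN : 0 < N) (hd : IsDenominator N x) : ∃ (γ : SL(2, ℤ)) (A : Matrix (Fin 2) (Fin 2) ℤ),
      (N : ℚ) • Spectacle.conjQ γ x = A.map (fun m : ℤ => (m : ℚ)) ∧
        ∀ i j, |(A i j : ℚ)| ≤ N ^ 2 * n := by
  have hN0 : (N : ℚ) ≠ 0 := by exact_mod_cast hN.ne'
  choose A hA using fun γ => hd.conjQ γ
  have hAe : ∀ γ i j, (A γ i j : ℚ) = N * Spectacle.conjQ γ x i j := by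
    intro γ i j
    have := congrFun (congrFun (hA γ) i) j
    simpa using this.symm
  have htr : ∀ γ, A γ 1 1 = -A γ 0 0 := by
    intro γ
    have : (A γ 1 1 : ℚ) = -A γ 0 0 := by rw [hAe, hAe, (hx.conjQ γ).apply_one_one]; ring
    exact_mod_cast this
  have hnorm : ∀ γ, ((A γ 0 0 ^ 2 + A γ 0 1 * A γ 1 0 : ℤ) : ℚ) = N ^ 2 * n := by
    intro γ
    push_cast
    rw [hAe, hAe, hAe]
    linear_combination (N : ℚ) ^ 2 * (hx.conjQ γ).eq
  -- the value of `a ^ 2 + b c` for the integral matrices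
  set D := A 1 0 0 ^ 2 + A 1 0 1 * A 1 1 0 with hDdef
  have hD : ∀ γ, A γ 0 0 ^ 2 + A γ 0 1 * A γ 1 0 = D := by
    intro γ
    have := (hnorm γ).trans (hnorm 1).symm
    exact_mod_cast this
  have hD0 : 0 < D := by
    have : (0 : ℚ) < (D : ℚ) := by
      rw [hnorm 1]
      have := hx.pos
      positivity
    exact_mod_cast this
  have hT : ∀ γ (m : ℤ), A (ModularGroup.T ^ m * γ) 0 0 = A γ 0 0 + m * A γ 1 0 ∧
      A (ModularGroup.T ^ m * γ) 0 1 = A γ 0 1 - 2 * m * A γ 0 0 - m ^ 2 * A γ 1 0 ∧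
      A (ModularGroup.T ^ m * γ) 1 0 = A γ 1 0 := by
    intro γ m
    have h1 : ∀ i j, (A (ModularGroup.T ^ m * γ) i j : ℚ) =
        N * (!![Spectacle.conjQ γ x 0 0 + m * Spectacle.conjQ γ x 1 0,
          Spectacle.conjQ γ x 0 1 - 2 * m * Spectacle.conjQ γ x 0 0 -
            m ^ 2 * Spectacle.conjQ γ x 1 0;
          Spectacle.conjQ γ x 1 0, -(Spectacle.conjQ γ x 0 0 + m * Spectacle.conjQ γ x 1 0)] :
          Matrix (Fin 2) (Fin 2) ℚ) i j := by
      intro i j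
      rw [hAe, conjQ_mul, conjQ_T_zpow (hx.conjQ γ).apply_one_one]
    have h00 := h1 0 0
    have h01 := h1 0 1
    have h10 := h1 1 0
    simp only [Matrix.of_apply, Matrix.cons_val', Matrix.cons_val_zero, Matrix.cons_val_one,
      Matrix.cons_val_fin_one] at h00 h01 h10
    refine ⟨?_, ?_, ?_⟩
    · have : (A (ModularGroup.T ^ m * γ) 0 0 : ℚ) = A γ 0 0 + m * A γ 1 0 := by
        rw [h00, hAe, hAe]; ring
      exact_mod_cast this
    · have : (A (ModularGroup.T ^ m * γ) 0 1 : ℚ) =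
          A γ 0 1 - 2 * m * A γ 0 0 - m ^ 2 * A γ 1 0 := by
        rw [h01, hAe, hAe, hAe]; ring
      exact_mod_cast this
    · have : (A (ModularGroup.T ^ m * γ) 1 0 : ℚ) = A γ 1 0 := by
        rw [h10, hAe]
      exact_mod_cast this
  have hS : ∀ γ, A (ModularGroup.S * γ) 1 0 = -A γ 0 1 := by
    intro γ
    have : (A (ModularGroup.S * γ) 1 0 : ℚ) = -A γ 0 1 := by
      rw [hAe, conjQ_mul, conjQ_S (hx.conjQ γ).apply_one_one, hAe]
      simp
    exact_mod_cast this
  -- minimise the lower left entry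
  obtain ⟨γ, hγ⟩ := Nat.sInf_mem (Set.range_nonempty fun γ => (A γ 1 0).natAbs)
  have hmin : ∀ δ, |A γ 1 0| ≤ |A δ 1 0| := by
    intro δ
    have h1 : (A γ 1 0).natAbs ≤ (A δ 1 0).natAbs := hγ.le.trans (Nat.sInf_le ⟨δ, rfl⟩)
    rw [Int.abs_eq_natAbs, Int.abs_eq_natAbs]
    exact_mod_cast h1
  obtain ⟨δ, hδ⟩ : ∃ δ, (A δ 1 0 ≠ 0 ∧ 2 * |A δ 0 0| ≤ |A δ 1 0| ∧ |A δ 1 0| ≤ |A δ 0 1|) ∨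
      (A δ 1 0 = 0 ∧ 2 * |A δ 0 1| ≤ |2 * A δ 0 0|) := by
    by_cases hc : A γ 1 0 = 0
    · have ha : 2 * A γ 0 0 ≠ 0 := by
        intro h
        have h1 := hD γ
        rw [hc, mul_zero, add_zero, (by omega : A γ 0 0 = 0)] at h1
        simp at h1
        omega
      obtain ⟨m, hm⟩ := exists_two_mul_abs_add_le (A γ 0 1) ha
      obtain ⟨h00, h01, h10⟩ := hT γ (-m)
      rw [hc] at h00 h01 h10
      refine ⟨ModularGroup.T ^ (-m) * γ, Or.inr ⟨h10, ?_⟩⟩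
      rw [h00, h01]
      convert hm using 2
      · congr 1; ring
      · ring
    · obtain ⟨m, hm⟩ := exists_two_mul_abs_add_le (A γ 0 0) hc
      obtain ⟨h00, h01, h10⟩ := hT γ m
      refine ⟨ModularGroup.T ^ m * γ, Or.inl ⟨by rwa [h10], by rwa [h00, h10], ?_⟩⟩
      have := hmin (ModularGroup.S * (ModularGroup.T ^ m * γ))
      rwa [hS, abs_neg, ← h10] at this
  obtain ⟨h1, h2, h3⟩ := abs_le_of_reduced (hD δ) hD0 hδ
  refine ⟨δ, A δ, hA δ, fun i j => ?_⟩
  rw [← hnorm δ, hD δ]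
  have : |A δ i j| ≤ D := by
    fin_cases i <;> fin_cases j
    · exact h1
    · exact h2
    · exact h3
    · change |A δ 1 1| ≤ D
      rw [htr, abs_neg]
      exact h1
  exact_mod_cast this

theorem hasNorm_of_mem {L : AddSubgroup (Matrix (Fin 2) (Fin 2) ℚ)} (hL : IsEvenLattice L)
    {h : Matrix (Fin 2) (Fin 2) ℚ} (hh : h.trace = 0) {n : ℚ} (hn : 0 < n)
    {x : Matrix (Fin 2) (Fin 2) ℚ} (hx : x - h ∈ L) (hx' : (x * x).trace = 2 * n) :
    HasNorm x n := by
  refine ⟨?_, hn, hx'⟩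
  have := (hL.span_eq (x - h)).1 (Submodule.subset_span hx)
  rwa [Matrix.trace_sub, hh, sub_zero] at this

theorem finite_quotient_vecSetoid {L : AddSubgroup (Matrix (Fin 2) (Fin 2) ℚ)}
    (hL : IsEvenLattice L) {h : Matrix (Fin 2) (Fin 2) ℚ} (hh : h.trace = 0) {n : ℚ≥0}
    (hn : 0 < n) (Γ : Subgroup SL(2, ℤ)) [Γ.FiniteIndex] :
    Finite (Quotient (vecSetoid L h n Γ)) := by
  obtain ⟨N, hN, hd⟩ := exists_isDenominator_coset hL.fg h
  have hN0 : (N : ℚ) ≠ 0 := by exact_mod_cast hN.ne'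
  have hn' : 0 < (n : ℚ) := by exact_mod_cast hn
  obtain ⟨B, hB⟩ := exists_nat_ge ((N : ℚ) ^ 2 * n)
  have hred : ∀ q : Quotient (vecSetoid L h n Γ),
      ∃ (γ : SL(2, ℤ)) (A : Fin 2 → Fin 2 → Set.Icc (-(B : ℤ)) B),
      (N : ℚ) • conjQ γ q.out.1 = Matrix.of fun i j => ((A i j : ℤ) : ℚ) := by
    intro q
    obtain ⟨γ, A, hA, hA'⟩ := (hasNorm_of_mem hL hh hn' q.out.2.1 q.out.2.2).exists_reduced hN
      (hd _ q.out.2.1)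
    refine ⟨γ, fun i j => ⟨A i j, ?_⟩, hA⟩
    have : |A i j| ≤ (B : ℤ) := by exact_mod_cast (hA' i j).trans hB
    exact abs_le.1 this
  choose γ A hA using hred
  refine Finite.of_injective (β := (Fin 2 → Fin 2 → Set.Icc (-(B : ℤ)) B) × (SL(2, ℤ) ⧸ Γ))
    (fun q => (A q, QuotientGroup.mk (γ q))) fun q q' hqq' => ?_
  obtain ⟨h1, h2⟩ := Prod.ext_iff.1 hqq'
  simp only at h1 h2
  have h3 : conjQ (γ q) q.out.1 = conjQ (γ q') q'.out.1 := by
    refine smul_right_injective _ hN0 ?_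
    simp only [hA, h1]
  rw [← Quotient.out_eq q, ← Quotient.out_eq q']
  refine (Quotient.sound (show vecSetoid L h n Γ q'.out q.out from
    ⟨(γ q)⁻¹ * γ q', QuotientGroup.eq.1 h2, ?_⟩)).symm
  rw [conjQ_mul, ← h3, ← conjQ_mul, inv_mul_cancel, conjQ_one]

/-! ### The classes of positive norm -/

theorem exists_mem_iff_plusMinus {Γ : Subgroup SL(2, ℤ)} {x y : Matrix (Fin 2) (Fin 2) ℚ} :
    (∃ γ ∈ Γ, y = conjQ γ x) ↔ ∃ γ ∈ plusMinus Γ, y = conjQ γ x := by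
  constructor
  · rintro ⟨γ, hγ, h⟩
    exact ⟨γ, le_plusMinus Γ hγ, h⟩
  · rintro ⟨γ, hγ, h⟩
    refine plusMinus_induction (Γ := Γ) (P := fun γ => y = conjQ γ x → ∃ γ ∈ Γ, y = conjQ γ x)
      (fun g hg => ?_) (fun g hg hg' => ⟨g, hg, hg'⟩) hγ h
    rwa [conjQ_neg] at hg

theorem trace_conjQ_mul_self (γ : SL(2, ℤ)) (x : Matrix (Fin 2) (Fin 2) ℚ) :
    (conjQ γ x * conjQ γ x).trace = (x * x).trace := by
  have : conjQ γ x * conjQ γ x = ratMat γ * (x * x) * ratMat γ⁻¹ := by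
    calc _ = ratMat γ * x * (ratMat γ⁻¹ * ratMat γ) * x * ratMat γ⁻¹ := by
          simp only [conjQ, Matrix.mul_assoc]
      _ = _ := by rw [ratMat_inv_mul, Matrix.mul_one]; simp only [Matrix.mul_assoc]
  rw [this, Matrix.trace_mul_cycle, ratMat_inv_mul, Matrix.one_mul]

/-- The action of `± Γ` on the vectors of `L + h` of a given norm. -/
abbrev vecAction {L : AddSubgroup (Matrix (Fin 2) (Fin 2) ℚ)} {h : Matrix (Fin 2) (Fin 2) ℚ}
    {Γ : Subgroup SL(2, ℤ)}
    (hΓL : ∀ γ ∈ Γ, ∀ x : Matrix (Fin 2) (Fin 2) ℚ, x - h ∈ L → conjQ γ x - h ∈ L) (n : ℚ≥0) :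
    MulAction (plusMinus Γ)
      {x : Matrix (Fin 2) (Fin 2) ℚ // x - h ∈ L ∧ (x * x).trace = 2 * n} where
  smul γ x := ⟨conjQ γ x.1, conjQ_coset_plusMinus hΓL γ.1 γ.2 x.1 x.2.1, by
    rw [trace_conjQ_mul_self, x.2.2]⟩
  one_smul x := Subtype.ext (conjQ_one x.1)
  mul_smul γ δ x := Subtype.ext (conjQ_mul γ.1 δ.1 x.1)

theorem apply_specialClass_pos {k : ℕ} {L : AddSubgroup (Matrix (Fin 2) (Fin 2) ℚ)}
    {h : Matrix (Fin 2) (Fin 2) ℚ} {Γ : Subgroup SL(2, ℤ)} {n : ℚ≥0} (hn : n ≠ 0)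
    [Finite (Quotient (vecSetoid L h n Γ))] (Λ : Homology k Γ →ₗ[ℂ] ℂ) :
    Λ (specialClass k L h Γ n) =
      ∑ᶠ q : Quotient (vecSetoid L h n Γ), Λ (cycleClass k Γ q.out.1) := by
  have := Fintype.ofFinite (Quotient (vecSetoid L h n Γ))
  rw [specialClass, if_neg hn, finsum_eq_sum_of_fintype, finsum_eq_sum_of_fintype, map_sum]

/-- The period of a single vector is multiplied by an index of isotropy groups, and summing over
orbits turns these indices into the index of `± Γ'` in `± Γ`. -/
theorem apply_specialClass_pos_of_le {k : ℕ} {L : AddSubgroup (Matrix (Fin 2) (Fin 2) ℚ)}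
    (hL : IsEvenLattice L) {h : Matrix (Fin 2) (Fin 2) ℚ} (hh : h.trace = 0)
    {Γ Γ' : Subgroup SL(2, ℤ)} [Γ.FiniteIndex] [Γ'.FiniteIndex] (hle : Γ' ≤ Γ)
    (hΓL : ∀ γ ∈ Γ, ∀ x : Matrix (Fin 2) (Fin 2) ℚ, x - h ∈ L → conjQ γ x - h ∈ L)
    {n : ℚ≥0} (hn : n ≠ 0) {F : Dbar → Coeff k} (hF : IsIncrementEquivariant Γ F)
    {Λ : Homology k Γ →ₗ[ℂ] ℂ} (hΛ : IsPeriodMap Γ F Λ)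
    {Λ' : Homology k Γ' →ₗ[ℂ] ℂ} (hΛ' : IsPeriodMap Γ' F Λ') :
    Λ' (specialClass k L h Γ' n) =
      (plusMinus Γ').relIndex (plusMinus Γ) * Λ (specialClass k L h Γ n) := by
  have hn' : 0 < n := pos_iff_ne_zero.2 hn
  have hnq : 0 < (n : ℚ) := by exact_mod_cast hn'
  have h1 := finite_quotient_vecSetoid hL hh hn' Γ
  have h2 := finite_quotient_vecSetoid hL hh hn' Γ'
  rw [apply_specialClass_pos hn, apply_specialClass_pos hn]
  let _ := vecAction hΓL n
  have hle' := plusMinus_mono hle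
  refine (finsum_orbits ((plusMinus Γ').subgroupOf (plusMinus Γ)) (vecSetoid L h n Γ)
    (vecSetoid L h n Γ') (fun x y => ?_) (fun x y => ?_)
    (f := fun x => Λ (cycleClass k Γ x.1)) (f' := fun x => Λ' (cycleClass k Γ' x.1))
    (fun g x => ?_) fun x => ?_).2
  · refine exists_mem_iff_plusMinus.trans ⟨?_, ?_⟩
    · rintro ⟨γ, hγ, e⟩
      exact ⟨⟨γ, hγ⟩, Subtype.ext e⟩
    · rintro ⟨γ, e⟩
      exact ⟨γ.1, γ.2, congrArg Subtype.val e⟩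
  · refine exists_mem_iff_plusMinus.trans ⟨?_, ?_⟩
    · rintro ⟨γ, hγ, e⟩
      exact ⟨⟨γ, hle' hγ⟩, hγ, Subtype.ext e⟩
    · rintro ⟨γ, hγ, e⟩
      exact ⟨γ.1, hγ, congrArg Subtype.val e⟩
  · exact hΛ.apply_cycleClass_conjQ hF (hasNorm_of_mem hL hh hnq x.2.1 x.2.2) g.2
  · have e : MulAction.stabilizer (plusMinus Γ) x =
        (plusMinus Γ ⊓ vecStab x.1).subgroupOf (plusMinus Γ) := by
      ext g
      rw [MulAction.mem_stabilizer_iff, Subgroup.mem_subgroupOf, Subgroup.mem_inf, mem_vecStab]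
      exact ⟨fun hg => ⟨g.2, congrArg Subtype.val hg⟩, fun hg => Subtype.ext hg.2⟩
    rw [e, Subgroup.relIndex_subgroupOf inf_le_left]
    exact IsPeriodMap.apply_cycleClass_of_le hle hF hΛ hΛ' (hasNorm_of_mem hL hh hnq x.2.1 x.2.2)
/-! ### Howe operators and rotations -/

/-- The rotation of the first two coordinates by the angle with cosine `P` and sine `Q`. -/
def rot (P Q : ℝ) : (Fin 3 → ℝ) →L[ℝ] (Fin 3 → ℝ) :=
  LinearMap.toContinuousLinearMap (Matrix.toLin' !![P, -Q, 0; Q, P, 0; 0, 0, 1])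

theorem rot_apply (P Q : ℝ) (x : Fin 3 → ℝ) :
    rot P Q x = ![P * x 0 - Q * x 1, Q * x 0 + P * x 1, x 2] := by
  change Matrix.toLin' !![P, -Q, 0; Q, P, 0; 0, 0, 1] x = _
  rw [Matrix.toLin'_apply]
  ext i
  fin_cases i <;> simp [Matrix.mulVec, dotProduct, Fin.sum_univ_three]
  ring

/-- The matrix of the rotation in the first two coordinates. -/
def rotMat (P Q : ℝ) : Matrix (Fin 2) (Fin 2) ℝ := !![P, -Q; Q, P]

theorem rot_apply_castSucc (P Q : ℝ) (x : Fin 3 → ℝ) (j : Fin 2) :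
    rot P Q x j.castSucc = ∑ i : Fin 2, rotMat P Q j i * x i.castSucc := by
  rw [rot_apply, Fin.sum_univ_two]
  fin_cases j <;> simp [rotMat]
  ring

theorem sum_rotMat_rot_single {P Q : ℝ} (h : P ^ 2 + Q ^ 2 = 1) (j : Fin 2) :
    ∑ i : Fin 2, rotMat P Q j i • rot P Q (Pi.single i.castSucc 1) = Pi.single j.castSucc 1 := by
  rw [Fin.sum_univ_two, rot_apply, rot_apply]
  ext l
  fin_cases j <;> fin_cases l <;> simp [rotMat] <;>
    first | ring1 | linear_combination h

/-- The Howe operators are equivariant under rotations. -/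
theorem howe_rot {P Q : ℝ} (h : P ^ 2 + Q ^ 2 = 1) {f : (Fin 3 → ℝ) → ℝ} (hf : Differentiable ℝ f)
    (j : Fin 2) (x : Fin 3 → ℝ) : howe j.castSucc f (rot P Q x) =
      ∑ i : Fin 2, rotMat P Q j i * howe i.castSucc (f ∘ rot P Q) x := by
  have h1 : fderiv ℝ (f ∘ rot P Q) x = (fderiv ℝ f (rot P Q x)).comp (rot P Q) := by
    rw [fderiv_comp _ hf.differentiableAt (rot P Q).differentiableAt, (rot P Q).fderiv]
  have h2 : fderiv ℝ f (rot P Q x) (Pi.single j.castSucc 1) =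
      ∑ i : Fin 2, rotMat P Q j i * fderiv ℝ f (rot P Q x) (rot P Q (Pi.single i.castSucc 1)) := by
    conv_lhs => rw [← sum_rotMat_rot_single h j, map_sum]
    exact Finset.sum_congr rfl fun i _ => by rw [map_smul, smul_eq_mul]
  simp only [howe, h1, ContinuousLinearMap.comp_apply, h2, rot_apply_castSucc, Function.comp_apply,
    Finset.sum_mul, Finset.mul_sum, ← Finset.sum_sub_distrib]
  exact Finset.sum_congr rfl fun i _ => by ring

theorem howe_sum {ι : Type*} (s : Finset ι) (c : ι → ℝ) {f : ι → (Fin 3 → ℝ) → ℝ}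
    (hf : ∀ i ∈ s, Differentiable ℝ (f i)) (j : Fin 3) :
    howe j (fun x => ∑ i ∈ s, c i * f i x) = fun x => ∑ i ∈ s, c i * howe j (f i) x := by
  funext x
  have h1 : fderiv ℝ (fun x => ∑ i ∈ s, c i * f i x) x = ∑ i ∈ s, c i • fderiv ℝ (f i) x := by
    refine (HasFDerivAt.fun_sum fun i hi => ?_).fderiv
    exact ((hf i hi).differentiableAt (x := x)).hasFDerivAt.const_mul (c i)
  simp only [howe, h1, _root_.sum_apply, Finset.mul_sum, ← Finset.sum_sub_distrib]
  refine Finset.sum_congr rfl fun i _ => ?_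
  rw [_root_.smul_apply, smul_eq_mul]
  ring

theorem contDiff_howe {f : (Fin 3 → ℝ) → ℝ} (hf : ContDiff ℝ ∞ f) (j : Fin 3) :
    ContDiff ℝ ∞ (howe j f) := by
  have h1 : ContDiff ℝ ∞ (fderiv ℝ f) := hf.fderiv_right (by norm_cast)
  have h2 : ContDiff ℝ ∞ fun x => fderiv ℝ f x (Pi.single j 1) := h1.clm_apply contDiff_const
  exact ((contDiff_apply ℝ ℝ j).mul hf).sub (contDiff_const.mul h2)

theorem contDiff_gauss : ContDiff ℝ ∞ gauss := by
  unfold gauss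
  fun_prop

/-- The functions `D_{β₁} ⋯ D_{β_m} φ₀`, for indices in the first two coordinates. -/
def howeGauss {m : ℕ} (β : Fin m → Fin 2) : (Fin 3 → ℝ) → ℝ :=
  (List.ofFn fun i => (β i).castSucc).foldr howe gauss

theorem howeGauss_cons {m : ℕ} (a : Fin 2) (β : Fin m → Fin 2) :
    howeGauss (Fin.cons a β : Fin (m + 1) → Fin 2) = howe a.castSucc (howeGauss β) := by
  simp [howeGauss, List.ofFn_succ]

theorem contDiff_howeGauss {m : ℕ} (β : Fin m → Fin 2) : ContDiff ℝ ∞ (howeGauss β) := by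
  have : ∀ l : List (Fin 3), ContDiff ℝ ∞ (l.foldr howe gauss) := by
    intro l
    induction l with
    | nil => exact contDiff_gauss
    | cons a l ih => exact contDiff_howe ih a
  exact this _

theorem differentiable_howeGauss {m : ℕ} (β : Fin m → Fin 2) : Differentiable ℝ (howeGauss β) :=
  (contDiff_howeGauss β).differentiable (by simp)

theorem gauss_rot {P Q : ℝ} (h : P ^ 2 + Q ^ 2 = 1) (x : Fin 3 → ℝ) :
    gauss (rot P Q x) = gauss x := by
  rw [gauss, gauss, rot_apply]
  congr 2
  simp only [Matrix.cons_val_zero, Matrix.cons_val_one, Matrix.cons_val]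
  linear_combination (x 0 ^ 2 + x 1 ^ 2) * h

theorem howeGauss_rot {P Q : ℝ} (h : P ^ 2 + Q ^ 2 = 1) {m : ℕ} (β : Fin m → Fin 2) :
    howeGauss β ∘ rot P Q = fun x =>
      ∑ β' : Fin m → Fin 2, (∏ i, rotMat P Q (β i) (β' i)) * howeGauss β' x := by
  induction m with
  | zero =>
    funext x
    simp [howeGauss, gauss_rot h]
  | succ m ih =>
    obtain ⟨a, β, rfl⟩ : ∃ a β', β = Fin.cons a β' := ⟨β 0, Fin.tail β, (Fin.cons_self_tail β).symm⟩
    funext x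
    rw [Function.comp_apply, howeGauss_cons, howe_rot h (differentiable_howeGauss β), ih,
      ← (Fin.consEquiv fun _ => Fin 2).sum_comp, Fintype.sum_prod_type]
    refine Finset.sum_congr rfl fun b _ => ?_
    rw [howe_sum _ _ fun β' _ => differentiable_howeGauss β', Finset.mul_sum]
    refine Finset.sum_congr rfl fun β' _ => ?_
    change _ = (∏ i, rotMat P Q ((Fin.cons a β : Fin (m + 1) → Fin 2) i)
      ((Fin.cons b β' : Fin (m + 1) → Fin 2) i)) *
        howeGauss (Fin.cons b β' : Fin (m + 1) → Fin 2) x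
    rw [howeGauss_cons, Fin.prod_univ_succ]
    simp only [Fin.cons_zero, Fin.cons_succ]
    ring

/-! ### Rotations of frames -/

theorem coord_conj_rotation {κ : SL(2, ℝ)} (h1 : κ 1 1 = κ 0 0) (h2 : κ 1 0 = -κ 0 1)
    (x : Matrix (Fin 2) (Fin 2) ℝ) : coord (conj κ x) =
      rot (κ 0 0 ^ 2 - κ 0 1 ^ 2) (2 * κ 0 0 * κ 0 1) (coord x) := by
  have hd := κ.det_coe
  rw [Matrix.det_fin_two, h1, h2] at hd
  have e : conj κ x =
      !![κ 0 0 * (κ 0 0 * x 0 0 + κ 0 1 * x 1 0) + κ 0 1 * (κ 0 0 * x 0 1 + κ 0 1 * x 1 1),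
      -κ 0 1 * (κ 0 0 * x 0 0 + κ 0 1 * x 1 0) + κ 0 0 * (κ 0 0 * x 0 1 + κ 0 1 * x 1 1);
      κ 0 0 * (-κ 0 1 * x 0 0 + κ 0 0 * x 1 0) + κ 0 1 * (-κ 0 1 * x 0 1 + κ 0 0 * x 1 1),
      -κ 0 1 * (-κ 0 1 * x 0 0 + κ 0 0 * x 1 0) + κ 0 0 * (-κ 0 1 * x 0 1 + κ 0 0 * x 1 1)] := by
    rw [conj, Matrix.SpecialLinearGroup.coe_inv, Matrix.adjugate_fin_two]
    ext i j
    fin_cases i <;> fin_cases j <;>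
      simp [Matrix.mul_apply, Fin.sum_univ_two, h1, h2] <;> ring
  rw [rot_apply, e]
  ext i
  fin_cases i
  · simp [coord]; ring
  · simp [coord]; ring
  · simp [coord]
    linear_combination (x 0 1 - x 1 0) * hd

theorem cos_sin_rotation {κ : SL(2, ℝ)} (h1 : κ 1 1 = κ 0 0) (h2 : κ 1 0 = -κ 0 1) :
    (κ 0 0 ^ 2 - κ 0 1 ^ 2) ^ 2 + (2 * κ 0 0 * κ 0 1) ^ 2 = 1 := by
  have hd := κ.det_coe
  rw [Matrix.det_fin_two, h1, h2] at hd
  linear_combination (κ 0 0 * κ 0 0 - κ 0 1 * -κ 0 1 + 1) * hd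

theorem adMatrix_rotation {κ : SL(2, ℝ)} (h1 : κ 1 1 = κ 0 0) (h2 : κ 1 0 = -κ 0 1) (j : Fin 2) :
    (∀ i : Fin 2, adMatrix κ i.castSucc j.castSucc =
      (rotMat (κ 0 0 ^ 2 - κ 0 1 ^ 2) (2 * κ 0 0 * κ 0 1) i j : ℂ)) ∧
      adMatrix κ 2 j.castSucc = 0 := by
  have hc : coord (basisMat j.castSucc) = Pi.single j.castSucc 1 := by
    have : basisMat j.castSucc = ∑ l, (Pi.single j.castSucc (1 : ℝ) : Fin 3 → ℝ) l • basisMat l := by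
      simp [Pi.single_apply]
    rw [this, coord_sum]
  constructor
  · intro i
    rw [adMatrix, Matrix.of_apply, coord_conj_rotation h1 h2, hc, rot_apply_castSucc,
      Finset.sum_eq_single j (fun l _ hl => by
        rw [Pi.single_eq_of_ne (by simpa using hl), mul_zero]) (by simp)]
    simp
  · rw [adMatrix, Matrix.of_apply, coord_conj_rotation h1 h2, hc, rot_apply]
    fin_cases j <;> simp

/-- A rotation acts on the tensors in the first two basis vectors by the rotation matrix. -/
theorem harmRep_rotation {k : ℕ} {κ : SL(2, ℝ)} (h1 : κ 1 1 = κ 0 0) (h2 : κ 1 0 = -κ 0 1)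
    (β : Fin k → Fin 2) :
    harmRep k κ (harmProj k (Pi.single (fun i => (β i).castSucc) 1)) =
      ∑ β' : Fin k → Fin 2,
        ((∏ i, rotMat (κ 0 0 ^ 2 - κ 0 1 ^ 2) (2 * κ 0 0 * κ 0 1) (β' i) (β i) : ℝ) : ℂ) •
          harmProj k (Pi.single (fun i => (β' i).castSucc) 1) := by
  rw [← harmProj_tensorAct]
  simp only [← map_smul, ← map_sum]
  congr 1
  ext δ
  rw [tensorAct_apply, Finset.sum_eq_single (fun i => (β i).castSucc)
    (fun l _ hl => by rw [Pi.single_eq_of_ne hl, mul_zero]) (by simp), Pi.single_eq_same, mul_one,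
    Finset.sum_apply]
  simp only [Pi.smul_apply, smul_eq_mul]
  by_cases hδ : ∃ β' : Fin k → Fin 2, δ = fun i => (β' i).castSucc
  · obtain ⟨β', rfl⟩ := hδ
    rw [Finset.sum_eq_single β' (fun l _ hl => by
      rw [Pi.single_eq_of_ne, mul_zero]
      intro e
      exact hl (funext fun i => (Fin.castSucc_injective 2 (congrFun e i)).symm)) (by simp),
      Pi.single_eq_same, mul_one]
    push_cast
    exact Finset.prod_congr rfl fun i _ => (adMatrix_rotation h1 h2 (β i)).1 (β' i)
  · rw [Finset.sum_eq_zero fun β' _ => by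
      rw [Pi.single_eq_of_ne (fun e => hδ ⟨β', e⟩), mul_zero]]
    obtain ⟨i, hi⟩ : ∃ i, δ i = 2 := by
      by_contra hne
      push Not at hne
      refine hδ ⟨fun i => (δ i).castPred (hne i), ?_⟩
      simp
    refine Finset.prod_eq_zero (Finset.mem_univ i) ?_
    rw [hi]
    exact (adMatrix_rotation h1 h2 (β i)).2
/-! ### Equivariance of the theta form -/

theorem denom_rotation {γ : SL(2, ℤ)} {z : ℍ} {κ : SL(2, ℝ)} (h1 : κ 1 1 = κ 0 0)
    (h2 : κ 1 0 = -κ 0 1) (h : toReal γ * gMat z = gMat (γ • z) * κ) :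
    denom γ z ^ 2 = ((z.im / (γ • z).im : ℝ) : ℂ) * (κ 0 0 - κ 0 1 * Complex.I) ^ 2 := by
  have hy := z.im_pos
  have hy' := (γ • z).im_pos
  set y' := (γ • z).im with hy'def
  have hs : √z.im ^ 2 = z.im := Real.sq_sqrt hy.le
  have hs' : √y' ^ 2 = y' := Real.sq_sqrt hy'.le
  have h0 : √z.im ≠ 0 := (Real.sqrt_pos.2 hy).ne'
  have h0' : √y' ≠ 0 := (Real.sqrt_pos.2 hy').ne'
  have hm := congrArg (fun g : SL(2, ℝ) => (g : Matrix (Fin 2) (Fin 2) ℝ)) h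
  simp only [Matrix.SpecialLinearGroup.coe_mul] at hm
  have e0 := congrFun (congrFun hm 1) 0
  have e1 := congrFun (congrFun hm 1) 1
  simp only [Matrix.mul_apply, Fin.sum_univ_two, toReal_apply, h1, h2] at e0 e1
  simp only [gMat, ← hy'def] at e0 e1
  simp at e0 e1
  have hc : ((γ 1 0 : ℤ) : ℝ) = -κ 0 1 / (√z.im * √y') := by
    field_simp
    field_simp at e0
    linarith
  have hd : ((γ 1 1 : ℤ) : ℝ) = κ 0 0 * √z.im / √y' - (γ 1 0 : ℤ) * z.re := by
    field_simp
    field_simp at e1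
    linarith
  have hz : (z : ℂ) = z.re + z.im * Complex.I := (Complex.re_add_im (z : ℂ)).symm
  have e : denom γ z = ((√z.im / √y' : ℝ) : ℂ) * (κ 0 0 - κ 0 1 * Complex.I) := by
    have e2 : denom γ z = ((γ 1 0 : ℤ) : ℝ) * (z : ℂ) + ((γ 1 1 : ℤ) : ℝ) := by
      simp [ModularGroup.denom_apply]
    have e3 : ((γ 1 0 : ℤ) : ℝ) * z.im = -κ 0 1 * (√z.im / √y') := by
      rw [hc]
      field_simp
      rw [hs]
    rw [e2, hd, hz]
    have e3' : (((γ 1 0 : ℤ) : ℝ) : ℂ) * z.im = -κ 0 1 * ((√z.im / √y' : ℝ) : ℂ) := by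
      exact_mod_cast e3
    push_cast at e3' ⊢
    linear_combination Complex.I * e3'
  rw [e, mul_pow, ← Complex.ofReal_pow, div_pow, hs, hs']

/-- The invariant forms transform by the rotation of frames. -/
theorem invForm_smul {γ : SL(2, ℤ)} {z : ℍ} {κ : SL(2, ℝ)} (h1 : κ 1 1 = κ 0 0)
    (h2 : κ 1 0 = -κ 0 1) (h : toReal γ * gMat z = gMat (γ • z) * κ) (α : Fin 2) (u : ℂ) :
    invForm (γ • z) α (u / denom γ z ^ 2) =
      ∑ i : Fin 2, rotMat (κ 0 0 ^ 2 - κ 0 1 ^ 2) (2 * κ 0 0 * κ 0 1) α i * invForm z i u := by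
  have hy := z.im_pos.ne'
  have hy' := (γ • z).im_pos.ne'
  have hd := κ.det_coe
  rw [Matrix.det_fin_two, h1, h2] at hd
  have hd' : ((κ 0 0 : ℝ) : ℂ) ^ 2 + (κ 0 1 : ℝ) ^ 2 = 1 := by
    have : (κ 0 0 : ℝ) ^ 2 + κ 0 1 ^ 2 = 1 := by linear_combination hd
    exact_mod_cast this
  have hu : u / denom γ z ^ 2 = (((γ • z).im / z.im : ℝ) : ℂ) *
      (u * (((κ 0 0 ^ 2 - κ 0 1 ^ 2 : ℝ) : ℂ) + ((2 * κ 0 0 * κ 0 1 : ℝ) : ℂ) * Complex.I)) := by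
    rw [div_eq_iff (pow_ne_zero 2 (UpperHalfPlane.denom_ne_zero _ _)), denom_rotation h1 h2 h]
    have hy0 : ((z.im : ℝ) : ℂ) ≠ 0 := by exact_mod_cast hy
    have hy0' : (((γ • z).im : ℝ) : ℂ) ≠ 0 := by exact_mod_cast hy'
    have e : (((κ 0 0 ^ 2 - κ 0 1 ^ 2 : ℝ) : ℂ) + ((2 * κ 0 0 * κ 0 1 : ℝ) : ℂ) * Complex.I) *
        (((κ 0 0 : ℝ) : ℂ) - (κ 0 1 : ℝ) * Complex.I) ^ 2 = 1 := by
      have e1 : ((κ 0 0 ^ 2 - κ 0 1 ^ 2 : ℝ) : ℂ) + ((2 * κ 0 0 * κ 0 1 : ℝ) : ℂ) * Complex.I =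
          (((κ 0 0 : ℝ) : ℂ) + (κ 0 1 : ℝ) * Complex.I) ^ 2 := by
        push_cast
        linear_combination (-(κ 0 1 : ℂ) ^ 2) * Complex.I_sq
      rw [e1, ← mul_pow]
      have e2 : (((κ 0 0 : ℝ) : ℂ) + (κ 0 1 : ℝ) * Complex.I) * ((κ 0 0 : ℝ) - (κ 0 1 : ℝ) * Complex.I)
          = 1 := by
        linear_combination hd' - (κ 0 1 : ℂ) ^ 2 * Complex.I_sq
      rw [e2, one_pow]
    push_cast at e ⊢
    field_simp
    linear_combination (-u) * e
  rw [hu, Fin.sum_univ_two]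
  have him : ∀ (c : ℝ) (w : ℂ), ((c : ℂ) * w).im = c * w.im := fun c w => by simp
  have hre : ∀ (c : ℝ) (w : ℂ), ((c : ℂ) * w).re = c * w.re := fun c w => by simp
  set P := κ 0 0 ^ 2 - κ 0 1 ^ 2
  set Q := 2 * κ 0 0 * κ 0 1
  have e1 : (u * ((P : ℂ) + (Q : ℂ) * Complex.I)).re = u.re * P - u.im * Q := by simp
  have e2 : (u * ((P : ℂ) + (Q : ℂ) * Complex.I)).im = u.re * Q + u.im * P := by simp
  fin_cases α
  · change (γ • z).im⁻¹ * ((((γ • z).im / z.im : ℝ) : ℂ) * (u * ((P : ℂ) + (Q : ℂ) * Complex.I))).im =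
      P * (z.im⁻¹ * u.im) + -Q * -(z.im⁻¹ * u.re)
    rw [him, e2]
    field_simp
    ring
  · change -((γ • z).im⁻¹ * ((((γ • z).im / z.im : ℝ) : ℂ) * (u * ((P : ℂ) + (Q : ℂ) * Complex.I))).re) =
      Q * (z.im⁻¹ * u.im) + P * -(z.im⁻¹ * u.re)
    rw [hre, e1]
    field_simp
    ring

theorem schwartzForm_apply (k : ℕ) (x : Matrix (Fin 2) (Fin 2) ℝ) (z : ℍ) (u : ℂ) :
    schwartzForm k x z u = ∑ β : Fin k → Fin 2,
      ((2 : ℝ) ^ (-((k : ℝ) + 1 / 2)) * ∑ α : Fin 2,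
        howeGauss (Fin.cons α β : Fin (k + 1) → Fin 2) (coord (conj (gMat z)⁻¹ x)) *
          invForm z α u) •
      harmRep k (gMat z) (harmProj k (Pi.single (fun i => (β i).castSucc) 1)) := by
  rw [schwartzForm, Finset.sum_comm, _root_.sum_apply]
  refine Finset.sum_congr rfl fun β _ => ?_
  rw [_root_.sum_apply, Finset.mul_sum, Finset.sum_smul]
  refine Finset.sum_congr rfl fun α _ => ?_
  have e : (α.castSucc :: List.ofFn fun i => (β i).castSucc).foldr howe gauss =
      howeGauss (Fin.cons α β : Fin (k + 1) → Fin 2) := by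
    simp [howeGauss, List.ofFn_succ]
  rw [e, _root_.smul_apply, ContinuousLinearMap.smulRight_apply, smul_smul, mul_assoc]

/-- The equivariance of the Schwartz form: the rotations of the frame act on the Howe operators, on
the invariant forms and on the tensors by the same matrix. -/
theorem schwartzForm_smul {k : ℕ} (γ : SL(2, ℤ)) (x : Matrix (Fin 2) (Fin 2) ℝ) (z : ℍ) (u : ℂ) :
    schwartzForm k (conj (toReal γ) x) (γ • z) (u / denom γ z ^ 2) =
      rep k γ (schwartzForm k x z u) := by
  obtain ⟨κ, h1, h2, h⟩ := exists_rotation γ z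
  set y := coord (conj (gMat z)⁻¹ x) with hy
  have hcoord : coord (conj (gMat (γ • z))⁻¹ (conj (toReal γ) x)) =
      rot (κ 0 0 ^ 2 - κ 0 1 ^ 2) (2 * κ 0 0 * κ 0 1) y := by
    rw [hy, ← coord_conj_rotation h1 h2, ← conj_mul, ← conj_mul]
    congr 2
    rw [inv_mul_eq_iff_eq_mul, ← mul_assoc, ← h, mul_inv_cancel_right]
  have hPQ := cos_sin_rotation h1 h2
  have hinv := invForm_smul h1 h2 h
  have hR := fun β : Fin k → Fin 2 => harmRep_rotation (k := k) h1 h2 β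
  set P := κ 0 0 ^ 2 - κ 0 1 ^ 2
  set Q := 2 * κ 0 0 * κ 0 1
  set V : (Fin k → Fin 2) → Coeff k := fun β =>
    harmRep k (gMat (γ • z)) (harmProj k (Pi.single (fun i => (β i).castSucc) 1)) with hV
  have hrep : ∀ β : Fin k → Fin 2, rep k γ (harmRep k (gMat z)
      (harmProj k (Pi.single (fun i => (β i).castSucc) 1))) =
        ∑ β' : Fin k → Fin 2, (∏ i, rotMat P Q (β' i) (β i)) • V β' := by
    intro β
    change harmRep k (toReal γ) (harmRep k (gMat z) _) = _
    rw [← Module.End.mul_apply, ← map_mul (harmRep k), h, map_mul (harmRep k),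
      Module.End.mul_apply, hR, map_sum]
    refine Finset.sum_congr rfl fun β' _ => ?_
    rw [map_smul]
    rfl
  -- the effect of the rotation on the coefficient functions
  have hcoef : ∀ β : Fin k → Fin 2, ∑ α : Fin 2,
      howeGauss (Fin.cons α β : Fin (k + 1) → Fin 2) (rot P Q y) *
        invForm (γ • z) α (u / denom γ z ^ 2) =
      ∑ β' : Fin k → Fin 2, (∏ i, rotMat P Q (β i) (β' i)) *
        ∑ α : Fin 2, howeGauss (Fin.cons α β' : Fin (k + 1) → Fin 2) y * invForm z α u := by
    intro β
    set S : Fin 2 → ℝ := fun α => ∑ β' : Fin k → Fin 2, (∏ i, rotMat P Q (β i) (β' i)) *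
      howeGauss (Fin.cons α β' : Fin (k + 1) → Fin 2) y with hS
    have hG : ∀ α : Fin 2, howeGauss (Fin.cons α β : Fin (k + 1) → Fin 2) (rot P Q y) =
        ∑ i : Fin 2, rotMat P Q α i * S i := by
      intro α
      rw [howeGauss_cons, howe_rot hPQ (differentiable_howeGauss β), howeGauss_rot hPQ]
      refine Finset.sum_congr rfl fun i _ => ?_
      rw [howe_sum _ _ fun β' _ => differentiable_howeGauss β', hS]
      simp only [howeGauss_cons]
    have hS' : ∑ β' : Fin k → Fin 2, (∏ i, rotMat P Q (β i) (β' i)) *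
        ∑ α : Fin 2, howeGauss (Fin.cons α β' : Fin (k + 1) → Fin 2) y * invForm z α u =
        ∑ α : Fin 2, S α * invForm z α u := by
      simp only [hS, Finset.mul_sum, Finset.sum_mul]
      rw [Finset.sum_comm]
      exact Finset.sum_congr rfl fun α _ => Finset.sum_congr rfl fun β' _ => by ring
    rw [hS']
    simp only [hG, hinv, Fin.sum_univ_two]
    simp only [rotMat, Matrix.of_apply, Matrix.cons_val', Matrix.cons_val_zero,
      Matrix.cons_val_one, Matrix.cons_val_fin_one]
    linear_combination (S 0 * invForm z 0 u + S 1 * invForm z 1 u) * hPQ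
  rw [schwartzForm_apply, schwartzForm_apply, hcoord, map_sum]
  simp only [hcoef]
  have hreal : ∀ (c : ℝ) (v : Coeff k), rep k γ (c • v) = c • rep k γ v :=
    fun c v => (repCLM k γ).map_smul c v
  simp only [hreal, hrep, Finset.smul_sum,
    Finset.mul_sum (s := (Finset.univ : Finset (Fin k → Fin 2))), Finset.sum_smul]
  rw [Finset.sum_comm]
  refine Finset.sum_congr rfl fun β' _ => Finset.sum_congr rfl fun β _ => ?_
  rw [smul_smul]
  congr 1
  ring

/-- The action of `SL₂(ℤ)` on the coefficients, as a continuous linear equivalence. -/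
def repCLE (k : ℕ) (γ : SL(2, ℤ)) : Coeff k ≃L[ℝ] Coeff k :=
  ContinuousLinearEquiv.equivOfInverse (repCLM k γ) (repCLM k γ⁻¹) (rep_inv_rep γ) (rep_rep_inv γ)

/-- Division by the derivative of `γ`, as a continuous linear equivalence. -/
def dilCLE (γ : SL(2, ℤ)) (z : ℍ) : ℂ ≃L[ℝ] ℂ :=
  ContinuousLinearEquiv.equivOfInverse (dil (denom γ z ^ 2)) (dil (1 / denom γ z ^ 2))
    (fun u => by
      have := UpperHalfPlane.denom_ne_zero γ z
      rw [dil_apply, dil_apply]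
      field_simp)
    (fun u => by
      have := UpperHalfPlane.denom_ne_zero γ z
      rw [dil_apply, dil_apply]
      field_simp)

/-- The pullback of values of forms, as a continuous linear equivalence. -/
def pullValue (k : ℕ) (γ : SL(2, ℤ)) (z : ℍ) : (ℂ →L[ℝ] Coeff k) ≃L[ℝ] (ℂ →L[ℝ] Coeff k) :=
  (dilCLE γ z).arrowCongr (repCLE k γ⁻¹)

theorem pullValue_apply {k : ℕ} (γ : SL(2, ℤ)) (z : ℍ) (T : ℂ →L[ℝ] Coeff k) (u : ℂ) :
    pullValue k γ z T u = rep k γ⁻¹ (T (u / denom γ z ^ 2)) := by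
  rw [← one_div_mul_eq_div]
  rfl

theorem pullForm_eq_pullValue {k : ℕ} (γ : SL(2, ℤ)) (ξ : OneForm k) (z : ℍ) :
    pullForm γ ξ z = pullValue k γ z (ξ (γ • z)) := by
  ext1 u
  rw [pullForm_apply, pullValue_apply]

/-- The permutation of `L + h` by an element of the group. -/
def cosetEquiv {L : AddSubgroup (Matrix (Fin 2) (Fin 2) ℚ)} {h : Matrix (Fin 2) (Fin 2) ℚ}
    {Γ : Subgroup SL(2, ℤ)}
    (hΓL : ∀ γ ∈ Γ, ∀ x : Matrix (Fin 2) (Fin 2) ℚ, x - h ∈ L → conjQ γ x - h ∈ L)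
    {γ : SL(2, ℤ)} (hγ : γ ∈ Γ) : {x // x - h ∈ L} ≃ {x // x - h ∈ L} where
  toFun x := ⟨conjQ γ x.1, hΓL γ hγ x.1 x.2⟩
  invFun x := ⟨conjQ γ⁻¹ x.1, hΓL γ⁻¹ (inv_mem hγ) x.1 x.2⟩
  left_inv x := Subtype.ext (by simp only [← conjQ_mul, inv_mul_cancel, conjQ_one])
  right_inv x := Subtype.ext (by simp only [← conjQ_mul, mul_inv_cancel, conjQ_one])

theorem pullForm_thetaForm {k : ℕ} {L : AddSubgroup (Matrix (Fin 2) (Fin 2) ℚ)}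
    {h : Matrix (Fin 2) (Fin 2) ℚ} {Γ : Subgroup SL(2, ℤ)}
    (hΓL : ∀ γ ∈ Γ, ∀ x : Matrix (Fin 2) (Fin 2) ℚ, x - h ∈ L → conjQ γ x - h ∈ L)
    {γ : SL(2, ℤ)} (hγ : γ ∈ Γ) (τ : ℍ) :
    pullForm γ (thetaForm k L h τ) = thetaForm k L h τ := by
  funext z
  rw [pullForm_eq_pullValue, thetaForm, map_smul, ContinuousLinearEquiv.map_tsum,
    ← (cosetEquiv hΓL hγ).tsum_eq, thetaForm]
  congr 2
  funext x
  ext u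
  have e1 : form (ratReal (conjQ γ x.1)) (ratReal (conjQ γ x.1)) =
      form (ratReal x.1) (ratReal x.1) := by
    rw [ratReal_conjQ, form_conj]
  have e2 : √τ.im • ratReal (conjQ γ x.1) = conj (toReal γ) (√τ.im • ratReal x.1) := by
    rw [ratReal_conjQ, conj, conj, Matrix.mul_smul, Matrix.smul_mul]
  change pullValue k γ z (Complex.exp (Real.pi * Complex.I *
    form (ratReal (conjQ γ x.1)) (ratReal (conjQ γ x.1)) * τ.re) •
      schwartzForm k (√τ.im • ratReal (conjQ γ x.1)) (γ • z)) u = _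
  rw [pullValue_apply, e1, e2, _root_.smul_apply, schwartzForm_smul, map_smul, rep_inv_rep]
  rfl
/-! ### Equivariance of the theta function on the boundary -/

theorem harmRep_tsum {k : ℕ} {ι : Type*} (g : SL(2, ℝ)) (f : ι → Coeff k) :
    harmRep k g (∑' i, f i) = ∑' i, harmRep k g (f i) :=
  let e : Coeff k ≃L[ℂ] Coeff k := LinearEquiv.toContinuousLinearEquiv
    (LinearEquiv.ofLinearMap (harmRep k g) (harmRep k g⁻¹)
      (by rw [← Module.End.mul_eq_comp, ← map_mul (harmRep k), mul_inv_cancel, map_one]; rfl)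
      (by rw [← Module.End.mul_eq_comp, ← map_mul (harmRep k), inv_mul_cancel, map_one]; rfl))
  e.map_tsum

/-- The value of the theta function on the boundary is `ρ(σ (1, x; 0, 1))` of a sum of multiples of
one vector. -/
theorem thetaAt_eq (k : ℕ) (L : AddSubgroup (Matrix (Fin 2) (Fin 2) ℚ))
    (h : Matrix (Fin 2) (Fin 2) ℚ) (τ : ℍ) : ∃ f : ℝ → ℂ, ∀ (σ : SL(2, ℤ)) (x : ℝ),
      thetaAt k L h τ σ x = ((τ.im ^ (-((k : ℝ) + 1) / 2) / latGen L σ : ℝ) : ℂ) •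
        harmRep k (toReal σ * nMat x) (∑' w : projSet L h σ, f w • vMinusTwo k) := by
  refine ⟨fun w => ((-1 / ((2 : ℝ) ^ (3 * (k : ℝ) / 2 + 1 / 2) * k) * hermite' (k + 1) (√τ.im * w) *
    Real.exp (-Real.pi * (√τ.im * w) ^ 2) : ℝ) : ℂ) *
      Complex.exp (Real.pi * Complex.I * (w : ℝ) ^ 2 * τ.re), fun σ x => ?_⟩
  rw [thetaAt, map_smul, map_mul (harmRep k), Module.End.mul_apply, harmRep_tsum]
  simp only [map_smul]
  rfl

theorem projSet_mul {L : AddSubgroup (Matrix (Fin 2) (Fin 2) ℚ)} {h : Matrix (Fin 2) (Fin 2) ℚ}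
    {Γ : Subgroup SL(2, ℤ)}
    (hΓL : ∀ γ ∈ Γ, ∀ x : Matrix (Fin 2) (Fin 2) ℚ, x - h ∈ L → conjQ γ x - h ∈ L)
    {γ : SL(2, ℤ)} (hγ : γ ∈ plusMinus Γ) (σ : SL(2, ℤ)) :
    projSet L h (γ * σ) = projSet L h σ := by
  refine setOf_exists_smul_eq (Γ := Γ) (X := {x | x - h ∈ L})
    (R := fun σ x w => form (ratReal x) (uAt σ) = 0 ∧
      w = form (conj (toReal σ)⁻¹ (ratReal x)) (basisMat 1))
    (fun γ hγ x hx => conjQ_coset_plusMinus hΓL γ hγ x hx) (fun γ σ x w hw => ?_) hγ σ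
  rw [ratReal_conjQ, uAt_mul, form_conj, ← conj_mul, map_mul toReal, _root_.mul_inv_rev,
    inv_mul_cancel_right]
  exact hw

theorem projSet_mul_T_zpow (L : AddSubgroup (Matrix (Fin 2) (Fin 2) ℚ))
    (h : Matrix (Fin 2) (Fin 2) ℚ) (σ : SL(2, ℤ)) (m : ℤ) :
    projSet L h (σ * ModularGroup.T ^ m) = projSet L h σ := by
  ext w
  refine exists_congr fun x => and_congr_right fun _ => ?_
  rw [uAt_mul_T_zpow, form_uAt_eq]
  refine and_congr_right fun h0 => ?_
  have e : form (conj (toReal (σ * ModularGroup.T ^ m))⁻¹ (ratReal x)) (basisMat 1) =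
      form (conj (toReal σ)⁻¹ (ratReal x)) (basisMat 1) := by
    rw [map_mul toReal, _root_.mul_inv_rev, conj_mul, toReal_T_zpow, ← nMat_neg, conj, coe_nMat_inv,
      coe_nMat]
    have e2 : basisMat 1 = (√2)⁻¹ • !![1, 0; 0, -1] := rfl
    rw [form, form, Matrix.trace_fin_two, Matrix.trace_fin_two, e2]
    simp only [Matrix.mul_apply, Fin.sum_univ_two]
    simp [h0]
  rw [e]

theorem projSet_neg (L : AddSubgroup (Matrix (Fin 2) (Fin 2) ℚ))
    (h : Matrix (Fin 2) (Fin 2) ℚ) (σ : SL(2, ℤ)) : projSet L h (-σ) = projSet L h σ := by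
  have e : ∀ x, conj (toReal (-σ))⁻¹ x = conj (toReal σ)⁻¹ x := by
    intro x
    have : (-toReal σ)⁻¹ = -(toReal σ)⁻¹ := by rw [inv_eq_iff_mul_eq_one]; simp
    rw [toReal_neg, this]
    simp [conj]
  ext w
  refine exists_congr fun x => and_congr_right fun _ => ?_
  rw [uAt_neg, e]

/-- The boundary theta function does not depend on the choice of representatives. -/
theorem thetaBdry_bdry (k : ℕ) (L : AddSubgroup (Matrix (Fin 2) (Fin 2) ℚ))
    (h : Matrix (Fin 2) (Fin 2) ℚ) (τ : ℍ) (σ : SL(2, ℤ)) (x : ℝ) :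
    thetaBdry k L h τ (bdry σ x) = thetaAt k L h τ σ x := by
  obtain ⟨f, hf⟩ := thetaAt_eq k L h τ
  have h1 : bdry σ x = bdry (Quotient.out (bdry σ x)).1 (Quotient.out (bdry σ x)).2 :=
    (Quotient.out_eq (bdry σ x)).symm
  obtain ⟨m, hm, hx⟩ := bdry_eq_iff.1 h1
  rw [thetaBdry, hf, hf]
  generalize (Quotient.out (bdry σ x)).1 = σ' at *
  generalize (Quotient.out (bdry σ x)).2 = x' at *
  have e : toReal (σ * ModularGroup.T ^ m) * nMat x' = toReal σ * nMat x := by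
    rw [map_mul toReal, toReal_T_zpow, mul_assoc, ← nMat_add, hx, add_comm]
  rcases hm with rfl | rfl
  · rw [projSet_mul_T_zpow, latGen_congr (uAt_mul_T_zpow σ m), e]
  · rw [projSet_neg, projSet_mul_T_zpow, latGen_congr ((uAt_neg _).trans (uAt_mul_T_zpow σ m)),
      toReal_neg, neg_mul, harmRep_neg, e]

theorem pullFun_thetaBdry {k : ℕ} {L : AddSubgroup (Matrix (Fin 2) (Fin 2) ℚ)}
    {h : Matrix (Fin 2) (Fin 2) ℚ} {Γ : Subgroup SL(2, ℤ)}
    (hΓL : ∀ γ ∈ Γ, ∀ x : Matrix (Fin 2) (Fin 2) ℚ, x - h ∈ L → conjQ γ x - h ∈ L)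
    {γ : SL(2, ℤ)} (hγ : γ ∈ Γ) (τ : ℍ) :
    pullFun γ (thetaBdry k L h τ) = thetaBdry k L h τ := by
  funext q
  obtain ⟨⟨σ, x⟩, rfl⟩ := Quotient.exists_rep q
  change rep k γ⁻¹ (thetaBdry k L h τ (bdry (γ * σ) x)) = thetaBdry k L h τ (bdry σ x)
  obtain ⟨f, hf⟩ := thetaAt_eq k L h τ
  have hγ' := le_plusMinus Γ hγ
  rw [thetaBdry_bdry, thetaBdry_bdry, hf, hf, latGen_mul hΓL hγ', projSet_mul hΓL hγ',
    map_mul toReal, mul_assoc, map_mul (harmRep k), Module.End.mul_apply, map_smul]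
  exact congrArg _ (rep_inv_rep γ _)

/-! ### The transfer of the theta class -/

theorem theta_mem_coneCocycles {k : ℕ} {L : AddSubgroup (Matrix (Fin 2) (Fin 2) ℚ)}
    {h : Matrix (Fin 2) (Fin 2) ℚ} {Γ Γ' : Subgroup SL(2, ℤ)}
    (hΓL : ∀ γ ∈ Γ, ∀ x : Matrix (Fin 2) (Fin 2) ℚ, x - h ∈ L → conjQ γ x - h ∈ L) {τ : ℍ}
    (hθ : (thetaForm k L h τ, thetaBdry k L h τ) ∈ coneCocycles k Γ') :
    (thetaForm k L h τ, thetaBdry k L h τ) ∈ coneCocycles k Γ :=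
  mem_coneCocycles_iff.2 ⟨(mem_coneCocycles_iff.1 hθ).1, fun _ hγ =>
    Prod.ext (pullForm_thetaForm hΓL hγ τ) (pullFun_thetaBdry hΓL hγ τ)⟩
theorem transfer_thetaClass {k : ℕ} {L : AddSubgroup (Matrix (Fin 2) (Fin 2) ℚ)}
    {h : Matrix (Fin 2) (Fin 2) ℚ} {Γ Γ' : Subgroup SL(2, ℤ)} [Fintype (Γ ⧸ Γ'.subgroupOf Γ)]
    [(Γ'.subgroupOf Γ).Normal] {τ : ℍ}
    (hθ' : (thetaForm k L h τ, thetaBdry k L h τ) ∈ coneCocycles k Γ')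
    (hθ : (thetaForm k L h τ, thetaBdry k L h τ) ∈ coneCocycles k Γ) :
    transfer k Γ Γ' (coneClass ⟨_, hθ'⟩) = coneClass ⟨_, hθ⟩ := by
  rw [transfer_coneClass]
  exact congrArg coneClass (Subtype.ext (averagePair_eq_self hθ))

end Spectacle

end

theorem mainTheorem5 (k : ℕ) (hk : 1 ≤ k)
    (L : AddSubgroup (Matrix (Fin 2) (Fin 2) ℚ)) (hL : Spectacle.IsEvenLattice L)
    (h : Matrix (Fin 2) (Fin 2) ℚ) (hh : Spectacle.IsDual L h)
    (Γ Γ' : Subgroup SL(2, ℤ)) (hΓ : Γ.FiniteIndex)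
    (hΓL : ∀ γ ∈ Γ, ∀ x : Matrix (Fin 2) (Fin 2) ℚ, x - h ∈ L → Spectacle.conjQ γ x - h ∈ L)
    (hle : Γ' ≤ Γ) (hnormal : (Γ'.subgroupOf Γ).Normal)
    (hindex : (Γ'.subgroupOf Γ).FiniteIndex)
    (hmain : Spectacle.MainIdentity k L h Γ') :
    Spectacle.MainIdentity k L h Γ := by
  have hΓ' : Γ'.FiniteIndex := ⟨by
    rw [← Subgroup.relIndex_mul_index hle]
    exact mul_ne_zero hindex.index_ne_zero hΓ.index_ne_zero⟩
  let _ : Fintype (Γ ⧸ Γ'.subgroupOf Γ) := Fintype.ofFinite _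
  obtain ⟨P, hP, hθ⟩ := hmain
  refine ⟨fun n => Spectacle.transfer k Γ Γ' (P n), fun n => ?_, fun τ => ?_⟩
  · refine (hP n).transfer hle fun F hF Λ Λ' hΛ hΛ' => ?_
    by_cases hn : n = 0
    · rw [hn]
      exact Spectacle.apply_specialClass_zero_of_le hle hΓL hF hΛ hΛ'
    · exact Spectacle.apply_specialClass_pos_of_le hL hh.1 hle hΓL hn hF hΛ hΛ'
  · obtain ⟨hτ, hsum⟩ := hθ τ
    have hτΓ := Spectacle.theta_mem_coneCocycles hΓL hτ
    refine ⟨hτΓ, ?_⟩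
    have h1 := hsum.map (Spectacle.transfer k Γ Γ') Spectacle.continuous_transfer
    rw [Spectacle.transfer_thetaClass hτ hτΓ] at h1
    refine h1.congr_fun fun n => ?_
    rw [Function.comp_apply, map_smul]
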